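/- Let $(\mathcal O,g)$ be a compact connected (effective) Riemannian orbifold of dimension $m\ge 1$, possibly with boundary and corners: a compact connected Hausdorff space $|\mathcal O|$ with an atlas of charts $\tilde U\to\tilde U/\Gamma\cong U\subseteq|\mathcal O|$, where $\tilde U$ is a connected relatively open subset of $[0,\infty)^m$, $\Gamma$ is a finite group of diffeomorphisms of $\tilde U$, and $g$ is given by $\Gamma$-invariant smooth Riemannian metrics on the sets $\tilde U$ compatible under the (smooth, isometric) changes of charts. Let $dv_g$ be its volume measure and $\mathrm{Vol}(\mathcal O,g)$ its volume. Let $\mathbb S^n\subset\mathbb R^{n+1}$ be the unit sphere with its round metric $can$. A map $\varphi:|\mathcal O|\to\mathbb S^n$ is called PC (piecewise conformal) if it is continuous and there is a closed set $S\subseteq|\mathcal O|$ (the walls between the pieces, together with the singular locus), whose preimage in every chart has $\sigma$-finite $(m-1)$-dimensional Hausdorff measure, such that off $S$ the map $\varphi$ is continuously differentiable (in charts) and conformal, i.e. $\varphi^*can=\rho\, g$ with $\rho>0$. Let $\mathrm{M\ddot ob}(\mathbb S^n)=\mathrm{Isom}(\mathbb H^{n+1})$ be the group of Möbius transformations of $\mathbb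 S^n$, and put $$V_c(n,\varphi)=\sup_{\mu\in \mathrm{M\ddot ob}(\mathbb S^n)}\mathrm{Vol}\bigl(\mathcal O,(\mu\circ\varphi)^*can\bigr)\in[0,\infty].$$ Call $t\in\mathbb R$ a Neumann eigenvalue of $(\mathcal O,g)$ if there is a nonzero $u\in H^1(\mathcal O,g)$ with $\int_{\mathcal O}\langle\nabla u,\nabla v\rangle_g\,dv_g=t\int_{\mathcal O}uv\,dv_g$ for all $v\in H^1(\mathcal O,g)$. If $\varphi:|\mathcal O|\to\mathbb S^n$ is a PC map, then the set of non-zero Neumann eigenvalues has a least element $\lambda_1(\mathcal O,g)$, and $$\lambda_1(\mathcal O,g)\,\mathrm{Vol}(\mathcal O,g)^{2/m}\le m\,V_c(n,\varphi)^{2/m}.$$ -/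

import Mathlib

open MeasureTheory Set
open scoped ENNReal ContDiff

/-- A map `f` defined on `s ⊆ ℝᵐ` pulls the metric `B` back to the metric `A` (metrics are given by
their matrices in the standard coordinates). -/
def PullsBackMetric {m : ℕ} (A B : (Fin m → ℝ) → Matrix (Fin m) (Fin m) ℝ)
    (f : (Fin m → ℝ) → (Fin m → ℝ)) (s : Set (Fin m → ℝ)) : Prop :=
  ∀ x ∈ s, ∀ v w : Fin m → ℝ,
    (fderivWithin ℝ f s x v) ⬝ᵥ ((B (f x)).mulVec (fderivWithin ℝ f s x w)) =
      v ⬝ᵥ ((A x).mulVec w)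

/-- A Riemannian orbifold chart of dimension `m` on the space `X`. The chart is
`dom → dom / group ≅ proj '' dom`, where `dom` is a connected relatively open subset of the
quadrant `[0, ∞)ᵐ` (so interior points, boundary points and corners are all allowed), `group` is a
finite group of diffeomorphisms of `dom` (acting effectively, being a group of permutations), and
`metric` is a smooth `group`-invariant Riemannian metric on `dom`. -/
structure RiemannianOrbifoldChart (m : ℕ) (X : Type*) [TopologicalSpace X] where
  dom : Set (Fin m → ℝ)
  isConnected_dom : IsConnected dom
  isOpen_dom : ∃ V : Set (Fin m → ℝ), IsOpen V ∧ dom = V ∩ {x | ∀ i, 0 ≤ x i}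
  group : Subgroup (Equiv.Perm dom)
  finite_group : Finite group
  proj : (Fin m → ℝ) → X
  continuousOn_proj : ContinuousOn proj dom
  isOpen_image_proj : ∀ V : Set (Fin m → ℝ), IsOpen V → IsOpen (proj '' (dom ∩ V))
  proj_eq_iff : ∀ x y : dom, proj x = proj y ↔ ∃ γ ∈ group, γ x = y
  metric : (Fin m → ℝ) → Matrix (Fin m) (Fin m) ℝ
  posDef_metric : ∀ x ∈ dom, (metric x).PosDef
  contDiffOn_metric : ∀ i j, ContDiffOn ℝ ∞ (fun x => metric x i j) dom
  smooth_isometric_group : ∀ γ ∈ group, ∃ f : (Fin m → ℝ) → (Fin m → ℝ),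
    (∀ x : dom, f x = γ x) ∧ ContDiffOn ℝ ∞ f dom ∧ PullsBackMetric metric metric f dom

/-- A Riemannian orbifold structure of dimension `m`, possibly with boundary and corners, on the
underlying space `X`: an atlas of charts covering `X`, such that any two points of chart domains
lying over the same point of `X` have neighbourhoods related by an isometric diffeomorphism
over `X`. -/
structure RiemannianOrbifold (m : ℕ) (X : Type*) [TopologicalSpace X] where
  atlas : Set (RiemannianOrbifoldChart m X)
  cover : ∀ p : X, ∃ c ∈ atlas, p ∈ c.proj '' c.dom
  compatible : ∀ c ∈ atlas, ∀ c' ∈ atlas, ∀ x ∈ c.dom, ∀ y ∈ c'.dom, c.proj x = c'.proj y →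
    ∃ h : PartialEquiv (Fin m → ℝ) (Fin m → ℝ),
      (∃ V, IsOpen V ∧ h.source = c.dom ∩ V) ∧ (∃ W, IsOpen W ∧ h.target = c'.dom ∩ W) ∧
      x ∈ h.source ∧ h x = y ∧
      ContDiffOn ℝ ∞ h h.source ∧ ContDiffOn ℝ ∞ h.symm h.target ∧
      (∀ z ∈ h.source, c'.proj (h z) = c.proj z) ∧
      PullsBackMetric c.metric c'.metric h h.source

/-- The unit sphere `Sⁿ ⊆ ℝⁿ⁺¹`. -/
abbrev UnitSphere (n : ℕ) : Type := Metric.sphere (0 : EuclideanSpace ℝ (Fin (n + 1))) 1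

/-- Möbius transformations of `Sⁿ`: the maps that the linear isometries of the Lorentzian form
`‖x‖² - t²` on `ℝⁿ⁺¹ × ℝ` induce on the projectivised light cone `{[x : 1] | ‖x‖ = 1} = Sⁿ`,
i.e. the action of `Isom(ℍⁿ⁺¹)` on the sphere at infinity. -/
def IsMoebius {n : ℕ} (μ : UnitSphere n → UnitSphere n) : Prop :=
  ∃ L : (EuclideanSpace ℝ (Fin (n + 1)) × ℝ) →ₗ[ℝ] (EuclideanSpace ℝ (Fin (n + 1)) × ℝ),
    (∀ z, ‖(L z).1‖ ^ 2 - (L z).2 ^ 2 = ‖z.1‖ ^ 2 - z.2 ^ 2) ∧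
    ∀ x : UnitSphere n, (μ x : EuclideanSpace ℝ (Fin (n + 1))) =
      ((L ((x : EuclideanSpace ℝ (Fin (n + 1))), 1)).2)⁻¹ •
        (L ((x : EuclideanSpace ℝ (Fin (n + 1))), 1)).1

/-- `w` is the weak (distributional) differential of `f` on the open set `V ⊆ ℝᵐ`. -/
def HasWeakFDerivOn {m : ℕ} (f : (Fin m → ℝ) → ℝ) (w : (Fin m → ℝ) → ((Fin m → ℝ) →L[ℝ] ℝ))
    (V : Set (Fin m → ℝ)) : Prop :=
  LocallyIntegrableOn f V ∧ LocallyIntegrableOn w V ∧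
  ∀ ψ : (Fin m → ℝ) → ℝ, ContDiff ℝ ∞ ψ → HasCompactSupport ψ → tsupport ψ ⊆ V →
    ∀ v : Fin m → ℝ, ∫ x, f x * fderiv ℝ ψ x v = - ∫ x, ψ x * w x v

namespace RiemannianOrbifoldChart

variable {m n : ℕ} {X : Type*} [TopologicalSpace X]

/-- The lift to the chart domain of a map to the sphere, read in `ℝⁿ⁺¹`. -/
def lift (c : RiemannianOrbifoldChart m X) (φ : X → UnitSphere n) :
    (Fin m → ℝ) → EuclideanSpace ℝ (Fin (n + 1)) :=
  fun x => (φ (c.proj x) : EuclideanSpace ℝ (Fin (n + 1)))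

/-- The matrix of the pullback `φ^* can` of the round metric in the chart. -/
noncomputable def pullbackCan (c : RiemannianOrbifoldChart m X) (φ : X → UnitSphere n)
    (x : Fin m → ℝ) : Matrix (Fin m) (Fin m) ℝ :=
  Matrix.of fun i j =>
    inner ℝ (fderivWithin ℝ (c.lift φ) c.dom x (Pi.single i 1))
      (fderivWithin ℝ (c.lift φ) c.dom x (Pi.single j 1))

/-- The inner product of two covectors at `x` induced by the metric. -/
noncomputable def cometric (c : RiemannianOrbifoldChart m X) (x : Fin m → ℝ)
    (ξ η : (Fin m → ℝ) →L[ℝ] ℝ) : ℝ :=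
  ∑ i, ∑ j, (c.metric x)⁻¹ i j * ξ (Pi.single i 1) * η (Pi.single j 1)

end RiemannianOrbifoldChart

namespace RiemannianOrbifold

variable {m n : ℕ} {X : Type*} [TopologicalSpace X]

section measure

variable [MeasurableSpace X]

/-- The volume measure on `X` of a (possibly degenerate) metric tensor, given by its matrices
`h c` in the charts. In one chart it is `1 / |group|` times the image of `√(det h) dx`; these local
measures agree on overlaps, so their supremum is the measure that restricts to each of them. -/
noncomputable def tensorVolume (O : RiemannianOrbifold m X)
    (h : RiemannianOrbifoldChart m X → (Fin m → ℝ) → Matrix (Fin m) (Fin m) ℝ) : Measure X :=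
  ⨆ c ∈ O.atlas, ((Nat.card c.group : ℝ≥0∞)⁻¹) •
    Measure.map c.proj
      ((volume.restrict c.dom).withDensity fun x => ENNReal.ofReal (√ ((h c x).det)))

/-- The Riemannian volume measure `dv_g`. -/
noncomputable def vol (O : RiemannianOrbifold m X) : Measure X :=
  O.tensorVolume fun c => c.metric

/-- `V_c(n, φ)`: the supremum over Möbius transformations `μ` of the volume of `X` with respect
to `(μ ∘ φ)^* can`. -/
noncomputable def conformalVolume (O : RiemannianOrbifold m X) (φ : X → UnitSphere n) : ℝ≥0∞ :=
  ⨆ (μ : UnitSphere n → UnitSphere n) (_ : IsMoebius μ),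
    O.tensorVolume (fun c => c.pullbackCan (μ ∘ φ)) univ

end measure

/-- PC (piecewise conformal) maps to the sphere: `φ` is continuous, and off a closed set `S` (the
walls between the pieces, together with the singular locus), which in charts has σ-finite
`(m-1)`-dimensional Hausdorff measure, `φ` is continuously differentiable and conformal, i.e.
`φ^* can = ρ g` with `ρ > 0`. -/
def IsPC (O : RiemannianOrbifold m X) (φ : X → UnitSphere n) : Prop :=
  Continuous φ ∧ ∃ S : Set X, IsClosed S ∧ ∀ c ∈ O.atlas,
    SigmaFinite ((Measure.hausdorffMeasure ((m : ℝ) - 1)).restrict (c.dom ∩ c.proj ⁻¹' S)) ∧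
    ∀ x ∈ c.dom, c.proj x ∉ S →
      ContDiffWithinAt ℝ 1 (c.lift φ) c.dom x ∧
      ∃ ρ : ℝ, 0 < ρ ∧ c.pullbackCan φ x = ρ • c.metric x

/-- `F` represents the function `⟨∇u, ∇v⟩_g`, with weak differentials of `u` and `v`. -/
def IsGradInner (O : RiemannianOrbifold m X) (u v F : X → ℝ) : Prop :=
  ∀ c ∈ O.atlas, ∃ du dv : (Fin m → ℝ) → ((Fin m → ℝ) →L[ℝ] ℝ),
    HasWeakFDerivOn (u ∘ c.proj) du (interior c.dom) ∧
    HasWeakFDerivOn (v ∘ c.proj) dv (interior c.dom) ∧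
    ∀ᵐ x ∂(volume.restrict c.dom), F (c.proj x) = c.cometric x (du x) (dv x)

section spectrum

variable [MeasurableSpace X]

/-- The Sobolev space `H¹(O, g)`. -/
def MemH1 (O : RiemannianOrbifold m X) (u : X → ℝ) : Prop :=
  MemLp u 2 O.vol ∧ ∃ F : X → ℝ, O.IsGradInner u u F ∧ Integrable F O.vol

/-- `t` is an eigenvalue of the (nonnegative) Laplacian with Neumann boundary conditions: there is
a nonzero `u ∈ H¹` with `∫ ⟨∇u, ∇v⟩ dv_g = t ∫ u v dv_g` for all `v ∈ H¹`. -/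
def IsNeumannEigenvalue (O : RiemannianOrbifold m X) (t : ℝ) : Prop :=
  ∃ u : X → ℝ, O.MemH1 u ∧ ¬ (u =ᵐ[O.vol] 0) ∧
    ∀ v : X → ℝ, O.MemH1 v →
      ∃ F : X → ℝ, O.IsGradInner u v F ∧ Integrable F O.vol ∧
        ∫ p, F p ∂O.vol = t * ∫ p, u p * v p ∂O.vol

/-- `λ₁(O, g)`: the first non-zero Neumann eigenvalue. -/
noncomputable def firstEigenvalue (O : RiemannianOrbifold m X) : ℝ :=
  sInf {t : ℝ | t ≠ 0 ∧ O.IsNeumannEigenvalue t}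

end spectrum

end RiemannianOrbifold

open Filter Topology
open Metric (ball ball_mem_nhds mem_ball_self closedBall mem_ball isOpen_ball ball_subset_ball ediam
  mem_closedBall isClosed_closedBall eventually_nhds_iff_ball isBounded_ball)
open ENNReal (ofReal ofReal_mul ofReal_ne_top ofReal_le_ofReal ofReal_lt_top ofReal_pow
  rpow_natCast)
open Real (log cos sin)
open Finset (sum_congr mul_sum)
open MeasureTheory.Measure (hausdorffMeasure)
set_option linter.unusedSectionVars false

local notation:max "ℝ^" m:max => Fin m → ℝ
local notation:max "𝔼^" m:max => EuclideanSpace ℝ (Fin m)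
local notation "Chart" => RiemannianOrbifoldChart

/-! ### Chart domains and the action of their finite groups. -/

namespace RiemannianOrbifoldChart

variable {m : ℕ} {X : Type*} [TopologicalSpace X] (c : Chart m X)

/-! For `m ≥ 2` this is the argument of Hersch in the form given to it by Li and Yau. A suitable
Lorentz boost is composed with `φ` so that the coordinate functions `x_i` of the resulting map `ψ`
have mean zero (`exists_integral_boostMap_eq_zero`). They are then admissible in the variational
characterisation of `λ₁`. If `ψ^* can = ρ g`, then `∑ x_i² = 1` and `∑ |∇x_i|² = m ρ`, so adding the
Rayleigh inequalities gives `λ₁ Vol ≤ m ∫ ρ`. Hölder's inequality with exponent `m / 2` and `∫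
ρ^{m/2} ≤ Vol(ψ^* can) ≤ V_c` finish the proof (`IsPCOff.mul_vol_rpow_le`). When `V_c = ∞` there is
nothing to show.

Two points of this argument need work. Balancing: the function `a ↦ ∫ log(√(1 + |a|²) + ⟨a, φ⟩)` on
`ℝⁿ⁺¹` tends to infinity at infinity, because fibres of a piecewise conformal map are null and so no
point of the sphere carries mass; at a minimiser the Euler equation says exactly that the boosted
map has mean zero. Regularity: the coordinates are known to be `C¹` only off the walls. Almost every
line parallel to a coordinate axis meets a set of σ-finite codimension-one Hausdorff measure in a
countable set (Eilenberg's inequality, `ae_finite_line_of_hausdorffMeasure_ne_top`), and the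
fundamental theorem of calculus tolerates countably many bad points of a continuous function. Hence
the classical differential is the weak one as soon as it is locally integrable
(`HasWeakFDerivOn.of_differentiableAt_off`), which finiteness of the volume of `ψ^* can` provides.

For `m = 1` Hölder's inequality goes the wrong way, and both sides are compared with `2π` instead.
On one hand `V_c ≥ 2π`: strong boosts blow up a short arc of the curve to nearly a full great circle
(`IsPCOff.two_pi_le_conformalVolume`). On the other hand `λ₁ L² ≤ (2π)²` for every one-dimensional
orbifold of length `L` (`mul_sq_vol_le`). There, a complete unit speed path `γ`, reflected at
boundary points, runs through the whole orbifold. The infimum `r(p)` of `|t|` over `γ t = p` is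
1-Lipschitz along such paths and satisfies `Vol{a < r ≤ b} ≤ 2 (b - a)`. Composing `r` with its
distribution function gives a 2-Lipschitz function `s` that is uniformly distributed on `[0, L]`,
and `cos(π s / L)` is the test function.

That `λ₁` exists at all is shown by the direct method (`exists_first_eigenvalue`). Its inputs are a
Rellich estimate, obtained from the Poincaré inequality on small convex cells
(`exists_rellich_functionals`), completeness of `H¹` (`exists_limit_of_cauchy`), and the fact that
functions without energy are constant on a connected orbifold (`exists_ae_eq_const`).

Underneath lie the consistency statements. The normalised chart volumes agree on overlaps because
points with nontrivial stabiliser are null (`vol_restrict`), almost-everywhere statements can be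
checked in charts (`ae_vol_iff`), and weak differentials transform as covectors, so that `⟨∇u, ∇v⟩`
is a function on the orbifold (`HasChartGrad.exists_inner`). -/

lemma measurableSet_dom : MeasurableSet c.dom := by
  obtain ⟨V, hV, h⟩ := c.isOpen_dom
  rw [h]
  refine hV.measurableSet.inter (IsClosed.measurableSet ?_)
  exact isClosed_Ici (a := (0 : ℝ^m))

/-- This makes chart domains locally convex, also at boundary points and corners, which is what the
mean value and Poincaré estimates require. -/
lemma exists_ball_inter_quadrant {x : ℝ^m} (hx : x ∈ c.dom) {U : Set ℝ^m}
    (hU : U ∈ 𝓝 x) : ∃ r > 0, ball x r ⊆ U ∧ c.dom ∩ ball x r = Ici 0 ∩ ball x r := by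
  obtain ⟨V, hV, h⟩ := c.isOpen_dom
  have hxV : x ∈ V := by rw [h] at hx; exact hx.1
  obtain ⟨r, hr, hb⟩ := Metric.mem_nhds_iff.1 (inter_mem hU (hV.mem_nhds hxV))
  refine ⟨r, hr, hb.trans inter_subset_left, ?_⟩
  rw [h]
  ext y
  constructor
  · rintro ⟨⟨_, h2⟩, h3⟩
    exact ⟨h2, h3⟩
  · rintro ⟨h2, h3⟩
    exact ⟨⟨(hb h3).2, h2⟩, h3⟩

lemma convex_dom_inter_ball {x : ℝ^m} {r : ℝ} (h : c.dom ∩ ball x r = Ici 0 ∩ ball x r) :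
    Convex ℝ (c.dom ∩ ball x r) := by
  rw [h]
  exact (convex_Ici 0).inter (convex_ball x r)

lemma interior_Ici_zero : interior (Ici (0 : ℝ^m)) = {x | ∀ i, 0 < x i} := by
  have : (Ici (0 : ℝ^m)) = Set.pi univ fun _ => Ici (0 : ℝ) := by ext x; simp [Pi.le_def]
  rw [this, interior_pi_set finite_univ]
  ext x; simp

lemma interior_dom_eq : ∃ V : Set ℝ^m, IsOpen V ∧ c.dom = V ∩ Ici 0 ∧
    interior c.dom = V ∩ interior (Ici (0 : ℝ^m)) := by
  obtain ⟨V, hV, h⟩ := c.isOpen_dom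
  have h' : c.dom = V ∩ Ici 0 := h
  exact ⟨V, hV, h', by rw [h', interior_inter, hV.interior_eq]⟩

lemma uniqueDiffOn_dom : UniqueDiffOn ℝ c.dom := by
  obtain ⟨V, hV, h, -⟩ := c.interior_dom_eq
  rw [h, inter_comm]
  refine UniqueDiffOn.inter (uniqueDiffOn_convex (convex_Ici (0 : ℝ^m)) ?_) hV
  rw [interior_Ici_zero]
  exact ⟨fun _ => 1, fun _ => one_pos⟩

lemma dom_subset_closure_interior : c.dom ⊆ closure (interior c.dom) := by
  obtain ⟨V, hV, h, h'⟩ := c.interior_dom_eq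
  rw [h', h]
  have : closure (interior (Ici (0 : ℝ^m))) = Ici 0 := by
    rw [(convex_Ici (𝕜 := ℝ) (0 : ℝ^m)).closure_interior_eq_closure_of_nonempty_interior,
      isClosed_Ici.closure_eq]
    rw [interior_Ici_zero]
    exact ⟨fun _ => 1, fun _ => one_pos⟩
  intro x hx
  rw [mem_closure_iff_nhds]
  intro t ht
  have h2 : x ∈ closure (interior (Ici (0 : ℝ^m))) := by rw [this]; exact hx.2
  obtain ⟨y, hy⟩ := mem_closure_iff_nhds.1 h2 (t ∩ V) (inter_mem ht (hV.mem_nhds hx.1))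
  exact ⟨y, hy.1.1, hy.1.2, hy.2⟩

/-- The points lost lie in the frontier of the quadrant, a convex set. Hence integrals over the
domain only see its interior, where weak differentials are defined. -/
lemma volume_dom_diff_interior : volume (c.dom \ interior c.dom) = 0 := by
  obtain ⟨V, hV, h, h'⟩ := c.interior_dom_eq
  refine measure_mono_null ?_ ((convex_Ici (0 : ℝ^m)).addHaar_frontier volume)
  rintro x ⟨hx, hx'⟩
  rw [h'] at hx'
  rw [h] at hx
  exact ⟨subset_closure hx.2, fun h2 => hx' ⟨hx.1, h2⟩⟩

lemma ae_mem_interior : ∀ᵐ x ∂(volume.restrict c.dom), x ∈ interior c.dom := by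
  rw [ae_restrict_iff' c.measurableSet_dom]
  have := measure_eq_zero_iff_ae_notMem.1 c.volume_dom_diff_interior
  filter_upwards [this] with x hx h2
  by_contra h3
  exact hx ⟨h2, h3⟩

/-- The action of a group element, extended by the identity off the chart domain. -/
noncomputable def act (γ : Equiv.Perm c.dom) (x : ℝ^m) : ℝ^m :=
  open Classical in if h : x ∈ c.dom then γ ⟨x, h⟩ else x

lemma act_of_mem (γ : Equiv.Perm c.dom) {x : ℝ^m} (h : x ∈ c.dom) :
    c.act γ x = γ ⟨x, h⟩ := by simp [act, h]

lemma act_coe (γ : Equiv.Perm c.dom) (x : c.dom) : c.act γ x = γ x := by rw [act_of_mem _ _ x.2]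

lemma act_mem (γ : Equiv.Perm c.dom) {x : ℝ^m} (h : x ∈ c.dom) : c.act γ x ∈ c.dom := by
  rw [act_of_mem _ _ h]; exact (γ ⟨x, h⟩).2

lemma mapsTo_act (γ : Equiv.Perm c.dom) : MapsTo (c.act γ) c.dom c.dom := fun _ h => c.act_mem γ h

lemma act_mul (γ δ : Equiv.Perm c.dom) {x : ℝ^m} (h : x ∈ c.dom) :
    c.act (γ * δ) x = c.act γ (c.act δ x) := by
  rw [act_of_mem _ _ h, act_of_mem _ δ h, act_coe]; rfl

lemma act_one {x : ℝ^m} : c.act 1 x = x := by unfold act; split_ifs <;> simp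

lemma act_inv_act (γ : Equiv.Perm c.dom) {x : ℝ^m} (h : x ∈ c.dom) : c.act γ⁻¹ (c.act γ x) = x := by
  rw [← act_mul _ _ _ h, inv_mul_cancel, act_one]

lemma injOn_act (γ : Equiv.Perm c.dom) : InjOn (c.act γ) c.dom := by
  intro x hx y hy h
  rw [← c.act_inv_act γ hx, h, c.act_inv_act γ hy]

lemma contDiffOn_act {γ : Equiv.Perm c.dom} (hγ : γ ∈ c.group) :
    ContDiffOn ℝ ∞ (c.act γ) c.dom := by
  obtain ⟨f, hf, hs, -⟩ := c.smooth_isometric_group γ hγ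
  exact hs.congr fun x hx => by rw [c.act_of_mem γ hx, ← hf]

lemma pullsBackMetric_act {γ : Equiv.Perm c.dom} (hγ : γ ∈ c.group) :
    PullsBackMetric c.metric c.metric (c.act γ) c.dom := by
  obtain ⟨f, hf, -, hp⟩ := c.smooth_isometric_group γ hγ
  have he : EqOn (c.act γ) f c.dom := fun x hx => by rw [c.act_of_mem γ hx, ← hf]
  intro x hx v w
  rw [fderivWithin_congr he (he hx), he hx]
  exact hp x hx v w

lemma proj_act {γ : Equiv.Perm c.dom} (hγ : γ ∈ c.group) {x : ℝ^m} (h : x ∈ c.dom) :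
    c.proj (c.act γ x) = c.proj x := by
  rw [c.act_of_mem γ h]
  exact ((c.proj_eq_iff ⟨x, h⟩ (γ ⟨x, h⟩)).2 ⟨γ, hγ, rfl⟩).symm

lemma exists_act_eq {x y : ℝ^m} (hx : x ∈ c.dom) (hy : y ∈ c.dom)
    (h : c.proj x = c.proj y) : ∃ γ ∈ c.group, c.act γ x = y := by
  obtain ⟨γ, hγ, h2⟩ := (c.proj_eq_iff ⟨x, hx⟩ ⟨y, hy⟩).1 h
  exact ⟨γ, hγ, by rw [c.act_of_mem γ hx, h2]⟩

lemma continuousOn_act {γ : Equiv.Perm c.dom} (hγ : γ ∈ c.group) : ContinuousOn (c.act γ) c.dom :=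
  (c.contDiffOn_act hγ).continuousOn

lemma iterate_act (γ : Equiv.Perm c.dom) (k : ℕ) {x : ℝ^m} (h : x ∈ c.dom) :
    (c.act γ)^[k] x = c.act (γ ^ k) x := by
  induction k with
  | zero => simp [act_one]
  | succ k ih => rw [Function.iterate_succ_apply', ih, pow_succ', c.act_mul _ _ h]

/-- An element of finite order whose differential at a fixed point is the identity is the identity
near that point. -/
lemma act_eq_self_near {γ : Equiv.Perm c.dom} (hγ : γ ∈ c.group) {x : ℝ^m}
    (hx : x ∈ c.dom) (hfix : c.act γ x = x)
    (hd : fderivWithin ℝ (c.act γ) c.dom x = ContinuousLinearMap.id ℝ _) :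
    ∀ᶠ y in 𝓝[c.dom] x, c.act γ y = y := by
  have := c.finite_group
  obtain ⟨N, hN, hN1⟩ : ∃ N : ℕ, 0 < N ∧ γ ^ N = 1 := by
    obtain ⟨N, hN, h⟩ := (isOfFinOrder_of_finite (⟨γ, hγ⟩ : c.group)).exists_pow_eq_one
    exact ⟨N, hN, by simpa using congrArg Subtype.val h⟩
  -- Averaging over the cyclic group generated by `γ`: `Φ` is invariant under `γ`, while its
  -- differential at `x` is `N` times the identity. Once `Φ` is injective near `x`, the equation `Φ
  -- (γ y) = Φ y` forces `γ y = y`.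
  set Φ : ℝ^m → ℝ^m := fun y => ∑ k ∈ Finset.range N, c.act (γ ^ k) y with hΦ
  have hpow : ∀ k, γ ^ k ∈ c.group := fun k => c.group.pow_mem hγ k
  have hΦs : ContDiffOn ℝ ∞ Φ c.dom := by
    apply ContDiffOn.sum
    exact fun k _ => c.contDiffOn_act (hpow k)
  have hΦγ : ∀ y ∈ c.dom, Φ (c.act γ y) = Φ y := by
    intro y hy
    simp only [hΦ]
    have h1 : ∀ k, c.act (γ ^ k) (c.act γ y) = c.act (γ ^ (k + 1)) y := by
      intro k
      rw [pow_succ, c.act_mul _ _ hy]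
    simp_rw [h1]
    have h2 := Finset.sum_range_succ (fun k => c.act (γ ^ k) y) N
    rw [Finset.sum_range_succ', hN1, pow_zero] at h2
    exact add_right_cancel h2
  have hγd : HasFDerivWithinAt (c.act γ) (ContinuousLinearMap.id ℝ _) c.dom x := by
    rw [← hd]
    exact ((c.contDiffOn_act hγ).differentiableOn (by simp) x hx).hasFDerivWithinAt
  have hkd : ∀ k, HasFDerivWithinAt (c.act (γ ^ k)) (ContinuousLinearMap.id ℝ ℝ^m) c.dom x := by
    intro k
    have := hγd.iterate hfix (c.mapsTo_act γ) k
    have h1 : (ContinuousLinearMap.id ℝ ℝ^m) ^ k = ContinuousLinearMap.id ℝ _ := one_pow k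
    rw [h1] at this
    exact this.congr (fun y hy => (c.iterate_act γ k hy).symm) (c.iterate_act γ k hx).symm
  have hΦd : fderivWithin ℝ Φ c.dom x = (N : ℝ) • ContinuousLinearMap.id ℝ _ := by
    have : HasFDerivWithinAt Φ (∑ k ∈ Finset.range N, ContinuousLinearMap.id ℝ ℝ^m)
        c.dom x := HasFDerivWithinAt.fun_sum fun k _ => hkd k
    rw [this.fderivWithin (c.uniqueDiffOn_dom x hx)]
    simp only [Finset.sum_const, Finset.card_range]
    exact (Nat.cast_smul_eq_nsmul ℝ N _).symm
  have hcont := hΦs.continuousOn_fderivWithin c.uniqueDiffOn_dom (by simp) x hx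
  have hNpos : (0 : ℝ) < N := by exact_mod_cast hN
  have hev : ∀ᶠ y in 𝓝[c.dom] x,
      ‖fderivWithin ℝ Φ c.dom y - (N : ℝ) • ContinuousLinearMap.id ℝ _‖ < N / 2 := by
    have h1 : Tendsto (fun y => ‖fderivWithin ℝ Φ c.dom y - (N : ℝ) • ContinuousLinearMap.id ℝ _‖)
        (𝓝[c.dom] x) (𝓝 0) := by
      rw [← hΦd]
      have := (hcont.tendsto.sub_const (fderivWithin ℝ Φ c.dom x)).norm
      simpa using this
    exact h1.eventually_lt_const (by positivity)
  obtain ⟨U, hU, hU2⟩ := mem_nhdsWithin_iff_exists_mem_nhds_inter.1 hev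
  obtain ⟨r, hr, hrU, hreq⟩ := c.exists_ball_inter_quadrant hx hU
  have hconv := c.convex_dom_inter_ball hreq
  -- On a convex piece where `dΦ` stays within `N / 2` of `N • id`, the mean value inequality gives
  -- `N ‖z - y‖ ≤ (N / 2) ‖z - y‖` whenever `Φ y = Φ z`.
  have hinj : InjOn Φ (c.dom ∩ ball x r) := by
    intro y hy z hz hyz
    have := hconv.norm_image_sub_le_of_norm_hasFDerivWithin_le' (f := Φ) (C := N / 2)
      (f' := fun y => fderivWithin ℝ Φ c.dom y) (φ := (N : ℝ) • ContinuousLinearMap.id ℝ _)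
      (fun w hw => ((hΦs.differentiableOn (by simp) w hw.1).hasFDerivWithinAt).mono
        inter_subset_left)
      (fun w hw => (hU2 ⟨hrU hw.2, hw.1⟩).le) hy hz
    rw [hyz, sub_self, zero_sub, norm_neg] at this
    simp only [_root_.smul_apply, ContinuousLinearMap.id_apply,
      norm_smul, Real.norm_natCast] at this
    have h3 : ‖z - y‖ ≤ 0 := by
      have h4 : (N : ℝ) / 2 * ‖z - y‖ ≤ 0 := by
        change (N : ℝ) * ‖z - y‖ ≤ N / 2 * ‖z - y‖ at this
        linarith
      by_contra h5
      push Not at h5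
      have : 0 < (N : ℝ) / 2 * ‖z - y‖ := by positivity
      linarith
    have := norm_le_zero_iff.1 h3
    exact (sub_eq_zero.1 this).symm
  have hct : Tendsto (c.act γ) (𝓝[c.dom] x) (𝓝 x) := by
    have := (c.continuousOn_act hγ x hx).tendsto
    rwa [hfix] at this
  filter_upwards [self_mem_nhdsWithin, mem_nhdsWithin_of_mem_nhds (ball_mem_nhds x hr),
    hct (ball_mem_nhds x hr)] with y h1 h2 h3
  exact hinj ⟨c.act_mem γ h1, h3⟩ ⟨h1, h2⟩ (hΦγ y h1)

/-- A group element that is the identity near some point is trivial. -/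
lemma eq_one_of_eventually_act_eq {γ : Equiv.Perm c.dom} (hγ : γ ∈ c.group) {x : ℝ^m}
    (hx : x ∈ c.dom) (h : ∀ᶠ y in 𝓝[c.dom] x, c.act γ y = y) : γ = 1 := by
  let Z : Set c.dom := {x | ∀ᶠ y in 𝓝[c.dom] (x : ℝ^m), c.act γ y = y}
  have : PreconnectedSpace c.dom :=
    isPreconnected_iff_preconnectedSpace.1 c.isConnected_dom.isPreconnected
  have hopen : IsOpen Z := by
    rw [isOpen_iff_mem_nhds]
    intro z hz
    have := eventually_eventually_nhdsWithin.2 hz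
    rw [nhds_subtype_eq_comap_nhdsWithin]
    exact ⟨_, this, fun y hy => hy⟩
  -- At a limit point of `Z` both equations, `γ y = y` and `dγ = id`, persist by continuity, and
  -- `act_eq_self_near` applies there.
  have hclosed : IsClosed Z := by
    rw [isClosed_iff_frequently]
    intro z hz
    have hfr : ∃ᶠ y in 𝓝[c.dom] (z : ℝ^m),
        c.act γ y = y ∧ fderivWithin ℝ (c.act γ) c.dom y = ContinuousLinearMap.id ℝ _ := by
      have h1 : ∃ᶠ y in map ((↑) : c.dom → ℝ^m) (𝓝 z),
          c.act γ y = y ∧ fderivWithin ℝ (c.act γ) c.dom y = ContinuousLinearMap.id ℝ _ := by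
        rw [frequently_map]
        refine hz.mono fun y hy => ?_
        have hyy : c.act γ y = y := hy.self_of_nhdsWithin y.2
        refine ⟨hyy, ?_⟩
        have := Filter.EventuallyEq.fderivWithin_eq (𝕜 := ℝ) (f₁ := c.act γ) (f := id)
          (s := c.dom) (x := (y : ℝ^m)) hy hyy
        rw [this, fderivWithin_id (c.uniqueDiffOn_dom _ y.2)]
      rwa [map_nhds_subtype_val] at h1
    refine c.act_eq_self_near hγ z.2 ?_ ?_
    · have h1 : Tendsto (fun y => c.act γ y - y) (𝓝[c.dom] (z : ℝ^m))
          (𝓝 (c.act γ z - z)) :=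
        (c.continuousOn_act hγ z z.2).sub continuousWithinAt_id
      have h2 : c.act γ z - z = 0 := by
        by_contra hne
        exact hfr ((h1.eventually_ne hne).mono fun y hy h3 => hy (sub_eq_zero.2 h3.1))
      exact sub_eq_zero.1 h2
    · have h1 : Tendsto (fun y => fderivWithin ℝ (c.act γ) c.dom y) (𝓝[c.dom] (z : ℝ^m))
          (𝓝 (fderivWithin ℝ (c.act γ) c.dom z)) :=
        (c.contDiffOn_act hγ).continuousOn_fderivWithin c.uniqueDiffOn_dom (by simp) z z.2
      by_contra hne
      exact hfr ((h1.eventually_ne hne).mono fun y hy h3 => hy h3.2)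
  have huniv : Z = univ := IsClopen.eq_univ ⟨hclosed, hopen⟩ ⟨⟨x, hx⟩, h⟩
  ext y
  have hy : y ∈ Z := by rw [huniv]; trivial
  have := hy.self_of_nhdsWithin y.2
  rw [act_coe] at this
  rw [this]; rfl

/-- On its fixed set `γ` coincides with the identity, so at almost every point of that set its
differential is the identity. If the set had positive measure, `γ` would be trivial near one of its
points and therefore everywhere. -/
lemma volume_fix {γ : Equiv.Perm c.dom} (hγ : γ ∈ c.group) (h1 : γ ≠ 1) :
    volume {x ∈ c.dom | c.act γ x = x} = 0 := by
  classical
  set F := {x ∈ c.dom | c.act γ x = x} with hF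
  have hFm : MeasurableSet F := by
    obtain ⟨g, hg, hgs⟩ : ∃ g : ℝ^m → ℝ^m, Measurable g ∧ EqOn g (c.act γ) c.dom := by
      refine ⟨c.dom.piecewise (c.act γ) id, ?_, fun x hx => piecewise_eq_of_mem _ _ _ hx⟩
      exact (measurable_of_restrict_of_restrict_compl c.measurableSet_dom (by
          rw [domRestrict_piecewise]
          exact (continuousOn_iff_continuous_domRestrict.1 (c.continuousOn_act hγ)).measurable)
        (by
          rw [domRestrict_piecewise_compl]
          exact measurable_subtype_coe))
    have : F = c.dom ∩ {x | g x = x} := by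
      ext x; constructor
      · rintro ⟨h2, h3⟩; exact ⟨h2, (hgs h2).trans h3⟩
      · rintro ⟨h2, h3⟩; exact ⟨h2, by rw [← hgs h2]; exact h3⟩
    rw [this]
    exact c.measurableSet_dom.inter (measurableSet_eq_fun hg measurable_id)
  have happ : ApproximatesLinearOn (c.act γ) (ContinuousLinearMap.id ℝ ℝ^m) F 0 := by
    intro x hx y hy
    simp [hx.2, hy.2]
  have := happ.norm_fderiv_sub_le volume hFm (fun x => fderivWithin ℝ (c.act γ) c.dom x)
    (fun x hx => (((c.contDiffOn_act hγ).differentiableOn (by simp) x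
      hx.1).hasFDerivWithinAt).mono fun y hy => hy.1)
  by_contra hne
  have : ∃ x ∈ F, fderivWithin ℝ (c.act γ) c.dom x = ContinuousLinearMap.id ℝ _ := by
    by_contra hcon
    push Not at hcon
    rw [ae_restrict_iff' hFm] at this
    apply hne
    rw [measure_eq_zero_iff_ae_notMem]
    filter_upwards [this] with x hx hxF
    have h2 := hx hxF
    have h3 : fderivWithin ℝ (c.act γ) c.dom x - ContinuousLinearMap.id ℝ _ = 0 := by
      rw [← nnnorm_eq_zero]; exact le_antisymm h2 zero_le
    exact hcon x hxF (sub_eq_zero.1 h3)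
  obtain ⟨x, hx, hxd⟩ := this
  exact h1 (c.eq_one_of_eventually_act_eq hγ hx.1 (c.act_eq_self_near hγ hx.1 hx.2 hxd))

end RiemannianOrbifoldChart

/-! ### Isometric changes of coordinates and the Riemannian volume of a chart. -/

lemma PullsBackMetric.inter_open {m : ℕ} {A B : ℝ^m → Matrix (Fin m) (Fin m) ℝ}
    {f : ℝ^m → ℝ^m} {s V : Set ℝ^m} (h : PullsBackMetric A B f s)
    (hV : IsOpen V) : PullsBackMetric A B f (s ∩ V) := by
  intro x hx v w
  rw [fderivWithin_inter (hV.mem_nhds hx.2)]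
  exact h x hx.1 v w

lemma PullsBackMetric.transpose_mul_mul {m : ℕ} {A B : ℝ^m → Matrix (Fin m) (Fin m) ℝ}
    {f : ℝ^m → ℝ^m} {s : Set ℝ^m} (h : PullsBackMetric A B f s)
    {x : ℝ^m} (hx : x ∈ s) :
    (LinearMap.toMatrix' (fderivWithin ℝ f s x : ℝ^m →ₗ[ℝ] ℝ^m)).transpose *
      B (f x) * (LinearMap.toMatrix' (fderivWithin ℝ f s x : ℝ^m →ₗ[ℝ] ℝ^m)) =
      A x := by
  set M := LinearMap.toMatrix' (fderivWithin ℝ f s x : ℝ^m →ₗ[ℝ] ℝ^m) with hM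
  have hMv : ∀ v, M.mulVec v = fderivWithin ℝ f s x v := by
    intro v
    rw [hM, LinearMap.toMatrix'_mulVec]; rfl
  ext i j
  have := h x hx (Pi.single i 1) (Pi.single j 1)
  rw [← hMv, ← hMv, Matrix.mulVec_mulVec, Matrix.dotProduct_mulVec, ← Matrix.vecMul_transpose,
    Matrix.vecMul_vecMul, ← Matrix.dotProduct_mulVec, ← Matrix.mul_assoc] at this
  simpa using this

/-- Determinants of the identity `Mᵀ B M = A`. This is the transformation rule that makes the
density `√det` independent of coordinates. -/
lemma PullsBackMetric.abs_det_mul_sqrt {m : ℕ} {A B : ℝ^m → Matrix (Fin m) (Fin m) ℝ}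
    {f : ℝ^m → ℝ^m} {s : Set ℝ^m} (h : PullsBackMetric A B f s)
    {x : ℝ^m} (hx : x ∈ s) :
    |(fderivWithin ℝ f s x).det| * √(B (f x)).det = √(A x).det := by
  have := congrArg Matrix.det (h.transpose_mul_mul hx)
  rw [Matrix.det_mul, Matrix.det_mul, Matrix.det_transpose, LinearMap.det_toMatrix'] at this
  rw [← this, mul_right_comm, Real.sqrt_mul (mul_self_nonneg _), Real.sqrt_mul_self_eq_abs]

namespace RiemannianOrbifoldChart

variable {m : ℕ} {X : Type*} [TopologicalSpace X] (c : Chart m X)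

lemma det_metric_pos {x : ℝ^m} (hx : x ∈ c.dom) : 0 < (c.metric x).det :=
  (c.posDef_metric x hx).det_pos

lemma continuousOn_metric : ContinuousOn c.metric c.dom :=
  continuousOn_pi.2 fun i => continuousOn_pi.2 fun j => (c.contDiffOn_metric i j).continuousOn

lemma continuousOn_sqrt_det : ContinuousOn (fun x => √(c.metric x).det) c.dom :=
  (Continuous.comp_continuousOn (g := fun M : Matrix (Fin m) (Fin m) ℝ => M.det)
    (Continuous.matrix_det continuous_id) c.continuousOn_metric).sqrt

lemma aemeasurable_ofReal_sqrt_det :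
    AEMeasurable (fun x => ofReal √(c.metric x).det) (volume.restrict c.dom) :=
  (c.continuousOn_sqrt_det.aemeasurable c.measurableSet_dom).ennreal_ofReal

/-- The Riemannian volume measure of a chart. -/
noncomputable def riemVolume : Measure ℝ^m :=
  (volume.restrict c.dom).withDensity fun x => ofReal √(c.metric x).det

/-- The density is positive on the domain, so the null sets are those of Lebesgue measure;
almost-everywhere statements move freely between the two measures. -/
lemma ae_riemVolume : ae c.riemVolume = ae (volume.restrict c.dom) := by
  apply le_antisymm
  · exact (withDensity_absolutelyContinuous _ _).ae_le
  · refine (withDensity_absolutelyContinuous' c.aemeasurable_ofReal_sqrt_det ?_).ae_le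
    rw [ae_restrict_iff' c.measurableSet_dom]
    exact Eventually.of_forall fun x hx => by
      have := c.det_metric_pos hx
      simp [this]

lemma riemVolume_eq_zero_iff {A : Set ℝ^m} : c.riemVolume A = 0 ↔ volume.restrict c.dom A = 0 := by
  rw [measure_eq_zero_iff_ae_notMem, measure_eq_zero_iff_ae_notMem, ae_riemVolume]

lemma riemVolume_compl_dom : c.riemVolume c.domᶜ = 0 := by
  rw [riemVolume_eq_zero_iff, Measure.restrict_apply c.measurableSet_dom.compl]
  simp

lemma riemVolume_dom_inter (A : Set ℝ^m) : c.riemVolume (c.dom ∩ A) = c.riemVolume A := by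
  refine le_antisymm (measure_mono inter_subset_right) ?_
  calc c.riemVolume A ≤ c.riemVolume ((c.dom ∩ A) ∪ c.domᶜ) := by
        apply measure_mono
        intro x hx
        by_cases h : x ∈ c.dom
        · exact Or.inl ⟨h, hx⟩
        · exact Or.inr h
    _ ≤ _ := measure_union_le _ _
    _ = _ := by rw [riemVolume_compl_dom, add_zero]

lemma setLIntegral_riemVolume {B : Set ℝ^m} (hB : MeasurableSet B) (hBd : B ⊆ c.dom)
    (g : ℝ^m → ℝ≥0∞) :
    ∫⁻ x in B, g x ∂c.riemVolume = ∫⁻ x in B, ofReal √(c.metric x).det * g x := by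
  unfold riemVolume
  rw [setLIntegral_withDensity_eq_setLIntegral_mul_non_measurable₀ _ _ _ hB]
  · rw [Measure.restrict_restrict hB, inter_eq_left.2 hBd]; rfl
  · exact Eventually.of_forall fun _ => ofReal_lt_top
  · exact c.aemeasurable_ofReal_sqrt_det.restrict

/-- The change of variables formula, in which the Jacobian is absorbed by the quotient of the two
densities. -/
lemma lintegral_image_isometry {c c' : Chart m X} {t B : Set ℝ^m} {f : ℝ^m → ℝ^m}
    (ht : t ⊆ c.dom) (hd : DifferentiableOn ℝ f t) (hp : PullsBackMetric c.metric c'.metric f t)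
    (hB : MeasurableSet B) (hBt : B ⊆ t) (hmap : MapsTo f t c'.dom) (hinj : InjOn f B)
    (g : ℝ^m → ℝ≥0∞) :
    ∫⁻ y in f '' B, g y ∂c'.riemVolume = ∫⁻ x in B, g (f x) ∂c.riemVolume := by
  rw [c.setLIntegral_riemVolume hB (hBt.trans ht), c'.setLIntegral_riemVolume
    (hB.image_of_continuousOn_injOn (hd.continuousOn.mono hBt) hinj)
    ((image_mono hBt).trans hmap.image_subset),
    lintegral_image_eq_lintegral_abs_det_fderiv_mul volume hB
      (fun x hx => ((hd x (hBt hx)).hasFDerivWithinAt).mono hBt) hinj]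
  refine setLIntegral_congr_fun hB fun x hx => ?_
  rw [← mul_assoc, ← ofReal_mul (abs_nonneg _), hp.abs_det_mul_sqrt (hBt hx)]

lemma riemVolume_image {c c' : Chart m X} {t B : Set ℝ^m} {f : ℝ^m → ℝ^m}
    (ht : t ⊆ c.dom) (hd : DifferentiableOn ℝ f t) (hp : PullsBackMetric c.metric c'.metric f t)
    (hB : MeasurableSet B) (hBt : B ⊆ t) (hmap : MapsTo f t c'.dom) (hinj : InjOn f B) :
    c'.riemVolume (f '' B) = c.riemVolume B := by
  simpa using lintegral_image_isometry ht hd hp hB hBt hmap hinj 1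

lemma riemVolume_act_image {γ : Equiv.Perm c.dom} (hγ : γ ∈ c.group) {B : Set ℝ^m}
    (hB : MeasurableSet B) (hBd : B ⊆ c.dom) : c.riemVolume (c.act γ '' B) = c.riemVolume B :=
  riemVolume_image subset_rfl ((c.contDiffOn_act hγ).differentiableOn (by simp))
    (c.pullsBackMetric_act hγ) hB hBd (c.mapsTo_act γ) ((c.injOn_act γ).mono hBd)

lemma measurableSet_act_image {γ : Equiv.Perm c.dom} (hγ : γ ∈ c.group) {B : Set ℝ^m}
    (hB : MeasurableSet B) (hBd : B ⊆ c.dom) : MeasurableSet (c.act γ '' B) :=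
  hB.image_of_continuousOn_injOn ((c.continuousOn_act hγ).mono hBd) ((c.injOn_act γ).mono hBd)

lemma preimage_proj_image {B : Set ℝ^m} (hBd : B ⊆ c.dom) :
    c.dom ∩ c.proj ⁻¹' (c.proj '' B) = ⋃ γ : c.group, c.act γ '' B := by
  ext x
  simp only [mem_inter_iff, mem_preimage, mem_image, mem_iUnion]
  constructor
  · rintro ⟨hx, y, hy, hyx⟩
    obtain ⟨γ, hγ, h⟩ := c.exists_act_eq (hBd hy) hx hyx
    exact ⟨⟨γ, hγ⟩, y, hy, h⟩
  · rintro ⟨γ, y, hy, rfl⟩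
    exact ⟨c.act_mem _ (hBd hy), y, hy, (c.proj_act γ.2 (hBd hy)).symm⟩

/-- The points of the chart domain with trivial stabiliser. -/
def regular : Set ℝ^m := {x ∈ c.dom | ∀ γ ∈ c.group, c.act γ x = x → γ = 1}

lemma volume_dom_diff_regular : volume (c.dom \ c.regular) = 0 := by
  have := c.finite_group
  have h : c.dom \ c.regular ⊆ ⋃ γ : c.group, {x ∈ c.dom | (γ : Equiv.Perm c.dom) ≠ 1 ∧
      c.act γ x = x} := by
    rintro x ⟨hx, hx'⟩
    simp only [regular, mem_ofPred_eq, not_and, not_forall] at hx'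
    obtain ⟨γ, hγ, h1, h2⟩ := hx' hx
    exact mem_iUnion.2 ⟨⟨γ, hγ⟩, hx, h2, h1⟩
  refine measure_mono_null h (measure_iUnion_null fun γ => ?_)
  by_cases h1 : (γ : Equiv.Perm c.dom) = 1
  · simp [h1]
  · exact measure_mono_null (fun x (hx : x ∈ c.dom ∧ _ ∧ _) => And.intro hx.1 hx.2.2)
      (c.volume_fix γ.2 h1)

lemma mem_regular_of_proj_eq {x y : ℝ^m} (hx : x ∈ c.regular) (hy : y ∈ c.dom)
    (h : c.proj x = c.proj y) : y ∈ c.regular := by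
  refine ⟨hy, fun γ hγ hfix => ?_⟩
  obtain ⟨δ, hδ, rfl⟩ := c.exists_act_eq hx.1 hy h
  have h1 : c.act (δ⁻¹ * γ * δ) x = x := by
    rw [c.act_mul _ _ hx.1, c.act_mul _ _ (c.act_mem _ hx.1), hfix, c.act_inv_act _ hx.1]
  have h2 := hx.2 _ (c.group.mul_mem (c.group.mul_mem (c.group.inv_mem hδ) hγ) hδ) h1
  have : γ = δ * (δ⁻¹ * γ * δ) * δ⁻¹ := by group
  rw [this, h2]; group

/-- A regular point differs from its finitely many nontrivial translates and can be separated from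
each of them by open sets. A small enough neighbourhood therefore contains at most one point of each
orbit. -/
lemma exists_open_injOn {x : ℝ^m} (hx : x ∈ c.regular) :
    ∃ V, IsOpen V ∧ x ∈ V ∧ c.dom ∩ V ⊆ c.regular ∧ InjOn c.proj (c.dom ∩ V) := by
  have := c.finite_group
  have h1 : ∀ γ : c.group, ∃ A B : Set ℝ^m, (γ : Equiv.Perm c.dom) ≠ 1 →
      IsOpen A ∧ IsOpen B ∧ x ∈ A ∧ c.act γ x ∈ B ∧ Disjoint A B := by
    intro γ
    by_cases h : (γ : Equiv.Perm c.dom) = 1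
    · exact ⟨∅, ∅, fun h2 => absurd h h2⟩
    · have : x ≠ c.act γ x := fun h2 => h (hx.2 γ γ.2 h2.symm)
      obtain ⟨A, B, hh⟩ := t2_separation this
      exact ⟨A, B, fun _ => hh⟩
  choose A B hAB using h1
  have h2 : ∀ᶠ y in 𝓝[c.dom] x, ∀ γ : c.group, (γ : Equiv.Perm c.dom) ≠ 1 →
      y ∈ A γ ∧ c.act γ y ∈ B γ := by
    rw [eventually_all]
    intro γ
    by_cases h : (γ : Equiv.Perm c.dom) = 1
    · exact Eventually.of_forall fun y h2 => absurd h h2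
    · obtain ⟨hA, hB, hxA, hxB, -⟩ := hAB γ h
      have e1 : ∀ᶠ y in 𝓝[c.dom] x, y ∈ A γ := mem_nhdsWithin_of_mem_nhds (hA.mem_nhds hxA)
      have e2 : ∀ᶠ y in 𝓝[c.dom] x, c.act γ y ∈ B γ :=
        (c.continuousOn_act γ.2 x hx.1) (hB.mem_nhds hxB)
      filter_upwards [e1, e2] with y h3 h4 _ using ⟨h3, h4⟩
  obtain ⟨V, hV, hxV, hVs⟩ := mem_nhdsWithin.1 h2
  have key : ∀ y ∈ c.dom ∩ V, ∀ γ ∈ c.group, c.act γ y ∈ c.dom ∩ V → γ = 1 := by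
    intro y hy γ hγ hy'
    by_contra hne
    have h3 := hVs hy.symm ⟨γ, hγ⟩ hne
    have h4 := hVs hy'.symm ⟨γ, hγ⟩ hne
    exact disjoint_left.1 (hAB ⟨γ, hγ⟩ hne).2.2.2.2 h4.1 h3.2
  refine ⟨V, hV, hxV, fun y hy => ⟨hy.1, fun γ hγ h => key y hy γ hγ (by rw [h]; exact hy)⟩, ?_⟩
  intro y hy z hz hyz
  obtain ⟨γ, hγ, rfl⟩ := c.exists_act_eq hy.1 hz.1 hyz
  rw [key y hy γ hγ hz, act_one]

lemma exists_seq_open_cover {s : Set ℝ^m} {p : Set ℝ^m → Prop} (h0 : p ∅)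
    (h : ∀ x ∈ s, ∃ V, IsOpen V ∧ x ∈ V ∧ p V) :
    ∃ W : ℕ → Set ℝ^m, (∀ j, IsOpen (W j)) ∧ (∀ j, p (W j)) ∧ s ⊆ ⋃ j, W j := by
  choose! V hV hxV hp using h
  obtain ⟨t, hts, htc, hst⟩ := TopologicalSpace.countable_cover_nhdsWithin
    (f := V) (s := s) fun x hx => mem_nhdsWithin_of_mem_nhds ((hV x hx).mem_nhds (hxV x hx))
  rcases t.eq_empty_or_nonempty with rfl | hne
  · refine ⟨fun _ => ∅, fun _ => isOpen_empty, fun _ => h0, ?_⟩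
    simpa using hst
  · obtain ⟨f, rfl⟩ := htc.exists_eq_range hne
    refine ⟨fun j => V (f j), fun j => hV _ (hts ⟨j, rfl⟩), fun j => hp _ (hts ⟨j, rfl⟩), ?_⟩
    simpa using hst

lemma isOpen_image_inter {V : Set ℝ^m} (hV : IsOpen V) :
    IsOpen (c.proj '' (c.dom ∩ V)) := c.isOpen_image_proj V hV

lemma isOpen_image_dom : IsOpen (c.proj '' c.dom) := by
  simpa using c.isOpen_image_proj univ isOpen_univ

variable [MeasurableSpace X]

/-- The image of the Riemannian volume of a chart, divided by the order of the group. -/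
noncomputable def pushVolume : Measure X :=
  ((Nat.card c.group : ℝ≥0∞)⁻¹) • Measure.map c.proj c.riemVolume

variable [BorelSpace X]

lemma measurableSet_preimage {A : Set X} (hA : MeasurableSet A) :
    MeasurableSet (c.dom ∩ c.proj ⁻¹' A) := by
  have h1 := (continuousOn_iff_continuous_domRestrict.1 c.continuousOn_proj).measurable hA
  have h2 := c.measurableSet_dom.subtype_image h1
  convert h2 using 1
  ext x; simp [and_comm]

lemma aemeasurable_proj : AEMeasurable c.proj c.riemVolume :=
  (c.continuousOn_proj.aemeasurable c.measurableSet_dom).mono_ac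
    (withDensity_absolutelyContinuous _ _)

lemma card_ne_zero : (Nat.card c.group : ℝ≥0∞) ≠ 0 := by
  have := c.finite_group
  exact_mod_cast Nat.card_pos.ne'

lemma card_ne_top : (Nat.card c.group : ℝ≥0∞) ≠ ⊤ := ENNReal.natCast_ne_top _

lemma pushVolume_apply {A : Set X} (hA : MeasurableSet A) :
    c.pushVolume A = (Nat.card c.group : ℝ≥0∞)⁻¹ * c.riemVolume (c.dom ∩ c.proj ⁻¹' A) := by
  unfold pushVolume
  rw [Measure.smul_apply, Measure.map_apply_of_aemeasurable c.aemeasurable_proj hA,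
    riemVolume_dom_inter, smul_eq_mul]

/-- The full preimage of the image is the union of the translates of `B`, all of the same volume,
and their number cancels the normalising factor. The translates may overlap, so only an inequality
results. -/
lemma pushVolume_image_le {B : Set ℝ^m} (hB : MeasurableSet B) (hBd : B ⊆ c.dom)
    (hBm : MeasurableSet (c.proj '' B)) :
    c.pushVolume (c.proj '' B) ≤ c.riemVolume B := by
  have := c.finite_group
  rw [c.pushVolume_apply hBm, c.preimage_proj_image hBd]
  calc (Nat.card c.group : ℝ≥0∞)⁻¹ * c.riemVolume (⋃ γ : c.group, c.act γ '' B)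
      ≤ (Nat.card c.group : ℝ≥0∞)⁻¹ * ∑' γ : c.group, c.riemVolume (c.act γ '' B) := by
        gcongr; exact measure_iUnion_le _
    _ = (Nat.card c.group : ℝ≥0∞)⁻¹ * (Nat.card c.group * c.riemVolume B) := by
        congr 1
        simp_rw [fun γ : c.group => c.riemVolume_act_image γ.2 hB hBd]
        rw [ENNReal.tsum_const, ENat.card_eq_coe_natCard, ENat.toENNReal_coe]
    _ = _ := by rw [← mul_assoc, ENNReal.inv_mul_cancel c.card_ne_zero c.card_ne_top, one_mul]

lemma pushVolume_image_of_injOn [T2Space X] {B : Set ℝ^m} (hB : MeasurableSet B)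
    (hBd : B ⊆ c.dom) (hinj : InjOn c.proj B) :
    c.pushVolume (c.proj '' B) = c.riemVolume B := by
  have := c.finite_group
  have hBm : MeasurableSet (c.proj '' B) :=
    hB.image_of_continuousOn_injOn (c.continuousOn_proj.mono hBd) hinj
  rw [c.pushVolume_apply hBm, c.preimage_proj_image hBd, measure_iUnion₀]
  · simp_rw [fun γ : c.group => c.riemVolume_act_image γ.2 hB hBd]
    rw [ENNReal.tsum_const, ENat.card_eq_coe_natCard, ENat.toENNReal_coe, ← mul_assoc,
      ENNReal.inv_mul_cancel c.card_ne_zero c.card_ne_top, one_mul]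
  · intro γ δ hne
    -- Since `proj` is injective on `B`, a common point of two translates comes from a single `b`
    -- and is fixed by `δ γ⁻¹`. The translates are thus disjoint up to nonregular points, which are
    -- null.
    have h1 : c.act γ '' B ∩ c.act δ '' B ⊆ c.dom \ c.regular := by
      rintro z ⟨⟨b, hb, rfl⟩, ⟨b', hb', h⟩⟩
      have e : b' = b := hinj hb' hb (by
        rw [← c.proj_act δ.2 (hBd hb'), h, c.proj_act γ.2 (hBd hb)])
      subst e
      refine ⟨c.act_mem _ (hBd hb), fun hr => hne ?_⟩
      have h2 := hr.2 (δ * (γ : Equiv.Perm c.dom)⁻¹) (c.group.mul_mem δ.2 (c.group.inv_mem γ.2))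
        (by rw [c.act_mul _ _ (c.act_mem _ (hBd hb)), c.act_inv_act _ (hBd hb), h])
      exact (Subtype.ext (mul_inv_eq_one.1 h2)).symm
    refine measure_mono_null h1 ?_
    rw [riemVolume_eq_zero_iff]
    exact le_antisymm ((Measure.restrict_apply_le _ _).trans c.volume_dom_diff_regular.le) zero_le
  · exact fun γ => (c.measurableSet_act_image γ.2 hB hBd).nullMeasurableSet

end RiemannianOrbifoldChart

/-! ### The volume measure of the orbifold. -/

namespace RiemannianOrbifold

variable {m : ℕ} {X : Type*} [TopologicalSpace X] [T2Space X] [MeasurableSpace X] [BorelSpace X]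
  (O : RiemannianOrbifold m X)

/-- Up to a null set, `A` is covered by countably many open sets on which the projection of `c` is
injective and one isometric change of charts to `c'` is defined. On measurable parts of these both
measures compute the Riemannian volume of a lift. The reverse inequality follows by exchanging the
charts. -/
lemma pushVolume_le {c c' : Chart m X} (hc : c ∈ O.atlas) (hc' : c' ∈ O.atlas)
    {A : Set X} (hA : MeasurableSet A) (hAU : A ⊆ c'.proj '' c'.dom) :
    c.pushVolume A ≤ c'.pushVolume A := by
  obtain ⟨W, hWo, hWp, hWs⟩ := RiemannianOrbifoldChart.exists_seq_open_cover
    (s := {x ∈ c.regular | c.proj x ∈ A})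
    (p := fun V => InjOn c.proj (c.dom ∩ V) ∧ ∃ h : ℝ^m → ℝ^m,
      DifferentiableOn ℝ h (c.dom ∩ V) ∧ MapsTo h (c.dom ∩ V) c'.dom ∧
      PullsBackMetric c.metric c'.metric h (c.dom ∩ V) ∧ ∀ z ∈ c.dom ∩ V, c'.proj (h z) = c.proj z)
    ⟨by simp, id, differentiableOn_id, fun x hx => by simp at hx, fun x hx => by simp at hx,
      by simp⟩ (by
      rintro x ⟨hx, hxA⟩
      obtain ⟨y, hy, hyx⟩ := hAU hxA
      obtain ⟨h, ⟨V, hV, hVs⟩, ⟨V', -, hVt⟩, hxs, -, hd, -, hproj, hp⟩ :=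
        O.compatible c hc c' hc' x hx.1 y hy hyx.symm
      obtain ⟨V₂, hV₂, hxV₂, -, hinj⟩ := c.exists_open_injOn hx
      have hsub : c.dom ∩ (V ∩ V₂) = h.source ∩ V₂ := by rw [hVs, inter_assoc]
      refine ⟨V ∩ V₂, hV.inter hV₂, ⟨?_, hxV₂⟩, ?_, h, ?_, ?_, ?_, ?_⟩
      · rw [hVs] at hxs; exact hxs.2
      · exact hinj.mono (inter_subset_inter_right _ inter_subset_right)
      · rw [hsub]; exact (hd.differentiableOn (by simp)).mono inter_subset_left
      · rw [hsub]
        intro z hz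
        have := h.map_source hz.1
        rw [hVt] at this
        exact this.1
      · rw [hsub]; exact hp.inter_open hV₂
      · rw [hsub]; exact fun z hz => hproj z hz.1)
  choose hinj h hd hmap hp hproj using hWp
  set E : ℕ → Set X := fun j => c.proj '' (c.dom ∩ W j) with hE
  have hEm : ∀ j, MeasurableSet (E j) := fun j => (c.isOpen_image_inter (hWo j)).measurableSet
  set D := disjointed E with hD
  have hDm : ∀ j, MeasurableSet (D j) := fun j => MeasurableSet.disjointed hEm j
  have hDE : ∀ j, D j ⊆ E j := disjointed_subset E
  have hpiece : ∀ j, c.pushVolume (A ∩ D j) = c'.pushVolume (A ∩ D j) := by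
    intro j
    set B := (c.dom ∩ c.proj ⁻¹' (A ∩ D j)) ∩ W j with hB
    have hBm : MeasurableSet B :=
      (c.measurableSet_preimage (hA.inter (hDm j))).inter (hWo j).measurableSet
    have hBW : B ⊆ c.dom ∩ W j := fun x hx => ⟨hx.1.1, hx.2⟩
    have himg : c.proj '' B = A ∩ D j := by
      apply Subset.antisymm
      · rintro _ ⟨x, hx, rfl⟩; exact hx.1.2
      · intro p hp
        obtain ⟨x, hx, rfl⟩ := hDE j hp.2
        exact ⟨x, ⟨⟨hx.1, hp⟩, hx.2⟩, rfl⟩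
    have hinj' : InjOn c'.proj (h j '' B) := by
      rintro _ ⟨x, hx, rfl⟩ _ ⟨y, hy, rfl⟩ hxy
      rw [hproj j x (hBW hx), hproj j y (hBW hy)] at hxy
      rw [hinj j (hBW hx) (hBW hy) hxy]
    have hhinj : InjOn (h j) B := by
      intro x hx y hy hxy
      apply hinj j (hBW hx) (hBW hy)
      rw [← hproj j x (hBW hx), hxy, hproj j y (hBW hy)]
    have himg' : c'.proj '' (h j '' B) = A ∩ D j := by
      rw [← himg, image_image]
      exact image_congr fun x hx => hproj j x (hBW hx)
    rw [← himg, c.pushVolume_image_of_injOn hBm (hBW.trans inter_subset_left)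
      ((hinj j).mono hBW), himg, ← himg', c'.pushVolume_image_of_injOn
      (hBm.image_of_continuousOn_injOn ((hd j).continuousOn.mono hBW) hhinj)
      ((image_mono hBW).trans (hmap j).image_subset) hinj']
    exact (RiemannianOrbifoldChart.riemVolume_image inter_subset_left (hd j) (hp j) hBm hBW
      (hmap j) hhinj).symm
  -- The uncovered part of `A` lifts to nonregular points of `c` only. Nothing needs to be known
  -- about its measure with respect to `c'`, because only an inequality is claimed.
  have hrest : c.pushVolume (A \ ⋃ j, E j) = 0 := by
    rw [c.pushVolume_apply (hA.diff (MeasurableSet.iUnion hEm))]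
    refine mul_eq_zero_of_right _ ?_
    rw [c.riemVolume_eq_zero_iff]
    refine le_antisymm ((Measure.restrict_apply_le _ _).trans ?_) zero_le
    rw [← c.volume_dom_diff_regular]
    refine measure_mono ?_
    rintro x ⟨hx, hxA, hxE⟩
    refine ⟨hx, fun hr => hxE ?_⟩
    obtain ⟨j, hj⟩ := mem_iUnion.1 (hWs ⟨hr, hxA⟩)
    exact mem_iUnion.2 ⟨j, x, ⟨hx, hj⟩, rfl⟩
  have hdisj : Pairwise (Function.onFun Disjoint fun j => A ∩ D j) := fun i j hij =>
    (disjoint_disjointed E hij).mono inter_subset_right inter_subset_right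
  calc c.pushVolume A ≤ c.pushVolume ((⋃ j, A ∩ D j) ∪ (A \ ⋃ j, E j)) := by
        apply measure_mono
        intro p hp
        rw [← inter_iUnion, hD, iUnion_disjointed]
        by_cases h : p ∈ ⋃ j, E j
        · exact Or.inl ⟨hp, h⟩
        · exact Or.inr ⟨hp, h⟩
    _ ≤ c.pushVolume (⋃ j, A ∩ D j) + 0 := by rw [← hrest]; exact measure_union_le _ _
    _ = ∑' j, c'.pushVolume (A ∩ D j) := by
        rw [add_zero, measure_iUnion hdisj fun j => hA.inter (hDm j)]
        exact tsum_congr hpiece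
    _ = c'.pushVolume (⋃ j, A ∩ D j) := (measure_iUnion hdisj fun j => hA.inter (hDm j)).symm
    _ ≤ _ := measure_mono (iUnion_subset fun j => inter_subset_left)

lemma pushVolume_inter_image (c : Chart m X) {A : Set X} (hA : MeasurableSet A) :
    c.pushVolume (A ∩ c.proj '' c.dom) = c.pushVolume A := by
  rw [c.pushVolume_apply hA, c.pushVolume_apply (hA.inter c.isOpen_image_dom.measurableSet)]
  congr 2
  ext x
  exact ⟨fun h => ⟨h.1, h.2.1⟩, fun h => ⟨h.1, h.2, x, h.1, rfl⟩⟩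

variable [CompactSpace X]

omit [T2Space X] [MeasurableSpace X] [BorelSpace X] in
lemma exists_finset_cover : ∃ s : Finset (Chart m X), ↑s ⊆ O.atlas ∧
    ∀ p, ∃ c ∈ s, p ∈ c.proj '' c.dom := by
  obtain ⟨t, ht⟩ := isCompact_univ.elim_finite_subcover
    (fun c : O.atlas => c.1.proj '' c.1.dom) (fun c => c.1.isOpen_image_dom) (by
      intro p _
      obtain ⟨c, hc, hp⟩ := O.cover p
      exact mem_iUnion.2 ⟨⟨c, hc⟩, hp⟩)
  classical
  refine ⟨t.image Subtype.val, ?_, ?_⟩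
  · intro c hc
    simp only [Finset.coe_image, mem_image] at hc
    obtain ⟨d, -, rfl⟩ := hc
    exact d.2
  · intro p
    obtain ⟨c, hc⟩ := mem_iUnion.1 (ht (mem_univ p))
    obtain ⟨hct, hp⟩ := mem_iUnion.1 hc
    exact ⟨c, Finset.mem_image_of_mem _ hct, hp⟩

omit [T2Space X] [MeasurableSpace X] [BorelSpace X] in
lemma exists_seq_cover [Nonempty X] : ∃ c : ℕ → Chart m X,
    (∀ k, c k ∈ O.atlas) ∧ ⋃ k, (c k).proj '' (c k).dom = univ := by
  obtain ⟨s, hs, hcov⟩ := O.exists_finset_cover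
  have hne : s.Nonempty := by
    obtain ⟨c, hc, -⟩ := hcov (Classical.arbitrary X)
    exact ⟨c, hc⟩
  obtain ⟨f, hf⟩ := s.finite_toSet.countable.exists_eq_range hne
  refine ⟨f, fun k => hs (by rw [hf]; exact ⟨k, rfl⟩), ?_⟩
  rw [eq_univ_iff_forall]
  intro p
  obtain ⟨c, hc, hp⟩ := hcov p
  have : c ∈ range f := by rw [← hf]; exact hc
  obtain ⟨k, rfl⟩ := this
  exact mem_iUnion.2 ⟨k, hp⟩

lemma vol_eq_iSup : O.vol = ⨆ c ∈ O.atlas, c.pushVolume := rfl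

variable [Nonempty X]

/-- A supremum of measures is awkward to evaluate on sets. Therefore a measure `ν` is glued from a
countable cover cut into disjoint pieces. By `pushVolume_le` it restricts to every chart measure, so
it bounds all of them from above, and it is itself at most the supremum. -/
lemma vol_restrict {c : Chart m X} (hc : c ∈ O.atlas) :
    O.vol.restrict (c.proj '' c.dom) = c.pushVolume := by
  obtain ⟨d, hd, hcov⟩ := O.exists_seq_cover
  set U : ℕ → Set X := fun k => (d k).proj '' (d k).dom with hU
  have hUm : ∀ k, MeasurableSet (U k) := fun k => (d k).isOpen_image_dom.measurableSet
  set D := disjointed U with hD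
  have hDm : ∀ j, MeasurableSet (D j) := fun j => MeasurableSet.disjointed hUm j
  have hDU : ∀ j, D j ⊆ U j := disjointed_subset U
  have hDuniv : ⋃ j, D j = univ := by rw [hD, iUnion_disjointed, hcov]
  set ν : Measure X := Measure.sum fun k => (d k).pushVolume.restrict (D k) with hν
  have hνapp : ∀ A, MeasurableSet A → ν A = ∑' k, (d k).pushVolume (A ∩ D k) := by
    intro A hA
    rw [hν, Measure.sum_apply _ hA]
    exact tsum_congr fun k => Measure.restrict_apply hA
  have hdisj : ∀ A : Set X, Pairwise (Function.onFun Disjoint fun j => A ∩ D j) := fun A i j hij =>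
    (disjoint_disjointed U hij).mono inter_subset_right inter_subset_right
  have key : ∀ c ∈ O.atlas, ν.restrict (c.proj '' c.dom) = c.pushVolume := by
    intro c hc
    ext A hA
    have hAU := hA.inter c.isOpen_image_dom.measurableSet
    rw [Measure.restrict_apply hA, hνapp _ hAU, ← pushVolume_inter_image c hA]
    have h1 : ∀ k, (d k).pushVolume (A ∩ c.proj '' c.dom ∩ D k) =
        c.pushVolume (A ∩ c.proj '' c.dom ∩ D k) := fun k => le_antisymm
      (O.pushVolume_le (hd k) hc (hAU.inter (hDm k)) fun p hp => hp.1.2)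
      (O.pushVolume_le hc (hd k) (hAU.inter (hDm k)) fun p hp => hDU k hp.2)
    rw [tsum_congr h1, ← measure_iUnion (hdisj _) fun k => hAU.inter (hDm k), ← inter_iUnion,
      hDuniv, inter_univ]
  have hvol : O.vol = ν := by
    apply le_antisymm
    · rw [vol_eq_iSup]
      refine iSup₂_le fun c hc => ?_
      rw [← key c hc]
      exact Measure.restrict_le_self
    · rw [Measure.le_iff]
      intro A hA
      have h1 : ∀ k, (d k).pushVolume ≤ O.vol := fun k => by
        rw [vol_eq_iSup]; exact le_iSup₂_of_le (d k) (hd k) le_rfl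
      rw [hνapp A hA]
      calc ∑' k, (d k).pushVolume (A ∩ D k) ≤ ∑' k, O.vol (A ∩ D k) :=
            ENNReal.tsum_le_tsum fun k => h1 k _
        _ = O.vol (⋃ k, A ∩ D k) := (measure_iUnion (hdisj A) fun k => hA.inter (hDm k)).symm
        _ ≤ O.vol A := measure_mono (iUnion_subset fun k => inter_subset_left)
  rw [hvol, key c hc]

lemma vol_apply {c : Chart m X} (hc : c ∈ O.atlas) {A : Set X}
    (hA : MeasurableSet A) (hAU : A ⊆ c.proj '' c.dom) :
    O.vol A = (Nat.card c.group : ℝ≥0∞)⁻¹ * c.riemVolume (c.dom ∩ c.proj ⁻¹' A) := by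
  rw [← c.pushVolume_apply hA, ← O.vol_restrict hc, Measure.restrict_apply hA, inter_eq_left.2 hAU]

lemma vol_image_of_injOn {c : Chart m X} (hc : c ∈ O.atlas)
    {B : Set ℝ^m} (hB : MeasurableSet B) (hBd : B ⊆ c.dom) (hinj : InjOn c.proj B) :
    O.vol (c.proj '' B) = c.riemVolume B := by
  have hBm : MeasurableSet (c.proj '' B) :=
    hB.image_of_continuousOn_injOn (c.continuousOn_proj.mono hBd) hinj
  rw [← c.pushVolume_image_of_injOn hB hBd hinj, ← O.vol_restrict hc, Measure.restrict_apply hBm,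
    inter_eq_left.2 (image_mono hBd)]

/-- Several points of `B` may lie in one orbit, so the pushforward can count a point of the image
repeatedly; this is why an inequality is stated. -/
lemma vol_restrict_image_le {c : Chart m X} (hc : c ∈ O.atlas)
    {B : Set ℝ^m} (hB : MeasurableSet B) (hBd : B ⊆ c.dom)
    (hBm : MeasurableSet (c.proj '' B)) :
    O.vol.restrict (c.proj '' B) ≤ Measure.map c.proj (c.riemVolume.restrict B) := by
  rw [Measure.le_iff]
  intro A hA
  have h1 : c.proj '' (c.dom ∩ c.proj ⁻¹' A ∩ B) = A ∩ c.proj '' B := by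
    ext p; constructor
    · rintro ⟨x, hx, rfl⟩; exact ⟨hx.1.2, x, hx.2, rfl⟩
    · rintro ⟨hp, x, hx, rfl⟩; exact ⟨x, ⟨⟨hBd hx, hp⟩, hx⟩, rfl⟩
  have hBA := (c.measurableSet_preimage hA).inter hB
  rw [Measure.restrict_apply hA, Measure.map_apply_of_aemeasurable
    (c.aemeasurable_proj.mono_measure Measure.restrict_le_self) hA, Measure.restrict_apply' hB]
  calc O.vol (A ∩ c.proj '' B) = c.pushVolume (c.proj '' (c.dom ∩ c.proj ⁻¹' A ∩ B)) := by
        rw [h1, ← O.vol_restrict hc, Measure.restrict_apply (hA.inter hBm),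
          inter_eq_left.2 (inter_subset_right.trans (image_mono hBd))]
    _ ≤ c.riemVolume (c.dom ∩ c.proj ⁻¹' A ∩ B) :=
        c.pushVolume_image_le hBA (fun x (hx : x ∈ c.dom ∩ _ ∩ B) => hx.1.1)
          (by rw [h1]; exact hA.inter hBm)
    _ ≤ c.riemVolume (c.proj ⁻¹' A ∩ B) := measure_mono fun x hx => ⟨hx.1.2, hx.2⟩

lemma vol_image_le {c : Chart m X} (hc : c ∈ O.atlas)
    {B : Set ℝ^m} (hB : MeasurableSet B) (hBd : B ⊆ c.dom)
    (hBm : MeasurableSet (c.proj '' B)) : O.vol (c.proj '' B) ≤ c.riemVolume B := by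
  have := O.vol_restrict_image_le hc hB hBd hBm univ
  rwa [Measure.restrict_apply_univ, Measure.map_apply_of_aemeasurable
    (c.aemeasurable_proj.mono_measure Measure.restrict_le_self) MeasurableSet.univ, preimage_univ,
    Measure.restrict_apply_univ] at this

/-- The image in the orbifold of a null set is null. -/
lemma vol_image_null {c : Chart m X} (hc : c ∈ O.atlas)
    {B : Set ℝ^m} (hBd : B ⊆ c.dom) (hB : volume B = 0) : O.vol (c.proj '' B) = 0 := by
  obtain ⟨W, hWo, hWp, hWs⟩ := RiemannianOrbifoldChart.exists_seq_open_cover (s := c.regular)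
    (p := fun V => c.dom ∩ V ⊆ c.regular ∧ InjOn c.proj (c.dom ∩ V)) (by simp)
    (fun x hx => by
      obtain ⟨V, h1, h2, h3, h4⟩ := c.exists_open_injOn hx
      exact ⟨V, h1, h2, h3, h4⟩)
  set E : ℕ → Set X := fun j => c.proj '' (c.dom ∩ W j) with hE
  have hEm : ∀ j, MeasurableSet (E j) := fun j => (c.isOpen_image_inter (hWo j)).measurableSet
  -- The volume formula on cells requires a measurable set, so `B` is enlarged to a measurable null
  -- set.
  set Z := toMeasurable volume B with hZ
  have hZ0 : volume Z = 0 := by rw [hZ, measure_toMeasurable, hB]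
  have hcov : c.proj '' B ⊆ (⋃ j, c.proj '' (c.dom ∩ W j ∩ Z)) ∪ (c.proj '' c.dom \ ⋃ j, E j) := by
    rintro _ ⟨x, hx, rfl⟩
    by_cases hxE : c.proj x ∈ ⋃ j, E j
    · left
      obtain ⟨j, y, hy, hyx⟩ := mem_iUnion.1 hxE
      obtain ⟨i, hi⟩ := mem_iUnion.1 (hWs (c.mem_regular_of_proj_eq ((hWp j).1 hy) (hBd hx) hyx))
      exact mem_iUnion.2 ⟨i, x, ⟨⟨hBd hx, hi⟩, subset_toMeasurable _ _ hx⟩, rfl⟩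
    · exact Or.inr ⟨⟨x, hBd hx, rfl⟩, hxE⟩
  refine measure_mono_null hcov (measure_union_null (measure_iUnion_null fun j => ?_) ?_)
  · rw [O.vol_image_of_injOn hc ((c.measurableSet_dom.inter (hWo j).measurableSet).inter
      (measurableSet_toMeasurable _ _)) (fun x hx => hx.1.1) ((hWp j).2.mono inter_subset_left),
      c.riemVolume_eq_zero_iff]
    exact le_antisymm ((Measure.restrict_apply_le _ _).trans
      ((measure_mono inter_subset_right).trans hZ0.le)) zero_le
  · rw [O.vol_apply hc (c.isOpen_image_dom.measurableSet.diff (MeasurableSet.iUnion hEm))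
      sdiff_subset]
    refine mul_eq_zero_of_right _ ?_
    rw [c.riemVolume_eq_zero_iff]
    refine le_antisymm ((Measure.restrict_apply_le _ _).trans ?_) zero_le
    rw [← c.volume_dom_diff_regular]
    refine measure_mono ?_
    rintro x ⟨hx, -, hxE⟩
    refine ⟨hx, fun hr => hxE ?_⟩
    obtain ⟨j, hj⟩ := mem_iUnion.1 (hWs hr)
    exact mem_iUnion.2 ⟨j, x, ⟨hx, hj⟩, rfl⟩

/-- This reduces almost-everywhere statements on the orbifold to Lebesgue measure in charts. One
direction is absolute continuity of the pushforward; the other uses a countable cover by charts and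
that images of null sets are null. -/
lemma ae_vol_iff {P : X → Prop} :
    (∀ᵐ p ∂O.vol, P p) ↔ ∀ c ∈ O.atlas, ∀ᵐ x ∂(volume.restrict c.dom), P (c.proj x) := by
  constructor
  · intro h c hc
    rw [← c.ae_riemVolume]
    have h1 : ∀ᵐ p ∂c.pushVolume, P p := by rw [← O.vol_restrict hc]; exact ae_restrict_of_ae h
    have h2 : ∀ᵐ p ∂(Measure.map c.proj c.riemVolume), P p := by
      unfold RiemannianOrbifoldChart.pushVolume at h1
      rwa [Measure.ae_ennreal_smul_measure_iff (by simp)] at h1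
    exact ae_of_ae_map c.aemeasurable_proj h2
  · intro h
    obtain ⟨d, hd, hcov⟩ := O.exists_seq_cover
    have h1 : {p | ¬ P p} ⊆ ⋃ k, (d k).proj '' {x ∈ (d k).dom | ¬ P ((d k).proj x)} := by
      intro p hp
      have : p ∈ ⋃ k, (d k).proj '' (d k).dom := by rw [hcov]; trivial
      obtain ⟨k, x, hx, rfl⟩ := mem_iUnion.1 this
      exact mem_iUnion.2 ⟨k, x, ⟨hx, hp⟩, rfl⟩
    refine measure_mono_null h1 (measure_iUnion_null fun k => O.vol_image_null (hd k)
      (fun x hx => hx.1) ?_)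
    have := h (d k) (hd k)
    rw [ae_restrict_iff' (d k).measurableSet_dom] at this
    rw [measure_eq_zero_iff_ae_notMem]
    filter_upwards [this] with x hx h2
    exact h2.2 (hx h2.1)

lemma lintegral_vol_restrict {c : Chart m X} (hc : c ∈ O.atlas) {f : X → ℝ≥0∞}
    (hf : AEMeasurable f O.vol) :
    ∫⁻ p in c.proj '' c.dom, f p ∂O.vol =
      (Nat.card c.group : ℝ≥0∞)⁻¹ * ∫⁻ x, f (c.proj x) ∂c.riemVolume := by
  have hf' : AEMeasurable f c.pushVolume := by rw [← O.vol_restrict hc]; exact hf.restrict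
  have h2 : AEMeasurable f (Measure.map c.proj c.riemVolume) := by
    refine hf'.mono_ac ?_
    unfold RiemannianOrbifoldChart.pushVolume
    exact Measure.absolutelyContinuous_smul (by simp)
  rw [O.vol_restrict hc]
  unfold RiemannianOrbifoldChart.pushVolume
  rw [lintegral_smul_measure, lintegral_map' h2 c.aemeasurable_proj, smul_eq_mul]

/-- Points of a chart domain have small relatively open neighbourhoods of finite volume. -/
lemma exists_nhds_vol_lt_top {c : Chart m X} (hc : c ∈ O.atlas)
    {x : ℝ^m} (hx : x ∈ c.dom) : ∃ V, IsOpen V ∧ x ∈ V ∧ O.vol (c.proj '' (c.dom ∩ V)) < ⊤ := by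
  have h1 := (c.continuousOn_sqrt_det x hx).eventually_lt_const (lt_add_one (√(c.metric x).det))
  obtain ⟨V, hV, hxV, hVs⟩ := mem_nhdsWithin.1 h1
  have hB := hV.inter (isOpen_ball (x := x) (ε := 1))
  refine ⟨V ∩ ball x 1, hB, ⟨hxV, mem_ball_self one_pos⟩, ?_⟩
  have hm : MeasurableSet (c.dom ∩ (V ∩ ball x 1)) := c.measurableSet_dom.inter hB.measurableSet
  refine (O.vol_image_le hc hm inter_subset_left
    (c.isOpen_image_inter hB).measurableSet).trans_lt ?_
  rw [← setLIntegral_one, c.setLIntegral_riemVolume hm inter_subset_left]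
  refine lt_of_le_of_lt (setLIntegral_mono' (g := fun _ =>
    ofReal (√(c.metric x).det + 1)) hm fun y hy => ?_) ?_
  · simp only [mul_one]
    exact ofReal_le_ofReal (le_of_lt (hVs ⟨hy.2.1, hy.1⟩))
  · rw [setLIntegral_const]
    refine ENNReal.mul_lt_top ofReal_lt_top ?_
    exact (measure_mono (fun y hy => hy.2.2)).trans_lt measure_ball_lt_top

instance isFiniteMeasure_vol : IsFiniteMeasure O.vol := by
  have : IsLocallyFiniteMeasure O.vol := by
    refine ⟨fun p => ?_⟩
    obtain ⟨c, hc, x, hx, rfl⟩ := O.cover p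
    obtain ⟨V, hV, hxV, hlt⟩ := O.exists_nhds_vol_lt_top hc hx
    exact ⟨_, (c.isOpen_image_inter hV).mem_nhds ⟨x, ⟨hx, hxV⟩, rfl⟩, hlt⟩
  exact ⟨isCompact_univ.measure_lt_top⟩

instance isOpenPosMeasure_vol : O.vol.IsOpenPosMeasure := by
  refine ⟨fun U hU ⟨p, hp⟩ h0 => ?_⟩
  obtain ⟨c, hc, x, hx, rfl⟩ := O.cover p
  have h1 : ∀ᵐ q ∂O.vol, q ∉ U := measure_eq_zero_iff_ae_notMem.1 h0
  have h2 := O.ae_vol_iff.1 h1 c hc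
  have h3 : ∀ᶠ y in 𝓝[c.dom] x, c.proj y ∈ U := c.continuousOn_proj x hx (hU.mem_nhds hp)
  obtain ⟨V, hV, hxV, hVs⟩ := mem_nhdsWithin.1 h3
  have h4 : (V ∩ interior c.dom).Nonempty :=
    mem_closure_iff.1 (c.dom_subset_closure_interior hx) V hV hxV
  have h5 := (hV.inter isOpen_interior).measure_pos volume h4
  rw [ae_restrict_iff' c.measurableSet_dom] at h2
  refine h5.ne' ?_
  rw [measure_eq_zero_iff_ae_notMem]
  filter_upwards [h2] with y hy h6
  exact hy (interior_subset h6.2) (hVs ⟨h6.1, interior_subset h6.2⟩)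

end RiemannianOrbifold

/-! ### Convolution with bump functions. -/

section mollify

open scoped Convolution
open ContinuousLinearMap (lsmul)

variable {m : ℕ} {F : Type*} [NormedAddCommGroup F] [NormedSpace ℝ F]

lemma lintegral_bump (φ : ContDiffBump (0 : ℝ^m)) : ∫⁻ t, ofReal (φ.normed volume t) = 1 := by
  rw [← ofReal_integral_eq_lintegral_ofReal φ.integrable_normed
    (Eventually.of_forall φ.nonneg_normed), φ.integral_normed, ENNReal.ofReal_one]

lemma enorm_bump_convolution_le (φ : ContDiffBump (0 : ℝ^m)) (g : ℝ^m → F)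
    (x : ℝ^m) : ‖(φ.normed volume ⋆[lsmul ℝ ℝ, volume] g) x‖ₑ ≤
      ∫⁻ t, ofReal (φ.normed volume t) * ‖g (x - t)‖ₑ := by
  rw [convolution_lsmul]
  refine (enorm_integral_le_lintegral_enorm _).trans_eq (lintegral_congr fun t => ?_)
  rw [enorm_smul, Real.enorm_of_nonneg (φ.nonneg_normed t)]

lemma lintegral_bump_tonelli (φ : ContDiffBump (0 : ℝ^m)) {G : ℝ^m → ℝ≥0∞} (hG : AEMeasurable G) :
    ∫⁻ x, ∫⁻ t, ofReal (φ.normed volume t) * G (x - t) = ∫⁻ x, G x := by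
  rw [lintegral_lintegral_swap]
  · have h1 : ∀ t, ∫⁻ x, ofReal (φ.normed volume t) * G (x - t) =
        ofReal (φ.normed volume t) * ∫⁻ x, G x := fun t => by
      rw [lintegral_const_mul' _ _ ofReal_ne_top, lintegral_sub_right_eq_self G t]
    simp_rw [h1]
    rw [lintegral_mul_const'' _ φ.continuous_normed.measurable.ennreal_ofReal.aemeasurable,
      lintegral_bump, one_mul]
  · refine AEMeasurable.mul ?_ ?_
    · exact (φ.continuous_normed.measurable.ennreal_ofReal.comp measurable_snd).aemeasurable
    · exact hG.comp_quasiMeasurePreserving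
        (quasiMeasurePreserving_sub_of_right_invariant volume volume)

lemma lintegral_bump_convolution_le (φ : ContDiffBump (0 : ℝ^m)) {g : ℝ^m → F}
    (hg : AEStronglyMeasurable g) :
    ∫⁻ x, ‖(φ.normed volume ⋆[lsmul ℝ ℝ, volume] g) x‖ₑ ≤ ∫⁻ x, ‖g x‖ₑ :=
  (lintegral_mono fun x => enorm_bump_convolution_le φ g x).trans_eq
    (lintegral_bump_tonelli φ hg.enorm)

/-- Jensen's inequality for the probability measure with density the normalised bump bounds the
square of the average by the average of the square; Tonelli then removes the translation. -/
lemma lintegral_bump_convolution_sq_le (φ : ContDiffBump (0 : ℝ^m)) {g : ℝ^m → F}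
    (hg : AEStronglyMeasurable g) :
    ∫⁻ x, ‖(φ.normed volume ⋆[lsmul ℝ ℝ, volume] g) x‖ₑ ^ 2 ≤ ∫⁻ x, ‖g x‖ₑ ^ 2 := by
  refine (lintegral_mono fun x => ?_).trans_eq
    (lintegral_bump_tonelli φ (G := fun x => ‖g x‖ₑ ^ 2) (hg.enorm.pow_const 2))
  refine (pow_le_pow_left' (enorm_bump_convolution_le φ g x) 2).trans ?_
  set P : Measure ℝ^m := volume.withDensity fun t => ofReal (φ.normed volume t)
    with hP
  have hφm : Measurable fun t => ofReal (φ.normed volume t) :=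
    φ.continuous_normed.measurable.ennreal_ofReal
  have hP1 : P univ = 1 := by
    rw [hP, withDensity_apply _ MeasurableSet.univ, Measure.restrict_univ, lintegral_bump]
  have hm : AEMeasurable (fun t => ‖g (x - t)‖ₑ) P := ((hg.enorm).comp_quasiMeasurePreserving
      (quasiMeasurePreserving_sub_left_of_right_invariant volume x)).mono_ac
      (withDensity_absolutelyContinuous _ _)
  have hconv : ∀ G : ℝ^m → ℝ≥0∞,
      ∫⁻ t, ofReal (φ.normed volume t) * G t = ∫⁻ t, G t ∂P := fun G => by
    rw [hP, lintegral_withDensity_eq_lintegral_mul_non_measurable _ hφm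
      (Eventually.of_forall fun _ => ofReal_lt_top)]
    rfl
  rw [hconv fun t => ‖g (x - t)‖ₑ, hconv fun t => ‖g (x - t)‖ₑ ^ 2]
  have h2 := ENNReal.lintegral_mul_le_Lp_mul_Lq P Real.HolderConjugate.two_two hm
    (g := fun _ => 1) aemeasurable_const
  simp only [Pi.mul_apply, mul_one, lintegral_const, hP1,
    ENNReal.rpow_two, one_pow, ENNReal.one_rpow] at h2
  calc (∫⁻ t, ‖g (x - t)‖ₑ ∂P) ^ 2 ≤ ((∫⁻ t, ‖g (x - t)‖ₑ ^ 2 ∂P) ^ (1 / 2 : ℝ)) ^ 2 :=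
        pow_le_pow_left' h2 2
    _ = _ := by rw [← rpow_natCast, ← ENNReal.rpow_mul]; norm_num

/-- `L¹` convergence from a.e. convergence and a bound on the norms. -/
lemma tendsto_lintegral_enorm_sub_of_le {α : Type*} [MeasurableSpace α] {μ : Measure α}
    {G : ℕ → α → F} {g : α → F} (hg : Integrable g μ) (hG : ∀ k, AEStronglyMeasurable (G k) μ)
    (hle : ∀ k, ∫⁻ x, ‖G k x‖ₑ ∂μ ≤ ∫⁻ x, ‖g x‖ₑ ∂μ)
    (hlim : ∀ᵐ x ∂μ, Tendsto (fun k => G k x) atTop (𝓝 (g x))) :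
    Tendsto (fun k => ∫⁻ x, ‖G k x - g x‖ₑ ∂μ) atTop (𝓝 0) := by
  set I := ∫⁻ x, ‖g x‖ₑ ∂μ with hI
  have hItop : I ≠ ⊤ := hg.2.ne
  have hmeas : ∀ k, AEMeasurable (fun x => ‖G k x‖ₑ + ‖g x‖ₑ - ‖G k x - g x‖ₑ) μ := fun k =>
    ((hG k).enorm.add hg.1.enorm).sub ((hG k).sub hg.1).enorm
  have hsub : ∀ k x, ‖G k x - g x‖ₑ ≤ ‖G k x‖ₑ + ‖g x‖ₑ := fun k x => enorm_sub_le
  have hfin : ∀ k, ∫⁻ x, ‖G k x - g x‖ₑ ∂μ ≠ ⊤ := fun k => by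
    refine ne_top_of_le_ne_top (ENNReal.add_ne_top.2 ⟨hItop, hItop⟩)
      ((lintegral_mono (hsub k)).trans ?_)
    rw [lintegral_add_left' (hG k).enorm]
    gcongr
    exact hle k
  have hint : ∀ k, ∫⁻ x, (‖G k x‖ₑ + ‖g x‖ₑ - ‖G k x - g x‖ₑ) ∂μ ≤
      I + I - ∫⁻ x, ‖G k x - g x‖ₑ ∂μ := fun k => by
    have hm : AEMeasurable (fun x => ‖G k x - g x‖ₑ) μ := ((hG k).sub hg.1).enorm
    rw [lintegral_sub' hm (hfin k) (Eventually.of_forall (hsub k)),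
      lintegral_add_left' (hG k).enorm]
    gcongr
    exact hle k
  -- Fatou's lemma for the nonnegative functions `‖G k‖ + ‖g‖ - ‖G k - g‖`, which tend to `2 ‖g‖`
  -- almost everywhere. Since the integrals of `‖G k‖` do not exceed `I`, this leaves no room for `∫
  -- ‖G k - g‖` in the limit.
  have hF : I + I ≤ liminf (fun k => I + I - ∫⁻ x, ‖G k x - g x‖ₑ ∂μ) atTop := by
    calc I + I = ∫⁻ x, liminf (fun k => ‖G k x‖ₑ + ‖g x‖ₑ - ‖G k x - g x‖ₑ) atTop ∂μ := by
          rw [hI, ← lintegral_add_left' hg.1.enorm]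
          refine lintegral_congr_ae ?_
          filter_upwards [hlim] with x hx
          have h1 : Tendsto (fun k => ‖G k x‖ₑ + ‖g x‖ₑ - ‖G k x - g x‖ₑ) atTop
              (𝓝 (‖g x‖ₑ + ‖g x‖ₑ - ‖g x - g x‖ₑ)) := by
            refine ENNReal.Tendsto.sub (hx.enorm.add tendsto_const_nhds)
              (hx.sub_const _).enorm (Or.inr ?_)
            simp
          rw [h1.liminf_eq]
          simp
      _ ≤ liminf (fun k => ∫⁻ x, (‖G k x‖ₑ + ‖g x‖ₑ - ‖G k x - g x‖ₑ) ∂μ) atTop :=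
          lintegral_liminf_le' hmeas
      _ ≤ _ := liminf_le_liminf (Eventually.of_forall hint)
  rw [ENNReal.tendsto_nhds_zero]
  intro ε hε
  by_cases hI0 : I + I = 0
  · refine Eventually.of_forall fun k => ?_
    refine ((lintegral_mono (hsub k)).trans ?_).trans (zero_le : 0 ≤ ε)
    rw [lintegral_add_left' (hG k).enorm, ← hI0]
    gcongr
    exact hle k
  · have hlt : I + I - ε < liminf (fun k => I + I - ∫⁻ x, ‖G k x - g x‖ₑ ∂μ) atTop :=
      lt_of_lt_of_le (ENNReal.sub_lt_self (ENNReal.add_ne_top.2 ⟨hItop, hItop⟩) hI0 hε.ne') hF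
    filter_upwards [eventually_lt_of_lt_liminf hlt] with k hk
    by_contra hcon
    push Not at hcon
    exact absurd hk (not_lt.2 (tsub_le_tsub_left hcon.le _))

/-- The bound of the outer radius by twice the inner one makes the bumps comparable to averages over
balls, so Lebesgue differentiation gives convergence almost everywhere. Convergence in `L¹` follows
because convolution does not increase the norm. -/
lemma tendsto_bump_convolution (φ : ℕ → ContDiffBump (0 : ℝ^m))
    (hφ : Tendsto (fun k => (φ k).rOut) atTop (𝓝 0)) (hφ' : ∀ k, (φ k).rOut ≤ 2 * (φ k).rIn)
    [CompleteSpace F] {g : ℝ^m → F} (hg : Integrable g) :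
    (∀ᵐ x, Tendsto (fun k => ((φ k).normed volume ⋆[lsmul ℝ ℝ, volume] g) x) atTop (𝓝 (g x))) ∧
    Tendsto (fun k => ∫⁻ x, ‖((φ k).normed volume ⋆[lsmul ℝ ℝ, volume] g) x - g x‖ₑ)
      atTop (𝓝 0) := by
  have h1 := ContDiffBump.ae_convolution_tendsto_right_of_locallyIntegrable (μ := volume)
    (l := atTop) hφ (Eventually.of_forall hφ') hg.locallyIntegrable
  refine ⟨h1, tendsto_lintegral_enorm_sub_of_le hg (fun k => ?_)
    (fun k => lintegral_bump_convolution_le (φ k) hg.1) h1⟩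
  exact ((φ k).hasCompactSupport_normed.contDiff_convolution_left (n := 0) _ (φ k).contDiff_normed
    hg.locallyIntegrable).continuous.aestronglyMeasurable

end mollify

/-! ### Weak differentials. -/

section weak

open scoped Convolution
open ContinuousLinearMap (lsmul)

variable {m : ℕ}

lemma MeasureTheory.LocallyIntegrableOn.integrable_smul_of_tsupport_subset
    {F : Type*} [NormedAddCommGroup F] [NormedSpace ℝ F] {f : ℝ^m → F}
    {V : Set ℝ^m} (hf : LocallyIntegrableOn f V) {ψ : ℝ^m → ℝ}
    (hψ : Continuous ψ) (hψc : HasCompactSupport ψ) (hψV : tsupport ψ ⊆ V) :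
    Integrable (fun x => ψ x • f x) := by
  have h1 := hf.integrableOn_compact_subset hψV hψc
  have h2 : IntegrableOn (fun x => ψ x • f x) (tsupport ψ) :=
    h1.continuousOn_smul hψ.continuousOn hψc
  rwa [integrableOn_iff_integrable_of_support_subset] at h2
  intro x hx
  apply subset_tsupport
  intro h0
  exact hx (by simp [h0])

namespace HasWeakFDerivOn

variable {f f' : ℝ^m → ℝ} {w w' : ℝ^m → (ℝ^m →L[ℝ] ℝ)}
  {V V' U : Set ℝ^m}

lemma mono (h : HasWeakFDerivOn f w V) (hU : U ⊆ V) : HasWeakFDerivOn f w U :=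
  ⟨h.1.mono_set hU, h.2.1.mono_set hU, fun ψ h1 h2 h3 v => h.2.2 ψ h1 h2 (h3.trans hU) v⟩

lemma integrable_mul_fderiv (h : HasWeakFDerivOn f w V) {ψ : ℝ^m → ℝ}
    (hψ : ContDiff ℝ ∞ ψ) (hψc : HasCompactSupport ψ) (hψV : tsupport ψ ⊆ V) (v : ℝ^m) :
    Integrable (fun x => f x * fderiv ℝ ψ x v) := by
  have h1 : Continuous (fun x => fderiv ℝ ψ x v) :=
    (hψ.continuous_fderiv (by simp)).clm_apply continuous_const
  have h2 : HasCompactSupport (fun x => fderiv ℝ ψ x v) :=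
    hψc.of_isClosed_subset (isClosed_tsupport _) (tsupport_fderiv_apply_subset ℝ v)
  have := h.1.integrable_smul_of_tsupport_subset h1 h2
    ((tsupport_fderiv_apply_subset ℝ v).trans hψV)
  simpa [mul_comm] using this

lemma integrable_smul (h : HasWeakFDerivOn f w V) {ψ : ℝ^m → ℝ}
    (hψ : ContDiff ℝ ∞ ψ) (hψc : HasCompactSupport ψ) (hψV : tsupport ψ ⊆ V) :
    Integrable (fun x => ψ x • w x) :=
  h.2.1.integrable_smul_of_tsupport_subset hψ.continuous hψc hψV

lemma integrable_mul_apply (h : HasWeakFDerivOn f w V) {ψ : ℝ^m → ℝ}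
    (hψ : ContDiff ℝ ∞ ψ) (hψc : HasCompactSupport ψ) (hψV : tsupport ψ ⊆ V) (v : ℝ^m) :
    Integrable (fun x => ψ x * w x v) := by
  have := (h.integrable_smul hψ hψc hψV).apply_continuousLinearMap v
  simpa using this

/-- The difference of the two differentials integrates to zero against every test function, so it
vanishes almost everywhere by the fundamental lemma of the calculus of variations. -/
lemma unique (hU : IsOpen U) (h : HasWeakFDerivOn f w U) (h' : HasWeakFDerivOn f' w' U)
    (hff' : ∀ᵐ x, x ∈ U → f x = f' x) : ∀ᵐ x, x ∈ U → w x = w' x := by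
  have := hU.ae_eq_zero_of_integral_contDiff_smul_eq_zero (μ := volume) (h.2.1.sub h'.2.1)
    (fun ψ h1 h2 h3 => by
      have e1 := h.integrable_smul h1 h2 h3
      have e2 := h'.integrable_smul h1 h2 h3
      have e3 : (fun x => ψ x • (w - w') x) = fun x => ψ x • w x - ψ x • w' x := by
        ext1 x; simp [smul_sub]
      rw [e3, integral_sub e1 e2, sub_eq_zero]
      ext v
      rw [ContinuousLinearMap.integral_apply e1, ContinuousLinearMap.integral_apply e2]
      have e4 := h.2.2 ψ h1 h2 h3 v
      have e5 := h'.2.2 ψ h1 h2 h3 v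
      have e6 : ∫ x, f x * fderiv ℝ ψ x v = ∫ x, f' x * fderiv ℝ ψ x v := by
        refine integral_congr_ae ?_
        filter_upwards [hff'] with x hx
        by_cases hxs : x ∈ tsupport ψ
        · rw [hx (h3 hxs)]
        · have : fderiv ℝ ψ x v = 0 := by
            by_contra hne
            exact hxs (tsupport_fderiv_apply_subset ℝ v (subset_tsupport _ hne))
          rw [this, mul_zero, mul_zero]
      simp only [smul_apply, smul_eq_mul]
      linarith)
  filter_upwards [this] with x hx hxU
  exact sub_eq_zero.1 (hx hxU)

lemma add (h : HasWeakFDerivOn f w V) (h' : HasWeakFDerivOn f' w' V) :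
    HasWeakFDerivOn (f + f') (w + w') V := by
  have hw : LocallyIntegrableOn (w + w') V := by
    have := h.2.1.sub h'.2.1.neg
    rwa [sub_neg_eq_add] at this
  refine ⟨h.1.add h'.1, hw, fun ψ h1 h2 h3 v => ?_⟩
  have e1 : (fun x => (f + f') x * fderiv ℝ ψ x v) =
      fun x => f x * fderiv ℝ ψ x v + f' x * fderiv ℝ ψ x v := by ext1 x; exact add_mul _ _ _
  have e2 : (fun x => ψ x * (w + w') x v) = fun x => ψ x * w x v + ψ x * w' x v := by
    ext1 x; exact mul_add _ _ _
  rw [e1, e2, integral_add (h.integrable_mul_fderiv h1 h2 h3 v)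
    (h'.integrable_mul_fderiv h1 h2 h3 v), integral_add (h.integrable_mul_apply h1 h2 h3 v)
    (h'.integrable_mul_apply h1 h2 h3 v), h.2.2 ψ h1 h2 h3 v, h'.2.2 ψ h1 h2 h3 v, neg_add]

lemma const_smul (h : HasWeakFDerivOn f w V) (a : ℝ) : HasWeakFDerivOn (a • f) (a • w) V := by
  refine ⟨h.1.smul a, h.2.1.smul a, fun ψ h1 h2 h3 v => ?_⟩
  simp only [Pi.smul_apply, smul_apply, smul_eq_mul, mul_assoc, mul_left_comm _ a]
  rw [integral_const_mul, integral_const_mul, h.2.2 ψ h1 h2 h3 v]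
  ring

/-- Locally Lipschitz functions are weakly differentiable. -/
lemma of_locallyLipschitzOn (hV : IsOpen V) (hf : LocallyLipschitzOn V f) : HasWeakFDerivOn f
    (fderiv ℝ f) V := by
  have hloc : ∀ K ⊆ V, IsCompact K → ∃ L C, K ⊆ interior L ∧ LipschitzOnWith C f L := by
    intro K hK hKc
    obtain ⟨L, hL, hKL, hLV⟩ := exists_compact_between hKc hV hK
    obtain ⟨C, hC⟩ := (hf.mono hLV).exists_lipschitzOnWith_of_compact hL
    exact ⟨L, C, hKL, hC⟩
  refine ⟨hf.continuousOn.locallyIntegrableOn hV.measurableSet,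
    (locallyIntegrableOn_iff hV.isLocallyClosed).2 fun K hK hKc => ?_, ?_⟩
  · obtain ⟨L, C, hKL, hC⟩ := hloc K hK hKc
    refine Measure.integrableOn_of_bounded (M := C) hKc.measure_lt_top.ne
      (measurable_fderiv ℝ f).aestronglyMeasurable ?_
    filter_upwards [ae_restrict_mem hKc.isClosed.measurableSet] with x hx
    exact norm_fderiv_le_of_lipschitzOn ℝ (mem_interior_iff_mem_nhds.1 (hKL hx)) hC
  · intro ψ hψ hψc hψV v
    obtain ⟨L, C, hKL, hC⟩ := hloc _ hψV hψc
    obtain ⟨g, hg, hfg⟩ := hC.extend_real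
    obtain ⟨D, hD⟩ := hψ.lipschitzWith_of_hasCompactSupport hψc (by simp)
    have h1 := hg.integral_lineDeriv_mul_eq (μ := volume) hD hψc v
    have e1 : ∀ᵐ x, lineDeriv ℝ g x v * ψ x = ψ x * fderiv ℝ f x v := by
      filter_upwards [hg.ae_differentiableAt (μ := volume)] with x hx
      by_cases hxs : x ∈ tsupport ψ
      · have h2 : f =ᶠ[𝓝 x] g := by
          filter_upwards [mem_interior_iff_mem_nhds.1 (hKL hxs)] with z hz using hfg hz
        rw [hx.lineDeriv_eq_fderiv, h2.fderiv_eq, mul_comm]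
      · rw [image_eq_zero_of_notMem_tsupport hxs, mul_zero, zero_mul]
    have e2 : ∀ x, lineDeriv ℝ ψ x (-v) * g x = -(f x * fderiv ℝ ψ x v) := by
      intro x
      rw [(hψ.differentiable (by simp) x).lineDeriv_eq_fderiv, map_neg]
      by_cases hxs : x ∈ tsupport ψ
      · rw [hfg (interior_subset (hKL hxs))]
        ring
      · rw [show fderiv ℝ ψ x = 0 by
          by_contra h; exact hxs (support_fderiv_subset ℝ h)]
        simp
    rw [integral_congr_ae e1, integral_congr_ae (Eventually.of_forall e2), integral_neg] at h1
    linarith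

lemma mk_of_contDiffOn (hV : IsOpen V) (hf : ContDiffOn ℝ 1 f V) : HasWeakFDerivOn f
    (fderiv ℝ f) V :=
  of_locallyLipschitzOn hV fun x hx => by
    obtain ⟨C, t, ht, hC⟩ := (hf.contDiffAt (hV.mem_nhds hx)).exists_lipschitzOnWith
    exact ⟨C, t, mem_nhdsWithin_of_mem_nhds ht, hC⟩

/-- Weak differentials are stable under local `L¹` convergence. -/
lemma of_tendsto {f : ℕ → ℝ^m → ℝ} {w : ℕ → ℝ^m → (ℝ^m →L[ℝ] ℝ)} {V : Set ℝ^m}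
    (h : ∀ j, HasWeakFDerivOn (f j) (w j) V) {f₀ : ℝ^m → ℝ}
    {w₀ : ℝ^m → (ℝ^m →L[ℝ] ℝ)} (hf₀ : LocallyIntegrableOn f₀ V)
    (hw₀ : LocallyIntegrableOn w₀ V)
    (hf : ∀ K ⊆ V, IsCompact K → Tendsto (fun j => ∫⁻ x in K, ‖f j x - f₀ x‖ₑ) atTop (𝓝 0))
    (hw : ∀ K ⊆ V, IsCompact K → Tendsto (fun j => ∫⁻ x in K, ‖w j x - w₀ x‖ₑ) atTop (𝓝 0)) :
    HasWeakFDerivOn f₀ w₀ V := by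
  refine ⟨hf₀, hw₀, fun ψ hψ hψc hψV v => ?_⟩
  set K := tsupport ψ with hK
  have hKc : IsCompact K := hψc
  have hdc : Continuous fun x => fderiv ℝ ψ x v :=
    (hψ.continuous_fderiv (by simp)).clm_apply continuous_const
  have hd0 : ∀ x ∉ K, fderiv ℝ ψ x v = 0 := fun x hx => by
    by_contra hne
    exact hx (tsupport_fderiv_apply_subset ℝ v (subset_tsupport _ hne))
  have hψ0 : ∀ x ∉ K, ψ x = 0 := fun x hx => image_eq_zero_of_notMem_tsupport hx
  obtain ⟨C₁, hC₁⟩ := hKc.exists_bound_of_continuousOn hdc.continuousOn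
  obtain ⟨C₂, hC₂⟩ := hKc.exists_bound_of_continuousOn hψ.continuous.continuousOn
  have key : ∀ (F : ℕ → ℝ^m → ℝ) (F₀ : ℝ^m → ℝ) (G : ℕ → ℝ≥0∞) (C : ℝ),
      Integrable F₀ → (∀ j, Integrable (F j)) →
      (∀ j, ∫⁻ x, ‖F j x - F₀ x‖ₑ ≤ ofReal C * G j) → Tendsto G atTop (𝓝 0) →
      Tendsto (fun j => ∫ x, F j x) atTop (𝓝 (∫ x, F₀ x)) := by
    intro F F₀ G C h1 h2 h3 h4
    refine tendsto_integral_of_L1 F₀ h1.1 (Eventually.of_forall h2) ?_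
    refine tendsto_of_tendsto_of_tendsto_of_le_of_le tendsto_const_nhds ?_ (fun _ => zero_le) h3
    have := ENNReal.Tendsto.const_mul (a := ofReal C) h4 (Or.inr ofReal_ne_top)
    rwa [mul_zero] at this
  have hbound : ∀ (F : ℝ^m → ℝ) (E : Type) [NormedAddCommGroup E] (g : ℝ^m → E)
      (C : ℝ), (∀ x ∉ K, F x = 0) → (∀ x ∈ K, ‖F x‖ ≤ C * ‖g x‖) → 0 ≤ C →
      ∫⁻ x, ‖F x‖ₑ ≤ ofReal C * ∫⁻ x in K, ‖g x‖ₑ := by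
    intro F E _ g C h0 h1 hC
    rw [← lintegral_const_mul' _ _ ofReal_ne_top, ← lintegral_indicator hKc.isClosed.measurableSet]
    refine lintegral_mono fun x => ?_
    by_cases hx : x ∈ K
    · rw [indicator_of_mem hx, ← ofReal_norm, ← ofReal_norm, ← ofReal_mul hC]
      exact ofReal_le_ofReal (h1 x hx)
    · rw [h0 x hx, enorm_zero]; exact zero_le
  have hfi : ∀ g : ℝ^m → ℝ, LocallyIntegrableOn g V → Integrable fun x => g x * fderiv ℝ ψ x v := by
    intro g hg
    simpa [mul_comm] using hg.integrable_smul_of_tsupport_subset hdc (hψc.fderiv_apply ℝ v)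
      ((tsupport_fderiv_apply_subset ℝ v).trans hψV)
  have hwi : ∀ g : ℝ^m → (ℝ^m →L[ℝ] ℝ), LocallyIntegrableOn g V →
      Integrable fun x => ψ x * g x v := by
    intro g hg
    have := hg.integrable_smul_of_tsupport_subset hψ.continuous hψc hψV
    exact this.apply_continuousLinearMap v
  have l1 := key (fun j x => f j x * fderiv ℝ ψ x v) (fun x => f₀ x * fderiv ℝ ψ x v)
    (fun j => ∫⁻ x in K, ‖f j x - f₀ x‖ₑ) |C₁| (hfi _ hf₀) (fun j => hfi _ (h j).1) (fun j =>
      hbound _ ℝ _ _ (fun x hx => by simp [hd0 x hx]) (fun x hx => by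
        rw [← sub_mul, norm_mul, mul_comm]
        exact mul_le_mul_of_nonneg_right ((hC₁ x hx).trans (le_abs_self _)) (norm_nonneg _))
        (abs_nonneg _)) (hf K hψV hKc)
  have l2 := key (fun j x => ψ x * w j x v) (fun x => ψ x * w₀ x v)
    (fun j => ∫⁻ x in K, ‖w j x - w₀ x‖ₑ) (|C₂| * ‖v‖) (hwi _ hw₀) (fun j => hwi _ (h j).2.1)
    (fun j => hbound _ _ _ _ (fun x hx => by simp [hψ0 x hx]) (fun x hx => by
        rw [← mul_sub, norm_mul, ← sub_apply]
        calc ‖ψ x‖ * ‖(w j x - w₀ x) v‖ ≤ |C₂| * (‖w j x - w₀ x‖ * ‖v‖) := by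
              gcongr
              · exact (hC₂ x hx).trans (le_abs_self _)
              · exact ContinuousLinearMap.le_opNorm _ _
          _ = _ := by ring) (by positivity)) (hw K hψV hKc)
  have l3 := l2.neg
  refine tendsto_nhds_unique l1 (l3.congr fun j => ?_)
  exact ((h j).2.2 ψ hψ hψc hψV v).symm

end HasWeakFDerivOn

end weak

section mollification

open scoped Convolution
open ContinuousLinearMap (lsmul)

variable {m : ℕ} {f : ℝ^m → ℝ} {w : ℝ^m → (ℝ^m →L[ℝ] ℝ)}
  {V K : Set ℝ^m}

/-- The derivative falls on the bump, and `y ↦ φ (x - y)` is a test function for the weak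
differential. Cutting `f` and `w` off outside `K'` is harmless, because this test function is
supported in the ball around `x`. -/
lemma HasWeakFDerivOn.fderiv_bump_convolution (h : HasWeakFDerivOn f w V) {K' : Set ℝ^m}
    (hK' : IsCompact K') (hK'V : K' ⊆ V) (φ : ContDiffBump (0 : ℝ^m)) {x : ℝ^m}
    (hx : closedBall x φ.rOut ⊆ K') :
    fderiv ℝ (φ.normed volume ⋆[lsmul ℝ ℝ, volume] (K'.indicator f)) x =
      (φ.normed volume ⋆[lsmul ℝ ℝ, volume] (K'.indicator w)) x := by
  have hf : Integrable (K'.indicator f) :=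
    (h.1.integrableOn_compact_subset hK'V hK').integrable_indicator hK'.measurableSet
  have hw : Integrable (K'.indicator w) := by
    have h1 : IntegrableOn w K' := h.2.1.integrableOn_compact_subset hK'V hK'
    exact (integrable_indicator_iff (f := w) hK'.measurableSet).2 h1
  rw [(φ.hasCompactSupport_normed.hasFDerivAt_convolution_left (lsmul ℝ ℝ) φ.contDiff_normed
    hf.locallyIntegrable x).fderiv]
  set ψ : ℝ^m → ℝ := fun y => φ.normed volume (x - y) with hψ
  have hψs : ContDiff ℝ ∞ ψ := φ.contDiff_normed.comp (contDiff_const.sub contDiff_id)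
  have hψsub : tsupport ψ ⊆ closedBall x φ.rOut := by
    refine closure_minimal (fun y hy => ?_) isClosed_closedBall
    have : x - y ∈ Function.support (φ.normed volume) := hy
    rw [φ.support_normed_eq] at this
    rw [mem_closedBall, dist_comm]
    have h2 := (mem_ball_zero_iff.1 this).le
    rwa [dist_eq_norm]
  have hψc : HasCompactSupport ψ :=
    (isCompact_closedBall x φ.rOut).of_isClosed_subset (isClosed_tsupport _) hψsub
  have hψV : tsupport ψ ⊆ V := hψsub.trans (hx.trans hK'V)
  have hψd : ∀ y v, fderiv ℝ ψ y v = - fderiv ℝ (φ.normed volume) (x - y) v := by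
    intro y v
    have h1 : HasFDerivAt (φ.normed volume) (fderiv ℝ (φ.normed volume) (x - y)) (x - y) :=
      ((φ.contDiff_normed (n := 1)).differentiable (by simp) _).hasFDerivAt
    have h2 : HasFDerivAt (fun y => x - y) (-ContinuousLinearMap.id ℝ ℝ^m) y :=
      (hasFDerivAt_id y).const_sub x
    have h3 : HasFDerivAt ψ _ y := h1.comp y h2
    rw [h3.fderiv]
    simp
  ext v
  have hcs : HasCompactSupport (fderiv ℝ (φ.normed volume)) := φ.hasCompactSupport_normed.fderiv ℝ
  have hcc : Continuous (fderiv ℝ (φ.normed volume)) :=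
    (φ.contDiff_normed (n := 1)).continuous_fderiv (by simp)
  have hex : ConvolutionExistsAt (fderiv ℝ (φ.normed volume)) (K'.indicator f) x
      ((lsmul ℝ ℝ).precompL ℝ^m) volume :=
    hcs.convolutionExists_left _ hcc hf.locallyIntegrable x
  have hex2 : ConvolutionExistsAt (φ.normed volume) (K'.indicator w) x (lsmul ℝ ℝ) volume :=
    φ.hasCompactSupport_normed.convolutionExists_left _ φ.continuous_normed hw.locallyIntegrable x
  rw [convolution_def, convolution_def, ContinuousLinearMap.integral_apply hex,
    ContinuousLinearMap.integral_apply hex2]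
  have e1 : ∫ t, ((lsmul ℝ ℝ).precompL ℝ^m) (fderiv ℝ (φ.normed volume) t)
      (K'.indicator f (x - t)) v = - ∫ y, f y * fderiv ℝ ψ y v := by
    rw [← integral_sub_left_eq_self _ volume x, ← integral_neg]
    refine integral_congr_ae (Eventually.of_forall fun y => ?_)
    simp only [ContinuousLinearMap.precompL_apply, sub_sub_cancel, hψd,
      ContinuousLinearMap.lsmul_apply, smul_eq_mul]
    by_cases hy : y ∈ K'
    · simp [hy, mul_comm]
    · have h0 : fderiv ℝ ψ y v = 0 := by
        by_contra hne
        exact hy (hx (hψsub (tsupport_fderiv_apply_subset ℝ v (subset_tsupport _ hne))))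
      rw [hψd, neg_eq_zero] at h0
      simp [h0, hy]
  have e2 : ∫ t, (lsmul ℝ ℝ) (φ.normed volume t) (K'.indicator w (x - t)) v = ∫ y, ψ y * w y v := by
    rw [← integral_sub_left_eq_self _ volume x]
    refine integral_congr_ae (Eventually.of_forall fun y => ?_)
    simp only [sub_sub_cancel, ContinuousLinearMap.lsmul_apply]
    by_cases hy : y ∈ K'
    · simp [hy, hψ]
    · have h0 : ψ y = 0 := by
        by_contra hne
        exact hy (hx (hψsub (subset_tsupport _ hne)))
      simp only [hy, not_false_eq_true, indicator_of_notMem, smul_zero, zero_apply, h0, zero_mul]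
  rw [e1, e2, h.2.2 ψ hψs hψc hψV v, neg_neg]

/-- The function is cut off to a compact thickening of `K` inside `V` and then mollified at scales
below the thickening, so that on `K` the smooth differentials are mollifications of `w`. The last
clause is the `L²` contraction of `lintegral_bump_convolution_sq_le`; it gives an energy bound
uniform in `k`. -/
theorem HasWeakFDerivOn.exists_mollify (h : HasWeakFDerivOn f w V) (hV : IsOpen V)
    (hK : IsCompact K) (hKV : K ⊆ V) :
    ∃ F : ℕ → ℝ^m → ℝ, (∀ k, ContDiff ℝ ∞ (F k)) ∧
      (∀ᵐ x ∂(volume.restrict K), Tendsto (fun k => F k x) atTop (𝓝 (f x))) ∧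
      Tendsto (fun k => ∫⁻ x in K, ‖F k x - f x‖ₑ) atTop (𝓝 0) ∧
      Tendsto (fun k => ∫⁻ x in K, ‖fderiv ℝ (F k) x - w x‖ₑ) atTop (𝓝 0) ∧
      ∀ k, ∫⁻ x in K, ‖fderiv ℝ (F k) x‖ₑ ^ 2 ≤ ∫⁻ x in V, ‖w x‖ₑ ^ 2 := by
  obtain ⟨δ, hδ, hδV⟩ := hK.exists_cthickening_subset_open hV hKV
  set K' := Metric.cthickening δ K with hK'def
  have hK' : IsCompact K' := hK.cthickening
  have hKK' : K ⊆ K' := Metric.self_subset_cthickening K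
  -- Outer radius `δ / (k + 1)` keeps the supports inside the thickening; the inner radius is half
  -- of it, as Lebesgue differentiation requires.
  let φ : ℕ → ContDiffBump (0 : ℝ^m) := fun k =>
    ⟨δ / (2 * (k + 1)), δ / (k + 1), by positivity, by
      have : (0 : ℝ) < k + 1 := by positivity
      exact div_lt_div_of_pos_left hδ this (by linarith)⟩
  have hφ0 : Tendsto (fun k => (φ k).rOut) atTop (𝓝 0) := by
    have := (tendsto_one_div_add_atTop_nhds_zero_nat (𝕜 := ℝ)).const_mul δ
    simpa [φ, div_eq_mul_inv] using this
  have hφ2 : ∀ k, (φ k).rOut ≤ 2 * (φ k).rIn := fun k => by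
    simp only [φ]
    have : (0 : ℝ) < k + 1 := by positivity
    field_simp
    rfl
  have hφδ : ∀ k, (φ k).rOut ≤ δ := fun k => by
    simp only [φ]
    have : (1 : ℝ) ≤ k + 1 := by
      have : (0 : ℝ) ≤ k := Nat.cast_nonneg k
      linarith
    exact div_le_self hδ.le this
  have hf : Integrable (K'.indicator f) :=
    (h.1.integrableOn_compact_subset hδV hK').integrable_indicator hK'.measurableSet
  have hw : Integrable (K'.indicator w) := by
    have h1 : IntegrableOn w K' := h.2.1.integrableOn_compact_subset hδV hK'
    exact (integrable_indicator_iff (f := w) hK'.measurableSet).2 h1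
  obtain ⟨a1, a2⟩ := tendsto_bump_convolution φ hφ0 hφ2 hf
  obtain ⟨-, b2⟩ := tendsto_bump_convolution φ hφ0 hφ2 hw
  have hd : ∀ k, ∀ x ∈ K, fderiv ℝ ((φ k).normed volume ⋆[lsmul ℝ ℝ, volume] (K'.indicator f)) x =
      ((φ k).normed volume ⋆[lsmul ℝ ℝ, volume] (K'.indicator w)) x := fun k x hx =>
    h.fderiv_bump_convolution hK' hδV (φ k)
      ((Metric.closedBall_subset_closedBall (hφδ k)).trans
        (Metric.closedBall_subset_cthickening hx δ))
  refine ⟨fun k => (φ k).normed volume ⋆[lsmul ℝ ℝ, volume] (K'.indicator f), fun k => ?_, ?_,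
    ?_, ?_, fun k => ?_⟩
  · exact (φ k).hasCompactSupport_normed.contDiff_convolution_left _ (φ k).contDiff_normed
      hf.locallyIntegrable
  · rw [ae_restrict_iff' hK.measurableSet]
    filter_upwards [a1] with x hx hxK
    rwa [indicator_of_mem (hKK' hxK)] at hx
  · refine tendsto_of_tendsto_of_tendsto_of_le_of_le tendsto_const_nhds a2 (fun _ => zero_le)
      fun k => ?_
    refine (setLIntegral_mono_ae' hK.measurableSet ?_).trans (setLIntegral_le_lintegral K _)
    refine Eventually.of_forall fun x hx => ?_
    rw [indicator_of_mem (hKK' hx)]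
  · refine tendsto_of_tendsto_of_tendsto_of_le_of_le tendsto_const_nhds b2 (fun _ => zero_le)
      fun k => ?_
    refine (setLIntegral_mono_ae' hK.measurableSet ?_).trans (setLIntegral_le_lintegral K _)
    refine Eventually.of_forall fun x hx => ?_
    rw [indicator_of_mem (hKK' hx), hd k x hx]
  · calc ∫⁻ x in K, ‖fderiv ℝ ((φ k).normed volume ⋆[lsmul ℝ ℝ, volume] (K'.indicator f)) x‖ₑ ^ 2
        = ∫⁻ x in K, ‖((φ k).normed volume ⋆[lsmul ℝ ℝ, volume] (K'.indicator w)) x‖ₑ ^ 2 :=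
          setLIntegral_congr_fun hK.measurableSet fun x hx => by rw [hd k x hx]
      _ ≤ ∫⁻ x, ‖((φ k).normed volume ⋆[lsmul ℝ ℝ, volume] (K'.indicator w)) x‖ₑ ^ 2 :=
          setLIntegral_le_lintegral K _
      _ ≤ ∫⁻ x, ‖K'.indicator w x‖ₑ ^ 2 := lintegral_bump_convolution_sq_le (φ k) hw.1
      _ = ∫⁻ x in K', ‖w x‖ₑ ^ 2 := by
          rw [← lintegral_indicator hK'.measurableSet]
          refine lintegral_congr fun x => ?_
          by_cases hx : x ∈ K'
          · simp [hx]
          · rw [indicator_of_notMem hx, indicator_of_notMem hx]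
            rw [← ofReal_norm, norm_zero]
            simp
      _ ≤ ∫⁻ x in V, ‖w x‖ₑ ^ 2 := lintegral_mono_set hδV

end mollification

/-! ### The chain rule for weak differentials under diffeomorphisms. -/

section chain

variable {m : ℕ} {f : ℝ^m → ℝ} {w : ℝ^m → (ℝ^m →L[ℝ] ℝ)}
  {U V K : Set ℝ^m} {h g : ℝ^m → ℝ^m}

section diffeo

variable (hU : IsOpen U) (hV : IsOpen V) (hmap : MapsTo h U V)
  (hinv : LeftInvOn g h U) (hh : ContDiffOn ℝ ∞ h U) (hg : ContDiffOn ℝ ∞ g V)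

include hU hV hmap hinv hh hg

lemma image_diffeo (hK : IsCompact K) (hKU : K ⊆ U) : IsCompact (h '' K) ∧ h '' K ⊆ V ∧
    (∀ y ∈ h '' K, HasFDerivWithinAt g (fderiv ℝ g y) (h '' K) y) ∧
    ContinuousOn (fun y => |(fderiv ℝ g y).det|) (h '' K) ∧ g '' (h '' K) = K ∧
    InjOn g (h '' K) := by
  have hKV : h '' K ⊆ V := (image_mono hKU).trans hmap.image_subset
  refine ⟨hK.image_of_continuousOn (hh.continuousOn.mono hKU), hKV, fun y hy =>
    ((hg.differentiableOn (by simp)).differentiableAt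
      (hV.mem_nhds (hKV hy))).hasFDerivAt.hasFDerivWithinAt,
    ((ContinuousLinearMap.continuous_det.comp_continuousOn
      (hg.continuousOn_fderiv_of_isOpen hV (by simp))).abs).mono hKV, ?_, ?_⟩
  · rw [image_image]
    exact (image_congr fun x hx => hinv (hKU hx)).trans (image_id' K)
  · rintro _ ⟨x, hx, rfl⟩ _ ⟨y, hy, rfl⟩ hxy
    rw [hinv (hKU hx), hinv (hKU hy)] at hxy
    rw [hxy]

/-- Change of variables by the inverse `g`; the constant bounds its Jacobian on the compact set `h
'' K`. -/
lemma exists_lintegral_comp_le (hK : IsCompact K) (hKU : K ⊆ U) :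
    ∃ C : ℝ≥0∞, C ≠ ⊤ ∧ ∀ a : ℝ^m → ℝ≥0∞, ∫⁻ x in K, a (h x) ≤ C * ∫⁻ y in h '' K, a y := by
  obtain ⟨hKc, -, hgd, hcont, himg, hginj⟩ := image_diffeo hU hV hmap hinv hh hg hK hKU
  obtain ⟨C, hC⟩ := hKc.exists_bound_of_continuousOn hcont
  refine ⟨ofReal C, ofReal_ne_top, fun a => ?_⟩
  have := lintegral_image_eq_lintegral_abs_det_fderiv_mul volume hKc.measurableSet hgd hginj
    (fun x => a (h x))
  rw [himg] at this
  rw [this, ← lintegral_const_mul' _ _ ofReal_ne_top]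
  refine setLIntegral_mono_ae' hKc.measurableSet (Eventually.of_forall ?_)
  rintro _ ⟨x, hx, rfl⟩
  rw [hinv (hKU hx)]
  gcongr
  exact (le_abs_self _).trans (hC _ ⟨x, hx, rfl⟩)

lemma integrableOn_comp {F : Type*} [NormedAddCommGroup F] [NormedSpace ℝ F]
    {a : ℝ^m → F} (hK : IsCompact K) (hKU : K ⊆ U) (ha : IntegrableOn a (h '' K)) :
    IntegrableOn (fun x => a (h x)) K := by
  obtain ⟨hKc, -, hgd, hcont, himg, hginj⟩ := image_diffeo hU hV hmap hinv hh hg hK hKU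
  have := integrableOn_image_iff_integrableOn_abs_det_fderiv_smul volume hKc.measurableSet hgd
    hginj (fun x => a (h x))
  rw [himg] at this
  rw [this]
  refine (ha.continuousOn_smul hcont hKc).congr_fun ?_ hKc.measurableSet
  rintro _ ⟨x, hx, rfl⟩
  simp only [hinv (hKU hx)]

/-- The classical chain rule holds for smooth approximations of `f` near the image of the support of
the test function. It passes to the limit because composition with `h` preserves `L¹` convergence on
compact sets and `dh` is bounded there. -/
lemma HasWeakFDerivOn.comp_diffeo (hf : HasWeakFDerivOn f w V) :
    HasWeakFDerivOn (fun x => f (h x)) (fun x => (w (h x)).comp (fderiv ℝ h x)) U := by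
  have hhd : ContinuousOn (fderiv ℝ h) U := hh.continuousOn_fderiv_of_isOpen hU (by simp)
  have hloc : ∀ K ⊆ U, IsCompact K → IsCompact (h '' K) ∧ h '' K ⊆ V := fun K hKU hK =>
    ⟨hK.image_of_continuousOn (hh.continuousOn.mono hKU),
      (image_mono hKU).trans hmap.image_subset⟩
  have hI1 : ∀ K ⊆ U, IsCompact K → IntegrableOn (fun x => f (h x)) K := fun K hKU hK =>
    integrableOn_comp hU hV hmap hinv hh hg hK hKU
      (hf.1.integrableOn_compact_subset (hloc K hKU hK).2 (hloc K hKU hK).1)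
  have hI2' : ∀ K ⊆ U, IsCompact K → IntegrableOn (fun x => w (h x)) K := fun K hKU hK =>
    integrableOn_comp hU hV hmap hinv hh hg hK hKU
      (hf.2.1.integrableOn_compact_subset (hloc K hKU hK).2 (hloc K hKU hK).1)
  have hI2 : ∀ K ⊆ U, IsCompact K →
      IntegrableOn (fun x => (w (h x)).comp (fderiv ℝ h x)) K := fun K hKU hK => by
    obtain ⟨C, hC⟩ := hK.exists_bound_of_continuousOn (hhd.mono hKU)
    have hi := hI2' K hKU hK
    refine Integrable.mono' (hi.norm.mul_const C) ?_ ?_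
    · exact (ContinuousLinearMap.compL ℝ ℝ^m ℝ^m ℝ).aestronglyMeasurable_comp₂
        hi.1 ((hhd.mono hKU).aestronglyMeasurable hK.measurableSet)
    · rw [ae_restrict_iff' hK.measurableSet]
      refine Eventually.of_forall fun x hx => ?_
      refine (ContinuousLinearMap.opNorm_comp_le _ _).trans ?_
      gcongr
      exact hC x hx
  refine ⟨(locallyIntegrableOn_iff hU.isLocallyClosed).2 hI1,
    (locallyIntegrableOn_iff hU.isLocallyClosed).2 hI2, fun ψ h1 h2 h3 v => ?_⟩
  obtain ⟨L, hL, hψL, hLU⟩ := exists_compact_between h2 hU h3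
  have hLi : interior L ⊆ U := interior_subset.trans hLU
  obtain ⟨F, hF1, -, hF3, hF4, -⟩ := hf.exists_mollify hV (hloc L hLU hL).1 (hloc L hLU hL).2
  obtain ⟨C, hC, hCle⟩ := exists_lintegral_comp_le hU hV hmap hinv hh hg hL hLU
  obtain ⟨M, hM⟩ := hL.exists_bound_of_continuousOn (hhd.mono hLU)
  have hlim : ∀ G : ℕ → ℝ^m → ℝ≥0∞, Tendsto (fun k => ∫⁻ y in h '' L, G k y) atTop (𝓝 0) →
      Tendsto (fun k => ∫⁻ x in L, G k (h x)) atTop (𝓝 0) := fun G hG =>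
    tendsto_of_tendsto_of_tendsto_of_le_of_le tendsto_const_nhds
      (by simpa using ENNReal.Tendsto.const_mul (a := C) hG (Or.inr hC)) (fun _ => zero_le)
      fun k => hCle (G k)
  refine (HasWeakFDerivOn.of_tendsto (f := fun k x => F k (h x))
    (fun k => HasWeakFDerivOn.mk_of_contDiffOn isOpen_interior
      (((hF1 k).of_le (by simp)).comp_contDiffOn ((hh.of_le (by simp)).mono hLi)))
    (((locallyIntegrableOn_iff hU.isLocallyClosed).2 hI1).mono_set hLi)
    (((locallyIntegrableOn_iff hU.isLocallyClosed).2 hI2).mono_set hLi)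
    (fun K hK _ => ?_) (fun K hK _ => ?_)).2.2 ψ h1 h2 hψL v
  · exact tendsto_of_tendsto_of_tendsto_of_le_of_le tendsto_const_nhds (hlim _ hF3)
      (fun _ => zero_le) fun k => lintegral_mono_set (hK.trans interior_subset)
  · have h4 := ENNReal.Tendsto.const_mul (a := ofReal M) (hlim _ hF4)
      (Or.inr ofReal_ne_top)
    rw [mul_zero] at h4
    refine tendsto_of_tendsto_of_tendsto_of_le_of_le tendsto_const_nhds h4 (fun _ => zero_le)
      fun k => ?_
    rw [← lintegral_const_mul' _ _ ofReal_ne_top]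
    refine (setLIntegral_mono' ‹IsCompact K›.measurableSet fun x hx => ?_).trans
      (lintegral_mono_set (hK.trans interior_subset))
    have hxU := hLi (hK hx)
    rw [fderiv_fun_comp x ((hF1 k).differentiable (by simp) _)
      ((hh.differentiableOn (by simp)).differentiableAt (hU.mem_nhds hxU)),
      ← ContinuousLinearMap.sub_comp, ← ofReal_norm, ← ofReal_norm, mul_comm,
      ← ofReal_mul (norm_nonneg _)]
    refine ofReal_le_ofReal ((ContinuousLinearMap.opNorm_comp_le _ _).trans ?_)
    gcongr
    exact hM x (interior_subset (hK hx))

end diffeo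

end chain

/-! ### Changes of charts. -/

section transition

variable {m : ℕ} {X : Type*} [TopologicalSpace X]

/-- Differentiating `g ∘ h = id` shows that `dh` is injective, hence surjective, so `h` is open at
interior points. Differentiability of `g` within the target domain suffices for the chain rule,
which matters because `h z` is not yet known to be an interior point. Changes of charts therefore
respect interior points. -/
lemma mapsTo_interior_of_leftInverse {D D' U U' : Set ℝ^m} {h g : ℝ^m → ℝ^m} (hU : IsOpen U)
    (hmap : MapsTo h (D ∩ U) (D' ∩ U')) (hinv : LeftInvOn g h (D ∩ U))
    (hh : ContDiffOn ℝ ∞ h (D ∩ U)) (hg : ContDiffOn ℝ ∞ g (D' ∩ U')) :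
    MapsTo h (interior D ∩ U) (interior D' ∩ U') := by
  intro z hz
  have hO : IsOpen (interior D ∩ U) := isOpen_interior.inter hU
  have hsub : interior D ∩ U ⊆ D ∩ U := inter_subset_inter_left _ interior_subset
  have hst : HasStrictFDerivAt h (fderiv ℝ h z) z :=
    ((hh.mono hsub).contDiffAt (hO.mem_nhds hz)).hasStrictFDerivAt (by simp)
  have hcomp : HasFDerivAt (fun y => g (h y))
      ((fderivWithin ℝ g (D' ∩ U') (h z)).comp (fderiv ℝ h z)) z := by
    refine HasFDerivWithinAt.comp_hasFDerivAt (t := D' ∩ U') z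
      ((hg.differentiableOn (by simp)) _ (hmap (hsub hz))).hasFDerivWithinAt hst.hasFDerivAt ?_
    filter_upwards [hO.mem_nhds hz] with y hy using hmap (hsub hy)
  have hid : HasFDerivAt (fun y => g (h y)) (ContinuousLinearMap.id ℝ ℝ^m) z := by
    refine (hasFDerivAt_id z).congr_of_eventuallyEq ?_
    filter_upwards [hO.mem_nhds hz] with y hy using hinv (hsub hy)
  have heq := hcomp.unique hid
  have hinj : Function.Injective (fderiv ℝ h z) := by
    intro a b hab
    have h1 := congrArg (fun L : ℝ^m →L[ℝ] ℝ^m => L a) heq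
    have h2 := congrArg (fun L : ℝ^m →L[ℝ] ℝ^m => L b) heq
    simp only [ContinuousLinearMap.comp_apply, ContinuousLinearMap.id_apply] at h1 h2
    rw [← h1, ← h2, hab]
  have hsurj : (fderiv ℝ h z : ℝ^m →ₗ[ℝ] ℝ^m).range = ⊤ :=
    LinearMap.range_eq_top.2 (LinearMap.injective_iff_surjective.1 hinj)
  have hmapn := hst.map_nhds_eq_of_surj hsurj
  refine ⟨?_, (hmap (hsub hz)).2⟩
  rw [mem_interior_iff_mem_nhds, ← hmapn, mem_map]
  filter_upwards [hO.mem_nhds hz] with y hy using (hmap (hsub hy)).1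

/-- `h` and `g` are mutually inverse isometric changes of charts between the relatively open sets
`c.dom ∩ V` and `c'.dom ∩ W`. -/
structure IsTransition (c c' : Chart m X) (h g : ℝ^m → ℝ^m)
    (V W : Set ℝ^m) : Prop where
  isOpen_left : IsOpen V
  isOpen_right : IsOpen W
  mapsTo : MapsTo h (c.dom ∩ V) (c'.dom ∩ W)
  mapsTo_symm : MapsTo g (c'.dom ∩ W) (c.dom ∩ V)
  leftInvOn : LeftInvOn g h (c.dom ∩ V)
  rightInvOn : LeftInvOn h g (c'.dom ∩ W)
  contDiffOn : ContDiffOn ℝ ∞ h (c.dom ∩ V)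
  contDiffOn_symm : ContDiffOn ℝ ∞ g (c'.dom ∩ W)
  proj_eq : ∀ z ∈ c.dom ∩ V, c'.proj (h z) = c.proj z
  pullsBack : PullsBackMetric c.metric c'.metric h (c.dom ∩ V)

lemma RiemannianOrbifold.exists_transition (O : RiemannianOrbifold m X)
    {c c' : Chart m X} (hc : c ∈ O.atlas) (hc' : c' ∈ O.atlas)
    {x y : ℝ^m} (hx : x ∈ c.dom) (hy : y ∈ c'.dom) (hxy : c.proj x = c'.proj y) :
    ∃ h g V W, IsTransition c c' h g V W ∧ x ∈ V ∧ h x = y := by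
  obtain ⟨h, ⟨V, hV, hVs⟩, ⟨W, hW, hWt⟩, hxs, hhx, h1, h2, h3, h4⟩ :=
    O.compatible c hc c' hc' x hx y hy hxy
  refine ⟨h, h.symm, V, W, ⟨hV, hW, ?_, ?_, ?_, ?_, ?_, ?_, ?_, ?_⟩, ?_, hhx⟩
  · rw [← hVs, ← hWt]; exact h.mapsTo
  · rw [← hVs, ← hWt]; exact h.mapsTo_symm
  · rw [← hVs]; exact h.leftInvOn
  · rw [← hWt]; exact h.rightInvOn
  · rwa [← hVs]
  · rwa [← hWt]
  · rwa [← hVs]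
  · rwa [← hVs]
  · rw [hVs] at hxs; exact hxs.2

namespace IsTransition

variable {c c' : Chart m X} {h g : ℝ^m → ℝ^m}
  {V W : Set ℝ^m}

lemma mapsTo_interior (t : IsTransition c c' h g V W) :
    MapsTo h (interior c.dom ∩ V) (interior c'.dom ∩ W) :=
  mapsTo_interior_of_leftInverse t.isOpen_left t.mapsTo t.leftInvOn t.contDiffOn
    t.contDiffOn_symm

/-- Weak differentials transform as covectors under changes of charts. -/
lemma ae_weakFDeriv_eq (t : IsTransition c c' h g V W) {u : X → ℝ} {w w' : ℝ^m → (ℝ^m →L[ℝ] ℝ)}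
    (hw : HasWeakFDerivOn (u ∘ c.proj) w (interior c.dom))
    (hw' : HasWeakFDerivOn (u ∘ c'.proj) w' (interior c'.dom)) :
    ∀ᵐ z, z ∈ interior c.dom ∩ V → w z = (w' (h z)).comp (fderiv ℝ h z) := by
  have hsub : interior c.dom ∩ V ⊆ c.dom ∩ V := inter_subset_inter_left _ interior_subset
  have hsub' : interior c'.dom ∩ W ⊆ c'.dom ∩ W := inter_subset_inter_left _ interior_subset
  have h1 := HasWeakFDerivOn.comp_diffeo (isOpen_interior.inter t.isOpen_left)
    (isOpen_interior.inter t.isOpen_right) t.mapsTo_interior (t.leftInvOn.mono hsub)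
    (t.contDiffOn.mono hsub) (t.contDiffOn_symm.mono hsub')
    (hw'.mono inter_subset_left)
  refine HasWeakFDerivOn.unique (isOpen_interior.inter t.isOpen_left)
    (hw.mono inter_subset_left) h1 (Eventually.of_forall fun z hz => ?_)
  simp [t.proj_eq z (hsub hz)]

end IsTransition

end transition

/-! ### The inner product of covectors. -/

namespace RiemannianOrbifoldChart

variable {m : ℕ} {X : Type*} [TopologicalSpace X] (c : Chart m X)

lemma cometric_eq_dotProduct (x : ℝ^m) (ξ η : ℝ^m →L[ℝ] ℝ) :
    c.cometric x ξ η = (fun i => ξ (Pi.single i 1)) ⬝ᵥ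
      ((c.metric x)⁻¹.mulVec fun j => η (Pi.single j 1)) := by
  unfold cometric dotProduct Matrix.mulVec dotProduct
  refine sum_congr rfl fun i _ => ?_
  rw [mul_sum]
  exact sum_congr rfl fun j _ => by ring

/-- With `M` the Jacobian matrix, covectors pull back by `Mᵀ` and `A = Mᵀ B M`. Positive
definiteness of `A` makes `M` invertible, and then `M A⁻¹ Mᵀ = B⁻¹`. -/
lemma cometric_comp {c c' : Chart m X} {h : ℝ^m → ℝ^m}
    {s : Set ℝ^m} (hp : PullsBackMetric c.metric c'.metric h s) {x : ℝ^m}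
    (hx : x ∈ s) (hxd : x ∈ c.dom) (ξ η : ℝ^m →L[ℝ] ℝ) :
    c.cometric x (ξ.comp (fderivWithin ℝ h s x)) (η.comp (fderivWithin ℝ h s x)) =
      c'.cometric (h x) ξ η := by
  set M := LinearMap.toMatrix' (fderivWithin ℝ h s x : ℝ^m →ₗ[ℝ] ℝ^m) with hM
  have hA := hp.transpose_mul_mul hx
  rw [← hM] at hA
  have hdet : (c.metric x).det ≠ 0 := (c.det_metric_pos hxd).ne'
  rw [← hA, Matrix.det_mul, Matrix.det_mul, Matrix.det_transpose] at hdet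
  have hMd : IsUnit M.det := isUnit_iff_ne_zero.2 (right_ne_zero_of_mul hdet)
  have key : ∀ ζ : ℝ^m →L[ℝ] ℝ, (fun i => (ζ.comp (fderivWithin ℝ h s x)) (Pi.single i 1)) =
        M.transpose.mulVec fun i => ζ (Pi.single i 1) := by
    intro ζ
    ext i
    have h1 : fderivWithin ℝ h s x (Pi.single i 1) = fun k => M k i := by
      ext k
      rw [hM, LinearMap.toMatrix'_apply]
      simp
    have h2 : ∀ v : ℝ^m, ζ v = ∑ k, v k * ζ (Pi.single k 1) := by
      intro v
      conv_lhs => rw [pi_eq_sum_univ' v]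
      rw [map_sum]
      refine sum_congr rfl fun k _ => ?_
      rw [map_smul, smul_eq_mul]
    rw [ContinuousLinearMap.comp_apply, h1, h2]
    rfl
  rw [cometric_eq_dotProduct, cometric_eq_dotProduct, key, key, ← hA, Matrix.mul_inv_rev,
    Matrix.mul_inv_rev, Matrix.mulVec_mulVec, Matrix.mulVec_transpose, ← Matrix.dotProduct_mulVec,
    Matrix.mulVec_mulVec]
  have hMt : IsUnit M.transpose.det := by rwa [Matrix.det_transpose]
  congr 2
  rw [← Matrix.mul_assoc, ← Matrix.mul_assoc, ← Matrix.mul_assoc, Matrix.mul_nonsing_inv _ hMd,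
    Matrix.one_mul, Matrix.mul_assoc, Matrix.nonsing_inv_mul _ hMt, Matrix.mul_one]

lemma continuousOn_metric_inv (i j : Fin m) : ContinuousOn (fun x => (c.metric x)⁻¹ i j) c.dom := by
  have h1 : ∀ x, (c.metric x)⁻¹ i j = (c.metric x).det⁻¹ * (c.metric x).adjugate i j := by
    intro x
    rw [Matrix.inv_def, Ring.inverse_eq_inv', Matrix.smul_apply, smul_eq_mul]
  simp_rw [h1]
  refine ContinuousOn.mul (ContinuousOn.inv₀ ?_ fun x hx => (c.det_metric_pos hx).ne') ?_
  · exact Continuous.comp_continuousOn (g := fun M : Matrix (Fin m) (Fin m) ℝ => M.det)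
      (Continuous.matrix_det continuous_id) c.continuousOn_metric
  · exact Continuous.comp_continuousOn
      (g := fun M : Matrix (Fin m) (Fin m) ℝ => M.adjugate i j)
      ((Continuous.matrix_adjugate continuous_id).matrix_elem i j) c.continuousOn_metric

lemma restrict_interior : volume.restrict (interior c.dom) = volume.restrict c.dom := by
  refine Measure.restrict_congr_set ?_
  rw [ae_eq_set]
  exact ⟨by rw [sdiff_eq_bot_iff.2 interior_subset]; exact measure_empty,
    c.volume_dom_diff_interior⟩

lemma aestronglyMeasurable_weakFDeriv {f : ℝ^m → ℝ}
    {w : ℝ^m → (ℝ^m →L[ℝ] ℝ)} (h : HasWeakFDerivOn f w (interior c.dom)) :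
    AEStronglyMeasurable w (volume.restrict c.dom) := by
  rw [← restrict_interior]
  exact h.2.1.aestronglyMeasurable

lemma aemeasurable_cometric {w w' : ℝ^m → (ℝ^m →L[ℝ] ℝ)}
    (hw : AEStronglyMeasurable w (volume.restrict c.dom))
    (hw' : AEStronglyMeasurable w' (volume.restrict c.dom)) :
    AEMeasurable (fun x => c.cometric x (w x) (w' x)) (volume.restrict c.dom) := by
  unfold cometric
  refine Finset.aemeasurable_fun_sum _ fun i _ => Finset.aemeasurable_fun_sum _ fun j _ => ?_
  refine AEMeasurable.mul (AEMeasurable.mul ?_ ?_) ?_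
  · exact (c.continuousOn_metric_inv i j).aemeasurable c.measurableSet_dom
  · exact (hw.apply_continuousLinearMap _).aemeasurable
  · exact (hw'.apply_continuousLinearMap _).aemeasurable

lemma cometric_add_left (x : ℝ^m) (ξ ξ' η : ℝ^m →L[ℝ] ℝ) :
    c.cometric x (ξ + ξ') η = c.cometric x ξ η + c.cometric x ξ' η := by
  simp only [cometric, add_apply, mul_add, add_mul, Finset.sum_add_distrib]

lemma cometric_smul_left (x : ℝ^m) (a : ℝ) (ξ η : ℝ^m →L[ℝ] ℝ) :
    c.cometric x (a • ξ) η = a * c.cometric x ξ η := by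
  simp only [cometric, smul_apply, smul_eq_mul, mul_sum]
  exact sum_congr rfl fun i _ => sum_congr rfl fun j _ => by ring

lemma posDef_metric_inv {x : ℝ^m} (hx : x ∈ c.dom) : (c.metric x)⁻¹.PosDef :=
  (c.posDef_metric x hx).inv

lemma cometric_symm {x : ℝ^m} (hx : x ∈ c.dom) (ξ η : ℝ^m →L[ℝ] ℝ) :
    c.cometric x ξ η = c.cometric x η ξ := by
  have h := (c.posDef_metric_inv hx).isHermitian
  unfold cometric
  rw [Finset.sum_comm]
  refine sum_congr rfl fun i _ => sum_congr rfl fun j _ => ?_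
  have := h.apply i j
  rw [star_trivial] at this
  rw [this]
  ring

lemma cometric_self_nonneg {x : ℝ^m} (hx : x ∈ c.dom) (ξ : ℝ^m →L[ℝ] ℝ) : 0 ≤ c.cometric x ξ ξ := by
  rw [cometric_eq_dotProduct]
  have := (c.posDef_metric_inv hx).posSemidef.dotProduct_mulVec_nonneg (fun i => ξ (Pi.single i 1))
  simpa using this

lemma cometric_add_right {x : ℝ^m} (hx : x ∈ c.dom) (ξ η η' : ℝ^m →L[ℝ] ℝ) :
    c.cometric x ξ (η + η') = c.cometric x ξ η + c.cometric x ξ η' := by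
  rw [c.cometric_symm hx, cometric_add_left, c.cometric_symm hx η, c.cometric_symm hx η']

lemma cometric_smul_right {x : ℝ^m} (hx : x ∈ c.dom) (a : ℝ) (ξ η : ℝ^m →L[ℝ] ℝ) :
    c.cometric x ξ (a • η) = a * c.cometric x ξ η := by
  rw [c.cometric_symm hx, cometric_smul_left, c.cometric_symm hx η]

lemma two_mul_abs_cometric_le {x : ℝ^m} (hx : x ∈ c.dom) (ξ η : ℝ^m →L[ℝ] ℝ) :
    2 * |c.cometric x ξ η| ≤ c.cometric x ξ ξ + c.cometric x η η := by
  have h1 := c.cometric_self_nonneg hx (ξ + η)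
  have h2 := c.cometric_self_nonneg hx (ξ + (-1 : ℝ) • η)
  rw [cometric_add_left, c.cometric_add_right hx, c.cometric_add_right hx] at h1 h2
  rw [cometric_smul_left, cometric_smul_left, c.cometric_smul_right hx,
    c.cometric_smul_right hx] at h2
  rw [c.cometric_symm hx η ξ] at h1 h2
  rcases abs_cases (c.cometric x ξ η) with ⟨h, -⟩ | ⟨h, -⟩ <;> rw [h] <;> linarith

end RiemannianOrbifoldChart

/-! ### Gradient products on the orbifold, the space H¹ and its two forms. -/

namespace RiemannianOrbifold

variable {m : ℕ} {X : Type*} [TopologicalSpace X] [T2Space X] [MeasurableSpace X] [BorelSpace X]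
  [CompactSpace X] [Nonempty X] (O : RiemannianOrbifold m X)

/-- Almost all of the orbifold is covered by countably many open sets that are images of
relatively open sets of chart domains on which the projection is injective. -/
lemma exists_seq_cells : ∃ (c : ℕ → Chart m X) (W : ℕ → Set ℝ^m),
    (∀ j, c j ∈ O.atlas) ∧ (∀ j, IsOpen (W j)) ∧ (∀ j, InjOn (c j).proj ((c j).dom ∩ W j)) ∧
    ∀ᵐ p ∂O.vol, ∃ j, p ∈ (c j).proj '' ((c j).dom ∩ W j) := by
  obtain ⟨d, hd, hcov⟩ := O.exists_seq_cover
  have hW : ∀ k, ∃ W : ℕ → Set ℝ^m, (∀ j, IsOpen (W j)) ∧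
      (∀ j, InjOn (d k).proj ((d k).dom ∩ W j)) ∧ (d k).regular ⊆ ⋃ j, W j := fun k =>
    RiemannianOrbifoldChart.exists_seq_open_cover (s := (d k).regular)
      (p := fun V => InjOn (d k).proj ((d k).dom ∩ V)) (by simp) (fun x hx => by
        obtain ⟨V, h1, h2, -, h4⟩ := (d k).exists_open_injOn hx
        exact ⟨V, h1, h2, h4⟩)
  choose W hWo hWi hWc using hW
  refine ⟨fun n => d n.unpair.1, fun n => W n.unpair.1 n.unpair.2, fun n => hd _,
    fun n => hWo _ _, fun n => hWi _ _, ?_⟩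
  have h1 : {p | ¬ ∃ n : ℕ, p ∈ (d n.unpair.1).proj '' ((d n.unpair.1).dom ∩
      W n.unpair.1 n.unpair.2)} ⊆ ⋃ k, (d k).proj '' ((d k).dom \ (d k).regular) := by
    intro p hp
    have : p ∈ ⋃ k, (d k).proj '' (d k).dom := by rw [hcov]; trivial
    obtain ⟨k, x, hx, rfl⟩ := mem_iUnion.1 this
    refine mem_iUnion.2 ⟨k, x, ⟨hx, fun hr => hp ?_⟩, rfl⟩
    obtain ⟨j, hj⟩ := mem_iUnion.1 (hWc k hr)
    exact ⟨Nat.pair k j, by simpa using ⟨x, ⟨hx, hj⟩, rfl⟩⟩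
  exact measure_mono_null h1 (measure_iUnion_null fun k => O.vol_image_null (hd k)
    (sdiff_subset) (d k).volume_dom_diff_regular)

/-- Functions on the chart domains that agree a.e. under changes of charts come from a function
on the orbifold. -/
lemma exists_glue {G : Chart m X → ℝ^m → ℝ}
    (hGm : ∀ c ∈ O.atlas, AEMeasurable (G c) (volume.restrict c.dom))
    (hG : ∀ c ∈ O.atlas, ∀ c' ∈ O.atlas, ∀ h g V W, IsTransition c c' h g V W →
      ∀ᵐ z, z ∈ c.dom ∩ V → G c' (h z) = G c z) :
    ∃ F : X → ℝ, Measurable F ∧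
      ∀ c ∈ O.atlas, ∀ᵐ x ∂(volume.restrict c.dom), F (c.proj x) = G c x := by
  classical
  obtain ⟨d, W, hd, hWo, hinj, hcov⟩ := O.exists_seq_cells
  set C : ℕ → Set ℝ^m := fun j => (d j).dom ∩ W j with hC
  set E : ℕ → Set X := fun j => (d j).proj '' C j with hE
  have hEo : ∀ j, IsOpen (E j) := fun j => (d j).isOpen_image_inter (hWo j)
  -- The inverse of the projection on the `j`-th cell. It is continuous on the image because
  -- projections of relatively open sets are open.
  let σ : ℕ → X → ℝ^m := fun j => Function.invFunOn (d j).proj (C j)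
  have hσC : ∀ j, ∀ p ∈ E j, σ j p ∈ C j := fun j p hp => Function.invFunOn_mem hp
  have hσp : ∀ j, ∀ p ∈ E j, (d j).proj (σ j p) = p := fun j p hp => Function.invFunOn_eq hp
  have hσ : ∀ j, ∀ y ∈ C j, σ j ((d j).proj y) = y := fun j y hy =>
    hinj j (hσC j _ ⟨y, hy, rfl⟩) hy (hσp j _ ⟨y, hy, rfl⟩)
  have hσc : ∀ j, ContinuousOn (σ j) (E j) := by
    intro j
    rw [continuousOn_iff']
    intro U hU
    refine ⟨(d j).proj '' ((d j).dom ∩ (W j ∩ U)), (d j).isOpen_image_inter ((hWo j).inter hU), ?_⟩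
    ext p
    constructor
    · rintro ⟨hpU, hpE⟩
      exact ⟨⟨σ j p, ⟨(hσC j p hpE).1, (hσC j p hpE).2, hpU⟩, hσp j p hpE⟩, hpE⟩
    · rintro ⟨⟨y, hy, rfl⟩, hpE⟩
      refine ⟨?_, hpE⟩
      rw [mem_preimage, hσ j y ⟨hy.1, hy.2.1⟩]
      exact hy.2.2
  let G' : ℕ → ℝ^m → ℝ := fun j => (hGm (d j) (hd j)).mk (G (d j))
  have hG'm : ∀ j, Measurable (G' j) := fun j => (hGm (d j) (hd j)).measurable_mk
  have hG'e : ∀ j, ∀ᵐ y, y ∈ (d j).dom → G (d j) y = G' j y := fun j =>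
    (ae_restrict_iff' (d j).measurableSet_dom).1 (hGm (d j) (hd j)).ae_eq_mk
  let τ : ℕ → X → ℝ^m := fun j => (E j).piecewise (σ j) fun _ => 0
  have hτm : ∀ j, Measurable (τ j) := fun j =>
    (hσc j).measurable_piecewise continuousOn_const (hEo j).measurableSet
  obtain ⟨F, hFm, hF⟩ := exists_measurable_piecewise (disjointed E)
    (fun j => MeasurableSet.disjointed (fun i => (hEo i).measurableSet) j)
    (fun j p => G' j (τ j p)) (fun j => (hG'm j).comp (hτm j)) (by
      intro i j hij p hp
      exact absurd hp.2 (disjoint_left.1 (disjoint_disjointed E hij) hp.1))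
  refine ⟨F, hFm, fun c hc => ?_⟩
  -- The value of `F` may be read off in any cell: locally a change of charts relates `c` to the
  -- chart of the cell, and `G` is compatible with it almost everywhere. The set where `G` differs
  -- from its measurable representative `G'` is carried to a null set by the differentiable inverse
  -- `g`.
  have hnull : ∀ j, volume {x ∈ c.dom | c.proj x ∈ E j ∧ G' j (σ j (c.proj x)) ≠ G c x} = 0 := by
    intro j
    refine measure_null_of_locally_null _ fun x₀ hx₀ => ?_
    obtain ⟨hx₀d, hx₀E, -⟩ := hx₀
    obtain ⟨h, g, V, W', t, hx₀V, hhx⟩ := O.exists_transition hc (hd j) hx₀d (hσC j _ hx₀E).1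
      (hσp j _ hx₀E).symm
    have hev : ∀ᶠ x in 𝓝[c.dom ∩ V] x₀, h x ∈ W j := t.contDiffOn.continuousOn x₀ ⟨hx₀d, hx₀V⟩
        ((hWo j).mem_nhds (by rw [hhx]; exact (hσC j _ hx₀E).2))
    obtain ⟨V₂, hV₂, hxV₂, hV₂s⟩ := mem_nhdsWithin.1 hev
    refine ⟨_, inter_mem_nhdsWithin _ ((hV₂.inter t.isOpen_left).mem_nhds ⟨hxV₂, hx₀V⟩), ?_⟩
    have hsub : {x ∈ c.dom | c.proj x ∈ E j ∧ G' j (σ j (c.proj x)) ≠ G c x} ∩ (V₂ ∩ V) ⊆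
        {z | ¬ (z ∈ c.dom ∩ V → G (d j) (h z) = G c z)} ∪
        g '' ({y | ¬ (y ∈ (d j).dom → G (d j) y = G' j y)} ∩ ((d j).dom ∩ W')) := by
      rintro x ⟨⟨hxd, hxE, hne⟩, hxV₂, hxV⟩
      have hhC : h x ∈ C j := ⟨(t.mapsTo ⟨hxd, hxV⟩).1, hV₂s ⟨hxV₂, hxd, hxV⟩⟩
      have e1 : σ j (c.proj x) = h x := by rw [← t.proj_eq x ⟨hxd, hxV⟩, hσ j _ hhC]
      rw [e1] at hne
      by_cases h1 : G (d j) (h x) = G c x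
      · right
        refine ⟨h x, ⟨fun h2 => hne ?_, t.mapsTo ⟨hxd, hxV⟩⟩, t.leftInvOn ⟨hxd, hxV⟩⟩
        rw [← h2 hhC.1, h1]
      · exact Or.inl fun h2 => h1 (h2 ⟨hxd, hxV⟩)
    refine measure_mono_null hsub (measure_union_null (hG c hc (d j) (hd j) h g V W' t) ?_)
    exact addHaar_image_eq_zero_of_differentiableOn_of_addHaar_eq_zero volume
      ((t.contDiffOn_symm.differentiableOn (by simp)).mono inter_subset_right)
      (measure_mono_null inter_subset_left (hG'e j))
  have h2 := O.ae_vol_iff.1 hcov c hc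
  rw [ae_restrict_iff' c.measurableSet_dom] at h2 ⊢
  have h3 : ∀ᵐ x, ∀ j, x ∉ {x ∈ c.dom | c.proj x ∈ E j ∧ G' j (σ j (c.proj x)) ≠ G c x} :=
    ae_all_iff.2 fun j => measure_eq_zero_iff_ae_notMem.1 (hnull j)
  filter_upwards [h2, h3] with x hx hx' hxd
  have hxU : c.proj x ∈ ⋃ j, disjointed E j := by
    rw [iUnion_disjointed]
    obtain ⟨j, hj⟩ := hx hxd
    exact mem_iUnion.2 ⟨j, hj⟩
  obtain ⟨j, hj⟩ := mem_iUnion.1 hxU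
  have hjE := disjointed_subset E j hj
  rw [hF j hj]
  simp only [τ, piecewise_eq_of_mem _ _ _ hjE]
  by_contra hne
  exact hx' j ⟨hxd, hjE, hne⟩

/-- `du` represents the differential of `u` in all charts, in the weak sense. -/
def HasChartGrad (u : X → ℝ) (du : Chart m X → ℝ^m → (ℝ^m →L[ℝ] ℝ)) : Prop :=
  ∀ c ∈ O.atlas, HasWeakFDerivOn (u ∘ c.proj) (du c) (interior c.dom)

variable {O}

/-- The chart expressions agree almost everywhere under changes of charts, because weak
differentials transform as covectors and the changes are isometric. They can therefore be glued. -/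
lemma HasChartGrad.exists_inner {u v : X → ℝ} {du dv : Chart m X → ℝ^m → (ℝ^m →L[ℝ] ℝ)}
    (hu : O.HasChartGrad u du) (hv : O.HasChartGrad v dv) :
    ∃ F : X → ℝ, Measurable F ∧ ∀ c ∈ O.atlas, ∀ᵐ x ∂(volume.restrict c.dom),
      F (c.proj x) = c.cometric x (du c x) (dv c x) := by
  refine O.exists_glue (G := fun c x => c.cometric x (du c x) (dv c x)) (fun c hc =>
    c.aemeasurable_cometric (c.aestronglyMeasurable_weakFDeriv (hu c hc))
      (c.aestronglyMeasurable_weakFDeriv (hv c hc))) ?_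
  intro c hc c' hc' h g V W t
  have h1 := c.ae_mem_interior
  rw [ae_restrict_iff' c.measurableSet_dom] at h1
  filter_upwards [h1, t.ae_weakFDeriv_eq (hu c hc) (hu c' hc'),
    t.ae_weakFDeriv_eq (hv c hc) (hv c' hc')] with z hz hzu hzv hzd
  have hzi := hz hzd.1
  have hfd : fderivWithin ℝ h (c.dom ∩ V) z = fderiv ℝ h z :=
    fderivWithin_of_mem_nhds (inter_mem (mem_interior_iff_mem_nhds.1 hzi)
      (t.isOpen_left.mem_nhds hzd.2))
  rw [hzu ⟨hzi, hzd.2⟩, hzv ⟨hzi, hzd.2⟩, ← hfd]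
  exact (RiemannianOrbifoldChart.cometric_comp t.pullsBack hzd hzd.1 _ _).symm

lemma HasChartGrad.add {u v : X → ℝ} {du dv : Chart m X → ℝ^m → (ℝ^m →L[ℝ] ℝ)}
    (hu : O.HasChartGrad u du) (hv : O.HasChartGrad v dv) : O.HasChartGrad (u + v) (du + dv) :=
  fun c hc => (hu c hc).add (hv c hc)

lemma HasChartGrad.const_smul {u : X → ℝ} {du : Chart m X → ℝ^m → (ℝ^m →L[ℝ] ℝ)}
    (hu : O.HasChartGrad u du) (a : ℝ) : O.HasChartGrad (a • u) (a • du) :=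
  fun c hc => (hu c hc).const_smul a

variable (O) in
lemma hasChartGrad_const (a : ℝ) : O.HasChartGrad (fun _ => a) 0 := fun c _ => by
  have := HasWeakFDerivOn.mk_of_contDiffOn (f := fun _ : ℝ^m => a)
    (isOpen_interior (s := c.dom)) contDiffOn_const
  have h0 : fderiv ℝ (fun _ : ℝ^m => a) = 0 := by ext1 x; simp
  rw [h0] at this
  exact this

/-- By uniqueness of weak differentials, the differentials hidden in `IsGradInner` may be replaced
by any fixed choice. -/
lemma isGradInner_iff {u v F : X → ℝ} {du dv : Chart m X → ℝ^m → (ℝ^m →L[ℝ] ℝ)}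
    (hu : O.HasChartGrad u du) (hv : O.HasChartGrad v dv) :
    O.IsGradInner u v F ↔ ∀ c ∈ O.atlas, ∀ᵐ x ∂(volume.restrict c.dom),
      F (c.proj x) = c.cometric x (du c x) (dv c x) := by
  constructor
  · intro h c hc
    obtain ⟨a, b, h1, h2, h3⟩ := h c hc
    have e1 : ∀ᵐ x ∂(volume.restrict c.dom), a x = du c x := by
      rw [← c.restrict_interior, ae_restrict_iff' isOpen_interior.measurableSet]
      exact HasWeakFDerivOn.unique isOpen_interior h1 (hu c hc)
        (Eventually.of_forall fun _ _ => rfl)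
    have e2 : ∀ᵐ x ∂(volume.restrict c.dom), b x = dv c x := by
      rw [← c.restrict_interior, ae_restrict_iff' isOpen_interior.measurableSet]
      exact HasWeakFDerivOn.unique isOpen_interior h2 (hv c hc)
        (Eventually.of_forall fun _ _ => rfl)
    filter_upwards [e1, e2, h3] with x h4 h5 h6
    rw [h6, h4, h5]
  · exact fun h c hc => ⟨du c, dv c, hu c hc, hv c hc, h c hc⟩

lemma IsGradInner.exists_hasChartGrad {u v F : X → ℝ} (h : O.IsGradInner u v F) :
    ∃ du, O.HasChartGrad u du := by
  choose! du dv h1 h2 h3 using h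
  exact ⟨du, h1⟩

lemma MemH1.exists_hasChartGrad {u : X → ℝ} (h : O.MemH1 u) : ∃ du, O.HasChartGrad u du := by
  obtain ⟨-, F, hF, -⟩ := h
  exact hF.exists_hasChartGrad

variable (O) in
/-- A choice of weak differentials of a function in all charts. -/
noncomputable def grad (u : X → ℝ) :
    Chart m X → ℝ^m → (ℝ^m →L[ℝ] ℝ) :=
  open Classical in if h : ∃ du, O.HasChartGrad u du then h.choose else 0

lemma HasChartGrad.grad {u : X → ℝ} {du : Chart m X → ℝ^m → (ℝ^m →L[ℝ] ℝ)}
    (h : O.HasChartGrad u du) : O.HasChartGrad u (O.grad u) := by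
  have h' : ∃ du, O.HasChartGrad u du := ⟨du, h⟩
  unfold RiemannianOrbifold.grad
  rw [dif_pos h']
  exact h'.choose_spec

lemma MemH1.hasChartGrad {u : X → ℝ} (h : O.MemH1 u) : O.HasChartGrad u (O.grad u) :=
  h.exists_hasChartGrad.choose_spec.grad

variable (O) in
/-- The function `⟨∇u, ∇v⟩`. -/
noncomputable def gradInner (u v : X → ℝ) : X → ℝ := open Classical in
  if h : ∃ F, Measurable F ∧ O.IsGradInner u v F then h.choose else 0

lemma HasChartGrad.gradInner {u v : X → ℝ} {du dv : Chart m X → ℝ^m → (ℝ^m →L[ℝ] ℝ)}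
    (hu : O.HasChartGrad u du) (hv : O.HasChartGrad v dv) :
    Measurable (O.gradInner u v) ∧ O.IsGradInner u v (O.gradInner u v) := by
  obtain ⟨F, hF, hF'⟩ := hu.exists_inner hv
  have h : ∃ F, Measurable F ∧ O.IsGradInner u v F := ⟨F, hF, (isGradInner_iff hu hv).2 hF'⟩
  unfold RiemannianOrbifold.gradInner
  rw [dif_pos h]
  exact h.choose_spec

lemma HasChartGrad.gradInner_ae {u v : X → ℝ} {du dv : Chart m X → ℝ^m → (ℝ^m →L[ℝ] ℝ)}
    (hu : O.HasChartGrad u du) (hv : O.HasChartGrad v dv) {c : Chart m X}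
    (hc : c ∈ O.atlas) : ∀ᵐ x ∂(volume.restrict c.dom),
      O.gradInner u v (c.proj x) = c.cometric x (du c x) (dv c x) :=
  (isGradInner_iff hu hv).1 (hu.gradInner hv).2 c hc

lemma IsGradInner.ae_eq_gradInner {u v F : X → ℝ} {du dv : Chart m X → ℝ^m → (ℝ^m →L[ℝ] ℝ)}
    (hu : O.HasChartGrad u du) (hv : O.HasChartGrad v dv) (h : O.IsGradInner u v F) :
    F =ᵐ[O.vol] O.gradInner u v := by
  refine O.ae_vol_iff.2 fun c hc => ?_
  filter_upwards [(isGradInner_iff hu hv).1 h c hc, hu.gradInner_ae hv hc] with x h1 h2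
  rw [h1, h2]

lemma gradInner_self_nonneg {u : X → ℝ} {du : Chart m X → ℝ^m → (ℝ^m →L[ℝ] ℝ)}
    (hu : O.HasChartGrad u du) : ∀ᵐ p ∂O.vol, 0 ≤ O.gradInner u u p := by
  refine O.ae_vol_iff.2 fun c hc => ?_
  filter_upwards [hu.gradInner_ae hu hc, ae_restrict_mem c.measurableSet_dom] with x h1 h2
  rw [h1]
  exact c.cometric_self_nonneg h2 _

lemma gradInner_add_left {u u' v : X → ℝ} {du du' dv : Chart m X → ℝ^m → (ℝ^m →L[ℝ] ℝ)}
    (hu : O.HasChartGrad u du) (hu' : O.HasChartGrad u' du') (hv : O.HasChartGrad v dv) :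
    O.gradInner (u + u') v =ᵐ[O.vol] O.gradInner u v + O.gradInner u' v := by
  refine O.ae_vol_iff.2 fun c hc => ?_
  filter_upwards [hu.gradInner_ae hv hc, hu'.gradInner_ae hv hc,
    (hu.add hu').gradInner_ae hv hc] with x h1 h2 h3
  refine h3.trans ((c.cometric_add_left _ _ _ _).trans ?_)
  rw [← h1, ← h2]
  rfl

lemma gradInner_smul_left {u v : X → ℝ} (a : ℝ) {du dv : Chart m X → ℝ^m → (ℝ^m →L[ℝ] ℝ)}
    (hu : O.HasChartGrad u du) (hv : O.HasChartGrad v dv) :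
    O.gradInner (a • u) v =ᵐ[O.vol] a • O.gradInner u v := by
  refine O.ae_vol_iff.2 fun c hc => ?_
  filter_upwards [hu.gradInner_ae hv hc, (hu.const_smul a).gradInner_ae hv hc] with x h1 h2
  refine h2.trans ((c.cometric_smul_left _ _ _ _).trans ?_)
  rw [← h1]
  rfl

lemma gradInner_symm {u v : X → ℝ} {du dv : Chart m X → ℝ^m → (ℝ^m →L[ℝ] ℝ)}
    (hu : O.HasChartGrad u du) (hv : O.HasChartGrad v dv) :
    O.gradInner u v =ᵐ[O.vol] O.gradInner v u := by
  refine O.ae_vol_iff.2 fun c hc => ?_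
  filter_upwards [hu.gradInner_ae hv hc, hv.gradInner_ae hu hc,
    ae_restrict_mem c.measurableSet_dom] with x h1 h2 h3
  rw [h1, h2, c.cometric_symm h3]

lemma abs_gradInner_le {u v : X → ℝ} {du dv : Chart m X → ℝ^m → (ℝ^m →L[ℝ] ℝ)}
    (hu : O.HasChartGrad u du) (hv : O.HasChartGrad v dv) :
    ∀ᵐ p ∂O.vol, ‖O.gradInner u v p‖ ≤ O.gradInner u u p + O.gradInner v v p := by
  refine O.ae_vol_iff.2 fun c hc => ?_
  filter_upwards [hu.gradInner_ae hv hc, hu.gradInner_ae hu hc, hv.gradInner_ae hv hc,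
    ae_restrict_mem c.measurableSet_dom] with x h1 h2 h3 h4
  rw [h1, h2, h3, Real.norm_eq_abs]
  have := c.two_mul_abs_cometric_le h4 (du c x) (dv c x)
  have := abs_nonneg (c.cometric x (du c x) (dv c x))
  linarith

lemma memH1_iff {u : X → ℝ} {du : Chart m X → ℝ^m → (ℝ^m →L[ℝ] ℝ)} (hu : O.HasChartGrad u du) :
    O.MemH1 u ↔ MemLp u 2 O.vol ∧ Integrable (O.gradInner u u) O.vol := by
  constructor
  · rintro ⟨h1, F, h2, h3⟩
    exact ⟨h1, h3.congr (h2.ae_eq_gradInner hu hu)⟩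
  · rintro ⟨h1, h2⟩
    exact ⟨h1, _, (hu.gradInner hu).2, h2⟩

/-- The mixed product is dominated by the two energy densities, so integrability is only demanded of
the latter. -/
lemma MemH1.integrable_gradInner {u v : X → ℝ} (hu : O.MemH1 u) (hv : O.MemH1 v) :
    Integrable (O.gradInner u v) O.vol := by
  have h1 := hu.hasChartGrad
  have h2 := hv.hasChartGrad
  exact Integrable.mono' (((memH1_iff h1).1 hu).2.add ((memH1_iff h2).1 hv).2)
    (h1.gradInner h2).1.aestronglyMeasurable (abs_gradInner_le h1 h2)

variable (O) in
lemma memH1_const (a : ℝ) : O.MemH1 (fun _ => a) := by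
  have h := O.hasChartGrad_const a
  refine (memH1_iff h).2 ⟨memLp_const a, ?_⟩
  refine (integrable_zero X ℝ O.vol).congr ?_
  refine O.ae_vol_iff.2 fun c hc => ?_
  filter_upwards [h.gradInner_ae h hc] with x hx
  rw [hx]
  simp [RiemannianOrbifoldChart.cometric]

lemma MemH1.add {u v : X → ℝ} (hu : O.MemH1 u) (hv : O.MemH1 v) : O.MemH1 (u + v) := by
  have h1 := hu.hasChartGrad
  have h2 := hv.hasChartGrad
  refine (memH1_iff (h1.add h2)).2 ⟨hu.1.add hv.1, ?_⟩
  have h3 : Integrable ((O.gradInner u u + O.gradInner v u) +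
      (O.gradInner u v + O.gradInner v v)) O.vol :=
    ((hu.integrable_gradInner hu).add (hv.integrable_gradInner hu)).add
      ((hu.integrable_gradInner hv).add (hv.integrable_gradInner hv))
  refine h3.congr ?_
  filter_upwards [gradInner_add_left h1 h2 (h1.add h2), gradInner_symm h1 (h1.add h2),
    gradInner_symm h2 (h1.add h2), gradInner_add_left h1 h2 h1, gradInner_add_left h1 h2 h2]
    with p e1 e2 e3 e4 e5
  refine Eq.symm (e1.trans ?_)
  change O.gradInner u (u + v) p + O.gradInner v (u + v) p = _
  rw [e2, e3, e4, e5]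
  rfl

lemma MemH1.const_smul {u : X → ℝ} (hu : O.MemH1 u) (a : ℝ) : O.MemH1 (a • u) := by
  have h1 := hu.hasChartGrad
  refine (memH1_iff (h1.const_smul a)).2 ⟨hu.1.const_smul a, ?_⟩
  refine (((hu.integrable_gradInner hu).smul a).smul a).congr ?_
  filter_upwards [gradInner_smul_left a h1 (h1.const_smul a), gradInner_symm h1 (h1.const_smul a),
    gradInner_smul_left a h1 h1] with p e1 e2 e3
  refine Eq.symm (e1.trans ?_)
  change a • O.gradInner u (a • u) p = _
  rw [e2, e3]
  rfl

variable (O) in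
/-- The Sobolev space `H¹` as a space of functions. -/
def H1 : Submodule ℝ (X → ℝ) where
  carrier := {u | O.MemH1 u}
  add_mem' := fun h1 h2 => MemH1.add h1 h2
  zero_mem' := O.memH1_const 0
  smul_mem' := fun a _ h => MemH1.const_smul h a

lemma integrable_mul_of_memH1 {u v : X → ℝ} (hu : O.MemH1 u) (hv : O.MemH1 v) :
    Integrable (fun p => u p * v p) O.vol := MemLp.integrable_mul hu.1 hv.1

variable (O) in
/-- The `L²` inner product on `H¹`. -/
noncomputable def l2Form : LinearMap.BilinForm ℝ O.H1 :=
  LinearMap.mk₂ ℝ (fun u v => ∫ p, u.1 p * v.1 p ∂O.vol)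
    (fun u u' v => by
      rw [← integral_add (integrable_mul_of_memH1 u.2 v.2) (integrable_mul_of_memH1 u'.2 v.2)]
      exact integral_congr_ae (Eventually.of_forall fun p => add_mul _ _ _))
    (fun a u v => by
      rw [smul_eq_mul, ← integral_const_mul]
      exact integral_congr_ae (Eventually.of_forall fun p => mul_assoc _ _ _))
    (fun u v v' => by
      rw [← integral_add (integrable_mul_of_memH1 u.2 v.2) (integrable_mul_of_memH1 u.2 v'.2)]
      exact integral_congr_ae (Eventually.of_forall fun p => mul_add _ _ _))
    (fun a u v => by
      rw [smul_eq_mul, ← integral_const_mul]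
      exact integral_congr_ae (Eventually.of_forall fun p => mul_left_comm _ _ _))

lemma integral_gradInner_symm {u v : X → ℝ} (hu : O.MemH1 u) (hv : O.MemH1 v) :
    ∫ p, O.gradInner u v p ∂O.vol = ∫ p, O.gradInner v u p ∂O.vol :=
  integral_congr_ae (gradInner_symm hu.hasChartGrad hv.hasChartGrad)

lemma integral_gradInner_add_left {u u' v : X → ℝ} (hu : O.MemH1 u) (hu' : O.MemH1 u')
    (hv : O.MemH1 v) : ∫ p, O.gradInner (u + u') v p ∂O.vol =
      ∫ p, O.gradInner u v p ∂O.vol + ∫ p, O.gradInner u' v p ∂O.vol := by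
  rw [← integral_add (hu.integrable_gradInner hv) (hu'.integrable_gradInner hv)]
  exact integral_congr_ae (gradInner_add_left hu.hasChartGrad hu'.hasChartGrad hv.hasChartGrad)

lemma integral_gradInner_smul_left {u v : X → ℝ} (a : ℝ) (hu : O.MemH1 u)
    (hv : O.MemH1 v) : ∫ p, O.gradInner (a • u) v p ∂O.vol = a * ∫ p, O.gradInner u v p ∂O.vol := by
  rw [← integral_const_mul]
  exact integral_congr_ae (gradInner_smul_left a hu.hasChartGrad hv.hasChartGrad)

variable (O) in
/-- The Dirichlet form on `H¹`. -/
noncomputable def dirichletForm : LinearMap.BilinForm ℝ O.H1 :=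
  LinearMap.mk₂ ℝ (fun u v => ∫ p, O.gradInner u.1 v.1 p ∂O.vol)
    (fun u u' v => integral_gradInner_add_left u.2 u'.2 v.2)
    (fun a u v => integral_gradInner_smul_left a u.2 v.2)
    (fun u v v' => by
      rw [integral_gradInner_symm u.2 v.2, integral_gradInner_symm u.2 v'.2,
        integral_gradInner_symm u.2 (v + v').2]
      exact integral_gradInner_add_left v.2 v'.2 u.2)
    (fun a u v => by
      rw [integral_gradInner_symm u.2 v.2, integral_gradInner_symm u.2 (a • v).2]
      exact integral_gradInner_smul_left a v.2 u.2)

lemma l2Form_apply (u v : O.H1) : O.l2Form u v = ∫ p, u.1 p * v.1 p ∂O.vol := rfl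

lemma dirichletForm_apply (u v : O.H1) :
    O.dirichletForm u v = ∫ p, O.gradInner u.1 v.1 p ∂O.vol := rfl

lemma l2Form_self_nonneg (u : O.H1) : 0 ≤ O.l2Form u u := integral_nonneg fun _ => mul_self_nonneg _

lemma l2Form_symm (u v : O.H1) : O.l2Form u v = O.l2Form v u := by
  simp only [l2Form_apply, mul_comm]

lemma dirichletForm_self_nonneg (u : O.H1) : 0 ≤ O.dirichletForm u u :=
  integral_nonneg_of_ae (gradInner_self_nonneg u.2.hasChartGrad)

lemma dirichletForm_symm (u v : O.H1) : O.dirichletForm u v = O.dirichletForm v u :=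
  integral_gradInner_symm u.2 v.2

lemma l2Form_self_eq_zero_iff (u : O.H1) : O.l2Form u u = 0 ↔ u.1 =ᵐ[O.vol] 0 := by
  rw [l2Form_apply, integral_eq_zero_iff_of_nonneg (fun _ => mul_self_nonneg _)
    (integrable_mul_of_memH1 u.2 u.2)]
  constructor
  · intro h
    filter_upwards [h] with p hp using mul_self_eq_zero.1 hp
  · intro h
    filter_upwards [h] with p hp
    simp [hp]

lemma isNeumannEigenvalue_iff {t : ℝ} : O.IsNeumannEigenvalue t ↔
    ∃ u : O.H1, O.l2Form u u ≠ 0 ∧ ∀ v, O.dirichletForm u v = t * O.l2Form u v := by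
  constructor
  · rintro ⟨u, hu, hne, h⟩
    refine ⟨⟨u, hu⟩, fun h0 => hne ((l2Form_self_eq_zero_iff ⟨u, hu⟩).1 h0), fun v => ?_⟩
    obtain ⟨F, h1, -, h3⟩ := h v.1 v.2
    rw [l2Form_apply, ← h3]
    exact integral_congr_ae (h1.ae_eq_gradInner hu.hasChartGrad v.2.hasChartGrad).symm
  · rintro ⟨u, hne, h⟩
    refine ⟨u.1, u.2, fun h0 => hne ((l2Form_self_eq_zero_iff u).2 h0), fun v hv => ?_⟩
    exact ⟨O.gradInner u.1 v, (u.2.hasChartGrad.gradInner hv.hasChartGrad).2,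
      u.2.integrable_gradInner hv, h ⟨v, hv⟩⟩

end RiemannianOrbifold

/-! ### The first eigenvalue of a nonnegative form with compact resolvent. -/

section abstract_spectral

variable {H : Type*} [AddCommGroup H] [Module ℝ H]

lemma LinearMap.BilinForm.apply_add_smul_self {a : LinearMap.BilinForm ℝ H}
    (hs : ∀ u v, a u v = a v u) (u v : H) (t : ℝ) :
    a (u + t • v) (u + t • v) = a u u + 2 * t * a u v + t ^ 2 * a v v := by
  simp only [map_add, LinearMap.add_apply, map_smul, LinearMap.smul_apply, smul_eq_mul, hs v u]
  ring

lemma LinearMap.BilinForm.apply_sub_self {a : LinearMap.BilinForm ℝ H}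
    (hs : ∀ u v, a u v = a v u) (u v : H) :
    a (u - v) (u - v) = a u u - 2 * a u v + a v v := by
  simp only [map_sub, LinearMap.sub_apply, hs v u]
  ring

/-- If `a` is nonnegative on a subspace containing `u`, `v` and vanishes at `u`, then `a u v = 0`.
-/
lemma eq_zero_of_forall_quadratic_nonneg {p q : ℝ} (h : ∀ t : ℝ, 0 ≤ 2 * t * p + t ^ 2 * q) :
    p = 0 := by
  by_contra hp
  have hq : 0 < |q| + 1 := by positivity
  -- Roughly the vertex of the parabola; replacing `q` by `|q| + 1` keeps the denominator positive
  -- whatever the sign of `q`.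
  have h1 := h (-p / (|q| + 1))
  have h2 : (-p / (|q| + 1)) ^ 2 * q ≤ (-p / (|q| + 1)) ^ 2 * (|q| + 1) :=
    mul_le_mul_of_nonneg_left (by linarith [le_abs_self q]) (sq_nonneg _)
  have h3 : 2 * (-p / (|q| + 1)) * p + (-p / (|q| + 1)) ^ 2 * (|q| + 1) = -(p ^ 2 / (|q| + 1)) := by
    field_simp
    ring
  have h4 : 0 < p ^ 2 / (|q| + 1) := by positivity
  linarith

/-- Sequences that are bounded for a form `a` relatively to which `b` is compact have
subsequences that are Cauchy for `b`. -/
lemma exists_subseq_cauchy {a b : LinearMap.BilinForm ℝ H} (hcomp : ∀ ε > 0, ∃ l : List (H →ₗ[ℝ] ℝ),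
      (∀ φ ∈ l, ∃ C, ∀ u, φ u ^ 2 ≤ C * b u u) ∧
      ∀ u, b u u ≤ ε * a u u + (l.map fun φ => φ u ^ 2).sum)
    {u : ℕ → H} {A B : ℝ} (hA : ∀ i j, a (u i - u j) (u i - u j) ≤ A) (hB : ∀ j, b (u j) (u j) ≤ B)
    (hb : ∀ v, 0 ≤ b v v) :
    ∃ n : ℕ → ℕ, (∀ k, k ≤ n k) ∧ ∀ ε > 0, ∃ N, ∀ i ≥ N, ∀ j ≥ N,
      b (u (n i) - u (n j)) (u (n i) - u (n j)) < ε := by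
  -- An ultrafilter beyond all finite sets makes every bounded sequence `φ (u j)` converge at once,
  -- so no diagonal extraction over the functionals is needed.
  set U : Filter ℕ := (hyperfilter ℕ : Filter ℕ) with hU
  have hB0 : 0 ≤ B := (hb _).trans (hB 0)
  have hlim : ∀ φ : H →ₗ[ℝ] ℝ, (∃ C, ∀ u, φ u ^ 2 ≤ C * b u u) →
      ∃ x, Tendsto (fun j => φ (u j)) U (𝓝 x) := by
    rintro φ ⟨C, hC⟩
    have hbd : ∀ j, φ (u j) ∈ Icc (-(|C| * B + 1)) (|C| * B + 1) := by
      intro j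
      have h1 : φ (u j) ^ 2 ≤ |C| * B := by
        refine (hC _).trans ((mul_le_mul_of_nonneg_right (le_abs_self C) (hb _)).trans ?_)
        exact mul_le_mul_of_nonneg_left (hB j) (abs_nonneg _)
      have h2 : 0 ≤ |C| * B := mul_nonneg (abs_nonneg _) hB0
      exact ⟨by nlinarith [sq_nonneg (φ (u j) + 1)], by nlinarith [sq_nonneg (φ (u j) - 1)]⟩
    have := (isCompact_Icc (a := -(|C| * B + 1)) (b := |C| * B + 1)).ultrafilter_le_nhds
      ((hyperfilter ℕ).map fun j => φ (u j))
      (tendsto_principal.2 (Eventually.of_forall hbd))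
    obtain ⟨x, -, hx⟩ := this
    exact ⟨x, hx⟩
  have hsets : ∀ ε > 0, ∃ s ∈ U, ∀ i ∈ s, ∀ j ∈ s, b (u i - u j) (u i - u j) < ε := by
    intro ε hε
    have hAp : 0 < |A| + 1 := by positivity
    obtain ⟨l, hl, hle⟩ := hcomp (ε / (2 * (|A| + 1))) (by positivity)
    have key : ∀ l : List (H →ₗ[ℝ] ℝ), (∀ φ ∈ l, ∃ C, ∀ u, φ u ^ 2 ≤ C * b u u) → ∀ η > 0,
        ∃ s ∈ U, ∀ i ∈ s, ∀ j ∈ s, (l.map fun φ => φ (u i - u j) ^ 2).sum < η := by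
      intro l
      induction l with
      | nil => exact fun _ η hη => ⟨univ, univ_mem, fun i _ j _ => by simpa using hη⟩
      | cons φ l ih =>
        intro hl η hη
        obtain ⟨s, hs, hs'⟩ := ih (fun ψ hψ => hl ψ (List.mem_cons_of_mem _ hψ)) (η / 2)
          (half_pos hη)
        obtain ⟨x, hx⟩ := hlim φ (hl φ List.mem_cons_self)
        have hr : 0 < √(η / 2) / 2 := by positivity
        refine ⟨s ∩ {j | φ (u j) ∈ ball x (√(η / 2) / 2)},
          inter_mem hs (hx (ball_mem_nhds x hr)), ?_⟩
        rintro i ⟨hi, hi'⟩ j ⟨hj, hj'⟩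
        have h1 : |φ (u i - u j)| < √(η / 2) := by
          rw [map_sub, ← Real.dist_eq]
          have := dist_triangle_right (φ (u i)) (φ (u j)) x
          have e1 := mem_ball.1 hi'
          have e2 := mem_ball.1 hj'
          linarith
        have h2 : φ (u i - u j) ^ 2 < η / 2 := by
          rw [← sq_abs, ← Real.sq_sqrt (half_pos hη).le]
          exact pow_lt_pow_left₀ h1 (abs_nonneg _) two_ne_zero
        have h3 := hs' i hi j hj
        simp only [List.map_cons, List.sum_cons]
        linarith
    obtain ⟨s, hs, hs'⟩ := key l hl (ε / 2) (half_pos hε)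
    refine ⟨s, hs, fun i hi j hj => ?_⟩
    have h1 := hle (u i - u j)
    have h2 : ε / (2 * (|A| + 1)) * a (u i - u j) (u i - u j) ≤ ε / 2 := by
      have : a (u i - u j) (u i - u j) ≤ |A| + 1 := by linarith [hA i j, le_abs_self A]
      calc _ ≤ ε / (2 * (|A| + 1)) * (|A| + 1) := by gcongr
        _ = ε / 2 := by field_simp
    linarith [hs' i hi j hj]
  choose! s hs hs' using hsets
  -- The sets for the tolerances `1 / (l + 1)`, `l ≤ k`, and the tail beyond `k` all belong to the
  -- ultrafilter, so they have a common element.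
  have hpick : ∀ k : ℕ, ∃ n, k ≤ n ∧ ∀ l ≤ k, n ∈ s (1 / ((l : ℝ) + 1)) := by
    intro k
    have h1 : (⋂ l ∈ Finset.range (k + 1), s (1 / ((l : ℝ) + 1))) ∈ U :=
      (Filter.biInter_finset_mem _).2 fun l _ => hs _ (by positivity)
    have h2 : Ici k ∈ U := by refine (Nat.hyperfilter_le_atTop) (Ici_mem_atTop k)
    obtain ⟨n, hn1, hn2⟩ := (inter_mem h1 h2 |> (Filter.nonempty_of_mem))
    refine ⟨n, hn2, fun l hl => ?_⟩
    exact (mem_iInter₂.1 hn1) l (Finset.mem_range.2 (by omega))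
  choose n hn1 hn2 using hpick
  refine ⟨n, hn1, fun ε hε => ?_⟩
  obtain ⟨N, hN⟩ := exists_nat_one_div_lt hε
  exact ⟨N, fun i hi j hj => (hs' _ (by positivity) _ (hn2 i N hi) _ (hn2 j N hj)).trans hN⟩

/-- The first eigenvalue of a closed form `a` with compact resolvent with respect to `b`, whose
kernel is spanned by `e`. -/
theorem exists_first_eigenvalue {a b : LinearMap.BilinForm ℝ H}
    (ha : ∀ u, 0 ≤ a u u) (hb : ∀ u, 0 ≤ b u u) (has : ∀ u v, a u v = a v u)
    (hbs : ∀ u v, b u v = b v u)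
    (hcomp : ∀ ε > 0, ∃ l : List (H →ₗ[ℝ] ℝ), (∀ φ ∈ l, ∃ C, ∀ u, φ u ^ 2 ≤ C * b u u) ∧
      ∀ u, b u u ≤ ε * a u u + (l.map fun φ => φ u ^ 2).sum)
    (hcomplete : ∀ u : ℕ → H, (∀ ε > 0, ∃ N, ∀ i ≥ N, ∀ j ≥ N,
      a (u i - u j) (u i - u j) < ε ∧ b (u i - u j) (u i - u j) < ε) →
      ∃ v, Tendsto (fun j => a (u j - v) (u j - v)) atTop (𝓝 0) ∧
        Tendsto (fun j => b (u j - v) (u j - v)) atTop (𝓝 0))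
    {e : H} (he : ∀ v, a e v = 0) (hbe : b e e ≠ 0)
    (hker : ∀ u, a u u = 0 → ∃ c : ℝ, b (u - c • e) (u - c • e) = 0)
    (hex : ∃ w, b w e = 0 ∧ b w w ≠ 0) :
    ∃ t : ℝ, 0 < t ∧ (∃ u, b u u ≠ 0 ∧ ∀ v, a u v = t * b u v) ∧
      ∀ u, b u e = 0 → t * b u u ≤ a u u := by
  set R : Set ℝ := {r | ∃ u, b u e = 0 ∧ b u u = 1 ∧ a u u = r} with hR
  have hnorm : ∀ u, b u e = 0 → b u u ≠ 0 → a u u / b u u ∈ R := by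
    intro u h1 h2
    have h3 : 0 < b u u := lt_of_le_of_ne (hb u) (Ne.symm h2)
    refine ⟨(√(b u u))⁻¹ • u, ?_, ?_, ?_⟩
    · simp [h1]
    · simp only [map_smul, LinearMap.smul_apply, smul_eq_mul, ← mul_assoc, ← mul_inv,
        Real.mul_self_sqrt h3.le]
      exact inv_mul_cancel₀ h2
    · simp only [map_smul, LinearMap.smul_apply, smul_eq_mul, ← mul_assoc, ← mul_inv,
        Real.mul_self_sqrt h3.le]
      rw [div_eq_inv_mul]
  have hRne : R.Nonempty := by
    obtain ⟨w, h1, h2⟩ := hex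
    exact ⟨_, hnorm w h1 h2⟩
  have hRb : BddBelow R := ⟨0, by rintro r ⟨u, -, -, rfl⟩; exact ha u⟩
  -- The eigenvalue is the infimum of the Rayleigh quotient on the `b`-orthogonal complement of `e`;
  -- it will be attained.
  set t := sInf R with ht
  have ht0 : 0 ≤ t := le_csInf hRne (by rintro r ⟨u, -, -, rfl⟩; exact ha u)
  have hray : ∀ u, b u e = 0 → t * b u u ≤ a u u := by
    intro u h1
    by_cases h2 : b u u = 0
    · rw [h2, mul_zero]; exact ha u
    · have h3 : 0 < b u u := lt_of_le_of_ne (hb u) (Ne.symm h2)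
      exact (le_div_iff₀ h3).1 (csInf_le hRb (hnorm u h1 h2))
  have hseq : ∀ j : ℕ, ∃ u, b u e = 0 ∧ b u u = 1 ∧ a u u < t + 1 / ((j : ℝ) + 1) := by
    intro j
    have hj : 0 < 1 / ((j : ℝ) + 1) := by positivity
    obtain ⟨r, ⟨u, h1, h2, h3⟩, hr⟩ := exists_lt_of_csInf_lt hRne
      (show sInf R < t + 1 / ((j : ℝ) + 1) by rw [← ht]; linarith)
    exact ⟨u, h1, h2, by rw [h3]; exact hr⟩
  choose u hue hub hua using hseq
  have hpar : ∀ (q : LinearMap.BilinForm ℝ H) (x y : H),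
      q (x - y) (x - y) + q (x + y) (x + y) = 2 * q x x + 2 * q y y := by
    intro q x y
    simp only [map_sub, map_add, LinearMap.sub_apply, LinearMap.add_apply]
    ring
  have hua2 : ∀ j, a (u j) (u j) ≤ t + 1 := by
    intro j
    have : 1 / ((j : ℝ) + 1) ≤ 1 := by
      rw [div_le_one (by positivity)]
      have : (0 : ℝ) ≤ j := Nat.cast_nonneg j
      linarith
    linarith [hua j]
  obtain ⟨n, hn, hcau⟩ := exists_subseq_cauchy hcomp (u := u) (A := 4 * (t + 1)) (B := 1)
    (fun i j => by
      have h1 := hpar a (u i) (u j)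
      linarith [ha (u i + u j), hua2 i, hua2 j]) (fun j => (hub j).le) hb
  -- A minimising sequence that is Cauchy for `b` is Cauchy for `a`. By the parallelogram law `a (uᵢ
  -- - uⱼ) = 2 a uᵢ + 2 a uⱼ - a (uᵢ + uⱼ)` on the diagonal. The last term is at least `t b (uᵢ +
  -- uⱼ) = t (4 - b (uᵢ - uⱼ))`, while the first two are close to `2 t` each.
  have hcau2 : ∀ ε > 0, ∃ N, ∀ i ≥ N, ∀ j ≥ N, a (u (n i) - u (n j)) (u (n i) - u (n j)) < ε ∧
      b (u (n i) - u (n j)) (u (n i) - u (n j)) < ε := by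
    intro ε hε
    have htp : 0 < t + 1 := by linarith
    obtain ⟨N1, hN1⟩ := hcau (min ε (ε / (2 * (t + 1)))) (lt_min hε (by positivity))
    obtain ⟨N2, hN2⟩ := exists_nat_one_div_lt (show 0 < ε / 8 by positivity)
    refine ⟨max N1 N2, fun i hi j hj => ?_⟩
    have h1 := hN1 i (le_trans (le_max_left _ _) hi) j (le_trans (le_max_left _ _) hj)
    refine ⟨?_, h1.trans_le (min_le_left _ _)⟩
    have h2 := h1.trans_le (min_le_right _ _)
    have hsmall : ∀ i ≥ max N1 N2, a (u (n i)) (u (n i)) < t + ε / 8 := by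
      intro i hi
      have h3 : N2 ≤ n i := (le_trans (le_max_right _ _) hi).trans (hn i)
      have h4 : 1 / ((n i : ℝ) + 1) ≤ 1 / ((N2 : ℝ) + 1) := by gcongr
      linarith [hua (n i)]
    have h5 := hpar a (u (n i)) (u (n j))
    have h6 := hpar b (u (n i)) (u (n j))
    rw [hub, hub] at h6
    have h7 := hray (u (n i) + u (n j)) (by rw [map_add, LinearMap.add_apply, hue, hue, add_zero])
    have h8 : b (u (n i) + u (n j)) (u (n i) + u (n j)) =
      4 - b (u (n i) - u (n j)) (u (n i) - u (n j)) := by linarith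
    rw [h8] at h7
    have h9 : t * b (u (n i) - u (n j)) (u (n i) - u (n j)) ≤ ε / 2 := by
      calc _ ≤ (t + 1) * (ε / (2 * (t + 1))) := by
            apply mul_le_mul (by linarith) h2.le (hb _) htp.le
        _ = ε / 2 := by field_simp
    linarith [hsmall i hi, hsmall j hj]
  obtain ⟨v, hva, hvb⟩ := hcomplete (fun i => u (n i)) hcau2
  have hCS : ∀ (q : LinearMap.BilinForm ℝ H), (∀ u, 0 ≤ q u u) → (∀ u v, q u v = q v u) →
      ∀ x y, q x y ^ 2 ≤ q x x * q y y := by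
    intro q hq hqs x y
    have h := discrim_le_zero (a := q y y) (b := 2 * q x y) (c := q x x) (fun s => by
      have := hq (x + s • y)
      rw [LinearMap.BilinForm.apply_add_smul_self hqs] at this
      linarith)
    unfold discrim at h
    linarith
  have hcont : ∀ (q : LinearMap.BilinForm ℝ H), (∀ u, 0 ≤ q u u) → (∀ u v, q u v = q v u) →
      Tendsto (fun j => q (u (n j) - v) (u (n j) - v)) atTop (𝓝 0) → ∀ y,
      Tendsto (fun j => q (u (n j)) y) atTop (𝓝 (q v y)) := by
    intro q hq hqs hlim y
    rw [← tendsto_sub_nhds_zero_iff]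
    have h1 := (hlim.mul_const (q y y)).sqrt
    rw [zero_mul, Real.sqrt_zero] at h1
    refine squeeze_zero_norm (fun j => ?_) h1
    rw [← LinearMap.sub_apply, ← map_sub]
    exact Real.abs_le_sqrt (hCS q hq hqs _ _)
  have hve : b v e = 0 := by
    have h1 := hcont b hb hbs hvb e
    simp only [hue] at h1
    exact (tendsto_nhds_unique h1 tendsto_const_nhds)
  have hself : ∀ (q : LinearMap.BilinForm ℝ H), (∀ u, 0 ≤ q u u) → (∀ u v, q u v = q v u) →
      Tendsto (fun j => q (u (n j) - v) (u (n j) - v)) atTop (𝓝 0) →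
      Tendsto (fun j => q (u (n j)) (u (n j))) atTop (𝓝 (q v v)) := by
    intro q hq hqs hlim
    have h1 := (hlim.add ((hcont q hq hqs hlim v).const_mul 2)).sub_const (q v v)
    have h2 : 0 + 2 * q v v - q v v = q v v := by ring
    rw [h2] at h1
    refine h1.congr fun j => ?_
    rw [LinearMap.BilinForm.apply_sub_self hqs]
    ring
  have hvb1 : b v v = 1 := by
    have h1 := hself b hb hbs hvb
    simp only [hub] at h1
    exact tendsto_nhds_unique h1 tendsto_const_nhds
  have hva1 : a v v = t := by
    refine le_antisymm ?_ ?_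
    · have h1 := hself a ha has hva
      have h2 : Tendsto (fun j : ℕ => t + 1 / ((j : ℝ) + 1)) atTop (𝓝 (t + 0)) :=
        tendsto_one_div_add_atTop_nhds_zero_nat.const_add t
      rw [add_zero] at h2
      refine le_of_tendsto_of_tendsto' h1 h2 fun j => (hua (n j)).le.trans ?_
      have : (j : ℝ) ≤ n j := by exact_mod_cast hn j
      gcongr
    · have := hray v hve
      rwa [hvb1, mul_one] at this
  refine ⟨t, ?_, ⟨v, by rw [hvb1]; exact one_ne_zero, ?_⟩, hray⟩
  -- If `t = 0`, the minimiser lies in the kernel of `a` and hence equals a multiple of `e` modulo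
  -- `b`. This contradicts that it is orthogonal to `e` and has norm one.
  · refine lt_of_le_of_ne ht0 fun h0 => ?_
    obtain ⟨c, hc⟩ := hker v (by rw [hva1, ← h0])
    have h1 := LinearMap.BilinForm.apply_sub_self hbs v (c • e)
    simp only [map_smul, LinearMap.smul_apply, smul_eq_mul, hve, hvb1, hc] at h1
    have := hb (c • e)
    simp only [map_smul, LinearMap.smul_apply, smul_eq_mul] at this
    linarith
  -- First variation: along `v + s • y` the Rayleigh inequality is an equality at `s = 0`, so its
  -- linear term vanishes. Vectors not orthogonal to `e` are then corrected by a multiple of `e`.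
  · have hEL : ∀ y, b y e = 0 → a v y = t * b v y := by
      intro y hy
      have := eq_zero_of_forall_quadratic_nonneg (p := a v y - t * b v y)
        (q := a y y - t * b y y) (fun s => by
          have h1 := hray (v + s • y) (by simp [hve, hy])
          rw [LinearMap.BilinForm.apply_add_smul_self has,
            LinearMap.BilinForm.apply_add_smul_self hbs, hva1, hvb1] at h1
          linarith)
      linarith
    intro y
    set r := b y e / b e e with hr
    have h1 := hEL (y - r • e) (by
      rw [map_sub, LinearMap.sub_apply, map_smul, LinearMap.smul_apply, smul_eq_mul, hr,
        div_mul_cancel₀ _ hbe, sub_self])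
    have h2 : a v e = 0 := by rw [has, he]
    simpa [h2, hve] using h1

end abstract_spectral

/-! ### The Poincaré inequality on convex sets. -/

section poincare

variable {m : ℕ}

lemma sq_lintegral_le {α : Type*} [MeasurableSpace α] {μ : Measure α} {G : α → ℝ≥0∞}
    (hG : AEMeasurable G μ) : (∫⁻ t, G t ∂μ) ^ 2 ≤ (∫⁻ t, G t ^ 2 ∂μ) * μ univ := by
  have h2 := ENNReal.lintegral_mul_le_Lp_mul_Lq μ Real.HolderConjugate.two_two hG
    (g := fun _ => 1) aemeasurable_const
  simp only [Pi.mul_apply, mul_one, lintegral_const, ENNReal.rpow_two, one_pow, one_mul] at h2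
  refine (pow_le_pow_left' h2 2).trans_eq ?_
  rw [mul_pow, ← rpow_natCast, ← ENNReal.rpow_mul, ← rpow_natCast, ← ENNReal.rpow_mul]
  norm_num

lemma lintegral_comp_smul_add {G : ℝ^m → ℝ≥0∞} (hG : Measurable G) {t : ℝ} (ht : t ≠ 0) (z : ℝ^m) :
    ∫⁻ y, G (z + t • y) = ofReal (|t|⁻¹ ^ m) * ∫⁻ y, G y := by
  have h1 : ∫⁻ y, G (z + t • y) = ∫⁻ y, G (z + y) ∂(Measure.map (t • ·) volume) := by
    rw [lintegral_map (f := fun y => G (z + y)) (hG.comp (measurable_const_add z))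
      (measurable_const_smul t)]
  rw [h1, Measure.map_addHaar_smul _ ht, lintegral_smul_measure,
    lintegral_add_left_eq_self (fun y => G y) z, smul_eq_mul]
  congr 2
  rw [abs_inv, abs_pow, Module.finrank_fintype_fun_eq_card, Fintype.card_fin, inv_pow]

/-- The fundamental theorem of calculus along the segment from `x` to `y`, followed by the
Cauchy–Schwarz inequality in `t`. -/
lemma enorm_sub_sq_le {F : ℝ^m → ℝ} (hF : ContDiff ℝ 1 F) (x y : ℝ^m) : ‖F y - F x‖ₑ ^ 2 ≤
      ‖y - x‖ₑ ^ 2 * ∫⁻ t in Icc (0 : ℝ) 1, ‖fderiv ℝ F ((1 - t) • x + t • y)‖ₑ ^ 2 := by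
  have hd : ∀ t : ℝ, HasDerivAt (fun t : ℝ => F ((1 - t) • x + t • y))
      (fderiv ℝ F ((1 - t) • x + t • y) (y - x)) t := by
    intro t
    have h1 : HasDerivAt (fun t : ℝ => (1 - t) • x + t • y) (y - x) t := by
      have := (((hasDerivAt_id t).const_sub 1).smul_const x).add ((hasDerivAt_id t).smul_const y)
      refine this.congr_deriv ?_
      simp [sub_eq_neg_add]
    exact ((hF.differentiable one_ne_zero _).hasFDerivAt).comp_hasDerivAt t h1
  have hc : Continuous fun t : ℝ => fderiv ℝ F ((1 - t) • x + t • y) :=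
    (hF.continuous_fderiv one_ne_zero).comp (by fun_prop)
  have h2 := intervalIntegral.integral_eq_sub_of_hasDerivAt (a := 0) (b := 1)
    (fun t _ => hd t) ((hc.clm_apply continuous_const).intervalIntegrable _ _)
  simp only [sub_self, zero_smul, one_smul, zero_add, sub_zero, add_zero] at h2
  rw [← h2, intervalIntegral.integral_of_le zero_le_one, ← integral_Icc_eq_integral_Ioc]
  have h3 : ‖∫ t in Icc (0 : ℝ) 1, fderiv ℝ F ((1 - t) • x + t • y) (y - x)‖ₑ ≤
      (∫⁻ t in Icc (0 : ℝ) 1, ‖fderiv ℝ F ((1 - t) • x + t • y)‖ₑ) * ‖y - x‖ₑ := by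
    refine (enorm_integral_le_lintegral_enorm _).trans ?_
    rw [← lintegral_mul_const' _ _ enorm_ne_top]
    exact lintegral_mono fun t => ContinuousLinearMap.le_opENorm _ _
  refine (pow_le_pow_left' h3 2).trans ?_
  rw [mul_pow, mul_comm]
  gcongr
  refine (sq_lintegral_le hc.enorm.aemeasurable).trans_eq ?_
  simp

/-- The segment estimate is integrated over pairs of points of `K`, whose segments stay in `K` by
convexity. For fixed `t` one substitutes for the point with the larger weight, so that the Jacobian
is at most `2 ^ m`. -/
lemma lintegral_prod_enorm_sub_sq_le {F : ℝ^m → ℝ} (hF : ContDiff ℝ 1 F)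
    {K : Set ℝ^m} (hK : Convex ℝ K) (hKm : MeasurableSet K) {ℓ : ℝ≥0∞}
    (hℓ : ∀ x ∈ K, ∀ y ∈ K, ‖y - x‖ₑ ≤ ℓ) :
    ∫⁻ p in K ×ˢ K, ‖F p.2 - F p.1‖ₑ ^ 2 ≤
      2 ^ m * ℓ ^ 2 * volume K * ∫⁻ x in K, ‖fderiv ℝ F x‖ₑ ^ 2 := by
  set G : ℝ^m → ℝ≥0∞ := K.indicator fun x => ‖fderiv ℝ F x‖ₑ ^ 2 with hG
  have hGm : Measurable G := by
    refine Measurable.indicator ?_ hKm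
    exact ((hF.continuous_fderiv one_ne_zero).enorm.measurable).pow_const 2
  have hGi : ∫⁻ x, G x = ∫⁻ x in K, ‖fderiv ℝ F x‖ₑ ^ 2 := lintegral_indicator hKm _
  have hhalf : ∀ t : ℝ, 1 / 2 ≤ t → ofReal (|t|⁻¹ ^ m) ≤ 2 ^ m := by
    intro t ht
    rw [abs_of_nonneg (by linarith), ofReal_pow (by positivity)]
    refine pow_le_pow_left' ?_ m
    have : t⁻¹ ≤ 2 := by rw [inv_le_comm₀ (by linarith) two_pos]; linarith
    exact (ofReal_le_ofReal this).trans_eq (by simp)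
  have hcombo : Measurable fun q : (ℝ^m × ℝ^m) × ℝ =>
      G ((1 - q.2) • q.1.1 + q.2 • q.1.2) := by
    refine hGm.comp (Continuous.measurable ?_)
    fun_prop
  have hstep : ∀ t ∈ Icc (0 : ℝ) 1,
      ∫⁻ p in K ×ˢ K, G ((1 - t) • p.1 + t • p.2) ≤ 2 ^ m * volume K * ∫⁻ x, G x := by
    intro t ht
    have hmt : Measurable fun p : ℝ^m × ℝ^m => G ((1 - t) • p.1 + t • p.2) :=
      hGm.comp (Continuous.measurable (by fun_prop))
    rw [Measure.volume_eq_prod, ← Measure.prod_restrict]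
    -- For `t ≥ 1 / 2` the map `y ↦ (1 - t) x + t y` is inverted; for `t ≤ 1 / 2` the map `x ↦ (1 -
    -- t) x + t y`.
    rcases le_total (1 / 2) t with h | h
    · rw [lintegral_prod _ hmt.aemeasurable]
      calc _ ≤ ∫⁻ _ in K, 2 ^ m * ∫⁻ x, G x := by
            refine lintegral_mono fun x => ?_
            refine (setLIntegral_le_lintegral _ _).trans ?_
            have h1 : t ≠ 0 := by intro h0; linarith
            dsimp only
            rw [lintegral_comp_smul_add hGm h1]
            gcongr
            exact hhalf _ h
        _ = _ := by rw [setLIntegral_const]; ring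
    · rw [lintegral_prod_symm _ hmt.aemeasurable]
      calc _ ≤ ∫⁻ _ in K, 2 ^ m * ∫⁻ x, G x := by
            refine lintegral_mono fun y => ?_
            refine (setLIntegral_le_lintegral _ _).trans ?_
            have h1 : (1 - t) ≠ 0 := by intro h0; linarith
            simp_rw [add_comm ((1 - t) • _)]
            rw [lintegral_comp_smul_add hGm h1]
            gcongr
            exact hhalf _ (by linarith)
        _ = _ := by rw [setLIntegral_const]; ring
  calc ∫⁻ p in K ×ˢ K, ‖F p.2 - F p.1‖ₑ ^ 2
      ≤ ∫⁻ p in K ×ˢ K, ℓ ^ 2 * ∫⁻ t in Icc (0 : ℝ) 1, G ((1 - t) • p.1 + t • p.2) := by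
        refine setLIntegral_mono' (hKm.prod hKm) fun p hp => ?_
        refine (enorm_sub_sq_le hF p.1 p.2).trans ?_
        refine mul_le_mul' (pow_le_pow_left' (hℓ _ hp.1 _ hp.2) 2) ?_
        · refine setLIntegral_mono' measurableSet_Icc fun t ht => le_of_eq ?_
          rw [hG, indicator_of_mem (hK hp.1 hp.2 (by linarith [ht.2]) ht.1 (by ring))]
    _ = ℓ ^ 2 * ∫⁻ t in Icc (0 : ℝ) 1, ∫⁻ p in K ×ˢ K, G ((1 - t) • p.1 + t • p.2) := by
        rw [lintegral_const_mul _ (hcombo.lintegral_prod_right'), lintegral_lintegral_swap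
          hcombo.aemeasurable]
    _ ≤ ℓ ^ 2 * ∫⁻ _ in Icc (0 : ℝ) 1, 2 ^ m * volume K * ∫⁻ x, G x := by
        exact mul_le_mul_right (setLIntegral_mono' measurableSet_Icc hstep) _
    _ = _ := by
        rw [setLIntegral_const, Real.volume_Icc, hGi]
        simp only [sub_zero, ENNReal.ofReal_one, mul_one]
        ring

/-- The Poincaré inequality on convex sets, for functions with weak differentials. -/
theorem HasWeakFDerivOn.lintegral_prod_enorm_sub_sq_le {f : ℝ^m → ℝ}
    {w : ℝ^m → (ℝ^m →L[ℝ] ℝ)} {V C : Set ℝ^m}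
    (h : HasWeakFDerivOn f w V) (hC : Convex ℝ C) (hCV : interior C ⊆ V)
    (hCb : Bornology.IsBounded C) {ℓ : ℝ≥0∞} (hℓ : ∀ x ∈ C, ∀ y ∈ C, ‖y - x‖ₑ ≤ ℓ) :
    ∫⁻ p in C ×ˢ C, ‖f p.2 - f p.1‖ₑ ^ 2 ≤
      2 ^ m * ℓ ^ 2 * volume C * ∫⁻ x in C, ‖w x‖ₑ ^ 2 := by
  set D := interior C with hD
  have hDo : IsOpen D := isOpen_interior
  have hCD : (C : Set ℝ^m) =ᵐ[volume] D := by
    rw [ae_eq_set]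
    refine ⟨measure_mono_null ?_ (hC.addHaar_frontier volume), ?_⟩
    · rw [hD]; exact fun x hx => ⟨subset_closure hx.1, hx.2⟩
    · rw [sdiff_eq_bot_iff.2 interior_subset]; exact measure_empty
  have e1 : (volume : Measure (ℝ^m × ℝ^m)).restrict (C ×ˢ C) = volume.restrict (D ×ˢ D) := by
    rw [Measure.volume_eq_prod, ← Measure.prod_restrict, ← Measure.prod_restrict,
      Measure.restrict_congr_set hCD]
  rw [e1, Measure.restrict_congr_set hCD, measure_congr hCD]
  have hw := h.mono hCV
  -- Inner parallel sets of the interior. They are compact and convex and exhaust it, so the smooth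
  -- inequality applies on each of them to mollifications.
  set K : ℕ → Set ℝ^m := fun j => {x | ball x (1 / ((j : ℝ) + 1)) ⊆ D} with hK
  have hpos : ∀ j : ℕ, 0 < 1 / ((j : ℝ) + 1) := fun j => by positivity
  have hKD : ∀ j, K j ⊆ D := fun j x hx => hx (mem_ball_self (hpos j))
  have hKcl : ∀ j, IsClosed (K j) := by
    intro j
    rw [← isOpen_compl_iff, Metric.isOpen_iff]
    intro x hx
    obtain ⟨z, hz, hzD⟩ := not_subset.1 hx
    refine ⟨1 / ((j : ℝ) + 1) - dist z x, sub_pos.2 hz, fun y hy hyK => hzD (hyK ?_)⟩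
    rw [mem_ball] at hy ⊢
    have := dist_triangle_right z y x
    linarith
  have hKc : ∀ j, IsCompact (K j) := fun j =>
    Metric.isCompact_of_isClosed_isBounded (hKcl j) (hCb.subset ((hKD j).trans interior_subset))
  have hDc : Convex ℝ D := hC.interior
  have hKconv : ∀ j, Convex ℝ (K j) := by
    intro j x hx y hy a b ha hb hab z hz
    have hz' : ‖z - (a • x + b • y)‖ < 1 / ((j : ℝ) + 1) := by rwa [mem_ball, dist_eq_norm] at hz
    have h1 : x + (z - (a • x + b • y)) ∈ D := hx (by simpa [mem_ball, dist_eq_norm] using hz')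
    have h2 : y + (z - (a • x + b • y)) ∈ D := hy (by simpa [mem_ball, dist_eq_norm] using hz')
    have h3 := hDc h1 h2 ha hb hab
    have h4 : a • (x + (z - (a • x + b • y))) + b • (y + (z - (a • x + b • y))) = z := by
      rw [smul_add, smul_add, add_add_add_comm, ← add_smul, hab, one_smul]
      abel
    rwa [h4] at h3
  have hKmono : Monotone K := by
    intro i j hij x hx
    refine (ball_subset_ball ?_).trans hx
    have : (i : ℝ) ≤ j := by exact_mod_cast hij
    gcongr
  have hKU : ⋃ j, K j = D := by
    refine subset_antisymm (iUnion_subset hKD) fun x hx => ?_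
    obtain ⟨ε, hε, hεD⟩ := Metric.isOpen_iff.1 hDo x hx
    obtain ⟨j, hj⟩ := exists_nat_one_div_lt hε
    exact mem_iUnion.2 ⟨j, (ball_subset_ball hj.le).trans hεD⟩
  have hprodU : ⋃ j, K j ×ˢ K j = D ×ˢ D := by rw [← hKU, iUnion_prod_of_monotone hKmono hKmono]
  have hdir : Directed (· ⊆ ·) fun j => K j ×ˢ K j :=
    Monotone.directed_le fun i j hij => prod_mono (hKmono hij) (hKmono hij)
  rw [← hprodU, setLIntegral_iUnion_of_directed _ hdir]
  refine iSup_le fun j => ?_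
  obtain ⟨F, hF, hFae, -, -, hFd⟩ := hw.exists_mollify hDo (hKc j) (hKD j)
  have hfst : ∀ᵐ p ∂((volume.restrict (K j)).prod (volume.restrict (K j))),
      Tendsto (fun k => F k p.1) atTop (𝓝 (f p.1)) :=
    Measure.quasiMeasurePreserving_fst.ae hFae
  have hsnd : ∀ᵐ p ∂((volume.restrict (K j)).prod (volume.restrict (K j))),
      Tendsto (fun k => F k p.2) atTop (𝓝 (f p.2)) :=
    Measure.quasiMeasurePreserving_snd.ae hFae
  have e2 : (volume : Measure (ℝ^m × ℝ^m)).restrict (K j ×ˢ K j) =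
      (volume.restrict (K j)).prod (volume.restrict (K j)) := by
    rw [Measure.volume_eq_prod, Measure.prod_restrict]
  -- Mollifications converge almost everywhere on the product, so Fatou's lemma transfers the
  -- inequality. The energy on the right is already bounded independently of the mollification.
  calc ∫⁻ p in K j ×ˢ K j, ‖f p.2 - f p.1‖ₑ ^ 2
      ≤ ∫⁻ p in K j ×ˢ K j, liminf (fun k => ‖F k p.2 - F k p.1‖ₑ ^ 2) atTop := by
        rw [e2]
        refine lintegral_mono_ae ?_
        filter_upwards [hfst, hsnd] with p h1 h2
        rw [(ENNReal.Tendsto.pow (n := 2) (h2.sub h1).enorm).liminf_eq]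
    _ ≤ liminf (fun k => ∫⁻ p in K j ×ˢ K j, ‖F k p.2 - F k p.1‖ₑ ^ 2) atTop := by
        refine lintegral_liminf_le fun k => ?_
        have := (hF k).continuous
        exact (Continuous.measurable (by fun_prop) : Measurable fun p : ℝ^m × ℝ^m =>
          ‖F k p.2 - F k p.1‖ₑ).pow_const 2
    _ ≤ 2 ^ m * ℓ ^ 2 * volume D * ∫⁻ x in D, ‖w x‖ₑ ^ 2 := by
        refine liminf_le_of_le (by isBoundedDefault) fun b hb => ?_
        obtain ⟨k, hk⟩ := hb.exists
        refine hk.trans ((_root_.lintegral_prod_enorm_sub_sq_le ((hF k).of_le (by simp)) (hKconv j)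
          (hKcl j).measurableSet (fun x hx y hy => hℓ x (interior_subset (hKD j hx)) y
            (interior_subset (hKD j hy)))).trans ?_)
        exact mul_le_mul' (by gcongr; exact hKD j) (hFd k)

/-- Expanding the square; this turns the inequality over pairs of points into a bound of `∫ f²` by
the squared mean and the energy. -/
lemma lintegral_prod_enorm_sub_sq_eq {α : Type*} [MeasurableSpace α] {μ : Measure α}
    [IsFiniteMeasure μ] {f : α → ℝ} (hf : MemLp f 2 μ) :
    ∫⁻ p, ‖f p.2 - f p.1‖ₑ ^ 2 ∂(μ.prod μ) =
      ofReal (2 * (μ.real univ * ∫ x, f x ^ 2 ∂μ - (∫ x, f x ∂μ) ^ 2)) := by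
  have h1 := hf.integrable one_le_two
  have h2 := hf.integrable_sq
  have e : ∀ p : α × α, (f p.2 - f p.1) ^ 2 =
      1 * f p.2 ^ 2 - 2 * (f p.1 * f p.2) + f p.1 ^ 2 * 1 := fun p => by ring
  have i1 : Integrable (fun p : α × α => 1 * f p.2 ^ 2) (μ.prod μ) :=
    (integrable_const (1 : ℝ)).mul_prod h2
  have i2 : Integrable (fun p : α × α => f p.1 * f p.2) (μ.prod μ) := h1.mul_prod h1
  have i3 : Integrable (fun p : α × α => f p.1 ^ 2 * 1) (μ.prod μ) :=
    h2.mul_prod (integrable_const (1 : ℝ))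
  have e3 : ∫ p, (f p.2 - f p.1) ^ 2 ∂(μ.prod μ) =
      2 * (μ.real univ * ∫ x, f x ^ 2 ∂μ - (∫ x, f x ∂μ) ^ 2) := by
    simp_rw [e]
    have s1 := integral_add (i1.sub (i2.const_mul 2)) i3
    have s2 := integral_sub i1 (i2.const_mul 2)
    simp only [Pi.sub_apply] at s1
    rw [s1, s2, integral_prod_mul (fun _ : α => (1 : ℝ)) (fun x => f x ^ 2),
      integral_prod_mul (fun x => f x ^ 2) (fun _ : α => (1 : ℝ)), integral_const_mul,
      integral_prod_mul f f]
    simp only [integral_const, smul_eq_mul, mul_one]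
    ring
  rw [← e3, ofReal_integral_eq_lintegral_ofReal]
  · refine lintegral_congr fun p => ?_
    rw [← enorm_pow, Real.enorm_of_nonneg (sq_nonneg _)]
  · simp_rw [e]
    exact (i1.sub (i2.const_mul 2)).add i3
  · exact Eventually.of_forall fun p => sq_nonneg _

lemma HasWeakFDerivOn.integral_sq_le {f : ℝ^m → ℝ} {w : ℝ^m → (ℝ^m →L[ℝ] ℝ)} {V C : Set ℝ^m}
    (h : HasWeakFDerivOn f w V) (hC : Convex ℝ C) (hCV : interior C ⊆ V)
    (hCb : Bornology.IsBounded C) {ℓ : ℝ} (hℓ0 : 0 ≤ ℓ) (hℓ : ∀ x ∈ C, ∀ y ∈ C, ‖y - x‖ ≤ ℓ)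
    (hf : MemLp f 2 (volume.restrict C)) (hw : ∫⁻ x in C, ‖w x‖ₑ ^ 2 ≠ ⊤) :
    ∫ x in C, f x ^ 2 ≤ (volume.real C)⁻¹ * (∫ x in C, f x) ^ 2 +
      2 ^ m * ℓ ^ 2 * (∫⁻ x in C, ‖w x‖ₑ ^ 2).toReal := by
  have hvol : volume C ≠ ⊤ := (hCb.measure_lt_top).ne
  have : IsFiniteMeasure (volume.restrict C) := ⟨by
    rw [Measure.restrict_apply_univ]; exact hvol.lt_top⟩
  rcases eq_or_ne (volume C) 0 with h0 | h0
  · have : volume.restrict C = 0 := Measure.restrict_eq_zero.2 h0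
    rw [this]
    simp
  have h1 := h.lintegral_prod_enorm_sub_sq_le hC hCV hCb (ℓ := ofReal ℓ) (fun x hx y hy => by
    rw [← ofReal_norm]
    exact ofReal_le_ofReal (hℓ x hx y hy))
  rw [Measure.volume_eq_prod, ← Measure.prod_restrict, lintegral_prod_enorm_sub_sq_eq hf,
    Measure.real, Measure.restrict_apply_univ] at h1
  set W := (∫⁻ x in C, ‖w x‖ₑ ^ 2).toReal with hW
  have hW0 : 0 ≤ W := ENNReal.toReal_nonneg
  have h2 : 2 ^ m * ofReal ℓ ^ 2 * volume C * ∫⁻ x in C, ‖w x‖ₑ ^ 2 =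
      ofReal (2 ^ m * ℓ ^ 2 * (volume C).toReal * W) := by
    rw [ofReal_mul (by positivity), ofReal_mul (by positivity),
      ofReal_mul (by positivity), ofReal_pow hℓ0, hW, ENNReal.ofReal_toReal hw,
      ENNReal.ofReal_toReal hvol, ofReal_pow two_pos.le]
    simp
  rw [h2, ENNReal.ofReal_le_ofReal_iff (by positivity)] at h1
  have hv : 0 < (volume C).toReal := ENNReal.toReal_pos h0 hvol
  rw [Measure.real]
  set v := (volume C).toReal
  set I := ∫ x in C, f x ^ 2
  set J := ∫ x in C, f x
  have h3 : v * I ≤ v * (v⁻¹ * J ^ 2 + 2 ^ m * ℓ ^ 2 * W) := by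
    have : v * (v⁻¹ * J ^ 2 + 2 ^ m * ℓ ^ 2 * W) = J ^ 2 + 2 ^ m * ℓ ^ 2 * v * W := by field_simp
    rw [this]
    have : 0 ≤ 2 ^ m * ℓ ^ 2 * v * W := by positivity
    linarith
  exact le_of_mul_le_mul_left h3 hv

end poincare

/-! ### Comparison of the metric with the Euclidean one. -/

namespace RiemannianOrbifoldChart

variable {m : ℕ} {X : Type*} [TopologicalSpace X] (c : Chart m X)

lemma cometric_sq_le {x : ℝ^m} (hx : x ∈ c.dom) (ξ η : ℝ^m →L[ℝ] ℝ) :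
    c.cometric x ξ η ^ 2 ≤ c.cometric x ξ ξ * c.cometric x η η := by
  have h := discrim_le_zero (a := c.cometric x η η) (b := 2 * c.cometric x ξ η)
    (c := c.cometric x ξ ξ) (fun s => by
      have := c.cometric_self_nonneg hx (ξ + s • η)
      rw [cometric_add_left, c.cometric_add_right hx, c.cometric_add_right hx,
        cometric_smul_left, cometric_smul_left, c.cometric_smul_right hx, c.cometric_smul_right hx,
        c.cometric_symm hx η ξ] at this
      linarith)
  unfold discrim at h
  linarith

/-- Cauchy–Schwarz against the covector dual to the basis vector `e_i`: its product with `ξ` is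
`ξ(e_i)` and its own square is `g_ii`. -/
lemma sq_apply_single_le_cometric {x : ℝ^m} (hx : x ∈ c.dom) (ξ : ℝ^m →L[ℝ] ℝ)
    (i : Fin m) : ξ (Pi.single i 1) ^ 2 ≤ c.metric x i i * c.cometric x ξ ξ := by
  have hdet : IsUnit (c.metric x).det := isUnit_iff_ne_zero.2 (c.det_metric_pos hx).ne'
  let η : ℝ^m →L[ℝ] ℝ := ∑ k, c.metric x k i • ContinuousLinearMap.proj k
  have hη : (fun k => η (Pi.single k 1)) = (c.metric x).mulVec (Pi.single i 1) := by
    ext k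
    simp [η, Pi.single_apply]
  have h1 : c.cometric x ξ η = ξ (Pi.single i 1) := by
    rw [cometric_eq_dotProduct, hη, Matrix.mulVec_mulVec, Matrix.nonsing_inv_mul _ hdet,
      Matrix.one_mulVec]
    simp
  have h2 : c.cometric x η η = c.metric x i i := by
    rw [cometric_eq_dotProduct, hη, Matrix.mulVec_mulVec, Matrix.nonsing_inv_mul _ hdet,
      Matrix.one_mulVec]
    simp
  have h3 := c.cometric_sq_le hx ξ η
  rw [h1, h2] at h3
  linarith

lemma sq_norm_le_cometric {x : ℝ^m} (hx : x ∈ c.dom) (ξ : ℝ^m →L[ℝ] ℝ) :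
    ‖ξ‖ ^ 2 ≤ m * (c.metric x).trace * c.cometric x ξ ξ := by
  have h1 : ‖ξ‖ ≤ ∑ i, |ξ (Pi.single i 1)| := by
    refine ContinuousLinearMap.opNorm_le_bound _ (Finset.sum_nonneg fun i _ => abs_nonneg _)
      fun v => ?_
    conv_lhs => rw [pi_eq_sum_univ' v]
    rw [map_sum]
    refine (norm_sum_le _ _).trans ?_
    rw [Finset.sum_mul]
    refine Finset.sum_le_sum fun i _ => ?_
    rw [map_smul, norm_smul, mul_comm]
    exact mul_le_mul_of_nonneg_left (norm_le_pi_norm v i) (norm_nonneg _)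
  calc ‖ξ‖ ^ 2 ≤ (∑ i, |ξ (Pi.single i 1)|) ^ 2 := by gcongr
    _ ≤ m * ∑ i, |ξ (Pi.single i 1)| ^ 2 := by
        simpa using sq_sum_le_card_mul_sum_sq (s := Finset.univ)
          (f := fun i => |ξ (Pi.single i 1)|)
    _ ≤ m * ∑ i, c.metric x i i * c.cometric x ξ ξ := by
        gcongr with i
        rw [sq_abs]
        exact c.sq_apply_single_le_cometric hx ξ i
    _ = _ := by rw [← Finset.sum_mul, Matrix.trace, mul_assoc]; rfl

lemma trace_metric_nonneg {x : ℝ^m} (hx : x ∈ c.dom) : 0 ≤ (c.metric x).trace :=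
  (c.posDef_metric x hx).posSemidef.trace_nonneg

lemma continuousOn_trace : ContinuousOn (fun x => (c.metric x).trace) c.dom :=
  Continuous.comp_continuousOn (g := fun M : Matrix (Fin m) (Fin m) ℝ => M.trace)
    (Continuous.matrix_trace continuous_id) c.continuousOn_metric

lemma sqrt_det_pos {x : ℝ^m} (hx : x ∈ c.dom) : 0 < √(c.metric x).det :=
  Real.sqrt_pos.2 (c.det_metric_pos hx)

/-- Every point has a small convex relatively open neighbourhood on which the metric is comparable
to the Euclidean metric. -/
lemma exists_ball_bounds {x : ℝ^m} (hx : x ∈ c.dom) {U : Set ℝ^m} (hU : U ∈ 𝓝 x) :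
    ∃ r > 0, ∃ δ > 0, ∃ M > 0, ball x r ⊆ U ∧ Convex ℝ (c.dom ∩ ball x r) ∧
      ∀ z ∈ c.dom ∩ ball x r, δ ≤ √(c.metric z).det ∧ √(c.metric z).det ≤ M ∧
        ∀ ξ : ℝ^m →L[ℝ] ℝ, ‖ξ‖ ^ 2 ≤ M * c.cometric z ξ ξ := by
  have hd := c.sqrt_det_pos hx
  have h1 : ∀ᶠ z in 𝓝[c.dom] x, √(c.metric z).det ∈ Ioo (√(c.metric x).det / 2)
      (√(c.metric x).det + 1) :=
    c.continuousOn_sqrt_det x hx (Ioo_mem_nhds (by linarith) (by linarith))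
  have h2 : ∀ᶠ z in 𝓝[c.dom] x, (c.metric z).trace < (c.metric x).trace + 1 :=
    c.continuousOn_trace x hx (Iio_mem_nhds (by linarith))
  obtain ⟨V, hV, hxV, hVs⟩ := mem_nhdsWithin.1 (h1.and h2)
  obtain ⟨r, hr, hrU, hreq⟩ := c.exists_ball_inter_quadrant hx (inter_mem hU (hV.mem_nhds hxV))
  have htr := c.trace_metric_nonneg hx
  refine ⟨r, hr, √(c.metric x).det / 2, by positivity,
    (√(c.metric x).det + 1) + m * ((c.metric x).trace + 1), by positivity,
    hrU.trans inter_subset_left, c.convex_dom_inter_ball hreq, ?_⟩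
  rintro z ⟨hz, hzr⟩
  obtain ⟨h3, h4⟩ := hVs ⟨(hrU hzr).2, hz⟩
  refine ⟨h3.1.le, ?_, fun ξ => (c.sq_norm_le_cometric hz ξ).trans ?_⟩
  · have : 0 ≤ m * ((c.metric x).trace + 1) := by positivity
    linarith [h3.2]
  · refine mul_le_mul_of_nonneg_right ?_ (c.cometric_self_nonneg hz ξ)
    have : m * (c.metric z).trace ≤ m * ((c.metric x).trace + 1) := by gcongr
    linarith

end RiemannianOrbifoldChart

lemma eLpNorm_two_sq {α E : Type*} [MeasurableSpace α] [NormedAddCommGroup E] {μ : Measure α}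
    (f : α → E) : eLpNorm f 2 μ ^ 2 = ∫⁻ x, ‖f x‖ₑ ^ 2 ∂μ := by
  rw [eLpNorm_eq_lintegral_rpow_enorm_toReal two_ne_zero ENNReal.ofNat_ne_top]
  simp only [ENNReal.toReal_ofNat, ENNReal.rpow_two]
  rw [← rpow_natCast, ← ENNReal.rpow_mul]
  norm_num

lemma exists_tendsto_lintegral_enorm_sub_sq {α E : Type*} [MeasurableSpace α]
    [NormedAddCommGroup E] [CompleteSpace E] {μ : Measure α} {f : ℕ → α → E}
    (hf : ∀ j, MemLp (f j) 2 μ)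
    (h : ∀ ε > 0, ∃ N, ∀ i ≥ N, ∀ j ≥ N, ∫⁻ x, ‖f i x - f j x‖ₑ ^ 2 ∂μ ≤ ofReal ε) :
    ∃ g, MemLp g 2 μ ∧ Tendsto (fun j => ∫⁻ x, ‖f j x - g x‖ₑ ^ 2 ∂μ) atTop (𝓝 0) := by
  have hp : Fact ((1 : ℝ≥0∞) ≤ 2) := ⟨one_le_two⟩
  have hc : CauchySeq fun j => (hf j).toLp (f j) := by
    rw [Metric.cauchySeq_iff]
    intro ε hε
    obtain ⟨N, hN⟩ := h ((ε / 2) ^ 2) (by positivity)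
    refine ⟨N, fun i hi j hj => ?_⟩
    have h1 := hN i hi j hj
    have h2 : eLpNorm (f i - f j) 2 μ ≤ ofReal (ε / 2) := by
      rw [← ENNReal.pow_le_pow_left_iff two_ne_zero, eLpNorm_two_sq, ← ofReal_pow (by positivity)]
      exact h1
    rw [Lp.dist_edist, Lp.edist_toLp_toLp]
    refine (ENNReal.toReal_le_of_le_ofReal (by positivity) h2).trans_lt (by linarith)
  obtain ⟨G, hG⟩ := cauchySeq_tendsto_of_complete hc
  refine ⟨G, Lp.memLp G, ?_⟩
  rw [Lp.tendsto_Lp_iff_tendsto_eLpNorm'] at hG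
  have h1 := ENNReal.Tendsto.pow (n := 2) hG
  rw [zero_pow two_ne_zero] at h1
  refine h1.congr fun j => ?_
  rw [← eLpNorm_two_sq]
  congr 1
  refine eLpNorm_congr_ae ?_
  filter_upwards [(hf j).coeFn_toLp] with x hx
  simp [hx]

lemma exists_subseq_tendsto_ae_of_lintegral_sq {α E : Type*} [MeasurableSpace α]
    [NormedAddCommGroup E] {μ : Measure α} {f : ℕ → α → E} {g : α → E}
    (hf : ∀ j, AEStronglyMeasurable (f j) μ) (hg : AEStronglyMeasurable g μ)
    (h : Tendsto (fun j => ∫⁻ x, ‖f j x - g x‖ₑ ^ 2 ∂μ) atTop (𝓝 0)) :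
    ∃ n : ℕ → ℕ, StrictMono n ∧ ∀ᵐ x ∂μ, Tendsto (fun j => f (n j) x) atTop (𝓝 (g x)) := by
  have h1 : Tendsto (fun j => eLpNorm (f j - g) 2 μ) atTop (𝓝 0) := by
    have h2 := (ENNReal.continuous_rpow_const (y := (1 / 2 : ℝ))).tendsto 0 |>.comp h
    rw [ENNReal.zero_rpow_of_pos (by norm_num)] at h2
    refine h2.congr fun j => ?_
    have : ∫⁻ x, ‖f j x - g x‖ₑ ^ 2 ∂μ = eLpNorm (f j - g) 2 μ ^ 2 := (eLpNorm_two_sq _).symm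
    rw [Function.comp_apply, this, ← rpow_natCast, ← ENNReal.rpow_mul]
    norm_num
  exact (tendstoInMeasure_of_tendsto_eLpNorm two_ne_zero hf hg h1).exists_seq_tendsto_ae

/-! ### Rellich compactness, completeness of H¹ and the first eigenvalue. -/

namespace RiemannianOrbifold

variable {m : ℕ} {X : Type*} [TopologicalSpace X] [T2Space X] [MeasurableSpace X] [BorelSpace X]
  [CompactSpace X] [Nonempty X] {O : RiemannianOrbifold m X}

lemma lintegral_riemVolume_le {c : Chart m X} (hc : c ∈ O.atlas) {f : X → ℝ≥0∞}
    (hf : AEMeasurable f O.vol) :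
    ∫⁻ x, f (c.proj x) ∂c.riemVolume ≤ Nat.card c.group * ∫⁻ p, f p ∂O.vol := by
  have h1 := O.lintegral_vol_restrict hc hf
  have h2 : ∫⁻ x, f (c.proj x) ∂c.riemVolume =
      Nat.card c.group * ∫⁻ p in c.proj '' c.dom, f p ∂O.vol := by
    rw [h1, ← mul_assoc, ENNReal.mul_inv_cancel c.card_ne_zero c.card_ne_top, one_mul]
  rw [h2]
  gcongr
  exact Measure.restrict_le_self

/-- Lebesgue integrals over parts of a chart domain are bounded by integrals over the orbifold. -/
lemma lintegral_chart_le {c : Chart m X} (hc : c ∈ O.atlas) {f : X → ℝ≥0∞}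
    (hf : AEMeasurable f O.vol) {Q : Set ℝ^m} (hQ : MeasurableSet Q) (hQd : Q ⊆ c.dom)
    {δ : ℝ} (hδ : 0 < δ) (hδQ : ∀ z ∈ Q, δ ≤ √(c.metric z).det) :
    ∫⁻ x in Q, f (c.proj x) ≤ ofReal (δ⁻¹ * Nat.card c.group) * ∫⁻ p, f p ∂O.vol := by
  have h1 := c.setLIntegral_riemVolume hQ hQd fun x => f (c.proj x)
  have h2 : ofReal δ * ∫⁻ x in Q, f (c.proj x) ≤ ∫⁻ x in Q, f (c.proj x) ∂c.riemVolume := by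
    rw [h1, ← lintegral_const_mul' _ _ ofReal_ne_top]
    refine setLIntegral_mono' hQ fun z hz => ?_
    gcongr
    exact hδQ z hz
  have h3 := h2.trans ((setLIntegral_le_lintegral _ _).trans (lintegral_riemVolume_le hc hf))
  rw [ofReal_mul (by positivity), ENNReal.ofReal_inv_of_pos hδ, ENNReal.ofReal_natCast, mul_assoc]
  rw [← ENNReal.mul_le_iff_le_inv (by simpa using hδ) ofReal_ne_top] 
  exact h3

lemma lintegral_enorm_sq_eq {u : X → ℝ} (hu : MemLp u 2 O.vol) :
    ∫⁻ p, ‖u p‖ₑ ^ 2 ∂O.vol = ofReal (∫ p, u p * u p ∂O.vol) := by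
  rw [ofReal_integral_eq_lintegral_ofReal (f := fun p => u p * u p) (MemLp.integrable_mul hu hu)
    (Eventually.of_forall fun p => mul_self_nonneg _)]
  refine lintegral_congr fun p => ?_
  rw [← enorm_pow, Real.enorm_of_nonneg (sq_nonneg _), sq]

lemma lintegral_comp_sq_le {c : Chart m X} (hc : c ∈ O.atlas) (u : O.H1)
    {Q : Set ℝ^m} (hQ : MeasurableSet Q) (hQd : Q ⊆ c.dom)
    {δ : ℝ} (hδ : 0 < δ) (hδQ : ∀ z ∈ Q, δ ≤ √(c.metric z).det) :
    ∫⁻ x in Q, ‖u.1 (c.proj x)‖ₑ ^ 2 ≤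
      ofReal (δ⁻¹ * Nat.card c.group * O.l2Form u u) := by
  have hu : MemLp u.1 2 O.vol := u.2.1
  refine (lintegral_chart_le hc (f := fun p => ‖u.1 p‖ₑ ^ 2)
    (hu.1.enorm.pow_const 2) hQ hQd hδ hδQ).trans_eq ?_
  rw [lintegral_enorm_sq_eq hu, ← ofReal_mul (by positivity)]
  rfl

lemma lintegral_grad_sq_le {c : Chart m X} (hc : c ∈ O.atlas) (u : O.H1)
    {du : Chart m X → ℝ^m → (ℝ^m →L[ℝ] ℝ)}
    (hdu : O.HasChartGrad u.1 du)
    {Q : Set ℝ^m} (hQ : MeasurableSet Q) (hQd : Q ⊆ c.dom)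
    {δ M : ℝ} (hδ : 0 < δ) (hM : 0 < M) (hδQ : ∀ z ∈ Q, δ ≤ √(c.metric z).det)
    (hMQ : ∀ z ∈ Q, ∀ ξ : ℝ^m →L[ℝ] ℝ, ‖ξ‖ ^ 2 ≤ M * c.cometric z ξ ξ) :
    ∫⁻ x in Q, ‖du c x‖ₑ ^ 2 ≤
      ofReal (M * (δ⁻¹ * Nat.card c.group) * O.dirichletForm u u) := by
  have h0 := hdu.gradInner_ae hdu hc
  rw [ae_restrict_iff' c.measurableSet_dom] at h0
  have h1 : ∫⁻ x in Q, ‖du c x‖ₑ ^ 2 ≤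
      ∫⁻ x in Q, ofReal M * ofReal (O.gradInner u.1 u.1 (c.proj x)) := by
    refine lintegral_mono_ae ?_
    refine (ae_restrict_iff' hQ).2 ?_
    filter_upwards [h0] with x hx hxQ
    rw [hx (hQd hxQ), ← ofReal_mul hM.le, ← ofReal_norm, ← ofReal_pow (norm_nonneg _)]
    exact ofReal_le_ofReal (hMQ x hxQ _)
  rw [lintegral_const_mul' _ _ ofReal_ne_top] at h1
  have hmeas : Measurable (O.gradInner u.1 u.1) := (hdu.gradInner hdu).1
  have h2 := lintegral_chart_le hc (f := fun p => ofReal (O.gradInner u.1 u.1 p))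
    hmeas.ennreal_ofReal.aemeasurable hQ hQd hδ hδQ
  rw [← ofReal_integral_eq_lintegral_ofReal (u.2.integrable_gradInner u.2)
    (gradInner_self_nonneg hdu)] at h2
  refine h1.trans ((mul_le_mul_right h2 _).trans_eq ?_)
  rw [← ofReal_mul (by positivity), ← ofReal_mul hM.le, mul_assoc M]
  rfl

lemma memLp_comp_proj {c : Chart m X} (hc : c ∈ O.atlas) (u : O.H1)
    {Q : Set ℝ^m} (hQ : MeasurableSet Q) (hQd : Q ⊆ c.dom)
    {δ : ℝ} (hδ : 0 < δ) (hδQ : ∀ z ∈ Q, δ ≤ √(c.metric z).det) :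
    MemLp (fun x => u.1 (c.proj x)) 2 (volume.restrict Q) := by
  have hdu : O.HasChartGrad u.1 (O.grad u.1) := u.2.hasChartGrad
  have h1 : AEStronglyMeasurable (fun x => u.1 (c.proj x)) (volume.restrict c.dom) := by
    rw [← c.restrict_interior]
    exact (hdu c hc).1.aestronglyMeasurable
  refine ⟨h1.mono_set hQd, ?_⟩
  rw [eLpNorm_lt_top_iff_lintegral_rpow_enorm_lt_top two_ne_zero ENNReal.ofNat_ne_top]
  simp only [ENNReal.toReal_ofNat, ENNReal.rpow_two]
  exact (lintegral_comp_sq_le hc u hQ hQd hδ hδQ).trans_lt ofReal_lt_top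

/-- The form `b` is compact relatively to the Dirichlet form over the open set `U`. -/
def IsRellichSet (O : RiemannianOrbifold m X) (U : Set X) : Prop :=
  ∀ ε > 0, ∃ l : List (O.H1 →ₗ[ℝ] ℝ), (∀ φ ∈ l, ∃ C, ∀ u, φ u ^ 2 ≤ C * O.l2Form u u) ∧
    ∀ u : O.H1, ∫ p in U, u.1 p * u.1 p ∂O.vol ≤
      ε * O.dirichletForm u u + (l.map fun φ => φ u ^ 2).sum

lemma IsRellichSet.mono {U V : Set X} (h : O.IsRellichSet V) (hUV : U ⊆ V) : O.IsRellichSet U := by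
  intro ε hε
  obtain ⟨l, hl, hl'⟩ := h ε hε
  refine ⟨l, hl, fun u => le_trans ?_ (hl' u)⟩
  exact setIntegral_mono_set (integrable_mul_of_memH1 u.2 u.2).integrableOn
    (Eventually.of_forall fun p => mul_self_nonneg _) hUV.eventuallyLE

lemma IsRellichSet.union {U V : Set X} (hU : O.IsRellichSet U) (hV : O.IsRellichSet V) :
    O.IsRellichSet (U ∪ V) := by
  intro ε hε
  obtain ⟨l, hl, hl'⟩ := hU (ε / 2) (half_pos hε)
  obtain ⟨k, hk, hk'⟩ := hV (ε / 2) (half_pos hε)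
  refine ⟨l ++ k, fun φ hφ => (List.mem_append.1 hφ).elim (hl φ) (hk φ), fun u => ?_⟩
  rw [List.map_append, List.sum_append]
  have h1 := hl' u
  have h2 := hk' u
  have hint := integrable_mul_of_memH1 u.2 u.2
  have h3 : ∫ p in U ∪ V, u.1 p * u.1 p ∂O.vol ≤
      ∫ p in U, u.1 p * u.1 p ∂O.vol + ∫ p in V, u.1 p * u.1 p ∂O.vol := by
    rw [← integral_add_measure hint.restrict hint.restrict]
    exact integral_mono_measure (Measure.restrict_union_le U V)
      (Eventually.of_forall fun p => mul_self_nonneg _)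
      (hint.restrict.add_measure hint.restrict)
  linarith

/-- Integration over a part of a chart domain, as a linear functional. -/
noncomputable def cellIntegral (c : Chart m X) (C : Set ℝ^m)
    (h : ∀ u : O.H1, IntegrableOn (fun x => u.1 (c.proj x)) C) : O.H1 →ₗ[ℝ] ℝ where
  toFun u := ∫ x in C, u.1 (c.proj x)
  map_add' u v := integral_add (h u) (h v)
  map_smul' a u := by
    rw [RingHom.id_apply, smul_eq_mul, ← integral_const_mul]
    rfl

lemma sq_setIntegral_le {C : Set ℝ^m} {f : ℝ^m → ℝ} {B : ℝ} (hB : 0 ≤ B)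
    (hC : volume C ≠ ⊤) (hf : AEStronglyMeasurable f (volume.restrict C))
    (h : ∫⁻ x in C, ‖f x‖ₑ ^ 2 ≤ ofReal B) :
    (∫ x in C, f x) ^ 2 ≤ volume.real C * B := by
  have h1 : ‖∫ x in C, f x‖ₑ ^ 2 ≤ ofReal B * volume C := by
    refine (pow_le_pow_left' (enorm_integral_le_lintegral_enorm _) 2).trans ?_
    refine (sq_lintegral_le hf.enorm).trans ?_
    rw [Measure.restrict_apply_univ]
    gcongr
  rw [← enorm_pow, Real.enorm_of_nonneg (sq_nonneg _), ← ENNReal.ofReal_toReal hC,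
    ← ofReal_mul hB, ENNReal.ofReal_le_ofReal_iff (by positivity)] at h1
  rw [Measure.real]
  linarith

lemma lintegral_image_le {c : Chart m X} (hc : c ∈ O.atlas)
    {B : Set ℝ^m} (hB : MeasurableSet B) (hBd : B ⊆ c.dom)
    (hBm : MeasurableSet (c.proj '' B)) {f : X → ℝ≥0∞} (hf : AEMeasurable f O.vol) :
    ∫⁻ p in c.proj '' B, f p ∂O.vol ≤ ∫⁻ x in B, f (c.proj x) ∂c.riemVolume := by
  have hpm : AEMeasurable c.proj (c.riemVolume.restrict B) :=
    c.aemeasurable_proj.mono_measure Measure.restrict_le_self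
  obtain ⟨g, hg, hfg⟩ := hf
  have h1 : ∀ᵐ x ∂(c.riemVolume), f (c.proj x) = g (c.proj x) := by
    rw [c.ae_riemVolume]
    exact O.ae_vol_iff.1 hfg c hc
  rw [lintegral_congr_ae (ae_restrict_of_ae hfg), lintegral_congr_ae (ae_restrict_of_ae h1),
    ← lintegral_map' hg.aemeasurable hpm]
  exact lintegral_mono' (O.vol_restrict_image_le hc hB hBd hBm) le_rfl

/-- A convex neighbourhood in a chart is cut into cells of side `1 / N`. The Poincaré inequality on
each cell bounds the `L²` norm by the mean values, which are finitely many linear functionals, and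
by the energy with a factor of order `N⁻²`. -/
lemma exists_isRellichSet_nhds (p : X) : ∃ U ∈ 𝓝 p, O.IsRellichSet U := by
  obtain ⟨c, hc, x₀, hx₀, rfl⟩ := O.cover p
  obtain ⟨r, hr, δ, hδ, M, hM, -, hconv, hb⟩ := c.exists_ball_bounds hx₀ univ_mem
  set Q := c.dom ∩ ball x₀ r with hQ
  have hQm : MeasurableSet Q := c.measurableSet_dom.inter measurableSet_ball
  have hQd : Q ⊆ c.dom := inter_subset_left
  have hQb : Bornology.IsBounded Q := isBounded_ball.subset inter_subset_right
  refine ⟨c.proj '' Q, (c.isOpen_image_inter isOpen_ball).mem_nhds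
    ⟨x₀, ⟨hx₀, mem_ball_self hr⟩, rfl⟩, fun ε hε => ?_⟩
  -- One factor `M` bounds the density from above when passing from the orbifold to the chart. The
  -- other, with `δ⁻¹` and the order of the group, bounds the Euclidean energy by the Dirichlet
  -- form.
  set A : ℝ := M * (M * (δ⁻¹ * Nat.card c.group)) with hA
  have hA0 : 0 ≤ A := by positivity
  obtain ⟨N, hN0, hN⟩ : ∃ N : ℕ, 0 < N ∧ 2 ^ m * (1 / (N : ℝ)) ^ 2 * A ≤ ε := by
    obtain ⟨N, hN⟩ := exists_nat_gt (2 ^ m * A / ε)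
    refine ⟨N + 1, N.succ_pos, ?_⟩
    rw [div_lt_iff₀ hε] at hN
    rw [one_div, inv_pow, mul_right_comm, ← div_eq_mul_inv, div_le_iff₀ (by positivity)]
    push_cast
    have : (0 : ℝ) ≤ N := Nat.cast_nonneg N
    have h1 : (N : ℝ) ≤ (N + 1) ^ 2 := by nlinarith
    have h2 := mul_le_mul_of_nonneg_left h1 hε.le
    linarith
  have hNp : (0 : ℝ) < N := by exact_mod_cast hN0
  -- Intersections of `Q` with half-open cubes of side `1 / N`. They are convex, pairwise disjoint
  -- and of diameter at most `1 / N` in the sup norm.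
  set cell : (Fin m → ℤ) → Set ℝ^m := fun k => Q ∩ {z | ∀ i, ⌊(N : ℝ) * z i⌋ = k i}
    with hcell
  have hcQ : ∀ k, cell k ⊆ Q := fun k => inter_subset_left
  have hcm : ∀ k, MeasurableSet (cell k) := by
    intro k
    refine hQm.inter ?_
    rw [ofPred_forall]
    refine MeasurableSet.iInter fun i => ?_
    have : Measurable fun z : ℝ^m => ⌊(N : ℝ) * z i⌋ :=
      Int.measurable_floor.comp ((measurable_pi_apply i).const_mul _)
    exact this (measurableSet_singleton (k i))
  have hcc : ∀ k, Convex ℝ (cell k) := by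
    intro k
    refine hconv.inter ?_
    have : {z : ℝ^m | ∀ i, ⌊(N : ℝ) * z i⌋ = k i} =
        ⋂ i, (fun z : ℝ^m => (N : ℝ) * z i) ⁻¹' Ico (k i : ℝ) (k i + 1) := by
      ext z
      simp [Int.floor_eq_iff]
    rw [this]
    refine convex_iInter fun i => ?_
    exact (convex_Ico _ _).is_linear_preimage
      (((N : ℝ) • LinearMap.proj (R := ℝ) (φ := fun _ : Fin m => ℝ) i).isLinear)
  have hcl : ∀ k, ∀ x ∈ cell k, ∀ y ∈ cell k, ‖y - x‖ ≤ 1 / (N : ℝ) := by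
    rintro k x ⟨-, hx⟩ y ⟨-, hy⟩
    refine (pi_norm_le_iff_of_nonneg (by positivity)).2 fun i => ?_
    have h1 := Int.abs_sub_lt_one_of_floor_eq_floor ((hy i).trans (hx i).symm)
    rw [← mul_sub, abs_mul, abs_of_pos hNp] at h1
    rw [Pi.sub_apply, Real.norm_eq_abs, le_div_iff₀ hNp]
    linarith
  have hcdisj : Pairwise (Function.onFun Disjoint cell) := by
    intro k l hkl
    refine disjoint_left.2 fun z hz hz' => hkl (funext fun i => ?_)
    rw [← hz.2 i, hz'.2 i]
  set J : Finset (Fin m → ℤ) := Fintype.piFinset fun i =>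
    Finset.Icc ⌊(N : ℝ) * (x₀ i - r)⌋ ⌊(N : ℝ) * (x₀ i + r)⌋ with hJ
  have hJU : ⋃ k ∈ J, cell k = Q := by
    refine subset_antisymm (iUnion₂_subset fun k _ => hcQ k) fun z hz => ?_
    refine mem_iUnion₂.2 ⟨fun i => ⌊(N : ℝ) * z i⌋, ?_, hz, fun i => rfl⟩
    refine Fintype.mem_piFinset.2 fun i => Finset.mem_Icc.2 ?_
    have h1 := (dist_le_pi_dist z x₀ i).trans_lt (mem_ball.1 hz.2)
    rw [Real.dist_eq, abs_lt] at h1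
    exact ⟨Int.floor_le_floor (by gcongr; linarith), Int.floor_le_floor (by gcongr; linarith)⟩
  have hml : ∀ u : O.H1, MemLp (fun x => u.1 (c.proj x)) 2 (volume.restrict Q) := fun u =>
    memLp_comp_proj hc u hQm hQd hδ fun z hz => (hb z hz).1
  have hfinQ : volume Q ≠ ⊤ := hQb.measure_lt_top.ne
  have hfin : ∀ k, volume (cell k) ≠ ⊤ := fun k => ((hQb.subset (hcQ k)).measure_lt_top).ne
  have hfm : IsFiniteMeasure (volume.restrict Q) := ⟨by
    rw [Measure.restrict_apply_univ]; exact hfinQ.lt_top⟩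
  have hint : ∀ k, ∀ u : O.H1, IntegrableOn (fun x => u.1 (c.proj x)) (cell k) := fun k u =>
    ((hml u).integrable one_le_two).mono_measure (Measure.restrict_mono (hcQ k) le_rfl)
  -- The weight is chosen so that the squares of the functionals are `M` times the mean value terms
  -- of the Poincaré inequality. A cell of measure zero gets weight zero, as the inverse of zero is
  -- zero.
  set L : (Fin m → ℤ) → (O.H1 →ₗ[ℝ] ℝ) := fun k =>
    √(M * (volume.real (cell k))⁻¹) • cellIntegral c (cell k) (hint k) with hL
  have hLsq : ∀ k u, L k u ^ 2 =
      M * (volume.real (cell k))⁻¹ * (∫ x in cell k, u.1 (c.proj x)) ^ 2 := by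
    intro k u
    simp only [hL, LinearMap.smul_apply, smul_eq_mul, mul_pow]
    rw [Real.sq_sqrt (by positivity)]
    rfl
  refine ⟨J.toList.map L, ?_, fun u => ?_⟩
  · intro φ hφ
    obtain ⟨k, -, rfl⟩ := List.mem_map.1 hφ
    refine ⟨M * (volume.real (cell k))⁻¹ * (volume.real (cell k) * (δ⁻¹ * Nat.card c.group)),
      fun u => ?_⟩
    have h0 : 0 ≤ O.l2Form u u := l2Form_self_nonneg u
    have h1 := sq_setIntegral_le (B := δ⁻¹ * Nat.card c.group * O.l2Form u u)
      (by positivity) (hfin k) ((hml u).1.mono_set (hcQ k))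
      (lintegral_comp_sq_le hc u (hcm k) ((hcQ k).trans hQd) hδ fun z hz => (hb z (hcQ k hz)).1)
    rw [hLsq, mul_assoc (M * _), mul_assoc (volume.real _)]
    gcongr
  · have hdu : O.HasChartGrad u.1 (O.grad u.1) := u.2.hasChartGrad
    set w := O.grad u.1 c with hw
    have hwQ : ∫⁻ x in Q, ‖w x‖ₑ ^ 2 ≤
        ofReal (M * (δ⁻¹ * Nat.card c.group) * O.dirichletForm u u) :=
      lintegral_grad_sq_le hc u hdu hQm hQd hδ hM (fun z hz => (hb z hz).1)
        fun z hz => (hb z hz).2.2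
    have hwt : ∫⁻ x in Q, ‖w x‖ₑ ^ 2 ≠ ⊤ := (hwQ.trans_lt ofReal_lt_top).ne
    have hwc : ∀ k, ∫⁻ x in cell k, ‖w x‖ₑ ^ 2 ≠ ⊤ := fun k =>
      ((lintegral_mono_set (hcQ k)).trans_lt hwt.lt_top).ne
    have hsq : IntegrableOn (fun x => u.1 (c.proj x) ^ 2) Q := (hml u).integrable_sq
    have h1 : ∫ x in Q, u.1 (c.proj x) ^ 2 = ∑ k ∈ J, ∫ x in cell k, u.1 (c.proj x) ^ 2 := by
      conv_lhs => rw [← hJU]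
      exact integral_biUnion_finset J (fun k _ => hcm k) (hcdisj.set_pairwise _)
        fun k _ => hsq.mono_set (hcQ k)
    have h2 : ∑ k ∈ J, (∫⁻ x in cell k, ‖w x‖ₑ ^ 2).toReal = (∫⁻ x in Q, ‖w x‖ₑ ^ 2).toReal := by
      rw [← ENNReal.toReal_sum fun k _ => hwc k]
      conv_rhs => rw [← hJU]
      rw [lintegral_biUnion_finset (hcdisj.set_pairwise _) fun k _ => hcm k]
    have h3 : ∀ k ∈ J, ∫ x in cell k, u.1 (c.proj x) ^ 2 ≤
        (volume.real (cell k))⁻¹ * (∫ x in cell k, u.1 (c.proj x)) ^ 2 +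
          2 ^ m * (1 / (N : ℝ)) ^ 2 * (∫⁻ x in cell k, ‖w x‖ₑ ^ 2).toReal := fun k _ =>
      HasWeakFDerivOn.integral_sq_le (hdu c hc) (hcc k)
        (interior_mono ((hcQ k).trans hQd)) (hQb.subset (hcQ k)) (by positivity) (hcl k)
        ((hml u).mono_measure (Measure.restrict_mono (hcQ k) le_rfl)) (hwc k)
    have h4 := Finset.sum_le_sum h3
    rw [← h1, Finset.sum_add_distrib, ← mul_sum, h2] at h4
    have hD : 0 ≤ O.dirichletForm u u := dirichletForm_self_nonneg u
    have h5 : (∫⁻ x in Q, ‖w x‖ₑ ^ 2).toReal ≤ M * (δ⁻¹ * Nat.card c.group) * O.dirichletForm u u :=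
      ENNReal.toReal_le_of_le_ofReal (by positivity) hwQ
    have h6 : ∫ p in c.proj '' Q, u.1 p * u.1 p ∂O.vol ≤ M * ∫ x in Q, u.1 (c.proj x) ^ 2 := by
      have e1 : ∫⁻ p in c.proj '' Q, ‖u.1 p‖ₑ ^ 2 ∂O.vol ≤
          ofReal M * ∫⁻ x in Q, ‖u.1 (c.proj x)‖ₑ ^ 2 := by
        refine (lintegral_image_le hc hQm hQd (c.isOpen_image_inter isOpen_ball).measurableSet
          (f := fun p => ‖u.1 p‖ₑ ^ 2) (u.2.1.1.enorm.pow_const 2)).trans ?_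
        rw [c.setLIntegral_riemVolume hQm hQd, ← lintegral_const_mul' _ _ ofReal_ne_top]
        refine setLIntegral_mono' hQm fun z hz => ?_
        gcongr
        exact (hb z hz).2.1
      have e2 : ∀ (α : Type _) [MeasurableSpace α] (μ : Measure α) (f : α → ℝ),
          Integrable (fun x => f x ^ 2) μ →
          ∫⁻ x, ‖f x‖ₑ ^ 2 ∂μ = ofReal (∫ x, f x ^ 2 ∂μ) := by
        intro α _ μ f hf
        rw [ofReal_integral_eq_lintegral_ofReal hf (Eventually.of_forall fun p => sq_nonneg _)]
        refine lintegral_congr fun p => ?_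
        rw [← enorm_pow, Real.enorm_of_nonneg (sq_nonneg _)]
      have hint2 : Integrable (fun p => u.1 p ^ 2) O.vol := MemLp.integrable_sq u.2.1
      rw [e2 X _ _ hint2.restrict] at e1
      have e3 : ∫⁻ x in Q, ‖u.1 (c.proj x)‖ₑ ^ 2 = ofReal (∫ x in Q, u.1 (c.proj x) ^ 2) := by
        rw [ofReal_integral_eq_lintegral_ofReal hsq (Eventually.of_forall fun p => sq_nonneg _)]
        refine lintegral_congr fun p => ?_
        rw [← enorm_pow, Real.enorm_of_nonneg (sq_nonneg _)]
      have e4 : 0 ≤ ∫ x in Q, u.1 (c.proj x) ^ 2 := integral_nonneg fun _ => sq_nonneg _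
      rw [e3, ← ofReal_mul hM.le, ENNReal.ofReal_le_ofReal_iff (by positivity)] at e1
      simpa only [← sq] using e1
    have h7 : (List.map (fun φ : O.H1 →ₗ[ℝ] ℝ => φ u ^ 2) (J.toList.map L)).sum =
        M * ∑ k ∈ J, (volume.real (cell k))⁻¹ * (∫ x in cell k, u.1 (c.proj x)) ^ 2 := by
      rw [List.map_map, Finset.sum_map_toList, mul_sum]
      refine sum_congr rfl fun k _ => ?_
      rw [Function.comp_apply, hLsq, mul_assoc]
    rw [h7]
    calc _ ≤ M * ∫ x in Q, u.1 (c.proj x) ^ 2 := h6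
      _ ≤ M * (∑ k ∈ J, (volume.real (cell k))⁻¹ * (∫ x in cell k, u.1 (c.proj x)) ^ 2 +
          2 ^ m * (1 / (N : ℝ)) ^ 2 * (M * (δ⁻¹ * Nat.card c.group) * O.dirichletForm u u)) := by
          gcongr
          refine h4.trans ?_
          gcongr
      _ = 2 ^ m * (1 / (N : ℝ)) ^ 2 * A * O.dirichletForm u u +
          M * ∑ k ∈ J, (volume.real (cell k))⁻¹ * (∫ x in cell k, u.1 (c.proj x)) ^ 2 := by
          rw [hA]; ring
      _ ≤ _ := by gcongr

lemma isRellichSet_univ : O.IsRellichSet univ := by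
  refine isCompact_univ.induction_on (p := O.IsRellichSet) ?_ (fun s t hst ht => ht.mono hst)
    (fun s t hs ht => hs.union ht) fun p _ => ?_
  · intro ε hε
    refine ⟨[], by simp, fun u => ?_⟩
    have := dirichletForm_self_nonneg u
    simp only [Measure.restrict_empty, integral_zero_measure, List.map_nil, List.sum_nil, add_zero]
    positivity
  · obtain ⟨U, hU, h⟩ := O.exists_isRellichSet_nhds p
    exact ⟨U, mem_nhdsWithin_of_mem_nhds hU, h⟩

lemma exists_rellich_functionals : ∀ ε > 0, ∃ l : List (O.H1 →ₗ[ℝ] ℝ),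
    (∀ φ ∈ l, ∃ C, ∀ u, φ u ^ 2 ≤ C * O.l2Form u u) ∧
    ∀ u : O.H1, O.l2Form u u ≤ ε * O.dirichletForm u u + (l.map fun φ => φ u ^ 2).sum := by
  intro ε hε
  obtain ⟨l, h1, h2⟩ := O.isRellichSet_univ ε hε
  refine ⟨l, h1, fun u => ?_⟩
  have := h2 u
  rwa [Measure.restrict_univ] at this

/-- With zero energy the Poincaré inequality says that the values at almost every pair of points
agree. Fubini provides one point whose value is taken almost everywhere. -/
lemma exists_nhds_ae_const {u : O.H1} (hu : O.dirichletForm u u = 0) (p : X) :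
    ∃ U, IsOpen U ∧ p ∈ U ∧ ∃ k : ℝ, ∀ᵐ q ∂O.vol, q ∈ U → u.1 q = k := by
  obtain ⟨c, hc, x₀, hx₀, rfl⟩ := O.cover p
  obtain ⟨r, hr, δ, hδ, M, hM, -, hconv, hb⟩ := c.exists_ball_bounds hx₀ univ_mem
  set Q := c.dom ∩ ball x₀ r with hQ
  have hQm : MeasurableSet Q := c.measurableSet_dom.inter measurableSet_ball
  have hQd : Q ⊆ c.dom := inter_subset_left
  have hQb : Bornology.IsBounded Q := isBounded_ball.subset inter_subset_right
  refine ⟨c.proj '' Q, c.isOpen_image_inter isOpen_ball, ⟨x₀, ⟨hx₀, mem_ball_self hr⟩, rfl⟩, ?_⟩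
  have hdu : O.HasChartGrad u.1 (O.grad u.1) := u.2.hasChartGrad
  have h1 := lintegral_grad_sq_le hc u hdu hQm hQd hδ hM (fun z hz => (hb z hz).1)
        fun z hz => (hb z hz).2.2
  rw [hu, mul_zero, ENNReal.ofReal_zero, nonpos_iff_eq_zero] at h1
  have h2 := HasWeakFDerivOn.lintegral_prod_enorm_sub_sq_le (hdu c hc) hconv (interior_mono hQd) hQb
    (ℓ := ofReal (2 * r)) (by
      rintro x ⟨-, hx⟩ y ⟨-, hy⟩
      rw [← ofReal_norm, ← dist_eq_norm]
      have := dist_triangle_right y x x₀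
      rw [mem_ball] at hx hy
      exact ofReal_le_ofReal (by linarith))
  rw [h1, mul_zero, nonpos_iff_eq_zero, Measure.volume_eq_prod, ← Measure.prod_restrict] at h2
  have hm : AEStronglyMeasurable (u.1 ∘ c.proj) (volume.restrict Q) :=
    (memLp_comp_proj hc u hQm hQd hδ fun z hz => (hb z hz).1).1
  have hmm : AEMeasurable (fun p : ℝ^m × ℝ^m =>
      ‖(u.1 ∘ c.proj) p.2 - (u.1 ∘ c.proj) p.1‖ₑ ^ 2)
      ((volume.restrict Q).prod (volume.restrict Q)) :=
    ((hm.comp_snd).sub (hm.comp_fst)).enorm.pow_const 2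
  rw [lintegral_eq_zero_iff' hmm] at h2
  have h3 := Measure.ae_ae_of_ae_prod h2
  have hk : ∃ k : ℝ, ∀ᵐ x ∂(volume.restrict Q), u.1 (c.proj x) = k := by
    by_cases h0 : volume.restrict Q = 0
    · exact ⟨0, by rw [h0]; simp⟩
    · have : NeBot (ae (volume.restrict Q)) := ae_neBot.2 h0
      obtain ⟨x, hx⟩ := h3.exists
      refine ⟨u.1 (c.proj x), ?_⟩
      filter_upwards [hx] with y hy
      simpa [sub_eq_zero] using hy
  obtain ⟨k, hk⟩ := hk
  refine ⟨k, ?_⟩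
  rw [ae_restrict_iff' hQm] at hk
  have h4 := O.vol_image_null hc (B := {x ∈ Q | ¬ u.1 (c.proj x) = k}) (fun x hx => hQd hx.1)
    (measure_mono_null (fun x hx => by
      rw [mem_ofPred_eq, Classical.not_imp]; exact ⟨hx.1, hx.2⟩) (ae_iff.1 hk))
  rw [ae_iff]
  refine measure_mono_null ?_ h4
  intro q hq
  simp only [mem_ofPred_eq, Classical.not_imp] at hq
  obtain ⟨⟨x, hx, rfl⟩, hne⟩ := hq
  exact ⟨x, ⟨hx, hne⟩, rfl⟩

/-- Functions with vanishing Dirichlet energy are constant. -/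
lemma exists_ae_eq_const [ConnectedSpace X] {u : O.H1} (hu : O.dirichletForm u u = 0) :
    ∃ k : ℝ, ∀ᵐ q ∂O.vol, u.1 q = k := by
  choose U hUo hpU k hk using fun p => exists_nhds_ae_const hu p
  -- Two of these neighbourhoods that meet do so in a nonempty open set, which has positive volume,
  -- so the constants agree. Hence `k` is locally constant.
  have hloc : ∀ p, ∀ q ∈ U p, k q = k p := by
    intro p q hq
    have hpos : O.vol (U p ∩ U q) ≠ 0 :=
      ((hUo p).inter (hUo q)).measure_ne_zero O.vol ⟨q, hq, hpU q⟩
    by_contra hne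
    refine hpos (measure_mono_null ?_ (measure_union_null (hk p) (hk q)))
    rintro z ⟨h1, h2⟩
    by_contra h3
    simp only [mem_union, mem_compl_iff, mem_ofPred_eq, not_or, not_not] at h3
    exact hne ((h3.2 h2).symm.trans (h3.1 h1))
  have hlc : IsLocallyConstant k := (IsLocallyConstant.iff_eventually_eq k).2 fun p =>
    eventually_of_mem ((hUo p).mem_nhds (hpU p)) (hloc p)
  obtain ⟨p₀⟩ : Nonempty X := inferInstance
  refine ⟨k p₀, ?_⟩
  have : O.vol ({q | ¬ u.1 q = k p₀}) = 0 := by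
    refine isCompact_univ.induction_on (p := fun s => O.vol ({q | ¬ u.1 q = k p₀} ∩ s) = 0)
      (by simp)
      (fun s t hst ht => measure_mono_null (inter_subset_inter_right _ hst) ht)
      (fun s t hs ht => by rw [inter_union_distrib_left]; exact measure_union_null hs ht)
      (fun p _ => ⟨U p, mem_nhdsWithin_of_mem_nhds ((hUo p).mem_nhds (hpU p)), ?_⟩) |> fun h => by
        simpa using h
    refine measure_mono_null ?_ (hk p)
    rintro q ⟨h1, h2⟩ h3
    refine h1 ((h3 h2).trans ?_)
    exact hlc.apply_eq_of_preconnectedSpace _ _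
  exact this

lemma HasChartGrad.sub {u v : X → ℝ} {du dv : Chart m X → ℝ^m → (ℝ^m →L[ℝ] ℝ)}
    (hu : O.HasChartGrad u du) (hv : O.HasChartGrad v dv) : O.HasChartGrad (u - v) (du - dv) := by
  have e1 : u - v = u + (-1 : ℝ) • v := by ext p; simp [sub_eq_add_neg]
  have e2 : du - dv = du + (-1 : ℝ) • dv := by ext c x w; simp [sub_eq_add_neg]
  rw [e1, e2]
  exact hu.add (hv.const_smul (-1))

lemma lintegral_cometric_le {c : Chart m X} (hc : c ∈ O.atlas) (u : O.H1)
    {du : Chart m X → ℝ^m → (ℝ^m →L[ℝ] ℝ)}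
    (hdu : O.HasChartGrad u.1 du) :
    ∫⁻ x, ofReal (c.cometric x (du c x) (du c x)) ∂c.riemVolume ≤
      ofReal (Nat.card c.group * O.dirichletForm u u) := by
  have h0 := hdu.gradInner_ae hdu hc
  rw [← c.ae_riemVolume] at h0
  have h1 : ∫⁻ x, ofReal (c.cometric x (du c x) (du c x)) ∂c.riemVolume =
      ∫⁻ x, ofReal (O.gradInner u.1 u.1 (c.proj x)) ∂c.riemVolume :=
    lintegral_congr_ae (by filter_upwards [h0] with x hx; rw [hx])
  have hmeas : Measurable (O.gradInner u.1 u.1) := (hdu.gradInner hdu).1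
  rw [h1, ofReal_mul (Nat.cast_nonneg _), ENNReal.ofReal_natCast]
  refine (lintegral_riemVolume_le hc (f := fun p => ofReal (O.gradInner u.1 u.1 p))
    hmeas.ennreal_ofReal.aemeasurable).trans_eq ?_
  rw [← ofReal_integral_eq_lintegral_ofReal (u.2.integrable_gradInner u.2)
    (gradInner_self_nonneg hdu)]
  rfl

lemma aestronglyMeasurable_comp_proj {c : Chart m X} (hc : c ∈ O.atlas)
    {f : X → ℝ} (hf : AEStronglyMeasurable f O.vol) :
    AEStronglyMeasurable (f ∘ c.proj) (volume.restrict c.dom) := by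
  obtain ⟨g, hg, hfg⟩ := hf
  have h1 : AEMeasurable c.proj (volume.restrict c.dom) :=
    c.continuousOn_proj.aemeasurable c.measurableSet_dom
  refine AEStronglyMeasurable.congr (f := g ∘ c.proj)
    (hg.measurable.comp_aemeasurable h1).aestronglyMeasurable ?_
  filter_upwards [O.ae_vol_iff.1 hfg c hc] with x hx using hx.symm

lemma lintegral_compact_le {ν : Measure ℝ^m} {K : Set ℝ^m} {E : Type*}
    [NormedAddCommGroup E] {C : ℝ≥0∞} (g : ℝ^m → E)
    (hg : AEStronglyMeasurable g (volume.restrict K))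
    (h : ∫⁻ x in K, ‖g x‖ₑ ^ 2 ≤ C * ∫⁻ x, ‖g x‖ₑ ^ 2 ∂ν) :
    ∫⁻ x in K, ‖g x‖ₑ ≤ (C * volume K * ∫⁻ x, ‖g x‖ₑ ^ 2 ∂ν) ^ (1 / 2 : ℝ) := by
  have h1 := sq_lintegral_le hg.enorm
  rw [Measure.restrict_apply_univ] at h1
  have h2 : (∫⁻ x in K, ‖g x‖ₑ) ^ 2 ≤ C * volume K * ∫⁻ x, ‖g x‖ₑ ^ 2 ∂ν := by
    refine h1.trans ((mul_le_mul_left h _).trans_eq (by ring))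
  refine le_trans (le_of_eq ?_) (ENNReal.rpow_le_rpow h2 (by norm_num : (0 : ℝ) ≤ 1 / 2))
  rw [← rpow_natCast, ← ENNReal.rpow_mul]
  norm_num

lemma tendsto_rpow_half_zero {G : ℕ → ℝ≥0∞} {C : ℝ≥0∞} (hC : C ≠ ⊤) (hG : Tendsto G atTop (𝓝 0)) :
    Tendsto (fun j => (C * G j) ^ (1 / 2 : ℝ)) atTop (𝓝 0) := by
  have h1 := ENNReal.Tendsto.const_mul (a := C) hG (Or.inr hC)
  rw [mul_zero] at h1
  have h2 := (ENNReal.continuous_rpow_const (y := (1 / 2 : ℝ))).tendsto 0 |>.comp h1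
  rwa [ENNReal.zero_rpow_of_pos (by norm_num)] at h2

/-- Limits of weak differentials in a chart. -/
lemma exists_limit_weakFDeriv {c : Chart m X} (hc : c ∈ O.atlas) (u : ℕ → O.H1)
    {du : ℕ → Chart m X → ℝ^m → (ℝ^m →L[ℝ] ℝ)}
    (hdu : ∀ j, O.HasChartGrad (u j).1 (du j)) {f : X → ℝ} (hf : MemLp f 2 O.vol)
    (hlim : Tendsto (fun j => ∫⁻ p, ‖(u j).1 p - f p‖ₑ ^ 2 ∂O.vol) atTop (𝓝 0))
    (h : ∀ ε > 0, ∃ N, ∀ i ≥ N, ∀ j ≥ N, O.dirichletForm (u i - u j) (u i - u j) < ε) :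
    ∃ w, HasWeakFDerivOn (f ∘ c.proj) w (interior c.dom) ∧ ∀ ε > 0, ∃ N, ∀ j ≥ N,
      ∫⁻ x, ofReal (c.cometric x (du j c x - w x) (du j c x - w x)) ∂c.riemVolume ≤
        ofReal ε := by
  have hG : (0 : ℝ) < Nat.card c.group := by
    have := c.card_ne_zero
    have h2 : Nat.card c.group ≠ 0 := by exact_mod_cast this
    positivity
  have hcau : ∀ ε > 0, ∃ N, ∀ i ≥ N, ∀ j ≥ N, ∫⁻ x, ofReal
      (c.cometric x (du i c x - du j c x) (du i c x - du j c x)) ∂c.riemVolume ≤ ofReal ε := by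
    intro ε hε
    obtain ⟨N, hN⟩ := h (ε / Nat.card c.group) (by positivity)
    refine ⟨N, fun i hi j hj => ?_⟩
    refine (lintegral_cometric_le hc (u i - u j) ((hdu i).sub (hdu j))).trans (ofReal_le_ofReal ?_)
    have := (hN i hi j hj).le
    rw [le_div_iff₀ hG] at this
    linarith
  -- This weight satisfies `θ ‖ξ‖² ≤ √det |ξ|_g²`, so differentials that are Cauchy in energy are
  -- Cauchy in the complete space `L²(θ dx)`. It is continuous and positive, hence bounded below on
  -- compact sets.
  set θ : ℝ^m → ℝ := fun x => √(c.metric x).det / (m * (c.metric x).trace + 1) with hθ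
  have hden : ∀ x ∈ c.dom, 0 < m * (c.metric x).trace + 1 := fun x hx => by
    have := c.trace_metric_nonneg hx
    positivity
  have hθpos : ∀ x ∈ c.dom, 0 < θ x := fun x hx => div_pos (c.sqrt_det_pos hx) (hden x hx)
  have hθc : ContinuousOn θ c.dom := c.continuousOn_sqrt_det.div
    ((continuousOn_const.mul c.continuousOn_trace).add continuousOn_const)
    fun x hx => (hden x hx).ne'
  set ν : Measure ℝ^m := (volume.restrict c.dom).withDensity fun x =>
    ofReal (θ x) with hν
  have hθm : AEMeasurable (fun x => ofReal (θ x)) (volume.restrict c.dom) :=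
    (hθc.aemeasurable c.measurableSet_dom).ennreal_ofReal
  have hνac : volume.restrict c.dom ≪ ν := by
    refine withDensity_absolutelyContinuous' hθm ?_
    filter_upwards [ae_restrict_mem c.measurableSet_dom] with x hx
    simpa using hθpos x hx
  have hνac' : ν ≪ volume.restrict c.dom := withDensity_absolutelyContinuous _ _
  have hνint : ∀ G : ℝ^m → ℝ≥0∞, ∫⁻ x, G x ∂ν = ∫⁻ x in c.dom, ofReal (θ x) * G x := fun G => by
    rw [hν, lintegral_withDensity_eq_lintegral_mul_non_measurable₀ _ hθm
      (Eventually.of_forall fun _ => ofReal_lt_top)]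
    rfl
  have hle : ∀ W : ℝ^m → (ℝ^m →L[ℝ] ℝ), ∫⁻ x, ‖W x‖ₑ ^ 2 ∂ν ≤
      ∫⁻ x, ofReal (c.cometric x (W x) (W x)) ∂c.riemVolume := by
    intro W
    have e := c.setLIntegral_riemVolume c.measurableSet_dom le_rfl
      fun x => ofReal (c.cometric x (W x) (W x))
    rw [hνint]
    refine le_trans ?_ (e.symm.le.trans (setLIntegral_le_lintegral _ _))
    refine setLIntegral_mono' c.measurableSet_dom fun x hx => ?_
    rw [← ofReal_norm, ← ofReal_pow (norm_nonneg _),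
      ← ofReal_mul (hθpos x hx).le, ← ofReal_mul (c.sqrt_det_pos hx).le]
    refine ofReal_le_ofReal ?_
    rw [hθ, div_mul_eq_mul_div, div_le_iff₀ (hden x hx), mul_assoc]
    refine mul_le_mul_of_nonneg_left ?_ (c.sqrt_det_pos hx).le
    have h1 := c.sq_norm_le_cometric hx (W x)
    have h2 := c.cometric_self_nonneg hx (W x)
    linarith
  have hdm : ∀ j, AEStronglyMeasurable (du j c) (volume.restrict c.dom) := fun j =>
    c.aestronglyMeasurable_weakFDeriv (hdu j c hc)
  have hmem : ∀ j, MemLp (du j c) 2 ν := by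
    intro j
    refine ⟨(hdm j).mono_ac hνac', ?_⟩
    have h1 := (hle (du j c)).trans (lintegral_cometric_le hc (u j) (hdu j))
    rw [← eLpNorm_two_sq] at h1
    by_contra h2
    rw [not_lt, top_le_iff] at h2
    rw [h2, ENNReal.top_pow two_ne_zero, top_le_iff] at h1
    exact ofReal_ne_top h1
  obtain ⟨w, hw, hwlim⟩ := exists_tendsto_lintegral_enorm_sub_sq hmem (fun ε hε => by
    obtain ⟨N, hN⟩ := hcau ε hε
    exact ⟨N, fun i hi j hj => (hle fun x => du i c x - du j c x).trans (hN i hi j hj)⟩)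
  have hwm : AEStronglyMeasurable w (volume.restrict c.dom) := hw.1.mono_ac hνac
  have hfm := aestronglyMeasurable_comp_proj hc hf.1
  have hum : ∀ j, AEStronglyMeasurable ((u j).1 ∘ c.proj) (volume.restrict c.dom) := fun j =>
    aestronglyMeasurable_comp_proj hc (u j).2.1.1
  have hK1 : ∀ K ⊆ interior c.dom, IsCompact K → ∃ C : ℝ≥0∞, C ≠ ⊤ ∧
      ∀ G : ℝ^m → ℝ≥0∞, ∫⁻ x in K, G x ≤ C * ∫⁻ x, G x ∂ν := by
    intro K hK hKc
    have hKd := hK.trans interior_subset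
    rcases K.eq_empty_or_nonempty with rfl | hne
    · exact ⟨0, ENNReal.zero_ne_top, by simp⟩
    obtain ⟨x₀, hx₀, hmin⟩ := hKc.exists_isMinOn hne (hθc.mono hKd)
    have hp : 0 < ofReal (θ x₀) := by simpa using hθpos x₀ (hKd hx₀)
    refine ⟨(ofReal (θ x₀))⁻¹, ENNReal.inv_ne_top.2 hp.ne', fun G => ?_⟩
    rw [← ENNReal.mul_le_iff_le_inv hp.ne' ofReal_ne_top, hνint,
      ← lintegral_const_mul' _ _ ofReal_ne_top]
    refine le_trans ?_ (lintegral_mono_set hKd)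
    refine setLIntegral_mono' hKc.isClosed.measurableSet fun x hx => ?_
    gcongr
    exact hmin hx
  have hK2 : ∀ K ⊆ interior c.dom, IsCompact K → ∃ C : ℝ≥0∞, C ≠ ⊤ ∧
      ∀ g : X → ℝ, AEStronglyMeasurable g O.vol →
        ∫⁻ x in K, ‖g (c.proj x)‖ₑ ^ 2 ≤ C * ∫⁻ p, ‖g p‖ₑ ^ 2 ∂O.vol := by
    intro K hK hKc
    have hKd := hK.trans interior_subset
    rcases K.eq_empty_or_nonempty with rfl | hne
    · exact ⟨0, ENNReal.zero_ne_top, by simp⟩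
    obtain ⟨x₀, hx₀, hmin⟩ := hKc.exists_isMinOn hne (c.continuousOn_sqrt_det.mono hKd)
    exact ⟨_, ofReal_ne_top, fun g hg => lintegral_chart_le hc
      (f := fun p => ‖g p‖ₑ ^ 2) (hg.enorm.pow_const 2) hKc.isClosed.measurableSet hKd
      (c.sqrt_det_pos (hKd hx₀)) fun z hz => hmin hz⟩
  have hlc : IsLocallyClosed (interior c.dom) := isOpen_interior.isLocallyClosed
  have hwloc : LocallyIntegrableOn w (interior c.dom) := by
    refine (locallyIntegrableOn_iff hlc).2 fun K hK hKc => ?_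
    obtain ⟨C, hC, hCG⟩ := hK1 K hK hKc
    refine ⟨hwm.mono_set (hK.trans interior_subset), ?_⟩
    refine (lintegral_compact_le (ν := ν) w (hwm.mono_set (hK.trans interior_subset))
      (hCG _)).trans_lt ?_
    refine ENNReal.rpow_lt_top_of_nonneg (by norm_num) ?_
    refine ENNReal.mul_ne_top (ENNReal.mul_ne_top hC (hKc.measure_lt_top (μ := volume)).ne) ?_
    rw [← eLpNorm_two_sq]
    exact ENNReal.pow_ne_top hw.2.ne
  have hfloc : LocallyIntegrableOn (f ∘ c.proj) (interior c.dom) := by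
    refine (locallyIntegrableOn_iff hlc).2 fun K hK hKc => ?_
    obtain ⟨C, hC, hCG⟩ := hK2 K hK hKc
    have hfin : IsFiniteMeasure (volume.restrict K) := ⟨by
      rw [Measure.restrict_apply_univ]; exact (hKc.measure_lt_top (μ := volume))⟩
    have : MemLp (f ∘ c.proj) 2 (volume.restrict K) := by
      refine ⟨hfm.mono_set (hK.trans interior_subset), ?_⟩
      have h1 := hCG f hf.1
      have h2 : C * ∫⁻ p, ‖f p‖ₑ ^ 2 ∂O.vol < ⊤ := by
        rw [← eLpNorm_two_sq]
        exact ENNReal.mul_lt_top hC.lt_top (ENNReal.pow_lt_top hf.2)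
      have h3 := h1.trans_lt h2
      have h4 : eLpNorm (f ∘ c.proj) 2 (volume.restrict K) ^ 2 < ⊤ := by
        rw [eLpNorm_two_sq]; exact h3
      exact (ENNReal.pow_lt_top_iff.1 h4).resolve_right two_ne_zero
    exact this.integrable one_le_two
  refine ⟨w, ?_, ?_⟩
  · refine HasWeakFDerivOn.of_tendsto (f := fun j => (u j).1 ∘ c.proj) (w := fun j => du j c)
      (fun j => hdu j c hc) hfloc hwloc ?_ ?_
    · intro K hK hKc
      obtain ⟨C, hC, hCG⟩ := hK2 K hK hKc
      refine tendsto_of_tendsto_of_tendsto_of_le_of_le tendsto_const_nhds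
        (tendsto_rpow_half_zero (ENNReal.mul_ne_top hC (hKc.measure_lt_top (μ := volume)).ne) hlim)
        (fun _ => zero_le) fun j => ?_
      have h1 := sq_lintegral_le (((hum j).sub hfm).mono_set (hK.trans interior_subset)).enorm
      rw [Measure.restrict_apply_univ] at h1
      have h2 := hCG (fun p => (u j).1 p - f p) ((u j).2.1.1.sub hf.1)
      have h3 : (∫⁻ x in K, ‖((u j).1 ∘ c.proj) x - (f ∘ c.proj) x‖ₑ) ^ 2 ≤
          C * volume K * ∫⁻ p, ‖(u j).1 p - f p‖ₑ ^ 2 ∂O.vol :=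
        h1.trans ((mul_le_mul_left h2 _).trans_eq (by ring))
      refine le_trans (le_of_eq ?_) (ENNReal.rpow_le_rpow h3 (by norm_num : (0 : ℝ) ≤ 1 / 2))
      rw [← rpow_natCast, ← ENNReal.rpow_mul]
      norm_num
    · intro K hK hKc
      obtain ⟨C, hC, hCG⟩ := hK1 K hK hKc
      refine tendsto_of_tendsto_of_tendsto_of_le_of_le tendsto_const_nhds
        (tendsto_rpow_half_zero (ENNReal.mul_ne_top hC (hKc.measure_lt_top (μ := volume)).ne) hwlim)
        (fun _ => zero_le) fun j => ?_
      exact lintegral_compact_le (ν := ν) (fun x => du j c x - w x)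
        (((hdm j).sub hwm).mono_set (hK.trans interior_subset)) (hCG _)
  · intro ε hε
    obtain ⟨N, hN⟩ := hcau ε hε
    obtain ⟨n, hn, hae⟩ := exists_subseq_tendsto_ae_of_lintegral_sq (fun j => (hmem j).1) hw.1 hwlim
    have hae' : ∀ᵐ x ∂c.riemVolume, Tendsto (fun j => du (n j) c x) atTop (𝓝 (w x)) := by
      rw [c.ae_riemVolume]
      exact hνac hae
    refine ⟨N, fun j hj => ?_⟩
    have hcont : ∀ x, Continuous fun ξ : ℝ^m →L[ℝ] ℝ => c.cometric x ξ ξ := by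
      intro x
      unfold RiemannianOrbifoldChart.cometric
      fun_prop
    -- The limit `w` was found in a weaker norm. The energy estimate is recovered by Fatou's lemma
    -- along a subsequence converging almost everywhere.
    calc ∫⁻ x, ofReal (c.cometric x (du j c x - w x) (du j c x - w x)) ∂c.riemVolume
        ≤ ∫⁻ x, liminf (fun i => ofReal (c.cometric x (du j c x - du (n i) c x)
            (du j c x - du (n i) c x))) atTop ∂c.riemVolume := by
          refine lintegral_mono_ae ?_
          filter_upwards [hae'] with x hx
          have h1 := (hcont x).tendsto (du j c x - w x) |>.comp (hx.const_sub (du j c x))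
          have h2 := (ENNReal.continuous_ofReal.tendsto _).comp h1
          exact h2.liminf_eq.symm.le
      _ ≤ liminf (fun i => ∫⁻ x, ofReal (c.cometric x (du j c x - du (n i) c x)
            (du j c x - du (n i) c x)) ∂c.riemVolume) atTop := by
          refine lintegral_liminf_le' fun i => ?_
          have := c.aemeasurable_cometric ((hdm j).sub (hdm (n i))) ((hdm j).sub (hdm (n i)))
          exact (this.mono_ac (withDensity_absolutelyContinuous _ _)).ennreal_ofReal
      _ ≤ ofReal ε := by
          refine liminf_le_of_le (by isBoundedDefault) fun b hb => ?_
          obtain ⟨i, hi, hi'⟩ := (hb.and (eventually_ge_atTop N)).exists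
          exact hi.trans (hN j hj (n i) (hi'.trans (hn.id_le i)))

/-- The Sobolev space is complete. -/
theorem exists_limit_of_cauchy (u : ℕ → O.H1) (h : ∀ ε > 0, ∃ N, ∀ i ≥ N, ∀ j ≥ N,
      O.dirichletForm (u i - u j) (u i - u j) < ε ∧ O.l2Form (u i - u j) (u i - u j) < ε) :
    ∃ v, Tendsto (fun j => O.dirichletForm (u j - v) (u j - v)) atTop (𝓝 0) ∧
      Tendsto (fun j => O.l2Form (u j - v) (u j - v)) atTop (𝓝 0) := by
  have hdu : ∀ j, O.HasChartGrad (u j).1 (O.grad (u j).1) := fun j => (u j).2.hasChartGrad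
  obtain ⟨f, hf, hlim⟩ := exists_tendsto_lintegral_enorm_sub_sq (μ := O.vol)
    (f := fun j => (u j).1) (fun j => (u j).2.1) (fun ε hε => by
      obtain ⟨N, hN⟩ := h ε hε
      refine ⟨N, fun i hi j hj => ?_⟩
      have h1 := lintegral_enorm_sq_eq (O := O) (u := (u i - u j).1) (u i - u j).2.1
      exact h1.le.trans (ofReal_le_ofReal (hN i hi j hj).2.le))
  have hw : ∀ c ∈ O.atlas, ∃ w, HasWeakFDerivOn (f ∘ c.proj) w (interior c.dom) ∧
      ∀ ε > 0, ∃ N, ∀ j ≥ N, ∫⁻ x, ofReal (c.cometric x (O.grad (u j).1 c x - w x)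
        (O.grad (u j).1 c x - w x)) ∂c.riemVolume ≤ ofReal ε := fun c hc =>
    exists_limit_weakFDeriv hc u hdu hf hlim fun ε hε => by
      obtain ⟨N, hN⟩ := h ε hε
      exact ⟨N, fun i hi j hj => (hN i hi j hj).1⟩
  choose! w hw1 hw2 using hw
  have hfw : O.HasChartGrad f w := hw1
  obtain ⟨s, hs, hcov⟩ := O.exists_finset_cover
  -- The energy on the orbifold is at most the sum of the chart energies over a finite cover; the
  -- tolerance is shared among the charts, with `+ 1` to avoid an empty division.
  have hQ : ∀ ε > 0, ∃ N, ∀ j ≥ N, ∫⁻ p, ofReal (O.gradInner ((u j).1 - f) ((u j).1 - f) p) ∂O.vol ≤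
        ofReal ε := by
    intro ε hε
    have hcard : (0 : ℝ) < s.card + 1 := by positivity
    choose! N hN using fun c (hc : c ∈ O.atlas) => hw2 c hc (ε / (s.card + 1)) (by positivity)
    refine ⟨s.sup N, fun j hj => ?_⟩
    have hg := (hdu j).sub hfw
    have hmeas : Measurable (O.gradInner ((u j).1 - f) ((u j).1 - f)) := (hg.gradInner hg).1
    calc ∫⁻ p, ofReal (O.gradInner ((u j).1 - f) ((u j).1 - f) p) ∂O.vol
        ≤ ∑ c ∈ s, ∫⁻ p in c.proj '' c.dom,
            ofReal (O.gradInner ((u j).1 - f) ((u j).1 - f) p) ∂O.vol := by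
          rw [← lintegral_finsetSum_measure]
          refine lintegral_mono' ?_ le_rfl
          have e1 : O.vol = O.vol.restrict (⋃ c ∈ s, c.proj '' c.dom) := by
            have : ⋃ c ∈ s, c.proj '' c.dom = univ := eq_univ_of_forall fun p => by
              obtain ⟨c, hc, hp⟩ := hcov p
              exact mem_iUnion₂.2 ⟨c, hc, hp⟩
            rw [this, Measure.restrict_univ]
          conv_lhs => rw [e1]
          rw [Measure.le_iff]
          intro A hA
          rw [Measure.restrict_apply hA, inter_iUnion₂, Measure.finsetSum_apply]
          refine (measure_biUnion_finset_le _ _).trans_eq ?_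
          exact sum_congr rfl fun c _ => (Measure.restrict_apply hA).symm
      _ ≤ ∑ c ∈ s, ofReal (ε / (s.card + 1)) := by
          refine Finset.sum_le_sum fun c hc => ?_
          refine (lintegral_image_le (hs hc) c.measurableSet_dom le_rfl
            c.isOpen_image_dom.measurableSet hmeas.ennreal_ofReal.aemeasurable).trans ?_
          refine (setLIntegral_le_lintegral _ _).trans ?_
          refine le_trans (le_of_eq ?_) (hN c (hs hc) j ((Finset.le_sup hc).trans hj))
          refine lintegral_congr_ae ?_
          have h1 := hg.gradInner_ae hg (hs hc)
          rw [← c.ae_riemVolume] at h1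
          filter_upwards [h1] with x hx
          rw [hx]
          rfl
      _ ≤ ofReal ε := by
          rw [Finset.sum_const, nsmul_eq_mul, ← ENNReal.ofReal_natCast,
            ← ofReal_mul (Nat.cast_nonneg _)]
          refine ofReal_le_ofReal ?_
          rw [mul_div_assoc', div_le_iff₀ hcard]
          nlinarith
  have hmem : ∀ j, Integrable (O.gradInner ((u j).1 - f) ((u j).1 - f)) O.vol →
      O.MemH1 ((u j).1 - f) := fun j hj =>
    (memH1_iff ((hdu j).sub hfw)).2 ⟨(u j).2.1.sub hf, hj⟩
  have hint : ∀ j, ∫⁻ p, ofReal (O.gradInner ((u j).1 - f) ((u j).1 - f) p) ∂O.vol < ⊤ →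
      Integrable (O.gradInner ((u j).1 - f) ((u j).1 - f)) O.vol := by
    intro j hj
    have hg := (hdu j).sub hfw
    exact ⟨(hg.gradInner hg).1.aestronglyMeasurable, (hasFiniteIntegral_iff_ofReal
      (gradInner_self_nonneg hg)).2 hj⟩
  -- The limit is `u N - (u N - f)`, and the second term has finite energy for large `N`.
  have hv : O.MemH1 f := by
    obtain ⟨N, hN⟩ := hQ 1 one_pos
    have h1 := hmem N (hint N ((hN N le_rfl).trans_lt ofReal_lt_top))
    have h2 := (u N).2.add (h1.const_smul (-1))
    have h3 : (u N).1 + (-1 : ℝ) • ((u N).1 - f) = f := by rw [neg_one_smul]; abel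
    rwa [h3] at h2
  refine ⟨⟨f, hv⟩, ?_, ?_⟩
  · rw [Metric.tendsto_atTop]
    intro ε hε
    obtain ⟨N, hN⟩ := hQ (ε / 2) (half_pos hε)
    refine ⟨N, fun j hj => ?_⟩
    have hg := (hdu j).sub hfw
    have h1 := hN j hj
    rw [← ofReal_integral_eq_lintegral_ofReal (hint j (h1.trans_lt ofReal_lt_top))
      (gradInner_self_nonneg hg), ENNReal.ofReal_le_ofReal_iff (by positivity)] at h1
    have h2 := dirichletForm_self_nonneg (u j - ⟨f, hv⟩)
    rw [Real.dist_eq, sub_zero, abs_of_nonneg h2]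
    exact lt_of_le_of_lt h1 (by linarith)
  · have h1 := (ENNReal.continuousAt_toReal ENNReal.zero_ne_top).tendsto.comp hlim
    rw [ENNReal.toReal_zero] at h1
    refine h1.congr fun j => ?_
    have h2 := lintegral_enorm_sq_eq (O := O) (u := (u j - (⟨f, hv⟩ : O.H1)).1)
      (u j - (⟨f, hv⟩ : O.H1)).2.1
    have h3 := l2Form_self_nonneg (u j - (⟨f, hv⟩ : O.H1))
    rw [Function.comp_apply]
    exact (congrArg ENNReal.toReal h2).trans (ENNReal.toReal_ofReal h3)

lemma continuous_of_continuousOn_charts {Y : Type*} [TopologicalSpace Y] {u : X → Y}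
    (h : ∀ c ∈ O.atlas, ContinuousOn (u ∘ c.proj) c.dom) : Continuous u := by
  rw [continuous_iff_continuousAt]
  intro p
  obtain ⟨c, hc, x, hx, rfl⟩ := O.cover p
  intro U hU
  have h1 : ∀ᶠ z in 𝓝[c.dom] x, u (c.proj z) ∈ U := h c hc x hx hU
  obtain ⟨V, hV, hxV, hVs⟩ := mem_nhdsWithin.1 h1
  refine mem_map.2 (mem_of_superset ((c.isOpen_image_inter hV).mem_nhds ⟨x, ⟨hx, hxV⟩, rfl⟩) ?_)
  rintro - ⟨z, hz, rfl⟩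
  exact hVs ⟨hz.2, hz.1⟩

lemma memLp_of_continuous {u : X → ℝ} (h : Continuous u) : MemLp u 2 O.vol := by
  obtain ⟨C, hC⟩ := isCompact_univ.exists_bound_of_continuousOn h.continuousOn
  exact MemLp.of_bound h.measurable.aestronglyMeasurable C
    (Eventually.of_forall fun p => hC p (mem_univ p))

/-- A function whose weak differential is locally bounded up to the boundary is in `H¹`. -/
lemma HasChartGrad.memH1_of_bound {u : X → ℝ} {du : Chart m X → ℝ^m → (ℝ^m →L[ℝ] ℝ)}
    (hu : O.HasChartGrad u du) (hc : MemLp u 2 O.vol)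
    (h : ∀ c ∈ O.atlas, ∀ x ∈ c.dom, ∃ V, IsOpen V ∧ x ∈ V ∧ ∃ B : ℝ,
      ∀ᵐ z, z ∈ c.dom ∩ V → c.cometric z (du c z) (du c z) ≤ B) : O.MemH1 u := by
  refine (memH1_iff hu).2 ⟨hc, ?_⟩
  have h1 : ∃ B : ℝ, ∀ᵐ p ∂O.vol, p ∈ univ → O.gradInner u u p ≤ B := by
    refine isCompact_univ.induction_on
      (p := fun s => ∃ B : ℝ, ∀ᵐ p ∂O.vol, p ∈ s → O.gradInner u u p ≤ B) ⟨0, by simp⟩ ?_ ?_ ?_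
    · rintro s t hst ⟨B, hB⟩
      exact ⟨B, by filter_upwards [hB] with p hp hps using hp (hst hps)⟩
    · rintro s t ⟨B, hB⟩ ⟨B', hB'⟩
      refine ⟨max B B', ?_⟩
      filter_upwards [hB, hB'] with p h1 h2 hp
      exact hp.elim (fun h => (h1 h).trans (le_max_left _ _)) fun h => (h2 h).trans
        (le_max_right _ _)
    · intro p _
      obtain ⟨c, hc, x, hx, rfl⟩ := O.cover p
      obtain ⟨V, hV, hxV, B, hB⟩ := h c hc x hx
      refine ⟨c.proj '' (c.dom ∩ V), mem_nhdsWithin_of_mem_nhds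
        ((c.isOpen_image_inter hV).mem_nhds ⟨x, ⟨hx, hxV⟩, rfl⟩), B, ?_⟩
      have h2 := hu.gradInner_ae hu hc
      rw [ae_restrict_iff' c.measurableSet_dom] at h2
      have h3 := O.vol_image_null hc
        (B := {z ∈ c.dom ∩ V | ¬ O.gradInner u u (c.proj z) ≤ B}) (fun z hz => hz.1.1) (by
          have h4 : ∀ᵐ z, z ∈ c.dom ∩ V → O.gradInner u u (c.proj z) ≤ B := by
            filter_upwards [h2, hB] with z h5 h6 hz
            rw [h5 hz.1]; exact h6 hz
          refine measure_mono_null ?_ (ae_iff.1 h4)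
          intro z hz
          rw [mem_ofPred_eq, Classical.not_imp]
          exact ⟨hz.1, hz.2⟩)
      rw [ae_iff]
      refine measure_mono_null ?_ h3
      intro q hq
      rw [mem_ofPred_eq, Classical.not_imp] at hq
      obtain ⟨⟨z, hz, rfl⟩, hne⟩ := hq
      exact ⟨z, ⟨hz, hne⟩, rfl⟩
  obtain ⟨B, hB⟩ := h1
  refine Integrable.of_bound (hu.gradInner hu).1.aestronglyMeasurable B ?_
  filter_upwards [hB, gradInner_self_nonneg hu] with p h1 h2
  rw [Real.norm_of_nonneg h2]
  exact h1 (mem_univ p)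

lemma hasChartGrad_of_contDiffOn {u : X → ℝ}
    (h : ∀ c ∈ O.atlas, ContDiffOn ℝ 1 (u ∘ c.proj) c.dom) :
    O.HasChartGrad u fun c => fderiv ℝ (u ∘ c.proj) := fun c hc =>
  HasWeakFDerivOn.mk_of_contDiffOn isOpen_interior ((h c hc).mono interior_subset)

/-- The differential within the domain is continuous up to the boundary, hence locally bounded
there. No boundary condition enters, in accordance with the Neumann problem. -/
lemma memH1_of_contDiffOn {u : X → ℝ}
    (h : ∀ c ∈ O.atlas, ContDiffOn ℝ 1 (u ∘ c.proj) c.dom) : O.MemH1 u := by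
  refine (hasChartGrad_of_contDiffOn h).memH1_of_bound
    (memLp_of_continuous (continuous_of_continuousOn_charts fun c hc => (h c hc).continuousOn)) ?_
  intro c hc x hx
  have h1 := (h c hc).continuousOn_fderivWithin c.uniqueDiffOn_dom le_rfl
  have h2 : ContinuousOn (fun z => c.cometric z (fderivWithin ℝ (u ∘ c.proj) c.dom z)
      (fderivWithin ℝ (u ∘ c.proj) c.dom z)) c.dom := by
    unfold RiemannianOrbifoldChart.cometric
    refine continuousOn_finsetSum _ fun i _ => continuousOn_finsetSum _ fun j _ => ?_
    exact ((c.continuousOn_metric_inv i j).mul (h1.clm_apply continuousOn_const)).mul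
      (h1.clm_apply continuousOn_const)
  set B := c.cometric x (fderivWithin ℝ (u ∘ c.proj) c.dom x)
      (fderivWithin ℝ (u ∘ c.proj) c.dom x) + 1 with hB
  obtain ⟨V, hV, hxV, hVs⟩ := mem_nhdsWithin.1 (h2 x hx (Iio_mem_nhds
    (show _ < B from lt_add_one _)))
  refine ⟨V, hV, hxV, B, ?_⟩
  have h3 := c.ae_mem_interior
  rw [ae_restrict_iff' c.measurableSet_dom] at h3
  filter_upwards [h3] with z hz hzV
  have h4 := fderivWithin_of_mem_nhds (𝕜 := ℝ) (f := u ∘ c.proj)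
    (mem_interior_iff_mem_nhds.1 (hz hzV.1))
  rw [← h4]
  exact (hVs ⟨hzV.2, hzV.1⟩ : _ < B).le

lemma regular_inter_interior_nonempty (c : Chart m X) : (c.regular ∩ interior c.dom).Nonempty := by
  have h1 : (interior c.dom).Nonempty := by
    obtain ⟨x, hx⟩ := c.isConnected_dom.nonempty
    exact closure_nonempty_iff.1 (nonempty_of_mem (c.dom_subset_closure_interior hx))
  have h2 : volume (interior c.dom) ≠ 0 := isOpen_interior.measure_ne_zero _ h1
  by_contra h3
  refine h2 (measure_mono_null (show interior c.dom ⊆ c.dom \ c.regular from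
    fun x hx => ⟨interior_subset hx, fun hr => h3 ⟨x, hr, hx⟩⟩) c.volume_dom_diff_regular)

/-- This supplies a nonconstant element of `H¹`, so that the Rayleigh quotient is minimised over a
nontrivial space. The bump is placed where the projection is injective. -/
lemma exists_smooth_bump [hm : NeZero m] : ∃ u : X → ℝ, O.MemH1 u ∧
    (∃ U, IsOpen U ∧ U.Nonempty ∧ ∀ p ∈ U, u p = 0) ∧
    (∃ U, IsOpen U ∧ U.Nonempty ∧ ∀ p ∈ U, u p = 1) := by
  classical
  obtain ⟨p₀⟩ : Nonempty X := inferInstance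
  obtain ⟨c, hc, -⟩ := O.cover p₀
  obtain ⟨x₀, hx₀r, hx₀i⟩ := regular_inter_interior_nonempty c
  obtain ⟨V, hV, hxV, -, hinj⟩ := c.exists_open_injOn hx₀r
  obtain ⟨r, hr, hrV⟩ := Metric.isOpen_iff.1 (hV.inter isOpen_interior) x₀ ⟨hxV, hx₀i⟩
  let β : ContDiffBump x₀ := ⟨r / 4, r / 2, by positivity, by linarith⟩
  have hout : closedBall x₀ (r / 2) ⊆ V ∩ interior c.dom :=
    (Metric.closedBall_subset_ball (by linarith)).trans hrV
  set E := c.proj '' (c.dom ∩ V) with hE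
  have hEo : IsOpen E := c.isOpen_image_inter hV
  set σ := Function.invFunOn c.proj (c.dom ∩ V) with hσ
  have hσm : ∀ p ∈ E, σ p ∈ c.dom ∩ V := fun p hp => Function.invFunOn_mem hp
  have hσp : ∀ p ∈ E, c.proj (σ p) = p := fun p hp => Function.invFunOn_eq hp
  have hσe : ∀ y ∈ c.dom ∩ V, σ (c.proj y) = y := fun y hy =>
    hinj (hσm _ ⟨y, hy, rfl⟩) hy (hσp _ ⟨y, hy, rfl⟩)
  set u : X → ℝ := fun p => if p ∈ E then β (σ p) else 0 with hu
  have huV : ∀ y ∈ c.dom ∩ V, u (c.proj y) = β y := fun y hy => by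
    rw [hu]
    simp only [if_pos (show c.proj y ∈ E from ⟨y, hy, rfl⟩), hσe y hy]
  -- The image of the closed ball is compact and so closed in a Hausdorff space. Off it the function
  -- is zero, so the extension by zero is smooth in all charts.
  have hK : IsClosed (c.proj '' closedBall x₀ (r / 2)) :=
    ((isCompact_closedBall x₀ (r / 2)).image_of_continuousOn (c.continuousOn_proj.mono
      (hout.trans (inter_subset_right.trans interior_subset)))).isClosed
  have huK : ∀ p ∉ c.proj '' closedBall x₀ (r / 2), u p = 0 := by
    intro p hp
    by_cases hpE : p ∈ E
    · rw [hu]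
      simp only [if_pos hpE]
      refine β.zero_of_le_dist ?_
      by_contra hlt
      push Not at hlt
      exact hp ⟨σ p, mem_closedBall.2 hlt.le, hσp p hpE⟩
    · rw [hu]; simp only [if_neg hpE]
  refine ⟨u, memH1_of_contDiffOn fun c' hc' y hy => ?_, ?_, ?_⟩
  · by_cases hyE : c'.proj y ∈ E
    · obtain ⟨h, g, V', W, t, hyV', hhy⟩ := O.exists_transition hc' hc hy (hσm _ hyE).1
        (hσp _ hyE).symm
      have h1 : ContDiffWithinAt ℝ 1 (fun z => β (h z)) c'.dom y := by
        have h2 : ContDiffWithinAt ℝ ∞ h (c'.dom ∩ V') y := t.contDiffOn y ⟨hy, hyV'⟩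
        have h3 : ContDiffWithinAt ℝ ∞ h c'.dom y :=
          (contDiffWithinAt_inter (t.isOpen_left.mem_nhds hyV')).1 h2
        exact (β.contDiff.contDiffAt (n := 1)).comp_contDiffWithinAt y (h3.of_le (by simp))
      refine h1.congr_of_eventuallyEq ?_ ?_
      · have hev : ∀ᶠ z in 𝓝[c'.dom] y, h z ∈ V ∧ z ∈ V' := by
          have h2 : ContinuousWithinAt h (c'.dom ∩ V') y := t.contDiffOn.continuousOn y ⟨hy, hyV'⟩
          have h3 : ContinuousWithinAt h c'.dom y :=
            (continuousWithinAt_inter (t.isOpen_left.mem_nhds hyV')).1 h2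
          exact (h3.eventually (hV.mem_nhds (by rw [hhy]; exact (hσm _ hyE).2))).and
            (mem_nhdsWithin_of_mem_nhds (t.isOpen_left.mem_nhds hyV'))
        filter_upwards [hev, self_mem_nhdsWithin] with z hz hzd
        rw [Function.comp_apply, ← t.proj_eq z ⟨hzd, hz.2⟩, huV _ ⟨(t.mapsTo ⟨hzd, hz.2⟩).1, hz.1⟩]
      · rw [Function.comp_apply, ← t.proj_eq y ⟨hy, hyV'⟩,
          huV _ (by rw [hhy]; exact hσm _ hyE)]
    · have hyK : c'.proj y ∈ (c.proj '' closedBall x₀ (r / 2))ᶜ := by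
        rintro ⟨z, hz, hzy⟩
        exact hyE ⟨z, ⟨interior_subset (hout hz).2, (hout hz).1⟩, hzy⟩
      have h1 := c'.continuousOn_proj y hy (hK.isOpen_compl.mem_nhds hyK)
      refine (contDiffWithinAt_const (c := (0 : ℝ))).congr_of_eventuallyEq ?_ (huK _ hyK)
      filter_upwards [h1] with z hz using huK _ hz
  · set U := ball x₀ r \ closedBall x₀ (r / 2) with hU
    have hUo : IsOpen U := isOpen_ball.sdiff isClosed_closedBall
    refine ⟨c.proj '' (c.dom ∩ U), c.isOpen_image_inter hUo, ?_, ?_⟩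
    -- A point of the annulus around the support, at sup-distance `3 r / 4`. It exists because the
    -- dimension is positive.
    · let z : ℝ^m := x₀ + fun _ => 3 / 4 * r
      have hd : dist z x₀ = 3 / 4 * r := by
        rw [dist_eq_norm, add_sub_cancel_left]
        have : Nonempty (Fin m) := ⟨0⟩
        rw [pi_norm_const, Real.norm_of_nonneg (by positivity)]
      have hzb : z ∈ ball x₀ r := by rw [mem_ball, hd]; linarith
      refine ⟨_, z, ⟨interior_subset (hrV hzb).2, hzb, ?_⟩, rfl⟩
      rw [mem_closedBall, hd]
      linarith
    · rintro - ⟨z, ⟨hzd, hzb, hzc⟩, rfl⟩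
      rw [huV z ⟨hzd, (hrV hzb).1⟩]
      refine β.zero_of_le_dist ?_
      rw [mem_closedBall] at hzc
      exact (not_le.1 hzc).le
  · refine ⟨c.proj '' (c.dom ∩ ball x₀ (r / 4)), c.isOpen_image_inter isOpen_ball,
      ⟨_, x₀, ⟨interior_subset hx₀i, mem_ball_self (by positivity)⟩, rfl⟩, ?_⟩
    rintro - ⟨z, ⟨hzd, hzb⟩, rfl⟩
    have h2 : z ∈ V := (hrV (ball_subset_ball (by linarith) hzb)).1
    rw [huV z ⟨hzd, h2⟩]
    exact β.one_of_mem_closedBall (Metric.ball_subset_closedBall hzb)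

/-- The first nonzero Neumann eigenvalue and its variational characterisation. -/
theorem exists_first_neumann_eigenvalue [ConnectedSpace X] [NeZero m] :
    ∃ t : ℝ, 0 < t ∧ O.IsNeumannEigenvalue t ∧ (∀ s, s ≠ 0 → O.IsNeumannEigenvalue s → t ≤ s) ∧
      ∀ u : O.H1, ∫ p, u.1 p ∂O.vol = 0 → t * O.l2Form u u ≤ O.dirichletForm u u := by
  set e : O.H1 := ⟨fun _ => 1, O.memH1_const 1⟩ with he
  have hbe : ∀ u : O.H1, O.l2Form u e = ∫ p, u.1 p ∂O.vol := fun u => by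
    rw [l2Form_apply]; simp [he]
  have hee : O.l2Form e e ≠ 0 := by
    rw [hbe]
    simp only [he, integral_const, smul_eq_mul, mul_one]
    have : O.vol univ ≠ 0 := isOpen_univ.measure_ne_zero _ univ_nonempty
    exact (ENNReal.toReal_pos this (measure_ne_top _ _)).ne'
  have hae : ∀ v, O.dirichletForm e v = 0 := by
    intro v
    rw [dirichletForm_apply]
    refine integral_eq_zero_of_ae (O.ae_vol_iff.2 fun c hc => ?_)
    filter_upwards [(O.hasChartGrad_const 1).gradInner_ae v.2.hasChartGrad hc] with x hx
    refine hx.trans ?_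
    simp [RiemannianOrbifoldChart.cometric]
  obtain ⟨t, ht, ⟨u, hu, huv⟩, hray⟩ := exists_first_eigenvalue
    (fun u => dirichletForm_self_nonneg (O := O) u) (fun u => l2Form_self_nonneg (O := O) u)
    dirichletForm_symm l2Form_symm O.exists_rellich_functionals exists_limit_of_cauchy
    hae hee (fun u hu => by
      obtain ⟨k, hk⟩ := exists_ae_eq_const hu
      refine ⟨k, (l2Form_self_eq_zero_iff _).2 ?_⟩
      filter_upwards [hk] with p hp
      simp [he, hp]) (by
      obtain ⟨w, hw, ⟨U, hUo, hUn, hU⟩, ⟨U', hUo', hUn', hU'⟩⟩ := O.exists_smooth_bump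
      set w' : O.H1 := ⟨w, hw⟩ with hw'
      set k := O.l2Form w' e / O.l2Form e e with hk
      refine ⟨w' - k • e, ?_, fun h0 => ?_⟩
      · simp [hk, hee]
      · rw [l2Form_self_eq_zero_iff] at h0
        have hwk : ∀ᵐ p ∂O.vol, w p = k := by
          filter_upwards [h0] with p hp
          have : w p - k * 1 = 0 := hp
          linarith
        have key : ∀ (U : Set X) (b : ℝ), IsOpen U → U.Nonempty → (∀ p ∈ U, w p = b) → b = k := by
          intro U b hUo hUn hU
          by_contra hne
          refine hUo.measure_ne_zero O.vol hUn (measure_mono_null ?_ (ae_iff.1 hwk))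
          intro p hp hpk
          exact hne ((hU p hp).symm.trans hpk)
        have h1 := key U 0 hUo hUn hU
        have h2 := key U' 1 hUo' hUn' hU'
        linarith)
  refine ⟨t, ht, isNeumannEigenvalue_iff.2 ⟨u, hu, huv⟩, ?_, fun u hu => hray u (by rw [hbe, hu])⟩
  intro s hs hsN
  obtain ⟨w, hw, hwv⟩ := isNeumannEigenvalue_iff.1 hsN
  -- Testing the eigenvalue equation with a constant shows that an eigenfunction for `s ≠ 0` has
  -- mean zero, so its Rayleigh quotient `s` is at least `t`.
  have h1 : O.l2Form w e = 0 := by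
    have := hwv e
    rw [dirichletForm_symm, hae] at this
    exact (mul_eq_zero.1 this.symm).resolve_left hs
  have h2 := hray w h1
  rw [hwv w] at h2
  exact le_of_mul_le_mul_right h2 (lt_of_le_of_ne (l2Form_self_nonneg w) (Ne.symm hw))

end RiemannianOrbifold

/-! ### Weak differentiability across sets of codimension one. -/

section lines

/-- Eilenberg's inequality: almost every line in a coordinate direction meets a set of finite
codimension-one Hausdorff measure in a finite set. -/
lemma ae_finite_line_of_hausdorffMeasure_ne_top {k : ℕ} (i : Fin (k + 1))
    {A : Set ℝ^(k + 1)} (hA : hausdorffMeasure (k : ℝ) A ≠ ⊤) :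
    ∀ᵐ y : ℝ^k, {t : ℝ | (i.insertNth t y : ℝ^(k + 1)) ∈ A}.Finite := by
  classical
  set π : ℝ^(k + 1) → ℝ^k := fun x => i.removeNth x with hπ
  have hπl : ∀ x y, edist (π x) (π y) ≤ edist x y := by
    intro x y
    rw [edist_pi_le_iff]
    exact fun j => edist_le_pi_edist x y (i.succAbove j)
  have hcov : ∀ n : ℕ, ∃ t : ℕ → Set ℝ^(k + 1), A ⊆ ⋃ j, t j ∧
      (∀ j, ediam (t j) ≤ ofReal (1 / ((n : ℝ) + 1))) ∧
      ∑' j, ⨆ _ : (t j).Nonempty, ediam (t j) ^ (k : ℝ) <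
        hausdorffMeasure (k : ℝ) A + 1 := by
    intro n
    have h1 : ⨅ (t : ℕ → Set ℝ^(k + 1)) (_ : A ⊆ ⋃ n, t n)
        (_ : ∀ j, ediam (t j) ≤ ofReal (1 / ((n : ℝ) + 1))),
          ∑' j, ⨆ _ : (t j).Nonempty, ediam (t j) ^ (k : ℝ) <
        hausdorffMeasure (k : ℝ) A + 1 := by
      refine lt_of_le_of_lt ?_ (ENNReal.lt_add_right hA one_ne_zero)
      rw [Measure.hausdorffMeasure_apply]
      exact le_iSup₂_of_le (ofReal (1 / ((n : ℝ) + 1)))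
        (ENNReal.ofReal_pos.2 (by positivity)) le_rfl
    simp only [iInf_lt_iff] at h1
    obtain ⟨t, h2, h3, h4⟩ := h1
    exact ⟨t, h2, h3, h4⟩
  choose t htA htd hts using hcov
  -- Projections of the covering sets need not be measurable, so measurable hulls of the same volume
  -- are counted.
  set B : ℕ → ℕ → Set ℝ^k := fun n j => toMeasurable volume (π '' t n j) with hB
  have hBm : ∀ n j, MeasurableSet (B n j) := fun n j => measurableSet_toMeasurable _ _
  -- `N n y` counts hulls containing `y`. A projected set has volume at most the `k`-th power of its
  -- diameter, so the integral of `N n` is bounded by the Hausdorff sum of the cover. By Fatou the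
  -- lower limit of `N n y` is finite for almost every `y`.
  set N : ℕ → ℝ^k → ℝ≥0∞ := fun n y => ∑' j, (B n j).indicator (fun _ => 1) y with hN
  have hNm : ∀ n, Measurable (N n) := fun n =>
    Measurable.tsum fun j => measurable_const.indicator (hBm n j)
  have hNi : ∀ n, ∫⁻ y, N n y ≤ hausdorffMeasure (k : ℝ) A + 1 := by
    intro n
    rw [hN, lintegral_tsum fun j => (measurable_const.indicator (hBm n j)).aemeasurable]
    refine le_trans (ENNReal.tsum_le_tsum fun j => ?_) (hts n).le
    rw [lintegral_indicator_const (hBm n j), one_mul, measure_toMeasurable]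
    rcases (t n j).eq_empty_or_nonempty with h0 | h0
    · rw [h0, image_empty, measure_empty]; exact zero_le
    · refine le_iSup_of_le h0 ?_
      refine (Real.volume_pi_le_diam_pow _).trans ?_
      rw [Fintype.card_fin, rpow_natCast]
      refine pow_le_pow_left' (Metric.ediam_le ?_) _
      rintro - ⟨x, hx, rfl⟩ - ⟨y, hy, rfl⟩
      exact (hπl x y).trans (Metric.edist_le_ediam_of_mem hx hy)
  have hfin : ∫⁻ y, liminf (fun n => N n y) atTop ≠ ⊤ := by
    refine ((lintegral_liminf_le hNm).trans_lt ?_).ne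
    refine lt_of_le_of_lt (liminf_le_of_le (by isBoundedDefault) fun b hb => ?_)
      (ENNReal.add_lt_top.2 ⟨hA.lt_top, ENNReal.one_lt_top⟩)
    obtain ⟨n, hn⟩ := hb.exists
    exact hn.trans (hNi n)
  filter_upwards [ae_lt_top (Measurable.liminf hNm) hfin] with y hy
  by_contra hinf
  obtain ⟨K, hK⟩ := ENNReal.exists_nat_gt hy.ne
  obtain ⟨T, hT, hTc⟩ := Set.Infinite.exists_subset_card_eq hinf K
  -- Given `K` points of `A` on the line over `y`, once the mesh is smaller than their mutual
  -- distances they lie in different covering sets, whence `N n y ≥ K`.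
  have hsep : ∀ᶠ n : ℕ in atTop, ∀ s ∈ T, ∀ r ∈ T, s ≠ r → 1 / ((n : ℝ) + 1) < |s - r| := by
    refine (Filter.eventually_all_finset T).2 fun s _ => (Filter.eventually_all_finset T).2
      fun r _ => ?_
    by_cases hsr : s = r
    · exact Eventually.of_forall fun n h => absurd hsr h
    · have := (tendsto_one_div_add_atTop_nhds_zero_nat (𝕜 := ℝ)).eventually
        (Iio_mem_nhds (abs_pos.2 (sub_ne_zero.2 hsr)))
      filter_upwards [this] with n hn _ using hn
  refine absurd hK (not_lt.2 (le_liminf_of_le (by isBoundedDefault) ?_))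
  filter_upwards [hsep] with n hn
  have hj : ∀ s ∈ T, ∃ j, (i.insertNth s y : ℝ^(k + 1)) ∈ t n j := fun s hs =>
    mem_iUnion.1 (htA n (hT hs))
  choose! J hJ using hj
  have hJi : InjOn J T := by
    intro s hs r hr hsr
    by_contra hne
    have h1 := hn s hs r hr hne
    have h2 := Metric.edist_le_ediam_of_mem (hJ s hs) (hsr ▸ hJ r hr)
    have h3 : edist s r ≤ edist (i.insertNth s y : ℝ^(k + 1)) (i.insertNth r y) := by
      have := edist_le_pi_edist (i.insertNth s y : ℝ^(k + 1)) (i.insertNth r y) i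
      simpa using this
    have h4 := h3.trans (h2.trans (htd n _))
    rw [edist_dist, ENNReal.ofReal_le_ofReal_iff (by positivity), Real.dist_eq] at h4
    linarith
  calc (K : ℝ≥0∞) = ∑ j ∈ T.image J, 1 := by
        rw [Finset.sum_const, Finset.card_image_of_injOn hJi, hTc]; simp
    _ = ∑ j ∈ T.image J, (B n j).indicator (fun _ => 1) y := by
        refine sum_congr rfl fun j hj => ?_
        obtain ⟨s, hs, rfl⟩ := Finset.mem_image.1 hj
        rw [indicator_of_mem]
        refine subset_toMeasurable _ _ ⟨_, hJ s hs, ?_⟩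
        simp [hπ]
    _ ≤ N n y := ENNReal.sum_le_tsum _

/-- A σ-finite set is a countable union of sets of finite measure, each met in finitely many points
by almost every line. -/
lemma ae_countable_line {k : ℕ} (i : Fin (k + 1)) {S : Set ℝ^(k + 1)}
    (hS : SigmaFinite ((hausdorffMeasure (k : ℝ)).restrict S)) :
    ∀ᵐ y : ℝ^k, {t : ℝ | (i.insertNth t y : ℝ^(k + 1)) ∈ S}.Countable := by
  set μ := (hausdorffMeasure (k : ℝ)).restrict S with hμ
  have h1 : ∀ n, ∀ᵐ y : ℝ^k,
      {t : ℝ | (i.insertNth t y : ℝ^(k + 1)) ∈ spanningSets μ n ∩ S}.Finite := by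
    intro n
    refine ae_finite_line_of_hausdorffMeasure_ne_top i ?_
    rw [← Measure.restrict_apply (measurableSet_spanningSets μ n)]
    exact (measure_spanningSets_lt_top μ n).ne
  filter_upwards [ae_all_iff.2 h1] with y hy
  refine (countable_iUnion fun n => (hy n).countable).mono ?_
  intro t ht
  have : (i.insertNth t y : ℝ^(k + 1)) ∈ ⋃ n, spanningSets μ n := by
    rw [iUnion_spanningSets]; trivial
  obtain ⟨n, hn⟩ := mem_iUnion.1 this
  exact mem_iUnion.2 ⟨n, hn, ht⟩

/-- Finite Hausdorff measure in dimension `m - 1` forces measure zero in dimension `m`, and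
Hausdorff measure in dimension `m` is Lebesgue measure for the sup norm. -/
lemma volume_eq_zero_of_sigmaFinite_hausdorffMeasure {m : ℕ} {S : Set ℝ^m}
    (hS : SigmaFinite ((hausdorffMeasure ((m : ℝ) - 1)).restrict S)) : volume S = 0 := by
  set μ := (hausdorffMeasure ((m : ℝ) - 1) : Measure ℝ^m).restrict S with hμ
  have h1 : ∀ n, volume (spanningSets μ n ∩ S) = 0 := by
    intro n
    have h2 : hausdorffMeasure ((m : ℝ) - 1) (spanningSets μ n ∩ S) ≠ ⊤ := by
      rw [← Measure.restrict_apply (measurableSet_spanningSets μ n)]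
      exact (measure_spanningSets_lt_top μ n).ne
    have h3 := (Measure.hausdorffMeasure_zero_or_top (sub_one_lt (m : ℝ))
      (spanningSets μ n ∩ S)).resolve_right h2
    have h4 := hausdorffMeasure_pi_real (ι := Fin m)
    rw [Fintype.card_fin] at h4
    rwa [h4] at h3
  refine measure_mono_null ?_ (measure_iUnion_null h1)
  rw [← iUnion_inter, iUnion_spanningSets, univ_inter]

/-- Integrals of derivatives of compactly supported functions that are continuous, and
differentiable off a countable set on almost every line. -/
lemma integral_deriv_eq_zero_of_lines {k : ℕ} (i : Fin (k + 1)) {F F' : ℝ^(k + 1) → ℝ}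
    (hF : Continuous F) (hFc : HasCompactSupport F) (hF'c : HasCompactSupport F')
    (hF' : Integrable F') {S : Set ℝ^(k + 1)}
    (hS : SigmaFinite ((hausdorffMeasure (k : ℝ)).restrict S))
    (hd : ∀ x ∉ S, HasLineDerivAt ℝ F (F' x) x (Pi.single i 1)) : ∫ x, F' x = 0 := by
  have hmp := volume_preserving_piFinSuccAbove (fun _ : Fin (k + 1) => ℝ) i
  have h1 : ∫ x, F' x = ∫ p : ℝ × ℝ^k, F' (i.insertNth p.1 p.2) := by
    rw [← hmp.symm.integral_comp (MeasurableEquiv.measurableEmbedding _)]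
    rfl
  have h2 : Integrable (fun p : ℝ × ℝ^k => F' (i.insertNth p.1 p.2)) :=
    (hmp.symm.integrable_comp_emb (MeasurableEquiv.measurableEmbedding _)).2 hF'
  rw [h1, Measure.volume_eq_prod, integral_prod_symm _ h2]
  refine integral_eq_zero_of_ae ?_
  obtain ⟨R, hR⟩ := (hFc.isCompact.union hF'c.isCompact).isBounded.subset_closedBall 0
  rw [Measure.volume_eq_prod] at h2
  filter_upwards [ae_countable_line i hS, h2.prod_left_ae] with y hy hyi
  set r := max R 0 + 1 with hr
  have hr0 : 0 < r := by positivity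
  have hout : ∀ t : ℝ, r ≤ |t| → (i.insertNth t y : ℝ^(k + 1)) ∉ tsupport F ∪ tsupport F' := by
    intro t ht hmem
    have h3 := hR hmem
    rw [mem_closedBall_zero_iff] at h3
    have h4 := norm_le_pi_norm (i.insertNth t y : ℝ^(k + 1)) i
    rw [Fin.insertNth_apply_same, Real.norm_eq_abs] at h4
    have := le_max_left R 0
    linarith
  have hzero : ∀ t : ℝ, r ≤ |t| → F' (i.insertNth t y) = 0 := fun t ht =>
    image_eq_zero_of_notMem_tsupport fun h => hout t ht (Or.inr h)
  have hzero' : ∀ t : ℝ, r ≤ |t| → F (i.insertNth t y) = 0 := fun t ht =>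
    image_eq_zero_of_notMem_tsupport fun h => hout t ht (Or.inl h)
  have e1 : ∫ t, F' (i.insertNth t y) = ∫ t in (-r)..r, F' (i.insertNth t y) := by
    rw [intervalIntegral.integral_of_le (by linarith),
      setIntegral_eq_integral_of_forall_compl_eq_zero]
    intro t ht
    refine hzero t ?_
    rw [mem_Ioc, not_and_or, not_lt, not_le] at ht
    rcases ht with h | h
    · rw [abs_of_nonpos (by linarith)]; linarith
    · rw [abs_of_pos (by linarith)]; exact h.le
  have hins : Continuous fun t : ℝ => (i.insertNth t y : ℝ^(k + 1)) :=
    Continuous.finInsertNth (A := fun _ => ℝ) i continuous_id continuous_const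
  -- The fundamental theorem of calculus for a continuous function differentiable off a countable
  -- set; the end points lie outside the supports, so the integral over the line is zero.
  have e2 := integral_eq_of_hasDerivAt_off_countable (fun t => F (i.insertNth t y))
    (fun t => F' (i.insertNth t y)) (a := -r) (b := r) hy (hF.comp hins).continuousOn
    (fun t ht => by
      have h5 := hd (i.insertNth t y) ht.2
      unfold HasLineDerivAt at h5
      have h6 : HasDerivAt (fun s : ℝ => F (i.insertNth t y + (s - t) • Pi.single i 1))
          (F' (i.insertNth t y)) t := by
        have h7 : HasDerivAt (fun s : ℝ => F (i.insertNth t y + s • Pi.single i 1))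
          (F' (i.insertNth t y)) (t - t) := by rw [sub_self]; exact h5
        simpa using h7.comp_sub_const t t
      refine h6.congr_of_eventuallyEq (Eventually.of_forall fun s => ?_)
      dsimp only
      congr 1
      refine i.forall_iff_succAbove.2 ⟨?_, fun j => ?_⟩ |> funext
      · simp
      · simp [Fin.succAbove_ne]) hyi.intervalIntegrable
  rw [Pi.zero_apply, e1, e2, hzero' r (le_abs_self r), hzero' (-r)
    (by rw [abs_neg]; exact le_abs_self r),
    sub_zero]

/-- Continuous functions that are differentiable off a set of σ-finite codimension-one Hausdorff
measure are weakly differentiable as soon as their differential is locally integrable. -/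
theorem HasWeakFDerivOn.of_differentiableAt_off {m : ℕ} {f : ℝ^m → ℝ}
    {V S : Set ℝ^m} (hm : 1 ≤ m) (hV : IsOpen V) (hf : ContinuousOn f V)
    (hS : SigmaFinite ((hausdorffMeasure ((m : ℝ) - 1)).restrict S))
    (hd : ∀ x ∈ V, x ∉ S → DifferentiableAt ℝ f x)
    (hint : LocallyIntegrableOn (fderiv ℝ f) V) : HasWeakFDerivOn f (fderiv ℝ f) V := by
  obtain ⟨k, rfl⟩ : ∃ k, m = k + 1 := ⟨m - 1, by omega⟩
  have hS' : SigmaFinite ((hausdorffMeasure (k : ℝ)).restrict S) := by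
    have : ((k + 1 : ℕ) : ℝ) - 1 = k := by push_cast; ring
    rwa [this] at hS
  have hfl : LocallyIntegrableOn f V := hf.locallyIntegrableOn hV.measurableSet
  refine ⟨hfl, hint, fun ψ hψ hψc hψV v => ?_⟩
  have hdc : ∀ v, Continuous fun x => fderiv ℝ ψ x v := fun v =>
    (hψ.continuous_fderiv (by simp)).clm_apply continuous_const
  have hsub : ∀ v, tsupport (fun x => fderiv ℝ ψ x v) ⊆ tsupport ψ := fun v =>
    closure_minimal (fun x hx => by
      by_contra hxK
      refine hx ?_
      have : x ∉ tsupport (fderiv ℝ ψ) := fun h => hxK (tsupport_fderiv_subset ℝ h)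
      simp only [image_eq_zero_of_notMem_tsupport this, zero_apply]) (isClosed_tsupport ψ)
  have i1 : ∀ v, Integrable fun x => f x * fderiv ℝ ψ x v := by
    intro v
    have := hfl.integrable_smul_of_tsupport_subset (hdc v) (hψc.fderiv_apply ℝ v)
      ((hsub v).trans hψV)
    simpa [mul_comm] using this
  have i2 : ∀ v, Integrable fun x => ψ x * fderiv ℝ f x v := fun v =>
    (hint.integrable_smul_of_tsupport_subset hψ.continuous hψc hψV).apply_continuousLinearMap v
  have hFc : Continuous fun x => ψ x * f x := by
    rw [continuous_iff_continuousAt]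
    intro x
    by_cases hx : x ∈ tsupport ψ
    · exact hψ.continuous.continuousAt.mul (hf.continuousAt (hV.mem_nhds (hψV hx)))
    · have h0 : (fun x => ψ x * f x) =ᶠ[𝓝 x] fun _ => 0 := by
        filter_upwards [(isClosed_tsupport ψ).isOpen_compl.mem_nhds hx] with z hz
        rw [image_eq_zero_of_notMem_tsupport hz, zero_mul]
      exact continuousAt_const.congr h0.symm
  -- The product `ψ f` is continuous with compact support and differentiable off `S`: on the support
  -- of `ψ` by the product rule, and elsewhere because it vanishes locally.
  have hbasis : ∀ i, ∫ x, (f x * fderiv ℝ ψ x (Pi.single i 1) + ψ x * fderiv ℝ f x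
    (Pi.single i 1)) = 0 := by
    intro i
    refine integral_deriv_eq_zero_of_lines i hFc (hψc.mul_right) ?_ ((i1 _).add (i2 _)) hS' ?_
    · refine HasCompactSupport.intro hψc fun x hx => ?_
      have h1 : fderiv ℝ ψ x = 0 := image_eq_zero_of_notMem_tsupport
        fun h => hx (tsupport_fderiv_subset ℝ h)
      rw [h1, image_eq_zero_of_notMem_tsupport hx]
      simp
    · intro x hx
      by_cases hxs : x ∈ tsupport ψ
      · have h1 := ((hψ.differentiable (by simp)) x).hasFDerivAt.mul
          (hd x (hψV hxs) hx).hasFDerivAt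
        have h2 := h1.hasLineDerivAt (Pi.single i 1)
        refine h2.congr_deriv ?_
        simp [add_comm]
      · have h0 : (fun x => ψ x * f x) =ᶠ[𝓝 x] fun _ => 0 := by
          filter_upwards [(isClosed_tsupport ψ).isOpen_compl.mem_nhds hxs] with z hz
          rw [image_eq_zero_of_notMem_tsupport hz, zero_mul]
        have h1 : fderiv ℝ ψ x = 0 := image_eq_zero_of_notMem_tsupport
          fun h => hxs (tsupport_fderiv_subset ℝ h)
        have h2 : HasFDerivAt (fun x => ψ x * f x) (0 : ℝ^(k + 1) →L[ℝ] ℝ) x :=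
          (hasFDerivAt_const (0 : ℝ) x).congr_of_eventuallyEq h0
        refine (h2.hasLineDerivAt (Pi.single i 1)).congr_deriv ?_
        rw [h1, image_eq_zero_of_notMem_tsupport hxs]
        simp
  have hb2 : ∀ i, ∫ x, f x * fderiv ℝ ψ x (Pi.single i 1) = -∫ x, ψ x * fderiv ℝ f x
    (Pi.single i 1) := by
    intro i
    have := hbasis i
    rw [integral_add (i1 _) (i2 _)] at this
    linarith
  have hv : ∀ L : ℝ^(k + 1) →L[ℝ] ℝ, L v = ∑ i, v i * L (Pi.single i 1) := by
    intro L
    conv_lhs => rw [pi_eq_sum_univ' v]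
    rw [map_sum]
    exact sum_congr rfl fun i _ => by rw [map_smul, smul_eq_mul]
  calc ∫ x, f x * fderiv ℝ ψ x v = ∫ x, ∑ i, v i * (f x * fderiv ℝ ψ x (Pi.single i 1)) := by
        refine integral_congr_ae (Eventually.of_forall fun x => ?_)
        dsimp only
        rw [hv, mul_sum]
        exact sum_congr rfl fun i _ => by ring
    _ = ∑ i, v i * ∫ x, f x * fderiv ℝ ψ x (Pi.single i 1) := by
        rw [integral_finsetSum _ fun i _ => (i1 _).const_mul _]
        exact sum_congr rfl fun i _ => integral_const_mul _ _
    _ = -∑ i, v i * ∫ x, ψ x * fderiv ℝ f x (Pi.single i 1) := by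
        rw [← Finset.sum_neg_distrib]
        exact sum_congr rfl fun i _ => by rw [hb2]; ring
    _ = -∫ x, ∑ i, v i * (ψ x * fderiv ℝ f x (Pi.single i 1)) := by
        rw [integral_finsetSum _ fun i _ => (i2 _).const_mul _]
        congr 1
        exact sum_congr rfl fun i _ => (integral_const_mul _ _).symm
    _ = -∫ x, ψ x * fderiv ℝ f x v := by
        congr 1
        refine integral_congr_ae (Eventually.of_forall fun x => ?_)
        dsimp only
        rw [hv, mul_sum]
        exact sum_congr rfl fun i _ => by ring

end lines

/-! ### Piecewise conformal maps and their coordinate functions. -/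

namespace RiemannianOrbifold

section pc

variable {m n : ℕ} {X : Type*} [TopologicalSpace X]

/-- `ψ` is piecewise conformal, with `S` containing the walls between the pieces. -/
structure IsPCOff (O : RiemannianOrbifold m X) (ψ : X → UnitSphere n) (S : Set X) : Prop where
  continuous : Continuous ψ
  isClosed : IsClosed S
  sigmaFinite : ∀ c ∈ O.atlas, SigmaFinite
    ((hausdorffMeasure ((m : ℝ) - 1)).restrict (c.dom ∩ c.proj ⁻¹' S))
  contDiff : ∀ c ∈ O.atlas, ∀ x ∈ c.dom, c.proj x ∉ S → ContDiffWithinAt ℝ 1 (c.lift ψ) c.dom x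
  conformal : ∀ c ∈ O.atlas, ∀ x ∈ c.dom, c.proj x ∉ S →
    ∃ ρ : ℝ, 0 < ρ ∧ c.pullbackCan ψ x = ρ • c.metric x

lemma isPC_iff {O : RiemannianOrbifold m X} {ψ : X → UnitSphere n} :
    O.IsPC ψ ↔ ∃ S, O.IsPCOff ψ S :=
  ⟨fun ⟨h, S, hS, hc⟩ => ⟨S, h, hS, fun c hcA => (hc c hcA).1,
    fun c hcA x hx hxS => ((hc c hcA).2 x hx hxS).1,
    fun c hcA x hx hxS => ((hc c hcA).2 x hx hxS).2⟩,
  fun ⟨S, h⟩ => ⟨h.continuous, S, h.isClosed, fun c hc => ⟨h.sigmaFinite c hc,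
    fun x hx hxS => ⟨h.contDiff c hc x hx hxS, h.conformal c hc x hx hxS⟩⟩⟩⟩

/-- The coordinate functions of a map to the sphere. -/
def coord (ψ : X → UnitSphere n) (i : Fin (n + 1)) : X → ℝ := fun p => (ψ p : 𝔼^(n + 1)) i

variable {O : RiemannianOrbifold m X} {ψ : X → UnitSphere n} {S : Set X}
  {c : Chart m X}

namespace IsPCOff

lemma isOpen_good (h : O.IsPCOff ψ S) : IsOpen (interior c.dom ∩ c.proj ⁻¹' Sᶜ) :=
  (c.continuousOn_proj.mono interior_subset).isOpen_inter_preimage isOpen_interior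
    h.isClosed.isOpen_compl

lemma ae_good (h : O.IsPCOff ψ S) (hc : c ∈ O.atlas) :
    ∀ᵐ x ∂(volume.restrict c.dom), x ∈ interior c.dom ∧ c.proj x ∉ S := by
  have h1 : ∀ᵐ x, x ∉ c.dom ∩ c.proj ⁻¹' S := measure_eq_zero_iff_ae_notMem.1
    (volume_eq_zero_of_sigmaFinite_hausdorffMeasure (h.sigmaFinite c hc))
  filter_upwards [c.ae_mem_interior, ae_restrict_of_ae h1] with x hx hx'
  exact ⟨hx, fun hs => hx' ⟨interior_subset hx, hs⟩⟩

lemma contDiffAt (h : O.IsPCOff ψ S) (hc : c ∈ O.atlas) {x : ℝ^m}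
    (hx : x ∈ interior c.dom) (hxS : c.proj x ∉ S) : ContDiffAt ℝ 1 (c.lift ψ) x :=
  (h.contDiff c hc x (interior_subset hx) hxS).contDiffAt (mem_interior_iff_mem_nhds.1 hx)

lemma pullbackCan_eq {x : ℝ^m} (hx : x ∈ interior c.dom) (i j : Fin m) :
    c.pullbackCan ψ x i j = inner ℝ (fderiv ℝ (c.lift ψ) x (Pi.single i 1))
      (fderiv ℝ (c.lift ψ) x (Pi.single j 1)) := by
  rw [RiemannianOrbifoldChart.pullbackCan, Matrix.of_apply,
    fderivWithin_of_mem_nhds (mem_interior_iff_mem_nhds.1 hx)]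

lemma fderiv_coord {x : ℝ^m} (hd : DifferentiableAt ℝ (c.lift ψ) x) (i : Fin (n + 1)) :
    HasFDerivAt (coord ψ i ∘ c.proj)
      ((EuclideanSpace.proj i : 𝔼^(n + 1) →L[ℝ] ℝ).comp (fderiv ℝ (c.lift ψ) x)) x :=
  (EuclideanSpace.proj i : 𝔼^(n + 1) →L[ℝ] ℝ).hasFDerivAt.comp x hd.hasFDerivAt

/-- The sum of the squared gradients of the coordinates is the trace of the pulled back metric with
respect to `g`, that is `ρ` times the trace of the identity. -/
lemma sum_cometric_coord {x : ℝ^m} (hx : x ∈ interior c.dom)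
    (hd : DifferentiableAt ℝ (c.lift ψ) x) {ρ : ℝ} (hρ : c.pullbackCan ψ x = ρ • c.metric x) :
    ∑ i, c.cometric x (fderiv ℝ (coord ψ i ∘ c.proj) x) (fderiv ℝ (coord ψ i ∘ c.proj) x) =
      m * ρ := by
  have hdet : IsUnit (c.metric x).det :=
    isUnit_iff_ne_zero.2 (c.det_metric_pos (interior_subset hx)).ne'
  have h1 : ∀ i a, fderiv ℝ (coord ψ i ∘ c.proj) x (Pi.single a 1) =
      (fderiv ℝ (c.lift ψ) x (Pi.single a 1)) i := fun i a => by
    rw [(fderiv_coord hd i).fderiv]; rfl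
  have hsymm : ∀ a b, c.metric x a b = c.metric x b a := fun a b => by
    have := (c.posDef_metric x (interior_subset hx)).isHermitian.apply b a
    rwa [star_trivial] at this
  calc _ = ∑ a, ∑ b, (c.metric x)⁻¹ a b * c.pullbackCan ψ x a b := by
        unfold RiemannianOrbifoldChart.cometric
        rw [Finset.sum_comm]
        refine sum_congr rfl fun a _ => ?_
        rw [Finset.sum_comm]
        refine sum_congr rfl fun b _ => ?_
        rw [pullbackCan_eq hx, PiLp.inner_apply, mul_sum]
        refine sum_congr rfl fun i _ => ?_
        rw [h1, h1]
        simp only [RCLike.inner_apply, conj_trivial]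
        ring
    _ = ρ * ((c.metric x)⁻¹ * c.metric x).trace := by
        rw [Matrix.trace, mul_sum]
        refine sum_congr rfl fun a _ => ?_
        rw [Matrix.diag_apply, Matrix.mul_apply, mul_sum]
        refine sum_congr rfl fun b _ => ?_
        rw [hρ, Matrix.smul_apply, smul_eq_mul, hsymm b a]
        ring
    _ = m * ρ := by
        rw [Matrix.nonsing_inv_mul _ hdet, Matrix.trace_one, Fintype.card_fin]
        ring

lemma sqrt_det_pullbackCan {x : ℝ^m} {ρ : ℝ} (hρ0 : 0 ≤ ρ)
    (hρ : c.pullbackCan ψ x = ρ • c.metric x) :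
    √(c.pullbackCan ψ x).det = ρ ^ ((m : ℝ) / 2) * √(c.metric x).det := by
  rw [hρ, Matrix.det_smul, Fintype.card_fin, Real.sqrt_mul (by positivity)]
  congr 1
  rw [Real.sqrt_eq_rpow, ← Real.rpow_natCast, ← Real.rpow_mul hρ0]
  congr 1
  ring

end IsPCOff

section measure

variable [T2Space X] [MeasurableSpace X] [BorelSpace X] [CompactSpace X] [Nonempty X]

lemma chart_lintegral_le_tensorVolume {k : Chart m X → ℝ^m → Matrix (Fin m) (Fin m) ℝ}
    (hc : c ∈ O.atlas) {A : Set X} (hA : MeasurableSet A) :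
    (Nat.card c.group : ℝ≥0∞)⁻¹ * ((volume.restrict c.dom).withDensity fun x =>
      ofReal √(k c x).det) (c.proj ⁻¹' A) ≤ O.tensorVolume k A := by
  have h1 : ((Nat.card c.group : ℝ≥0∞)⁻¹) • Measure.map c.proj
      ((volume.restrict c.dom).withDensity fun x => ofReal (√ ((k c x).det))) ≤
      O.tensorVolume k := le_iSup₂_of_le c hc le_rfl
  refine le_trans (le_of_eq ?_) (h1 A)
  rw [Measure.smul_apply, smul_eq_mul, Measure.map_apply_of_aemeasurable _ hA]
  exact (c.continuousOn_proj.aemeasurable c.measurableSet_dom).mono_ac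
    (withDensity_absolutelyContinuous _ _)

/-- Only a lower bound for the volume of the pulled back tensor is needed. It follows from the fact
that each chart measure is below the supremum, applied to a disjoint decomposition, so the tensor
volume itself need not be shown to be consistent on overlaps. -/
lemma lintegral_le_tensorVolume {k : Chart m X → ℝ^m → Matrix (Fin m) (Fin m) ℝ} {f : X → ℝ≥0∞}
    (hf : Measurable f) (h : ∀ c ∈ O.atlas, ∀ᵐ x ∂(volume.restrict c.dom),
      ofReal √(k c x).det = f (c.proj x) * ofReal √(c.metric x).det) :
    ∫⁻ p, f p ∂O.vol ≤ O.tensorVolume k univ := by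
  have key : ∀ c ∈ O.atlas, ∀ A, MeasurableSet A → A ⊆ c.proj '' c.dom →
      ∫⁻ p in A, f p ∂O.vol ≤ O.tensorVolume k A := by
    intro c hc A hA hAs
    refine le_trans (le_of_eq ?_) (chart_lintegral_le_tensorVolume hc hA)
    have hpre := c.measurableSet_preimage hA
    have e1 : O.vol.restrict A = (c.pushVolume).restrict A := by
      rw [← O.vol_restrict hc, Measure.restrict_restrict hA, inter_eq_left.2 hAs]
    have e2 : ∫⁻ p in A, f p ∂c.pushVolume = (Nat.card c.group : ℝ≥0∞)⁻¹ *
        ∫⁻ x, A.indicator f (c.proj x) ∂c.riemVolume := by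
      rw [← lintegral_indicator hA]
      unfold RiemannianOrbifoldChart.pushVolume
      rw [lintegral_smul_measure, lintegral_map' (hf.indicator hA).aemeasurable c.aemeasurable_proj,
        smul_eq_mul]
    rw [e1, e2]
    congr 1
    have e3 := c.setLIntegral_riemVolume c.measurableSet_dom le_rfl
      fun x => A.indicator f (c.proj x)
    have e4 : ∫⁻ x, A.indicator f (c.proj x) ∂c.riemVolume =
        ∫⁻ x in c.dom, A.indicator f (c.proj x) ∂c.riemVolume := by
      rw [Measure.restrict_eq_self_of_ae_mem]
      exact (measure_eq_zero_iff_ae_notMem.1 c.riemVolume_compl_dom).mono fun x hx => not_not.1 hx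
    have e5 : ((volume.restrict c.dom).withDensity fun x => ofReal √(k c x).det)
        (c.proj ⁻¹' A) = ((volume.restrict c.dom).withDensity fun x =>
          ofReal √(k c x).det) (c.dom ∩ c.proj ⁻¹' A) := by
      refine measure_congr ?_
      have : ∀ᵐ x ∂((volume.restrict c.dom).withDensity fun x => ofReal √(k c x).det),
          x ∈ c.dom := (withDensity_absolutelyContinuous _ _) (ae_restrict_mem c.measurableSet_dom)
      filter_upwards [this] with x hx
      exact propext ⟨fun h => ⟨hx, h⟩, fun h => h.2⟩
    rw [e4, e3, e5, withDensity_apply _ hpre, Measure.restrict_restrict hpre,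
      inter_eq_left.2 (inter_subset_left : c.dom ∩ c.proj ⁻¹' A ⊆ c.dom)]
    have e6 : ∫⁻ x in c.dom, ofReal √(c.metric x).det * A.indicator f (c.proj x) =
        ∫⁻ x in c.dom, (c.dom ∩ c.proj ⁻¹' A).indicator
          (fun x => ofReal √(k c x).det) x := by
      refine lintegral_congr_ae ?_
      filter_upwards [h c hc, ae_restrict_mem c.measurableSet_dom] with x hx hxd
      by_cases hxA : c.proj x ∈ A
      · rw [indicator_of_mem hxA, indicator_of_mem (show x ∈ c.dom ∩ c.proj ⁻¹' A from ⟨hxd, hxA⟩),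
          hx,
          mul_comm]
      · rw [indicator_of_notMem hxA, indicator_of_notMem
          (show x ∉ c.dom ∩ c.proj ⁻¹' A from fun h => hxA h.2), mul_zero]
    rw [e6, lintegral_indicator hpre, Measure.restrict_restrict hpre,
      inter_eq_left.2 (inter_subset_left : c.dom ∩ c.proj ⁻¹' A ⊆ c.dom)]
  obtain ⟨d, hd, hcov⟩ := O.exists_seq_cover
  set D := disjointed fun k => (d k).proj '' (d k).dom with hD
  have hDm : ∀ k, MeasurableSet (D k) := fun k =>
    MeasurableSet.disjointed (fun i => (d i).isOpen_image_dom.measurableSet) k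
  have hDU : ⋃ k, D k = univ := by rw [hD, iUnion_disjointed, hcov]
  calc ∫⁻ p, f p ∂O.vol = ∑' k, ∫⁻ p in D k, f p ∂O.vol := by
        rw [← lintegral_iUnion hDm (disjoint_disjointed _), hDU, Measure.restrict_univ]
    _ ≤ ∑' k, O.tensorVolume _ (D k) :=
        ENNReal.tsum_le_tsum fun k => key (d k) (hd k) _ (hDm k) (disjointed_subset _ k)
    _ = O.tensorVolume _ univ := by rw [← measure_iUnion (disjoint_disjointed _) hDm, hDU]

namespace IsPCOff

/-- On a compact set the differentials of the coordinates are bounded by a constant times `√ρ`. The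
density of the pulled back volume is `ρ^{m/2} √det g`, which is integrable and, together with a
constant, controls `√ρ`. -/
lemma locallyIntegrableOn_fderiv_coord (hm : 1 ≤ m) (h : O.IsPCOff ψ S)
    (hfin : O.tensorVolume (fun c => c.pullbackCan ψ) univ ≠ ⊤) (hc : c ∈ O.atlas)
    (i : Fin (n + 1)) :
    LocallyIntegrableOn (fderiv ℝ (coord ψ i ∘ c.proj)) (interior c.dom) := by
  have hdens : ∫⁻ x in c.dom, ofReal √(c.pullbackCan ψ x).det ≠ ⊤ := by
    have h1 := chart_lintegral_le_tensorVolume (k := fun c => c.pullbackCan ψ) hc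
      (A := univ) MeasurableSet.univ
    rw [preimage_univ, withDensity_apply _ MeasurableSet.univ, Measure.restrict_univ] at h1
    intro h2
    rw [h2, ENNReal.mul_top (ENNReal.inv_ne_zero.2 c.card_ne_top)] at h1
    exact hfin (top_le_iff.1 h1)
  refine (locallyIntegrableOn_iff isOpen_interior.isLocallyClosed).2 fun K hK hKc => ?_
  have hKd := hK.trans interior_subset
  refine ⟨(measurable_fderiv ℝ _).aestronglyMeasurable, ?_⟩
  rcases K.eq_empty_or_nonempty with rfl | hne
  · simp [HasFiniteIntegral]
  obtain ⟨x₀, hx₀, hmin⟩ := hKc.exists_isMinOn hne (c.continuousOn_sqrt_det.mono hKd)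
  obtain ⟨C, hC⟩ := hKc.exists_bound_of_continuousOn (c.continuousOn_trace.mono hKd)
  have hδ := c.sqrt_det_pos (hKd hx₀)
  set δ := √(c.metric x₀).det with hδd
  have hC0 : 0 ≤ C := (norm_nonneg _).trans (hC x₀ hx₀)
  set D := √((m : ℝ) * C * m) with hD
  have hbound : ∀ᵐ x ∂(volume.restrict K), ‖fderiv ℝ (coord ψ i ∘ c.proj) x‖ₑ ≤
      ofReal D * (1 + ofReal δ⁻¹ * ofReal √(c.pullbackCan ψ x).det) := by
    have h1 := ae_restrict_of_ae_restrict_of_subset hKd (h.ae_good hc)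
    filter_upwards [h1, ae_restrict_mem hKc.isClosed.measurableSet] with x hx hxK
    obtain ⟨ρ, hρ, hρe⟩ := h.conformal c hc x (hKd hxK) hx.2
    have hd := (h.contDiffAt hc hx.1 hx.2).differentiableAt one_ne_zero
    have h2 := sum_cometric_coord hx.1 hd hρe
    have h3 : c.cometric x (fderiv ℝ (coord ψ i ∘ c.proj) x) (fderiv ℝ (coord ψ i ∘ c.proj) x) ≤
        m * ρ := by
      rw [← h2]
      exact Finset.single_le_sum (f := fun i => c.cometric x (fderiv ℝ (coord ψ i ∘ c.proj) x)
        (fderiv ℝ (coord ψ i ∘ c.proj) x)) (fun j _ => c.cometric_self_nonneg (hKd hxK) _)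
        (Finset.mem_univ i)
    have h4 := c.sq_norm_le_cometric (hKd hxK) (fderiv ℝ (coord ψ i ∘ c.proj) x)
    have htr : (c.metric x).trace ≤ C := (le_abs_self _).trans (hC x hxK)
    have htr0 := c.trace_metric_nonneg (hKd hxK)
    have h0 := c.cometric_self_nonneg (hKd hxK) (fderiv ℝ (coord ψ i ∘ c.proj) x)
    have h5 : ‖fderiv ℝ (coord ψ i ∘ c.proj) x‖ ≤ D * √ρ := by
      rw [hD, ← Real.sqrt_mul (by positivity)]
      refine Real.le_sqrt_of_sq_le (h4.trans ?_)
      calc _ ≤ m * C * (m * ρ) := by gcongr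
        _ = _ := by ring
    have h6 : √ρ ≤ 1 + δ⁻¹ * √(c.pullbackCan ψ x).det := by
      rw [sqrt_det_pullbackCan hρ.le hρe]
      have hδx : δ ≤ √(c.metric x).det := hmin hxK
      -- For `ρ ≤ 1` the constant suffices; for `ρ ≥ 1` the exponent `m / 2` is at least `1 / 2`,
      -- which uses `1 ≤ m`.
      have h7 : √ρ ≤ 1 + ρ ^ ((m : ℝ) / 2) := by
        rw [Real.sqrt_eq_rpow]
        rcases le_total ρ 1 with h8 | h8
        · have : ρ ^ (1 / 2 : ℝ) ≤ 1 := Real.rpow_le_one hρ.le h8 (by norm_num)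
          have := Real.rpow_nonneg hρ.le ((m : ℝ) / 2)
          linarith
        · have : ρ ^ (1 / 2 : ℝ) ≤ ρ ^ ((m : ℝ) / 2) := by
            refine Real.rpow_le_rpow_of_exponent_le h8 ?_
            have : (1 : ℝ) ≤ m := by exact_mod_cast hm
            linarith
          linarith
      refine h7.trans ?_
      have h9 := Real.rpow_nonneg hρ.le ((m : ℝ) / 2)
      have h10 : 1 ≤ δ⁻¹ * √(c.metric x).det := by
        rw [inv_mul_eq_div, le_div_iff₀ hδ, one_mul]; exact hδx
      nlinarith
    rw [← ofReal_norm, ← ofReal_mul (by positivity), ← ENNReal.ofReal_one,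
      ← ENNReal.ofReal_add (by positivity) (by positivity), ← ofReal_mul (by positivity)]
    exact ofReal_le_ofReal (h5.trans (by gcongr))
  refine (lintegral_mono_ae hbound).trans_lt ?_
  rw [lintegral_const_mul' _ _ ofReal_ne_top]
  refine ENNReal.mul_lt_top ofReal_lt_top ?_
  rw [lintegral_add_left measurable_const, lintegral_const_mul' _ _ ofReal_ne_top]
  refine ENNReal.add_lt_top.2 ⟨?_, ENNReal.mul_lt_top ofReal_lt_top ?_⟩
  · rw [setLIntegral_const, one_mul]; exact hKc.measure_lt_top
  · exact (lintegral_mono_set hKd).trans_lt hdens.lt_top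

lemma hasChartGrad_coord (hm : 1 ≤ m) (h : O.IsPCOff ψ S)
    (hfin : O.tensorVolume (fun c => c.pullbackCan ψ) univ ≠ ⊤) (i : Fin (n + 1)) :
    O.HasChartGrad (coord ψ i) fun c => fderiv ℝ (coord ψ i ∘ c.proj) := by
  intro c hc
  refine HasWeakFDerivOn.of_differentiableAt_off hm isOpen_interior ?_ (h.sigmaFinite c hc) ?_
    (h.locallyIntegrableOn_fderiv_coord hm hfin hc i)
  · have h1 : Continuous (coord ψ i) := (EuclideanSpace.proj i : 𝔼^(n + 1) →L[ℝ] ℝ).continuous.comp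
        (continuous_subtype_val.comp h.continuous)
    exact h1.comp_continuousOn (c.continuousOn_proj.mono interior_subset)
  · intro x hx hxS
    exact (fderiv_coord ((h.contDiffAt hc hx fun hs => hxS ⟨interior_subset hx,
      hs⟩).differentiableAt
      one_ne_zero) i).differentiableAt

/-- The conformal factor of a piecewise conformal map of finite volume. -/
theorem exists_conformal_factor (hm : 1 ≤ m) (h : O.IsPCOff ψ S)
    (hfin : O.tensorVolume (fun c => c.pullbackCan ψ) univ ≠ ⊤) :
    ∃ ρ : X → ℝ, Measurable ρ ∧ (∀ p, 0 ≤ ρ p) ∧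
      (∀ᵐ p ∂O.vol, ∑ i, O.gradInner (coord ψ i) (coord ψ i) p = m * ρ p) ∧
      (∀ c ∈ O.atlas, ∀ᵐ x ∂(volume.restrict c.dom),
        c.pullbackCan ψ x = ρ (c.proj x) • c.metric x) ∧
      ∫⁻ p, ofReal (ρ p ^ ((m : ℝ) / 2)) ∂O.vol ≤
        O.tensorVolume (fun c => c.pullbackCan ψ) univ := by
  have hm0 : (m : ℝ) ≠ 0 := by
    have : m ≠ 0 := by omega
    exact_mod_cast this
  have hg := h.hasChartGrad_coord hm hfin
  -- The factor is recovered from the gradients of the coordinates, which makes it a measurable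
  -- function on `X`. The maximum with zero gives nonnegativity everywhere and changes nothing
  -- almost everywhere.
  set ρ : X → ℝ := fun p => max 0 ((m : ℝ)⁻¹ * ∑ i, O.gradInner (coord ψ i) (coord ψ i) p) with hρ
  have hρm : Measurable ρ := by
    refine measurable_const.max (Measurable.const_mul ?_ _)
    exact Finset.measurable_fun_sum _ fun i _ => ((hg i).gradInner (hg i)).1
  have hchart : ∀ c ∈ O.atlas, ∀ᵐ x ∂(volume.restrict c.dom),
      ∑ i, O.gradInner (coord ψ i) (coord ψ i) (c.proj x) = m * ρ (c.proj x) ∧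
      c.pullbackCan ψ x = ρ (c.proj x) • c.metric x := by
    intro c hc
    have h1 : ∀ᵐ x ∂(volume.restrict c.dom), ∀ i, O.gradInner (coord ψ i) (coord ψ i) (c.proj x) =
        c.cometric x (fderiv ℝ (coord ψ i ∘ c.proj) x) (fderiv ℝ (coord ψ i ∘ c.proj) x) :=
      ae_all_iff.2 fun i => (hg i).gradInner_ae (hg i) hc
    filter_upwards [h1, h.ae_good hc] with x hx hxg
    obtain ⟨r, hr, hre⟩ := h.conformal c hc x (interior_subset hxg.1) hxg.2
    have h2 := sum_cometric_coord hxg.1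
      ((h.contDiffAt hc hxg.1 hxg.2).differentiableAt one_ne_zero) hre
    have h3 : ∑ i, O.gradInner (coord ψ i) (coord ψ i) (c.proj x) = m * r := by
      rw [← h2]
      exact sum_congr rfl fun i _ => hx i
    have h4 : ρ (c.proj x) = r := by
      simp only [hρ]
      rw [h3, ← mul_assoc, inv_mul_cancel₀ hm0, one_mul, max_eq_right hr.le]
    rw [h4]
    exact ⟨h3, hre⟩
  refine ⟨ρ, hρm, fun p => le_max_left _ _, O.ae_vol_iff.2 fun c hc => (hchart c hc).mono
    fun x hx => hx.1, fun c hc => (hchart c hc).mono fun x hx => hx.2, ?_⟩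
  refine lintegral_le_tensorVolume (hρm.pow_const _).ennreal_ofReal fun c hc => ?_
  filter_upwards [hchart c hc] with x hx
  rw [sqrt_det_pullbackCan (le_max_left _ _) hx.2, ofReal_mul
    (Real.rpow_nonneg (le_max_left _ _) _)]

end IsPCOff

end measure

end pc

end RiemannianOrbifold

/-! ### Lorentz boosts and their action on the sphere. -/

section boost

variable {E : Type*} [NormedAddCommGroup E] [InnerProductSpace ℝ E]

/-- The dilation factor of the Lorentz boost with velocity `a` at a point of the sphere. -/
noncomputable def boostFactor (a y : E) : ℝ := √(1 + ‖a‖ ^ 2) + inner ℝ a y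

/-- The conformal map of the sphere induced by the Lorentz boost with velocity `a`. -/
noncomputable def boostMap (a y : E) : E :=
  (boostFactor a y)⁻¹ • (y + (1 + inner ℝ a y / (1 + √(1 + ‖a‖ ^ 2))) • a)

lemma one_le_sqrt_one_add_sq (a : E) : 1 ≤ √(1 + ‖a‖ ^ 2) :=
  Real.one_le_sqrt.2 (by nlinarith [sq_nonneg ‖a‖])

lemma norm_lt_sqrt_one_add_sq (a : E) : ‖a‖ < √(1 + ‖a‖ ^ 2) := Real.lt_sqrt_of_sq_lt (by linarith)

lemma abs_inner_le_of_norm_eq_one (a : E) {y : E} (hy : ‖y‖ = 1) : |inner ℝ a y| ≤ ‖a‖ := by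
  simpa [hy] using abs_real_inner_le_norm a y

lemma boostFactor_pos (a : E) {y : E} (hy : ‖y‖ = 1) : 0 < boostFactor a y := by
  have h1 := neg_le_of_abs_le (abs_inner_le_of_norm_eq_one a hy)
  have h2 := norm_lt_sqrt_one_add_sq a
  unfold boostFactor
  linarith

/-- The space component of the Lorentz boost. -/
noncomputable def boostSpace (a x : E) (t : ℝ) : E :=
  x + (t + inner ℝ a x / (1 + √(1 + ‖a‖ ^ 2))) • a

/-- The boost is an isometry of the Lorentzian form, in polarised version. That it preserves the
sphere and is conformal on it are both consequences. -/
lemma inner_boostSpace (a x x' : E) (t t' : ℝ) : inner ℝ (boostSpace a x t) (boostSpace a x' t') -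
      (√(1 + ‖a‖ ^ 2) * t + inner ℝ a x) * (√(1 + ‖a‖ ^ 2) * t' + inner ℝ a x') =
      inner ℝ x x' - t * t' := by
  have hs := Real.sq_sqrt (show 0 ≤ 1 + ‖a‖ ^ 2 by positivity)
  have h1 := one_le_sqrt_one_add_sq a
  unfold boostSpace
  set s := √(1 + ‖a‖ ^ 2)
  have ha : inner ℝ a a = s ^ 2 - 1 := by rw [real_inner_self_eq_norm_sq]; linarith
  simp only [inner_add_left, inner_add_right, inner_smul_left, inner_smul_right, ha,
    conj_trivial, real_inner_comm a x]
  have : 1 + s ≠ 0 := by positivity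
  field_simp
  ring

lemma boostMap_eq (a y : E) : boostMap a y = (boostFactor a y)⁻¹ • boostSpace a y 1 := rfl

lemma norm_boostMap (a : E) {y : E} (hy : ‖y‖ = 1) : ‖boostMap a y‖ = 1 := by
  have h := inner_boostSpace a y y 1 1
  have hT := boostFactor_pos a hy
  rw [real_inner_self_eq_norm_sq, real_inner_self_eq_norm_sq, hy] at h
  have h2 : ‖boostSpace a y 1‖ = boostFactor a y := by
    rw [← abs_of_pos hT, ← abs_of_nonneg (norm_nonneg (boostSpace a y 1)),
      ← sq_eq_sq_iff_abs_eq_abs]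
    unfold boostFactor
    nlinarith
  rw [boostMap_eq, norm_smul, norm_inv, h2, Real.norm_of_nonneg hT.le, inv_mul_cancel₀ hT.ne']

lemma hasFDerivAt_boostMap (a : E) {y : E} (hy : boostFactor a y ≠ 0) :
    ∃ D : E →L[ℝ] E, HasFDerivAt (boostMap a) D y ∧ ∀ v, D v =
      (boostFactor a y)⁻¹ • boostSpace a v 0 -
        (inner ℝ a v / boostFactor a y ^ 2) • boostSpace a y 1 := by
  have h1 : HasFDerivAt (boostFactor a) (innerSL ℝ a) y := by
    have := (innerSL ℝ a).hasFDerivAt (x := y)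
    exact this.const_add _
  have h2 : HasFDerivAt (fun y => boostSpace a y 1)
      (ContinuousLinearMap.id ℝ E + ((1 + √(1 + ‖a‖ ^ 2))⁻¹ • innerSL ℝ a).smulRight a) y := by
    have h3 : HasFDerivAt (fun y => (1 + √(1 + ‖a‖ ^ 2))⁻¹ * inner ℝ a y)
        ((1 + √(1 + ‖a‖ ^ 2))⁻¹ • innerSL ℝ a) y := ((innerSL ℝ a).hasFDerivAt (x := y)).const_mul _
    have h4 := (hasFDerivAt_id y).add ((h3.const_add 1).smul_const a)
    refine h4.congr_of_eventuallyEq (Eventually.of_forall fun z => ?_)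
    change boostSpace a z 1 = z + (1 + (1 + √(1 + ‖a‖ ^ 2))⁻¹ * inner ℝ a z) • a
    rw [boostSpace, div_eq_inv_mul]
  have h5 := ((hasDerivAt_inv hy).comp_hasFDerivAt y h1).smul h2
  refine ⟨_, h5, fun v => ?_⟩
  simp only [Function.comp, boostSpace, add_apply, smul_apply, ContinuousLinearMap.smulRight_apply,
    ContinuousLinearMap.id_apply, innerSL_apply_apply, smul_eq_mul]
  rw [sub_eq_add_neg, ← neg_smul]
  congr 2
  · congr 2; ring
  · ring

/-- The vector `(y, 1)` is null, and for tangent `v` the vector `(v, 0)` is Lorentz-orthogonal to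
it. The boost preserves these relations, which evaluates the four inner products in the expanded
differential; all terms other than the multiple of `⟨v, w⟩` cancel. -/
lemma inner_fderiv_boostMap (a : E) {y v w : E} (hy : ‖y‖ = 1) (hv : inner ℝ y v = (0 : ℝ))
    (hw : inner ℝ y w = (0 : ℝ)) :
    inner ℝ (fderiv ℝ (boostMap a) y v) (fderiv ℝ (boostMap a) y w) =
      (boostFactor a y ^ 2)⁻¹ * inner ℝ v w := by
  have hT := boostFactor_pos a hy
  obtain ⟨D, hD, hDv⟩ := hasFDerivAt_boostMap a hT.ne'
  rw [hD.fderiv, hDv, hDv]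
  have e1 := inner_boostSpace a v w 0 0
  have e2 := inner_boostSpace a v y 0 1
  have e3 := inner_boostSpace a y w 1 0
  have e4 := inner_boostSpace a y y 1 1
  rw [real_inner_comm] at hv
  have hF : √(1 + ‖a‖ ^ 2) * 1 + inner ℝ a y = boostFactor a y := by rw [mul_one]; rfl
  rw [hF] at e2 e3 e4
  rw [real_inner_self_eq_norm_sq y, hy] at e4
  rw [hv] at e2
  rw [hw] at e3
  have f1 : inner ℝ (boostSpace a v 0) (boostSpace a w 0) = inner ℝ v w +
    inner ℝ a v * inner ℝ a w := by linarith
  have f2 : inner ℝ (boostSpace a v 0) (boostSpace a y 1) = inner ℝ a v * boostFactor a y := by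
    linarith
  have f3 : inner ℝ (boostSpace a y 1) (boostSpace a w 0) = boostFactor a y * inner ℝ a w := by
    linarith
  have f4 : inner ℝ (boostSpace a y 1) (boostSpace a y 1) = boostFactor a y * boostFactor a y := by
    linarith
  simp only [inner_sub_left, inner_sub_right, inner_smul_left, inner_smul_right, conj_trivial,
    f1, f2, f3, f4]
  field_simp
  ring

lemma contDiffAt_boostMap (a : E) {y : E} (hy : boostFactor a y ≠ 0) :
    ContDiffAt ℝ 1 (boostMap a) y := by
  have h1 : ContDiff ℝ 1 (fun y : E => inner ℝ a y) := (innerSL ℝ a).contDiff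
  have h2 : ContDiffAt ℝ 1 (boostFactor a) y := contDiffAt_const.add h1.contDiffAt
  exact (h2.inv hy).smul (contDiffAt_id.add
    ((contDiffAt_const.add (h1.contDiffAt.div_const _)).smul contDiffAt_const))

end boost

section sphere

variable {n : ℕ}

/-- The Lorentz boost acting on the unit sphere. -/
noncomputable def sphereBoost (a : 𝔼^(n + 1)) (y : UnitSphere n) :
    UnitSphere n :=
  ⟨boostMap a y, by rw [mem_sphere_zero_iff_norm, norm_boostMap a (norm_eq_of_mem_sphere y)]⟩

lemma isMoebius_sphereBoost (a : 𝔼^(n + 1)) : IsMoebius (sphereBoost a) := by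
  refine ⟨{ toFun := fun z => (boostSpace a z.1 z.2, √(1 + ‖a‖ ^ 2) * z.2 + inner ℝ a z.1)
            map_add' := fun z w => ?_
            map_smul' := fun r z => ?_ }, fun z => ?_, fun x => ?_⟩
  · refine Prod.ext ?_ ?_
    · simp only [boostSpace, Prod.fst_add, Prod.snd_add, inner_add_right]
      module
    · simp only [Prod.fst_add, Prod.snd_add, inner_add_right]
      ring
  · refine Prod.ext ?_ ?_
    · simp only [boostSpace, Prod.smul_fst, Prod.smul_snd, inner_smul_right, smul_eq_mul,
        RingHom.id_apply]
      module
    · simp only [Prod.smul_fst, Prod.smul_snd, inner_smul_right, smul_eq_mul, RingHom.id_apply]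
      ring
  · have h := inner_boostSpace a z.1 z.1 z.2 z.2
    rw [real_inner_self_eq_norm_sq, real_inner_self_eq_norm_sq] at h
    change ‖boostSpace a z.1 z.2‖ ^ 2 - (√(1 + ‖a‖ ^ 2) * z.2 + inner ℝ a z.1) ^ 2 = _
    rw [sq (√(1 + ‖a‖ ^ 2) * z.2 + inner ℝ a z.1), h, sq z.2]
  · change boostMap a _ = (√(1 + ‖a‖ ^ 2) * 1 + inner ℝ a _)⁻¹ • boostSpace a _ 1
    rw [mul_one]
    rfl

lemma continuous_sphereBoost (a : 𝔼^(n + 1)) : Continuous (sphereBoost a) := by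
  refine Continuous.subtype_mk (continuous_iff_continuousAt.2 fun y => ?_) _
  exact ContinuousAt.comp (f := fun y : UnitSphere n => (y : 𝔼^(n + 1)))
    (contDiffAt_boostMap a (boostFactor_pos a (norm_eq_of_mem_sphere y)).ne').continuousAt
    continuous_subtype_val.continuousAt

end sphere

namespace RiemannianOrbifold

variable {m n : ℕ} {X : Type*} [TopologicalSpace X] {O : RiemannianOrbifold m X}
  {ψ : X → UnitSphere n} {S : Set X} {c : Chart m X}

lemma norm_lift (ψ : X → UnitSphere n) (x : ℝ^m) : ‖c.lift ψ x‖ = 1 :=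
  norm_eq_of_mem_sphere (ψ (c.proj x))

/-- Differentiation of `‖ψ‖² = 1` within the domain, whose differentials are unique also at boundary
points. It gives the tangency needed for conformality of boosts. -/
lemma inner_lift_fderivWithin {x : ℝ^m} (hx : x ∈ c.dom)
    (hd : DifferentiableWithinAt ℝ (c.lift ψ) c.dom x) (v : ℝ^m) :
    inner ℝ (c.lift ψ x) (fderivWithin ℝ (c.lift ψ) c.dom x v) = (0 : ℝ) := by
  have h1 := hd.hasFDerivWithinAt.norm_sq
  have h2 : HasFDerivWithinAt (fun z => ‖c.lift ψ z‖ ^ 2) (0 : ℝ^m →L[ℝ] ℝ) c.dom x := by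
    simp only [norm_lift]
    exact hasFDerivWithinAt_const _ _ _
  have h3 := (c.uniqueDiffOn_dom x hx).eq h1 h2
  have h4 := congrArg (fun L => L v) h3
  simp only [smul_apply, ContinuousLinearMap.comp_apply, innerSL_apply_apply, zero_apply] at h4
  simpa using h4

lemma pullbackCan_sphereBoost (a : 𝔼^(n + 1)) {x : ℝ^m}
    (hx : x ∈ c.dom) (hd : DifferentiableWithinAt ℝ (c.lift ψ) c.dom x) :
    c.pullbackCan (sphereBoost a ∘ ψ) x =
      (boostFactor a (c.lift ψ x) ^ 2)⁻¹ • c.pullbackCan ψ x := by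
  have hT := (boostFactor_pos a (norm_lift (c := c) ψ x)).ne'
  have h1 : fderivWithin ℝ (c.lift (sphereBoost a ∘ ψ)) c.dom x =
      (fderiv ℝ (boostMap a) (c.lift ψ x)).comp (fderivWithin ℝ (c.lift ψ) c.dom x) :=
    fderiv_comp_fderivWithin x ((contDiffAt_boostMap a hT).differentiableAt one_ne_zero) hd
      (c.uniqueDiffOn_dom x hx)
  ext i j
  rw [Matrix.smul_apply, smul_eq_mul, RiemannianOrbifoldChart.pullbackCan,
    RiemannianOrbifoldChart.pullbackCan, Matrix.of_apply, Matrix.of_apply, h1,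
    ContinuousLinearMap.comp_apply, ContinuousLinearMap.comp_apply,
    inner_fderiv_boostMap a (norm_lift ψ x) (inner_lift_fderivWithin hx hd _)
      (inner_lift_fderivWithin hx hd _)]

lemma IsPCOff.sphereBoost (h : O.IsPCOff ψ S) (a : 𝔼^(n + 1)) :
    O.IsPCOff (sphereBoost a ∘ ψ) S where
  continuous := (continuous_sphereBoost a).comp h.continuous
  isClosed := h.isClosed
  sigmaFinite := h.sigmaFinite
  contDiff c hc x hx hxS :=
    (contDiffAt_boostMap a (boostFactor_pos a (norm_lift ψ x)).ne').comp_contDiffWithinAt x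
      (h.contDiff c hc x hx hxS)
  conformal c hc x hx hxS := by
    obtain ⟨ρ, hρ, hρe⟩ := h.conformal c hc x hx hxS
    have hT := boostFactor_pos a (norm_lift (c := c) ψ x)
    exact ⟨(boostFactor a (c.lift ψ x) ^ 2)⁻¹ * ρ, by positivity, by
      rw [pullbackCan_sphereBoost a hx ((h.contDiff c hc x hx hxS).differentiableWithinAt
        one_ne_zero), hρe, smul_smul]⟩

/-- A conformal immersion has injective differential. -/
lemma IsPCOff.exists_antilipschitzWith_fderiv (h : O.IsPCOff ψ S) (hc : c ∈ O.atlas) {x : ℝ^m}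
    (hx : x ∈ interior c.dom) (hxS : c.proj x ∉ S) :
    ∃ K, AntilipschitzWith K (fderiv ℝ (c.lift ψ) x) := by
  obtain ⟨ρ, hρ, hρe⟩ := h.conformal c hc x (interior_subset hx) hxS
  set f := fderiv ℝ (c.lift ψ) x with hf
  have h1 : ∀ v : ℝ^m, v ⬝ᵥ (c.pullbackCan ψ x).mulVec v = inner ℝ (f v) (f v) := by
    intro v
    have h2 : f v = ∑ i, v i • f (Pi.single i 1) := by
      conv_lhs => rw [pi_eq_sum_univ v, map_sum]
      refine sum_congr rfl fun i _ => ?_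
      rw [map_smul]
      congr 2
      ext j
      rw [Pi.single_apply]
      simp [eq_comm]
    rw [h2, sum_inner]
    refine sum_congr rfl fun i _ => ?_
    rw [inner_sum, Matrix.mulVec, dotProduct, mul_sum]
    refine sum_congr rfl fun j _ => ?_
    rw [pullbackCan_eq hx, inner_smul_left, inner_smul_right, conj_trivial]
    ring
  have hker : LinearMap.ker (f : ℝ^m →ₗ[ℝ] 𝔼^(n + 1)) = ⊥ := by
    rw [LinearMap.ker_eq_bot']
    intro v hv
    by_contra hne
    have h3 := (c.posDef_metric x (interior_subset hx)).dotProduct_mulVec_pos hne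
    have h4 := h1 v
    have hv' : f v = 0 := hv
    rw [hρe, hv', inner_zero_left, Matrix.smul_mulVec, dotProduct_smul, smul_eq_mul] at h4
    have h5 : (star v) = v := star_trivial v
    rw [h5] at h3
    have := mul_pos hρ h3
    linarith
  obtain ⟨K, -, hK⟩ := LinearMap.exists_antilipschitzWith (f : ℝ^m →ₗ[ℝ] 𝔼^(n + 1)) hker
  exact ⟨K, hK⟩

lemma IsPCOff.eventually_ne (h : O.IsPCOff ψ S) (hc : c ∈ O.atlas) {x : ℝ^m}
    (hx : x ∈ interior c.dom) (hxS : c.proj x ∉ S) (y : 𝔼^(n + 1)) :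
    ∀ᶠ z in 𝓝[≠] x, c.lift ψ z ≠ y :=
  ((h.contDiffAt hc hx hxS).differentiableAt one_ne_zero).hasFDerivAt.eventually_ne
    (h.exists_antilipschitzWith_fderiv hc hx hxS)

variable [T2Space X] [MeasurableSpace X] [BorelSpace X] [CompactSpace X] [Nonempty X]

/-- Off the walls the differential is injective, so a fibre has no accumulation point there and is
locally a single point, which is null in positive dimension. Hence the volume measure pushed to the
sphere has no atoms. -/
lemma IsPCOff.vol_fiber_eq_zero [NeZero m] (h : O.IsPCOff ψ S) (y : 𝔼^(n + 1)) :
    O.vol {p | (ψ p : 𝔼^(n + 1)) = y} = 0 := by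
  have h1 : ∀ᵐ p ∂O.vol, (ψ p : 𝔼^(n + 1)) ≠ y := by
    refine O.ae_vol_iff.2 fun c hc => ?_
    have h2 : volume {x | x ∈ interior c.dom ∧ c.proj x ∉ S ∧ c.lift ψ x = y} = 0 := by
      refine measure_null_of_locally_null _ fun x hx => ⟨{x}, ?_, measure_singleton x⟩
      have h3 := eventually_nhdsWithin_iff.1 (h.eventually_ne hc hx.1 hx.2.1 y)
      refine mem_nhdsWithin_iff_eventually.2 (h3.mono fun z hz hzm => ?_)
      by_contra hne
      exact hz hne hzm.2.2
    have h4 := measure_eq_zero_iff_ae_notMem.1 h2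
    filter_upwards [h.ae_good hc, ae_restrict_of_ae h4] with x hx hx'
    exact fun he => hx' ⟨hx.1, hx.2, he⟩
  rw [ae_iff] at h1
  simpa using h1

end RiemannianOrbifold

/-- Replacing `⟨a, y⟩` by the boost factor minus `√(1 + |a|²)` leaves an expression that depends on
`y` only through `T⁻¹ y` and `T⁻¹`, where `T` is the boost factor. These are the quantities the
Euler equation controls. -/
lemma boostMap_eq_add {F : Type*} [NormedAddCommGroup F] [InnerProductSpace ℝ F] (a : F) {y : F}
    (hT : boostFactor a y ≠ 0) : boostMap a y = (boostFactor a y)⁻¹ • y +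
      ((boostFactor a y)⁻¹ * (1 + √(1 + ‖a‖ ^ 2))⁻¹ + (1 + √(1 + ‖a‖ ^ 2))⁻¹) • a := by
  have h1 : inner ℝ a y = boostFactor a y - √(1 + ‖a‖ ^ 2) := by
    unfold boostFactor
    ring
  have h3 : 1 + √(1 + ‖a‖ ^ 2) ≠ 0 := by positivity
  rw [boostMap, h1, smul_add, smul_smul]
  congr 2
  field_simp
  ring

/-! ### The conformal barycentre. -/

section barycenter

variable {n : ℕ} {X : Type*} [TopologicalSpace X] [CompactSpace X] [MeasurableSpace X]
  [BorelSpace X] {ν : Measure X} [IsFiniteMeasure ν] {ψ : X → UnitSphere n}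

local notation "E" => 𝔼^(n + 1)

lemma continuous_boostFactor_comp (hψ : Continuous ψ) :
    Continuous fun z : E × X => boostFactor z.1 (ψ z.2 : E) := by
  have hval : Continuous fun p => (ψ p : E) := continuous_subtype_val.comp hψ
  unfold boostFactor
  fun_prop

lemma continuous_boostFactor_comp_left (hψ : Continuous ψ) (a : E) :
    Continuous fun p => boostFactor a (ψ p : E) := by
  have hval : Continuous fun p => (ψ p : E) := continuous_subtype_val.comp hψ
  unfold boostFactor
  fun_prop

lemma boostFactor_comp_pos (a : E) (p : X) : 0 < boostFactor a (ψ p : E) :=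
  boostFactor_pos a (norm_eq_of_mem_sphere (ψ p))

lemma integrable_of_continuous_of_compactSpace {F : Type*} [NormedAddCommGroup F]
    [SecondCountableTopology F] {f : X → F} (hf : Continuous f) : Integrable f ν := by
  borelize F
  obtain ⟨C, hC⟩ := isCompact_univ.exists_bound_of_continuousOn hf.continuousOn
  exact ⟨hf.measurable.aestronglyMeasurable,
    HasFiniteIntegral.of_bounded (C := C) (Eventually.of_forall fun p => hC p (mem_univ p))⟩

/-- Small caps carry uniformly little mass if there are no atoms. -/
lemma exists_forall_measure_cap_le (hψ : Continuous ψ)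
    (hatom : ∀ y : E, ν {p | (ψ p : E) = y} = 0) {κ : ℝ≥0∞} (hκ : 0 < κ) :
    ∃ ε > 0, ∀ e : E, ‖e‖ = 1 → ν {p | 1 + inner ℝ e (ψ p : E) < ε} ≤ κ := by
  have hval : Continuous fun p => (ψ p : E) := continuous_subtype_val.comp hψ
  have hmeas : ∀ (e : E) (ε : ℝ), MeasurableSet {p | 1 + inner ℝ e (ψ p : E) < ε} := fun e ε =>
    (isOpen_lt (by fun_prop) continuous_const).measurableSet
  have key : ∃ ε > 0, ∀ e ∈ Metric.sphere (0 : E) 1, ν {p | 1 + inner ℝ e (ψ p : E) < ε} ≤ κ := by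
    refine (isCompact_sphere (0 : E) 1).induction_on
      (p := fun s => ∃ ε > 0, ∀ e ∈ s, ν {p | 1 + inner ℝ e (ψ p : E) < ε} ≤ κ)
      ⟨1, one_pos, fun e he => he.elim⟩ (fun s t hst ⟨ε, hε, h⟩ => ⟨ε, hε, fun e he => h e
        (hst he)⟩)
      ?_ ?_
    · rintro s t ⟨ε, hε, h⟩ ⟨ε', hε', h'⟩
      refine ⟨min ε ε', lt_min hε hε', fun e he => ?_⟩
      rcases he with he | he
      · exact (measure_mono (show {p | 1 + inner ℝ e (ψ p : E) < min ε ε'} ⊆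
          {p | 1 + inner ℝ e (ψ p : E) < ε} from fun p hp =>
            show 1 + inner ℝ e (ψ p : E) < ε from lt_of_lt_of_le hp (min_le_left _ _))).trans
              (h e he)
      · exact (measure_mono (show {p | 1 + inner ℝ e (ψ p : E) < min ε ε'} ⊆
          {p | 1 + inner ℝ e (ψ p : E) < ε'} from fun p hp =>
            show 1 + inner ℝ e (ψ p : E) < ε' from lt_of_lt_of_le hp (min_le_right _ _))).trans
              (h' e he)
    · intro e he
      -- The caps around `-e` shrink to a point, which carries no mass. Halving the size of a cap
      -- lets one bound serve all directions near `e`, and compactness of the sphere makes it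
      -- uniform.
      have hlim := tendsto_measure_iInter_atTop (μ := ν)
        (s := fun k : ℕ => {p | 1 + inner ℝ e (ψ p : E) < 1 / ((k : ℝ) + 1)})
        (fun k => (hmeas e _).nullMeasurableSet)
        (fun k l hkl p (hp : 1 + inner ℝ e (ψ p : E) < 1 / ((l : ℝ) + 1)) =>
          show 1 + inner ℝ e (ψ p : E) < 1 / ((k : ℝ) + 1) from lt_of_lt_of_le hp (by gcongr)) ⟨0,
            measure_ne_top _ _⟩
      have h0 : ν (⋂ k : ℕ, {p | 1 + inner ℝ e (ψ p : E) < 1 / ((k : ℝ) + 1)}) = 0 := by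
        refine measure_mono_null (show _ ⊆ {p | (ψ p : E) = -e} from fun p hp => ?_) (hatom (-e))
        have h1 : 1 + inner ℝ e (ψ p : E) ≤ 0 := by
          refine ge_of_tendsto' tendsto_one_div_add_atTop_nhds_zero_nat fun k => ?_
          exact (mem_iInter.1 hp k).le
        have he1 : ‖e‖ = 1 := mem_sphere_zero_iff_norm.1 he
        have hp1 : ‖(ψ p : E)‖ = 1 := norm_eq_of_mem_sphere (ψ p)
        have h2 := norm_add_sq_real e (ψ p : E)
        rw [he1, hp1] at h2
        have h3 : ‖e + (ψ p : E)‖ = 0 := by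
          have := norm_nonneg (e + (ψ p : E))
          nlinarith
        exact (neg_eq_of_add_eq_zero_right (norm_eq_zero.1 h3)).symm
      rw [h0] at hlim
      obtain ⟨k, hk⟩ := (hlim.eventually (gt_mem_nhds hκ)).exists
      refine ⟨ball e (1 / ((k : ℝ) + 1) / 2),
        mem_nhdsWithin_of_mem_nhds (ball_mem_nhds e (by positivity)),
        1 / ((k : ℝ) + 1) / 2, by positivity, fun e' he' => ?_⟩
      refine le_trans (measure_mono (show {p | 1 + inner ℝ e' (ψ p : E) < 1 / ((k : ℝ) + 1) / 2} ⊆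
        {p | 1 + inner ℝ e (ψ p : E) < 1 / ((k : ℝ) + 1)} from fun p hp => ?_)) hk.le
      rw [mem_ofPred_eq] at hp ⊢
      have h1 := abs_inner_le_of_norm_eq_one (e - e') (norm_eq_of_mem_sphere (ψ p))
      rw [inner_sub_left] at h1
      have h2 : ‖e - e'‖ < 1 / ((k : ℝ) + 1) / 2 := by rw [← dist_eq_norm, dist_comm]; exact he'
      have h3 := (le_abs_self _).trans h1
      linarith
  obtain ⟨ε, hε, h⟩ := key
  exact ⟨ε, hε, fun e he => h e (mem_sphere_zero_iff_norm.2 he)⟩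

/-- Off the cap around `-a / |a|` the logarithm is at least `log |a|` up to a constant; on it, at
least `-log(3 |a|)`. Since the cap carries at most a quarter of the total mass `V`, the integral
grows at least like `(V / 2) log |a|`. -/
lemma tendsto_integral_log_boostFactor (hψ : Continuous ψ)
    (hatom : ∀ y : E, ν {p | (ψ p : E) = y} = 0) (hν : ν univ ≠ 0) :
    Tendsto (fun a : E => ∫ p, log (boostFactor a (ψ p : E)) ∂ν) (cocompact E) atTop := by
  set V := ν.real univ with hV
  have hVpos : 0 < V := ENNReal.toReal_pos hν (measure_ne_top _ _)
  obtain ⟨ε, hε, hcap⟩ := exists_forall_measure_cap_le (κ := ofReal (V / 4)) hψ hatom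
    (ENNReal.ofReal_pos.2 (by positivity))
  have hbound : ∀ a : E, 1 ≤ ‖a‖ → V / 2 * log ‖a‖ + (V * min (log ε) 0 - V / 4 * log 3) ≤
      ∫ p, log (boostFactor a (ψ p : E)) ∂ν := by
    intro a ha
    set r := ‖a‖ with hr
    have hr0 : 0 < r := by linarith
    set A := {p | 1 + inner ℝ (r⁻¹ • a) (ψ p : E) < ε} with hA
    have hAm : MeasurableSet A := by
      have hval : Continuous fun p => (ψ p : E) := continuous_subtype_val.comp hψ
      exact (isOpen_lt (by fun_prop) continuous_const).measurableSet
    have hAV : ν.real A ≤ V / 4 := by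
      refine ENNReal.toReal_le_of_le_ofReal (by positivity) (hcap _ ?_)
      rw [norm_smul, norm_inv, norm_norm, inv_mul_cancel₀ hr0.ne']
    have hlr : 0 ≤ log r := Real.log_nonneg ha
    set δ := min (log ε) 0 with hδ
    have hl3 : 0 ≤ log 3 := Real.log_nonneg (by norm_num)
    have hpt : ∀ p, A.indicator (fun _ => -(2 * log r + δ + log 3)) p +
        (log r + δ) ≤ log (boostFactor a (ψ p : E)) := by
      intro p
      have hp1 : ‖(ψ p : E)‖ = 1 := norm_eq_of_mem_sphere (ψ p)
      have hs := norm_lt_sqrt_one_add_sq a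
      have hs2 := Real.sq_sqrt (show 0 ≤ 1 + ‖a‖ ^ 2 by positivity)
      have hT : boostFactor a (ψ p : E) = √(1 + ‖a‖ ^ 2) + inner ℝ a (ψ p : E) := rfl
      rw [← hr] at hs hs2 hT
      by_cases hp : p ∈ A
      · rw [indicator_of_mem hp]
        -- The factor is at least `√(1 + r²) - r = 1 / (√(1 + r²) + r)`, and `√(1 + r²) ≤ 2 r` for
        -- `r ≥ 1`.
        have h1 : (3 * r)⁻¹ ≤ boostFactor a (ψ p : E) := by
          have h2 := neg_le_of_abs_le (abs_inner_le_of_norm_eq_one a hp1)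
          rw [hT, inv_le_iff_one_le_mul₀ (by positivity)]
          have h3 : √(1 + r ^ 2) ≤ 2 * r := Real.sqrt_le_iff.2 ⟨by positivity, by nlinarith⟩
          nlinarith
        have h2 := Real.log_le_log (by positivity) h1
        rw [Real.log_inv, Real.log_mul (by norm_num) hr0.ne'] at h2
        linarith
      · rw [indicator_of_notMem hp]
        have h1 : ε ≤ 1 + r⁻¹ * inner ℝ a (ψ p : E) := by
          have := not_lt.1 (show ¬ (1 + inner ℝ (r⁻¹ • a) (ψ p : E) < ε) from hp)
          rwa [inner_smul_left, conj_trivial] at this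
        have h2 : ε * r ≤ boostFactor a (ψ p : E) := by
          have h3 : ε * r ≤ (1 + r⁻¹ * inner ℝ a (ψ p : E)) * r := by gcongr
          have h4 : (1 + r⁻¹ * inner ℝ a (ψ p : E)) * r = r + inner ℝ a (ψ p : E) := by field_simp
          rw [hT]
          linarith
        have h3 := Real.log_le_log (by positivity) h2
        rw [Real.log_mul hε.ne' hr0.ne'] at h3
        have : δ ≤ log ε := min_le_left _ _
        linarith
    have hcont : Continuous fun p => log (boostFactor a (ψ p : E)) :=
      (continuous_boostFactor_comp_left hψ a).log fun p => (boostFactor_comp_pos a p).ne'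
    have hint := integral_mono (μ := ν)
      (((integrable_const _).indicator hAm).add (integrable_const _))
      (integrable_of_continuous_of_compactSpace hcont) hpt
    refine le_trans ?_ hint
    have e1 : ∫ p, (A.indicator (fun _ => -(2 * log r + δ + log 3)) p +
        (log r + δ)) ∂ν = ν.real A * -(2 * log r + δ + log 3) +
        V * (log r + δ) := by
      rw [integral_add ((integrable_const _).indicator hAm) (integrable_const _),
        integral_indicator hAm, setIntegral_const, integral_const, smul_eq_mul, smul_eq_mul]
    refine le_trans ?_ (le_of_eq e1.symm)
    have hδ0 : δ ≤ 0 := min_le_right _ _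
    have hA0 : 0 ≤ ν.real A := measureReal_nonneg
    nlinarith [mul_le_mul_of_nonneg_right hAV (show 0 ≤ 2 * log r + log 3 by positivity),
      mul_nonneg hA0 (neg_nonneg.2 hδ0), mul_nonneg hVpos.le (neg_nonneg.2 hδ0)]
  have h1 : Tendsto (fun a : E => V / 2 * log ‖a‖ + (V * min (log ε) 0 -
      V / 4 * log 3)) (cocompact E) atTop :=
    tendsto_atTop_add_const_right _ _ ((Real.tendsto_log_atTop.comp
      tendsto_norm_cocompact_atTop).const_mul_atTop (by positivity))
  refine tendsto_atTop_mono' _ ?_ h1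
  filter_upwards [tendsto_norm_cocompact_atTop.eventually_ge_atTop 1] with a ha
  exact hbound a ha

/-- The function `b ↦ √(1 + |b|²) J + ⟨b, Y⟩` has a minimum at `a`, so its differential vanishes
there. This determines `Y`, and substituting it into the minimal value determines `V`. -/
lemma eq_neg_smul_of_forall_le {F : Type*} [NormedAddCommGroup F] [InnerProductSpace ℝ F]
    {a Y : F} {J V : ℝ} (heq : √(1 + ‖a‖ ^ 2) * J + inner ℝ a Y = V)
    (hmin : ∀ b : F, V ≤ √(1 + ‖b‖ ^ 2) * J + inner ℝ b Y) :
    Y = -((√(1 + ‖a‖ ^ 2))⁻¹ * J) • a ∧ V = J / √(1 + ‖a‖ ^ 2) := by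
  have hs1 := one_le_sqrt_one_add_sq a
  have hs2 : √(1 + ‖a‖ ^ 2) ^ 2 = 1 + ‖a‖ ^ 2 := Real.sq_sqrt (by positivity)
  have hcrit : ∀ b : F, (√(1 + ‖a‖ ^ 2))⁻¹ * inner ℝ a b * J + inner ℝ b Y = 0 := by
    intro b
    have h1 : HasDerivAt (fun τ : ℝ => a + τ • b) b 0 := by
      simpa using ((hasDerivAt_id (0 : ℝ)).smul_const b).const_add a
    have h2 := (h1.norm_sq.const_add 1).sqrt (by simp only [zero_smul, add_zero]; positivity)
    have h3 : HasDerivAt (fun τ : ℝ => inner ℝ (a + τ • b) Y) (inner ℝ b Y) 0 := by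
      have := h1.inner ℝ (hasDerivAt_const (0 : ℝ) Y)
      simpa using this
    have h4 := (h2.mul_const J).add h3
    have h5 : IsLocalMin ((fun τ : ℝ => √(1 + ‖a + τ • b‖ ^ 2) * J) +
        fun τ : ℝ => inner ℝ (a + τ • b) Y) 0 := by
      refine Eventually.of_forall fun τ => ?_
      simp only [Pi.add_apply, zero_smul, add_zero]
      rw [heq]
      exact hmin _
    have h6 := h5.hasDerivAt_eq_zero h4
    simp only [zero_smul, add_zero] at h6
    rw [← h6]
    field_simp
  have hYeq : Y = -((√(1 + ‖a‖ ^ 2))⁻¹ * J) • a := by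
    rw [neg_smul, eq_neg_iff_add_eq_zero]
    refine ext_inner_left ℝ fun b => ?_
    rw [inner_add_right, inner_smul_right, inner_zero_right, ← hcrit b, real_inner_comm a b]
    ring
  refine ⟨hYeq, ?_⟩
  have h1 : inner ℝ a Y = -((√(1 + ‖a‖ ^ 2))⁻¹ * J) * (√(1 + ‖a‖ ^ 2) ^ 2 - 1) := by
    rw [hs2, add_sub_cancel_left]
    conv_lhs => rw [hYeq]
    rw [inner_smul_right, real_inner_self_eq_norm_sq]
  rw [h1] at heq
  generalize √(1 + ‖a‖ ^ 2) = s at heq hs1 ⊢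
  rw [← heq]
  field_simp
  ring

/-- The inequality `log x ≤ x - 1` bounds the increment of the logarithmic integral by an explicit
function of `b` that touches it at `a`. The minimum property passes to that function, so no
differentiation under the integral is needed. -/
lemma integral_boostMap_eq_zero_of_forall_le (hψ : Continuous ψ) (a : E)
    (ha : ∀ b : E, ∫ p, log (boostFactor a (ψ p : E)) ∂ν ≤ ∫ p, log (boostFactor b (ψ p : E)) ∂ν) :
    ∫ p, boostMap a (ψ p : E) ∂ν = 0 := by
  have hcontT : ∀ a : E, Continuous fun p => boostFactor a (ψ p : E) :=
    continuous_boostFactor_comp_left hψ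
  have hval : Continuous fun p => (ψ p : E) := continuous_subtype_val.comp hψ
  obtain ⟨T, hT⟩ : ∃ T : X → ℝ, ∀ p, T p = boostFactor a (ψ p : E) := ⟨_, fun _ => rfl⟩
  have hTpos : ∀ p, 0 < T p := fun p => hT p ▸ boostFactor_comp_pos a p
  have hTc : Continuous T := (hcontT a).congr fun p => (hT p).symm
  have hTinv : Continuous fun p => (T p)⁻¹ := hTc.inv₀ fun p => (hTpos p).ne'
  obtain ⟨J, hJ⟩ : ∃ J, J = ∫ p, (T p)⁻¹ ∂ν := ⟨_, rfl⟩
  obtain ⟨Y, hY⟩ : ∃ Y, Y = ∫ p, (T p)⁻¹ • (ψ p : E) ∂ν := ⟨_, rfl⟩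
  have hYi : Integrable (fun p => (T p)⁻¹ • (ψ p : E)) ν :=
    integrable_of_continuous_of_compactSpace (hTinv.smul hval)
  have hJi : Integrable (fun p => (T p)⁻¹) ν := integrable_of_continuous_of_compactSpace hTinv
  have hratio : ∀ b : E, ∫ p, boostFactor b (ψ p : E) / T p ∂ν =
      √(1 + ‖b‖ ^ 2) * J + inner ℝ b Y := by
    intro b
    rw [hJ, hY, ← integral_const_mul, ← integral_inner hYi,
      ← integral_add (hJi.const_mul _) (hYi.const_inner b)]
    refine integral_congr_ae (Eventually.of_forall fun p => ?_)
    change (√(1 + ‖b‖ ^ 2) + inner ℝ b (ψ p : E)) / T p = _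
    dsimp only
    rw [inner_smul_right, add_div, div_eq_mul_inv, div_eq_mul_inv]
    ring
  have hmin : ∀ b : E, ν.real univ ≤ √(1 + ‖b‖ ^ 2) * J + inner ℝ b Y := by
    intro b
    rw [← hratio]
    have h1 := ha b
    simp only [← hT] at h1
    have hb : ∀ p, 0 < boostFactor b (ψ p : E) := boostFactor_comp_pos b
    have hci : Integrable (fun p => log (boostFactor b (ψ p : E))) ν :=
      integrable_of_continuous_of_compactSpace ((hcontT b).log fun p => (hb p).ne')
    have hTi : Integrable (fun p => log (T p)) ν :=
      integrable_of_continuous_of_compactSpace (hTc.log fun p => (hTpos p).ne')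
    have hqi : Integrable (fun p => boostFactor b (ψ p : E) / T p) ν :=
      integrable_of_continuous_of_compactSpace ((hcontT b).div hTc fun p => (hTpos p).ne')
    have h2 : ∫ p, (log (boostFactor b (ψ p : E)) - log (T p)) ∂ν ≤
        ∫ p, (boostFactor b (ψ p : E) / T p - 1) ∂ν := by
      refine integral_mono (hci.sub hTi) (hqi.sub (integrable_const _)) fun p => ?_
      dsimp only
      rw [← Real.log_div (hb p).ne' (hTpos p).ne']
      exact Real.log_le_sub_one_of_pos (div_pos (hb p) (hTpos p))
    rw [integral_sub hci hTi, integral_sub hqi (integrable_const _), integral_const,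
      smul_eq_mul, mul_one] at h2
    linarith
  have heq : √(1 + ‖a‖ ^ 2) * J + inner ℝ a Y = ν.real univ := by
    rw [← hratio a]
    have : ∀ p, boostFactor a (ψ p : E) / T p = 1 := fun p => by rw [← hT, div_self (hTpos p).ne']
    simp only [this, integral_const, smul_eq_mul, mul_one]
  obtain ⟨hYeq, hV⟩ := eq_neg_smul_of_forall_le heq hmin
  have hs1 := one_le_sqrt_one_add_sq a
  have hform : ∀ p, boostMap a (ψ p : E) = (T p)⁻¹ • (ψ p : E) +
      ((T p)⁻¹ * (1 + √(1 + ‖a‖ ^ 2))⁻¹ + (1 + √(1 + ‖a‖ ^ 2))⁻¹) • a := fun p => by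
    rw [boostMap_eq_add a (boostFactor_comp_pos a p).ne', hT]
  generalize √(1 + ‖a‖ ^ 2) = s at *
  have h3 : 1 + s ≠ 0 := by positivity
  -- The total coefficient of `a` in the mean of the boosted map, after inserting the two
  -- conclusions of `eq_neg_smul_of_forall_le`.
  have h4 : -(s⁻¹ * J) + (J * (1 + s)⁻¹ + J / s * (1 + s)⁻¹) = 0 := by
    field_simp
    ring
  have h5 : Integrable (fun p => (T p)⁻¹ * (1 + s)⁻¹ + (1 + s)⁻¹) ν :=
    (hJi.mul_const _).add (integrable_const _)
  calc ∫ p, boostMap a (ψ p : E) ∂ν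
      = ∫ p, ((T p)⁻¹ • (ψ p : E) + ((T p)⁻¹ * (1 + s)⁻¹ + (1 + s)⁻¹) • a) ∂ν :=
        integral_congr_ae (Eventually.of_forall hform)
    _ = Y + (∫ p, ((T p)⁻¹ * (1 + s)⁻¹ + (1 + s)⁻¹) ∂ν) • a := by
        rw [integral_add hYi (h5.smul_const a), integral_smul_const, hY]
    _ = Y + (J * (1 + s)⁻¹ + J / s * (1 + s)⁻¹) • a := by
        rw [integral_add (hJi.mul_const _) (integrable_const _), integral_mul_const,
          integral_const, smul_eq_mul, hV, hJ]
    _ = 0 := by rw [hYeq, ← add_smul, h4, zero_smul]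

/-- Conformal barycentre: a measure without atoms can be balanced by a Lorentz boost. -/
theorem exists_integral_boostMap_eq_zero (hψ : Continuous ψ)
    (hatom : ∀ y : E, ν {p | (ψ p : E) = y} = 0) :
    ∃ a : E, ∫ p, boostMap a (ψ p : E) ∂ν = 0 := by
  rcases eq_or_ne (ν univ) 0 with hν | hν
  · refine ⟨0, ?_⟩
    rw [Measure.measure_univ_eq_zero.1 hν, integral_zero_measure]
  have hlogcont : Continuous fun z : E × X => log (boostFactor z.1 (ψ z.2 : E)) :=
    (continuous_boostFactor_comp hψ).log fun z => (boostFactor_comp_pos z.1 z.2).ne'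
  have hcont : Continuous fun a : E => ∫ p, log (boostFactor a (ψ p : E)) ∂ν := by
    have := continuous_parametric_integral_of_continuous (μ := ν)
      (f := fun (a : E) p => log (boostFactor a (ψ p : E))) hlogcont isCompact_univ
    simpa using this
  obtain ⟨a, ha⟩ := hcont.exists_forall_le (tendsto_integral_log_boostFactor hψ hatom hν)
  exact ⟨a, integral_boostMap_eq_zero_of_forall_le hψ a ha⟩

end barycenter

/-! ### The estimate in dimension at least two. -/

namespace RiemannianOrbifold

variable {m n : ℕ} {X : Type*} [TopologicalSpace X] [T2Space X] [MeasurableSpace X]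
  [BorelSpace X] [CompactSpace X] [Nonempty X] {O : RiemannianOrbifold m X}
  {φ ψ : X → UnitSphere n} {S : Set X}

lemma tensorVolume_sphereBoost_le (φ : X → UnitSphere n) (a : 𝔼^(n + 1)) :
    O.tensorVolume (fun c => c.pullbackCan (sphereBoost a ∘ φ)) univ ≤ O.conformalVolume φ :=
  le_iSup₂ (f := fun (μ : UnitSphere n → UnitSphere n) (_ : IsMoebius μ) =>
    O.tensorVolume (fun c => c.pullbackCan (μ ∘ φ)) univ) (sphereBoost a) (isMoebius_sphereBoost a)

lemma continuous_coord (hψ : Continuous ψ) (i : Fin (n + 1)) : Continuous (coord ψ i) :=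
  (EuclideanSpace.proj i : 𝔼^(n + 1) →L[ℝ] ℝ).continuous.comp (continuous_subtype_val.comp hψ)

lemma sum_coord_sq (ψ : X → UnitSphere n) (p : X) : ∑ i, coord ψ i p ^ 2 = 1 := by
  have h1 : ‖(ψ p : 𝔼^(n + 1))‖ = 1 := norm_eq_of_mem_sphere (ψ p)
  have h2 := EuclideanSpace.norm_sq_eq (ψ p : 𝔼^(n + 1))
  rw [h1, one_pow] at h2
  rw [h2]
  exact sum_congr rfl fun i _ => (by rw [Real.norm_eq_abs, sq_abs]; rfl)

/-- Hölder's inequality against the constant one. It will be used with `q = m / 2`, and `q ≥ 1` is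
the point where dimension one is excluded. -/
lemma lintegral_le_rpow_mul_rpow {ν : Measure X} {ρ : X → ℝ} (hρ : Measurable ρ)
    (hρ0 : ∀ p, 0 ≤ ρ p) {q : ℝ} (hq : 1 ≤ q) :
    ∫⁻ p, ofReal (ρ p) ∂ν ≤
      (∫⁻ p, ofReal (ρ p ^ q) ∂ν) ^ (1 / q) * ν univ ^ (1 - 1 / q) := by
  have h := eLpNorm'_le_eLpNorm'_mul_rpow_measure_univ (μ := ν) one_pos hq hρ.aestronglyMeasurable
  simp only [eLpNorm', ENNReal.rpow_one, div_one] at h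
  refine le_trans (le_of_eq ?_) (h.trans (le_of_eq ?_))
  · exact lintegral_congr fun p => by rw [Real.enorm_of_nonneg (hρ0 p)]
  · congr 2
    refine lintegral_congr fun p => ?_
    rw [Real.enorm_of_nonneg (hρ0 p), ENNReal.ofReal_rpow_of_nonneg (hρ0 p) (by linarith)]

/-- The Rayleigh quotient of a balanced conformal map bounds the first eigenvalue, in dimension
at least two. -/
theorem IsPCOff.mul_vol_rpow_le (hm : 2 ≤ m) (h : O.IsPCOff φ S) (hV : O.conformalVolume φ ≠ ⊤)
    {t : ℝ} (ht : 0 ≤ t)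
    (hray : ∀ u : O.H1, ∫ p, u.1 p ∂O.vol = 0 → t * O.l2Form u u ≤ O.dirichletForm u u) :
    ofReal t * O.vol univ ^ ((2 : ℝ) / m) ≤
      (m : ℝ≥0∞) * O.conformalVolume φ ^ ((2 : ℝ) / m) := by
  have hm1 : 1 ≤ m := by omega
  have : NeZero m := ⟨by omega⟩
  have hm2 : (2 : ℝ) ≤ m := by exact_mod_cast hm
  -- The boost is chosen so that the coordinates of the boosted map have mean zero; absence of atoms
  -- comes from the nullity of fibres.
  obtain ⟨a, ha⟩ := exists_integral_boostMap_eq_zero (ν := O.vol) h.continuous h.vol_fiber_eq_zero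
  have hψ := h.sphereBoost a
  have hvol := O.tensorVolume_sphereBoost_le φ a
  have hfin := ne_top_of_le_ne_top hV hvol
  generalize hψe : _root_.sphereBoost a ∘ φ = ψ at hψ hvol hfin
  obtain ⟨ρ, hρm, hρ0, hsum, -, hρint⟩ := hψ.exists_conformal_factor hm1 hfin
  have hg := hψ.hasChartGrad_coord hm1 hfin
  have hq : 1 ≤ (m : ℝ) / 2 := by linarith
  have hρ1 := lintegral_le_rpow_mul_rpow (ν := O.vol) hρm hρ0 hq
  rw [one_div_div] at hρ1
  have hexp : (0 : ℝ) ≤ 1 - 2 / m := by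
    rw [sub_nonneg, div_le_one (by linarith)]
    exact hm2
  have hρ2 : ∫⁻ p, ofReal (ρ p) ∂O.vol ≤
      O.conformalVolume φ ^ ((2 : ℝ) / m) * O.vol univ ^ (1 - (2 : ℝ) / m) :=
    hρ1.trans (mul_le_mul_left (ENNReal.rpow_le_rpow (hρint.trans hvol) (by positivity)) _)
  have hρi : Integrable ρ O.vol := by
    refine ⟨hρm.aestronglyMeasurable, ?_⟩
    rw [hasFiniteIntegral_iff_ofReal (Eventually.of_forall hρ0)]
    exact hρ2.trans_lt (ENNReal.mul_lt_top (ENNReal.rpow_lt_top_of_nonneg (by positivity) hV)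
      (ENNReal.rpow_lt_top_of_nonneg hexp (measure_ne_top _ _)))
  have hnn : ∀ i, ∀ᵐ p ∂O.vol, 0 ≤ O.gradInner (coord ψ i) (coord ψ i) p := fun i =>
    gradInner_self_nonneg (hg i)
  have hgi : ∀ i, Integrable (O.gradInner (coord ψ i) (coord ψ i)) O.vol := fun i => by
    refine (hρi.const_mul m).mono' ((hg i).gradInner (hg i)).1.aestronglyMeasurable ?_
    filter_upwards [hsum, ae_all_iff.2 hnn] with p hp hp0
    rw [Real.norm_of_nonneg (hp0 i), ← hp]
    exact Finset.single_le_sum (f := fun i => O.gradInner (coord ψ i) (coord ψ i) p)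
      (fun j _ => hp0 j) (Finset.mem_univ i)
  have hmem : ∀ i, O.MemH1 (coord ψ i) := fun i =>
    (memH1_iff (hg i)).2 ⟨memLp_of_continuous (continuous_coord hψ.continuous i), hgi i⟩
  have hmean : ∀ i, ∫ p, coord ψ i p ∂O.vol = 0 := by
    intro i
    have hc : Continuous fun p => (ψ p : 𝔼^(n + 1)) := continuous_subtype_val.comp hψ.continuous
    have h1 := (EuclideanSpace.proj i : 𝔼^(n + 1) →L[ℝ] ℝ).integral_comp_comm
      (integrable_of_continuous_of_compactSpace (ν := O.vol) hc)
    have h2 : ∫ p, (ψ p : 𝔼^(n + 1)) ∂O.vol = 0 := by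
      subst hψe
      exact ha
    rw [h2, map_zero] at h1
    exact h1
  have hineq : ∀ i, t * ∫ p, coord ψ i p ^ 2 ∂O.vol ≤
      ∫ p, O.gradInner (coord ψ i) (coord ψ i) p ∂O.vol := by
    intro i
    have h1 := hray ⟨coord ψ i, hmem i⟩ (hmean i)
    rw [l2Form_apply, dirichletForm_apply] at h1
    simpa only [sq] using h1
  -- Summation over the coordinates: the squares add up to one and the energies to `m ρ`.
  have htot : t * O.vol.real univ ≤ m * ∫ p, ρ p ∂O.vol := by
    have h1 := Finset.sum_le_sum fun i (_ : i ∈ Finset.univ) => hineq i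
    have hsq : ∀ i, Integrable (fun p => coord ψ i p ^ 2) O.vol := fun i =>
      integrable_of_continuous_of_compactSpace ((continuous_coord hψ.continuous i).pow 2)
    rw [← mul_sum, ← integral_finsetSum _ fun i _ => hsq i,
      ← integral_finsetSum _ fun i _ => hgi i, integral_congr_ae hsum, integral_const_mul] at h1
    simpa [sum_coord_sq] using h1
  have hmain : ofReal t * O.vol univ ≤
      m * (O.conformalVolume φ ^ ((2 : ℝ) / m) * O.vol univ ^ (1 - (2 : ℝ) / m)) := by
    refine le_trans ?_ (mul_le_mul_right hρ2 _)
    rw [← ofReal_integral_eq_lintegral_ofReal hρi (Eventually.of_forall hρ0),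
      ← ENNReal.ofReal_natCast, ← ofReal_mul (by positivity),
      ← ENNReal.ofReal_toReal (measure_ne_top O.vol univ), ← ofReal_mul ht]
    exact ofReal_le_ofReal htot
  -- The factor `Vol^{1 - 2/m}` is cancelled, which needs it to be nonzero and finite; with zero
  -- volume the left side vanishes.
  rcases eq_or_ne (O.vol univ) 0 with h0 | h0
  · rw [h0, ENNReal.zero_rpow_of_pos (by positivity), mul_zero]
    exact zero_le
  · have hne0 : O.vol univ ^ (1 - (2 : ℝ) / m) ≠ 0 :=
      (ENNReal.rpow_pos h0.bot_lt (measure_ne_top _ _)).ne'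
    have hnet : O.vol univ ^ (1 - (2 : ℝ) / m) ≠ ⊤ :=
      (ENNReal.rpow_lt_top_of_nonneg hexp (measure_ne_top _ _)).ne
    refine (ENNReal.mul_le_mul_iff_left hne0 hnet).1 ?_
    rw [mul_assoc, mul_assoc, ← ENNReal.rpow_add _ _ h0 (measure_ne_top _ _),
      add_sub_cancel, ENNReal.rpow_one]
    exact hmain

end RiemannianOrbifold

/-! ### Dimension one: the conformal volume is at least 2π. -/

namespace RiemannianOrbifold

variable {m n : ℕ} {X : Type*} [TopologicalSpace X] [T2Space X] [MeasurableSpace X]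
  [BorelSpace X] [CompactSpace X] [Nonempty X]

lemma setLIntegral_vol_image {O : RiemannianOrbifold m X} {c : Chart m X}
    (hc : c ∈ O.atlas) {B : Set ℝ^m} (hB : MeasurableSet B) (hBd : B ⊆ c.dom)
    (hinj : InjOn c.proj B) {f : X → ℝ≥0∞} (hf : Measurable f) :
    ∫⁻ p in c.proj '' B, f p ∂O.vol =
      ∫⁻ x in B, ofReal √(c.metric x).det * f (c.proj x) := by
  have hae : AEMeasurable c.proj (c.riemVolume.restrict B) :=
    c.aemeasurable_proj.mono_measure Measure.restrict_le_self
  have h1 : O.vol.restrict (c.proj '' B) = Measure.map c.proj (c.riemVolume.restrict B) := by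
    ext A hA
    have h2 : A ∩ c.proj '' B = c.proj '' (c.dom ∩ c.proj ⁻¹' A ∩ B) := by
      ext p
      constructor
      · rintro ⟨hp, x, hx, rfl⟩
        exact ⟨x, ⟨⟨hBd hx, hp⟩, hx⟩, rfl⟩
      · rintro ⟨x, ⟨⟨-, hp⟩, hx⟩, rfl⟩
        exact ⟨hp, x, hx, rfl⟩
    have h3 : c.riemVolume.restrict B (c.proj ⁻¹' A) = c.riemVolume (c.dom ∩ c.proj ⁻¹' A ∩ B) := by
      rw [Measure.restrict_apply' hB]
      congr 1
      ext x
      exact ⟨fun h => ⟨⟨hBd h.2, h.1⟩, h.2⟩, fun h => ⟨h.1.2, h.2⟩⟩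
    rw [Measure.restrict_apply hA, h2, Measure.map_apply_of_aemeasurable hae hA, h3]
    exact O.vol_image_of_injOn hc ((c.measurableSet_preimage hA).inter hB)
      (inter_subset_right.trans hBd) (hinj.mono inter_subset_right)
  rw [h1, lintegral_map' hf.aemeasurable hae]
  exact c.setLIntegral_riemVolume hB hBd _

lemma setLIntegral_fin_one {f : ℝ^1 → ℝ≥0∞} {B : Set ℝ} :
    ∫⁻ x in {x : ℝ^1 | x 0 ∈ B}, f x = ∫⁻ t in B, f fun _ => t := by
  have h := (volume_preserving_funUnique (Fin 1) ℝ).symm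
  have h1 := h.setLIntegral_comp_preimage_emb (MeasurableEquiv.measurableEmbedding _) f
    {x : ℝ^1 | x 0 ∈ B}
  exact h1.symm

/-- A curve of positive speed in the sphere is blown up by boosts to nearly a great circle. -/
lemma ofReal_two_pi_le_of_boost {E : Type*} [NormedAddCommGroup E] [InnerProductSpace ℝ E]
    {y : ℝ → E} {v : E} {x₀ : ℝ} (hy1 : ∀ x, ‖y x‖ = 1) (hy : HasStrictDerivAt y v x₀) (hv : v ≠ 0)
    {w : ℝ → ℝ} (hw : ContinuousAt w x₀) (hwv : w x₀ = ‖v‖) {J : Set ℝ} (hJ : J ∈ 𝓝 x₀) {M : ℝ≥0∞}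
    (hM : ∀ a : E, ∫⁻ x in J, ofReal ((boostFactor a (y x))⁻¹ * w x) ≤ M) :
    ofReal (2 * Real.pi) ≤ M := by
  set κ := ‖v‖ with hκ
  have hκ0 : 0 < κ := norm_pos_iff.2 hv
  -- Near `x₀` the curve moves away at speed at most `b = (1 + ε) κ`, while the length density is at
  -- least `k = (1 - ε) κ`. The comparison loses the factor `k / b`, which tends to one with `ε →
  -- 0`.
  have key : ∀ ε : ℝ, 0 < ε → ε < 1 → ofReal (2 * Real.pi * ((1 - ε) / (1 + ε))) ≤ M := by
    intro ε hε hε1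
    set k := (1 - ε) * κ with hk
    set b := (1 + ε) * κ with hb
    have hk0 : 0 < k := mul_pos (by linarith) hκ0
    have hb0 : 0 < b := by positivity
    have e1 : ∀ᶠ x in 𝓝 x₀, ‖y x - y x₀‖ ≤ b * |x - x₀| := by
      have h1 := (hasStrictFDerivAt_iff_isLittleO.1 hy.hasStrictFDerivAt).def
        (show 0 < ε * κ by positivity)
      have h2 : Tendsto (fun x => (x, x₀)) (𝓝 x₀) (𝓝 (x₀, x₀)) :=
        (continuous_id.prodMk continuous_const).tendsto' _ _ rfl
      filter_upwards [h2.eventually h1] with x hx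
      have h3 : ‖(x - x₀) • v‖ = |x - x₀| * κ := by rw [norm_smul, Real.norm_eq_abs]
      have h4 : ‖y x - y x₀ - (x - x₀) • v‖ ≤ ε * κ * |x - x₀| := by simpa using hx
      have h5 := norm_le_norm_add_norm_sub' (y x - y x₀) ((x - x₀) • v)
      rw [h3] at h5
      rw [hb]
      linarith
    have e2 : ∀ᶠ x in 𝓝 x₀, k < w x := hw.eventually_const_lt (by rw [hwv, hk]; nlinarith)
    obtain ⟨δ, hδ, hball⟩ := Metric.eventually_nhds_iff.1 ((e1.and e2).and hJ)
    have hA : ∀ A : ℝ, 0 < A → ofReal (4 * (k / b) * Real.arctan (A * b * (δ / 2))) ≤ M := by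
      intro A hA0
      -- A boost towards the antipode of `y x₀` with velocity `A` expands most at `y x₀`. In the
      -- limit `A → ∞` the arctangent below tends to `π / 2` and the bound becomes `2 π k / b`.
      refine le_trans ?_ (hM (-A • y x₀))
      have hF : ∀ x : ℝ, HasDerivAt (fun x => 2 * (k / b) * Real.arctan (A * b * (x - x₀)))
          (k * (2 * A / (1 + (A * b * (x - x₀)) ^ 2))) x := by
        intro x
        have h1 : HasDerivAt (fun x => A * b * (x - x₀)) (A * b) x := by
          simpa using ((hasDerivAt_id x).sub_const x₀).const_mul (A * b)
        refine (h1.arctan.const_mul (2 * (k / b))).congr_deriv ?_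
        field_simp
      have hcont : Continuous fun x : ℝ => k * (2 * A / (1 + (A * b * (x - x₀)) ^ 2)) := by
        refine continuous_const.mul (continuous_const.div (by fun_prop) fun x => by positivity)
      have hint := intervalIntegral.integral_eq_sub_of_hasDerivAt
        (a := x₀ - δ / 2) (b := x₀ + δ / 2) (fun x _ => hF x) (hcont.intervalIntegrable _ _)
      have hval : ∫ x in (x₀ - δ / 2)..(x₀ + δ / 2), k * (2 * A / (1 + (A * b * (x - x₀)) ^ 2)) =
          4 * (k / b) * Real.arctan (A * b * (δ / 2)) := by
        rw [hint]
        have h1 : A * b * (x₀ + δ / 2 - x₀) = A * b * (δ / 2) := by ring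
        have h2 : A * b * (x₀ - δ / 2 - x₀) = -(A * b * (δ / 2)) := by ring
        rw [h1, h2, Real.arctan_neg]
        ring
      rw [← hval, intervalIntegral.integral_of_le (by linarith),
        ofReal_integral_eq_lintegral_ofReal ((hcont.integrableOn_Icc (a := x₀ - δ / 2)
          (b := x₀ + δ / 2)).mono_set Ioc_subset_Icc_self)
          (Eventually.of_forall fun x => by positivity)]
      have hdist : ∀ x ∈ Ioc (x₀ - δ / 2) (x₀ + δ / 2), dist x x₀ < δ := fun x hx => by
        rw [Real.dist_eq, abs_lt]
        exact ⟨by linarith [hx.1], by linarith [hx.2]⟩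
      refine le_trans (setLIntegral_mono' measurableSet_Ioc fun x hx => ?_)
        (lintegral_mono_set fun x hx => (hball (hdist x hx)).2)
      obtain ⟨⟨hx1, hx2⟩, -⟩ := hball (hdist x hx)
      refine ofReal_le_ofReal ?_
      have hTpos := boostFactor_pos (-A • y x₀) (hy1 x)
      -- On the sphere the factor equals `√(1 + A²) - A + (A / 2) |y x - y x₀|²`, and `√(1 + A²) ≤ A
      -- + 1 / (2 A)`.
      have hT : boostFactor (-A • y x₀) (y x) ≤ (1 + (A * b * (x - x₀)) ^ 2) / (2 * A) := by
        have hna : ‖-A • y x₀‖ = A := by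
          rw [norm_smul, hy1, mul_one, norm_neg, Real.norm_of_nonneg hA0.le]
        have hsq := norm_sub_sq_real (y x) (y x₀)
        rw [hy1, hy1] at hsq
        have hs : √(1 + A ^ 2) ≤ A + 1 / (2 * A) := by
          refine Real.sqrt_le_iff.2 ⟨by positivity, ?_⟩
          have : (A + 1 / (2 * A)) ^ 2 = 1 + A ^ 2 + (1 / (2 * A)) ^ 2 := by
            field_simp
            ring
          rw [this]
          nlinarith [sq_nonneg (1 / (2 * A))]
        have hd : ‖y x - y x₀‖ ^ 2 ≤ (b * |x - x₀|) ^ 2 := by gcongr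
        rw [mul_pow, sq_abs] at hd
        have hin : inner ℝ (-A • y x₀) (y x) = -A * inner ℝ (y x) (y x₀) := by
          rw [inner_smul_left, real_inner_comm]; rfl
        unfold boostFactor
        rw [hna, hin]
        have e : (1 + (A * b * (x - x₀)) ^ 2) / (2 * A) =
            1 / (2 * A) + A / 2 * (b ^ 2 * (x - x₀) ^ 2) := by field_simp
        rw [e]
        nlinarith
      calc k * (2 * A / (1 + (A * b * (x - x₀)) ^ 2))
          = ((1 + (A * b * (x - x₀)) ^ 2) / (2 * A))⁻¹ * k := by rw [inv_div]; ring
        _ ≤ (boostFactor (-A • y x₀) (y x))⁻¹ * w x := by gcongr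
    have hlim : Tendsto (fun A : ℝ => ofReal (4 * (k / b) * Real.arctan (A * b * (δ / 2)))) atTop
        (𝓝 (ofReal (4 * (k / b) * (Real.pi / 2)))) := by
      refine ENNReal.tendsto_ofReal (Tendsto.const_mul _ ?_)
      have h1 : Tendsto (fun A : ℝ => A * b * (δ / 2)) atTop atTop :=
        (tendsto_id.atTop_mul_const hb0).atTop_mul_const (by positivity)
      exact (tendsto_nhds_of_tendsto_nhdsWithin Real.tendsto_arctan_atTop).comp h1
    have h1 := le_of_tendsto hlim ((eventually_gt_atTop 0).mono hA)
    have h2 : 4 * (k / b) * (Real.pi / 2) = 2 * Real.pi * ((1 - ε) / (1 + ε)) := by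
      rw [hk, hb, mul_div_mul_right _ _ hκ0.ne']
      ring
    rwa [h2] at h1
  have hlim : Tendsto (fun ε : ℝ => ofReal (2 * Real.pi * ((1 - ε) / (1 + ε)))) (𝓝[>] 0)
      (𝓝 (ofReal (2 * Real.pi))) := by
    refine ENNReal.tendsto_ofReal (tendsto_nhdsWithin_of_tendsto_nhds ?_)
    have : ContinuousAt (fun ε : ℝ => 2 * Real.pi * ((1 - ε) / (1 + ε))) 0 :=
      continuousAt_const.mul ((continuousAt_const.sub continuousAt_id).div
        (continuousAt_const.add continuousAt_id) (by simp))
    simpa [ContinuousAt] using this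
  refine le_of_tendsto hlim ?_
  filter_upwards [Ioo_mem_nhdsGT (show (0 : ℝ) < 1 by norm_num)] with ε hε
  exact key ε hε.1 hε.2

/-- The conformal volume of a piecewise conformal map of a one-dimensional orbifold. -/
theorem IsPCOff.two_pi_le_conformalVolume {O : RiemannianOrbifold 1 X} {φ : X → UnitSphere n}
    {S : Set X} (h : O.IsPCOff φ S) : ofReal (2 * Real.pi) ≤ O.conformalVolume φ := by
  rcases eq_or_ne (O.conformalVolume φ) ⊤ with hV | hV
  · rw [hV]; exact le_top
  obtain ⟨p⟩ : Nonempty X := inferInstance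
  obtain ⟨c, hc, -⟩ := O.cover p
  obtain ⟨x₁, hx₁r, hx₁i⟩ := regular_inter_interior_nonempty c
  obtain ⟨V, hVo, hxV, -, hinj⟩ := c.exists_open_injOn hx₁r
  -- Walls are null, so the open set of interior points where the projection is injective contains a
  -- point off the walls. Injectivity makes the orbifold volume of the arc equal to its volume in
  -- the chart.
  obtain ⟨x₀, ⟨hx₀V, hx₀i⟩, hx₀S⟩ : ∃ x₀, x₀ ∈ V ∩ interior c.dom ∧ c.proj x₀ ∉ S := by
    by_contra! hcon
    have h1 := h.ae_good hc
    rw [ae_iff] at h1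
    have h2 : volume.restrict c.dom (V ∩ interior c.dom) = 0 :=
      measure_mono_null (show V ∩ interior c.dom ⊆
        {x | ¬(x ∈ interior c.dom ∧ c.proj x ∉ S)} from fun x hx hx' => hx'.2 (hcon x hx)) h1
    rw [Measure.restrict_apply (hVo.inter isOpen_interior).measurableSet,
      inter_eq_left.2 (inter_subset_right.trans interior_subset)] at h2
    exact (hVo.inter isOpen_interior).measure_ne_zero _ ⟨x₁, hxV, hx₁i⟩ h2
  set y : ℝ → 𝔼^(n + 1) := fun t => c.lift φ fun _ => t with hy
  set J : Set ℝ := {t | (fun _ => t) ∈ V ∩ (interior c.dom ∩ c.proj ⁻¹' Sᶜ)} with hJ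
  have hcst : Continuous fun t : ℝ => (fun _ => t : ℝ^1) := by fun_prop
  have hJo : IsOpen J := (hVo.inter h.isOpen_good).preimage hcst
  have hx₀e : (fun _ => x₀ 0 : ℝ^1) = x₀ := by ext i; rw [Fin.fin_one_eq_zero i]
  have hx₀J : x₀ 0 ∈ J := by
    rw [hJ, mem_ofPred_eq, hx₀e]
    exact ⟨hx₀V, hx₀i, hx₀S⟩
  have hC := h.contDiffAt hc hx₀i hx₀S
  set w : ℝ → ℝ := fun t => ‖fderiv ℝ (c.lift φ) (fun _ => t) (Pi.single 0 1)‖ with hw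
  have hw0 : ContinuousAt w (x₀ 0) := by
    have h1 : ContinuousAt (fderiv ℝ (c.lift φ)) (fun _ => x₀ 0) := by
      rw [hx₀e]
      exact (hC.fderiv_right (m := 0) (by norm_num)).continuousAt
    have h2 := ContinuousAt.comp (f := fun t : ℝ => (fun _ => t : ℝ^1)) h1 hcst.continuousAt
    exact (h2.clm_apply continuousAt_const).norm
  have hsingle : (fun _ => 1 : ℝ^1) = Pi.single 0 1 := by ext i; rw [Fin.fin_one_eq_zero i]; simp
  have hderiv : HasStrictDerivAt y (fderiv ℝ (c.lift φ) x₀ (Pi.single 0 1)) (x₀ 0) := by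
    have h1 := hC.hasStrictFDerivAt one_ne_zero
    rw [← hx₀e] at h1
    have h2 : HasStrictDerivAt (fun t : ℝ => (fun _ => t : ℝ^1)) (fun _ => 1) (x₀ 0) :=
      hasStrictDerivAt_pi.2 fun _ => hasStrictDerivAt_id _
    have h3 := h1.comp_hasStrictDerivAt (x₀ 0) h2
    rw [hsingle, hx₀e] at h3
    exact h3
  have hv : fderiv ℝ (c.lift φ) x₀ (Pi.single 0 1) ≠ 0 := by
    obtain ⟨K, hK⟩ := h.exists_antilipschitzWith_fderiv hc hx₀i hx₀S
    intro h0
    have := hK.injective (h0.trans (map_zero _).symm)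
    simpa using congrFun this 0
  refine ofReal_two_pi_le_of_boost (fun t => norm_lift φ _) hderiv hv hw0
    (by simp only [hw]; rw [hx₀e]) (hJo.mem_nhds hx₀J) fun a => ?_
  have hψ := h.sphereBoost a
  have hvol := O.tensorVolume_sphereBoost_le φ a
  obtain ⟨ρ, hρm, hρ0, -, hρe, hρint⟩ := hψ.exists_conformal_factor le_rfl
    (ne_top_of_le_ne_top hV hvol)
  have hf : Measurable fun p => ofReal (ρ p ^ (((1 : ℕ) : ℝ) / 2)) :=
    (hρm.pow_const _).ennreal_ofReal
  set B : Set ℝ^1 := {x | x 0 ∈ J} with hB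
  have hBeq : ∀ x : ℝ^1, (fun _ => x 0) = x := fun x => by ext i; rw [Fin.fin_one_eq_zero i]
  have hBJ : ∀ x ∈ B, x ∈ V ∩ (interior c.dom ∩ c.proj ⁻¹' Sᶜ) := fun x hx => by
    have : (fun _ => x 0) ∈ V ∩ (interior c.dom ∩ c.proj ⁻¹' Sᶜ) := hx
    rwa [hBeq] at this
  have hBd : B ⊆ c.dom := fun x hx => interior_subset (hBJ x hx).2.1
  have hBm : MeasurableSet B := (hJo.preimage (continuous_apply 0)).measurableSet
  have h1 := setLIntegral_vol_image hc hBm hBd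
    (hinj.mono (show B ⊆ c.dom ∩ V from fun x hx => ⟨hBd hx, (hBJ x hx).1⟩)) hf
  refine le_trans (le_of_eq ?_) ((setLIntegral_le_lintegral (c.proj '' B) _).trans
    (hρint.trans hvol))
  rw [h1, ← setLIntegral_fin_one (B := J) (f := fun x => ofReal ((boostFactor a (c.lift φ x))⁻¹ *
      ‖fderiv ℝ (c.lift φ) x (Pi.single 0 1)‖))]
  refine setLIntegral_congr_fun_ae hBm ?_
  have h2 := (ae_restrict_iff' c.measurableSet_dom).1 (hρe c hc)
  filter_upwards [h2] with x hx hxB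
  have hxg := (hBJ x hxB).2
  have hd := (h.contDiffAt hc hxg.1 hxg.2).differentiableAt one_ne_zero
  rw [mul_comm (ofReal √_), ← ofReal_mul (Real.rpow_nonneg (hρ0 _) _),
    ← sqrt_det_pullbackCan (hρ0 _) (hx (hBd hxB)),
    pullbackCan_sphereBoost a (hBd hxB) hd.differentiableWithinAt, Matrix.det_fin_one,
    Matrix.smul_apply, smul_eq_mul, pullbackCan_eq hxg.1, real_inner_self_eq_norm_sq,
    ← inv_pow, ← mul_pow, Real.sqrt_sq]
  exact mul_nonneg (inv_nonneg.2 (boostFactor_pos a (norm_lift φ x)).le) (norm_nonneg _)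

end RiemannianOrbifold

/-! ### Dimension one: arc length in charts. -/

namespace RiemannianOrbifoldChart

variable {X : Type*} [TopologicalSpace X] (c : Chart 1 X)

/-- A one-dimensional chart domain, as a subset of the real line. -/
def ray : Set ℝ := {x | (fun _ => x) ∈ c.dom}

/-- The one-dimensional chart domain reflected in the origin. -/
def line : Set ℝ := {x | (fun _ => |x|) ∈ c.dom}

/-- The speed of the coordinate, extended evenly. -/
noncomputable def dens (x : ℝ) : ℝ := √(c.metric (fun _ => |x|) 0 0)

/-- The point of `X` with a given coordinate. -/
def toPoint (x : ℝ) : X := c.proj fun _ => x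

/-- The signed length of a segment of a one-dimensional chart. -/
noncomputable def len (x y : ℝ) : ℝ := ∫ z in x..y, c.dens z

variable {c}

lemma const_apply_zero (x : ℝ^1) : (fun _ => x 0) = x := by ext i; rw [Fin.fin_one_eq_zero i]

lemma nonneg_of_mem_ray {x : ℝ} (hx : x ∈ c.ray) : 0 ≤ x := by
  obtain ⟨V, -, hV⟩ := c.isOpen_dom
  have h1 : (fun _ => x) ∈ c.dom := hx
  rw [hV] at h1
  exact h1.2 0

lemma ray_subset_line : c.ray ⊆ c.line := fun x hx => by
  have h1 : (fun _ => x) ∈ c.dom := hx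
  change (fun _ => |x|) ∈ c.dom
  rwa [abs_of_nonneg (nonneg_of_mem_ray hx)]

lemma mem_ray_of_mem_line {x : ℝ} (hx : x ∈ c.line) (h0 : 0 ≤ x) : x ∈ c.ray := by
  have h1 : (fun _ => |x|) ∈ c.dom := hx
  rwa [abs_of_nonneg h0] at h1

lemma isOpen_line : IsOpen c.line := by
  obtain ⟨V, hVo, hV⟩ := c.isOpen_dom
  have h1 : c.line = (fun x : ℝ => (fun _ => |x| : ℝ^1)) ⁻¹' V := by
    ext x
    change (fun _ => |x|) ∈ c.dom ↔ _
    rw [hV]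
    exact ⟨fun h => h.1, fun h => ⟨h, fun _ => abs_nonneg x⟩⟩
  rw [h1]
  exact hVo.preimage (by fun_prop)

lemma continuousOn_dens : ContinuousOn c.dens c.line := by
  have h1 : ContinuousOn (fun x : ℝ => c.metric (fun _ => |x|) 0 0) c.line :=
    (c.contDiffOn_metric 0 0).continuousOn.comp
      (f := fun x : ℝ => (fun _ => |x| : ℝ^1)) (by fun_prop) fun x hx => hx
  exact h1.sqrt

lemma dens_pos {x : ℝ} (hx : x ∈ c.line) : 0 < c.dens x :=
  Real.sqrt_pos.2 ((c.posDef_metric _ hx).diag_pos)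

lemma sq_dens {x : ℝ} (hx : x ∈ c.ray) : c.dens x ^ 2 = c.metric (fun _ => x) 0 0 := by
  have h1 := (c.posDef_metric _ hx).diag_pos (i := 0)
  rw [dens, abs_of_nonneg (nonneg_of_mem_ray hx), Real.sq_sqrt h1.le]

lemma ordConnected_ray : c.ray.OrdConnected := by
  have h1 : c.ray = (fun x : ℝ^1 => x 0) '' c.dom := by
    ext x
    constructor
    · intro hx
      exact ⟨fun _ => x, hx, rfl⟩
    · rintro ⟨z, hz, rfl⟩
      change (fun _ => z 0) ∈ c.dom
      rwa [const_apply_zero]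
  rw [h1]
  exact (c.isConnected_dom.isPreconnected.image _ (continuous_apply 0).continuousOn).ordConnected

lemma uIcc_subset_ray {x y : ℝ} (hx : x ∈ c.ray) (hy : y ∈ c.ray) : uIcc x y ⊆ c.ray :=
  c.ordConnected_ray.uIcc_subset hx hy

lemma intervalIntegrable_dens {x y : ℝ} (h : uIcc x y ⊆ c.line) :
    IntervalIntegrable c.dens volume x y := (c.continuousOn_dens.mono h).intervalIntegrable

/-- The even extension makes the speed continuous on an open set, so the length is differentiable
from both sides even at the boundary point `0`. -/
lemma hasStrictDerivAt_len {x y : ℝ} (h : uIcc x y ⊆ c.line) :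
    HasStrictDerivAt (c.len x) (c.dens y) y := by
  have hy : c.line ∈ 𝓝 y := c.isOpen_line.mem_nhds (h right_mem_uIcc)
  refine intervalIntegral.integral_hasStrictDerivAt_right (intervalIntegrable_dens h)
    ?_ (c.continuousOn_dens.continuousAt hy)
  exact c.continuousOn_dens.stronglyMeasurableAtFilter c.isOpen_line _ (h right_mem_uIcc)

lemma len_self (x : ℝ) : c.len x x = 0 := intervalIntegral.integral_same

lemma len_symm (x y : ℝ) : c.len y x = -c.len x y := intervalIntegral.integral_symm _ _

lemma len_add {x y z : ℝ} (hx : x ∈ c.ray) (hy : y ∈ c.ray) (hz : z ∈ c.ray) :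
    c.len x y + c.len y z = c.len x z :=
  intervalIntegral.integral_add_adjacent_intervals
    (intervalIntegrable_dens ((uIcc_subset_ray hx hy).trans c.ray_subset_line))
    (intervalIntegrable_dens ((uIcc_subset_ray hy hz).trans c.ray_subset_line))

lemma len_pos {x y : ℝ} (h : uIcc x y ⊆ c.line) (hxy : x < y) : 0 < c.len x y :=
  intervalIntegral.intervalIntegral_pos_of_pos_on (intervalIntegrable_dens h)
    (fun _ hz => dens_pos (h (Icc_subset_uIcc (Ioo_subset_Icc_self hz)))) hxy

lemma len_nonneg {x y : ℝ} (hx : x ∈ c.ray) (hy : y ∈ c.ray) (hxy : x ≤ y) : 0 ≤ c.len x y := by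
  rcases hxy.eq_or_lt with rfl | h
  · rw [len_self]
  · exact (len_pos ((uIcc_subset_ray hx hy).trans c.ray_subset_line) h).le

lemma eq_of_len_eq {x y z : ℝ} (hx : x ∈ c.ray) (hy : y ∈ c.ray) (hz : z ∈ c.ray)
    (h : c.len x y = c.len x z) : y = z := by
  have h1 := len_add hx hy hz
  rcases lt_trichotomy y z with h2 | h2 | h2
  · have := len_pos ((uIcc_subset_ray hy hz).trans c.ray_subset_line) h2
    linarith
  · exact h2
  · have := len_pos ((uIcc_subset_ray hz hy).trans c.ray_subset_line) h2
    rw [len_symm] at this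
    linarith

/-- The coordinate of unit speed around a point of a chart. -/
lemma exists_len_eq {x : ℝ} (hx : x ∈ c.ray) : ∃ E : ℝ → ℝ, E 0 = x ∧
    ∀ᶠ τ in 𝓝 0, ContinuousAt E τ ∧ uIcc x (E τ) ⊆ c.line ∧ c.len x (E τ) = τ := by
  have hxl := ray_subset_line hx
  have h1 : HasStrictDerivAt (c.len x) (c.dens x) x :=
    hasStrictDerivAt_len (by rwa [uIcc_self, singleton_subset_iff])
  have h2 := h1.hasStrictFDerivAt_equiv (dens_pos hxl).ne'
  set P := h2.toOpenPartialHomeomorph (c.len x) with hP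
  have hPc : ∀ y, P y = c.len x y := fun y => rfl
  have hxs : x ∈ P.source := h2.mem_toOpenPartialHomeomorph_source
  have h0 : P x = 0 := len_self x
  have ht : (0 : ℝ) ∈ P.target := h0 ▸ P.map_source hxs
  have hE0 : P.symm 0 = x := by rw [← h0, P.left_inv hxs]
  refine ⟨P.symm, hE0, ?_⟩
  obtain ⟨η, hη, hball⟩ := Metric.isOpen_iff.1 c.isOpen_line x hxl
  have h3 : ∀ᶠ τ in 𝓝 0, P.symm τ ∈ ball x η := by
    have := P.symm.continuousAt (x := 0) ht
    rw [ContinuousAt, hE0] at this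
    exact this.eventually (ball_mem_nhds x hη)
  filter_upwards [h3, P.open_target.mem_nhds ht] with τ h4 h5
  refine ⟨P.symm.continuousAt h5, ?_, P.right_inv h5⟩
  rw [Real.ball_eq_Ioo] at h4 hball
  exact (ordConnected_Ioo.uIcc_subset ⟨by linarith, by linarith⟩ h4).trans hball

lemma mem_interior_dom_iff {x : ℝ} (hx : x ∈ c.ray) : (fun _ => x) ∈ interior c.dom ↔ 0 < x := by
  obtain ⟨V, hV, hVd, hint⟩ := c.interior_dom_eq
  have h1 : (fun _ => x) ∈ c.dom := hx
  rw [hint, interior_Ici_zero]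
  rw [hVd] at h1
  exact ⟨fun h => h.2 0, fun h => ⟨h1.1, fun _ => h⟩⟩

lemma isOpen_image_toPoint {x : ℝ} (hx : x ∈ c.ray) {η : ℝ} (hη : 0 < η) :
    c.toPoint '' (c.ray ∩ ball x η) ∈ 𝓝 (c.toPoint x) := by
  have h1 := c.isOpen_image_inter (V := {z : ℝ^1 | z 0 ∈ ball x η})
    (isOpen_ball.preimage (continuous_apply 0))
  refine mem_of_superset (h1.mem_nhds ⟨fun _ => x, ⟨hx, mem_ball_self hη⟩, rfl⟩) ?_
  rintro _ ⟨z, ⟨hzd, hz⟩, rfl⟩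
  refine ⟨z 0, ⟨?_, hz⟩, ?_⟩
  · change (fun _ => z 0) ∈ c.dom
    rwa [const_apply_zero]
  · change c.proj (fun _ => z 0) = _
    rw [const_apply_zero]

variable [T2Space X] [MeasurableSpace X] [BorelSpace X] [CompactSpace X] [Nonempty X]
  {O : RiemannianOrbifold 1 X}

/-- The projection may identify points of the segment under the group, so its length is only an
upper bound for the volume of the image. -/
lemma vol_image_toPoint_Icc_le (hc : c ∈ O.atlas) {x y : ℝ} (hx : x ∈ c.ray) (hy : y ∈ c.ray)
    (hxy : x ≤ y) : O.vol (c.toPoint '' Icc x y) ≤ ofReal (c.len x y) := by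
  have hsub : Icc x y ⊆ c.ray := by rw [← uIcc_of_le hxy]; exact uIcc_subset_ray hx hy
  set B : Set ℝ^1 := {z | z 0 ∈ Icc x y} with hB
  have hBc : IsClosed B := isClosed_Icc.preimage (continuous_apply 0)
  have hBd : B ⊆ c.dom := fun z hz => by
    have : (fun _ => z 0) ∈ c.dom := hsub hz
    rwa [const_apply_zero] at this
  have himg : c.proj '' B = c.toPoint '' Icc x y := by
    ext p
    constructor
    · rintro ⟨z, hz, rfl⟩
      exact ⟨z 0, hz, by rw [toPoint, const_apply_zero]⟩
    · rintro ⟨t, ht, rfl⟩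
      exact ⟨fun _ => t, ht, rfl⟩
  have hK : IsCompact (c.toPoint '' Icc x y) := by
    refine isCompact_Icc.image_of_continuousOn ?_
    exact c.continuousOn_proj.comp (f := fun t : ℝ => (fun _ => t : ℝ^1)) (by fun_prop)
      fun t ht => hsub ht
  have h1 := O.vol_image_le hc hBc.measurableSet hBd (by rw [himg]; exact hK.isClosed.measurableSet)
  rw [himg] at h1
  refine h1.trans (le_of_eq ?_)
  rw [← setLIntegral_one, c.setLIntegral_riemVolume hBc.measurableSet hBd,
    RiemannianOrbifold.setLIntegral_fin_one, len, intervalIntegral.integral_of_le hxy,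
    ← integral_Icc_eq_integral_Ioc, ofReal_integral_eq_lintegral_ofReal]
  · refine setLIntegral_congr_fun measurableSet_Icc fun t ht => ?_
    change ofReal √(c.metric fun _ => t).det * 1 = _
    rw [mul_one, Matrix.det_fin_one, dens, abs_of_nonneg (nonneg_of_mem_ray (hsub ht))]
  · exact (c.continuousOn_dens.mono (hsub.trans ray_subset_line)).integrableOn_Icc
  · filter_upwards [ae_restrict_mem measurableSet_Icc] with t ht
    exact (dens_pos (ray_subset_line (hsub ht))).le

end RiemannianOrbifoldChart

namespace IsTransition

open RiemannianOrbifoldChart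

variable {X : Type*} [TopologicalSpace X] {c c' : Chart 1 X}
  {h g : ℝ^1 → ℝ^1} {V W : Set ℝ^1}

/-- One-dimensional changes of charts preserve the length up to orientation. -/
lemma exists_len_eq (t : IsTransition c c' h g V W) {x : ℝ} (hx : x ∈ c.ray)
    (hxV : (fun _ => x) ∈ V) : ∃ ς : ℝ, (ς = 1 ∨ ς = -1) ∧ ∀ᶠ u in 𝓝[c.ray] x,
      h (fun _ => u) 0 ∈ c'.ray ∧ c'.toPoint (h (fun _ => u) 0) = c.toPoint u ∧
      c'.len (h (fun _ => x) 0) (h (fun _ => u) 0) = ς * c.len x u := by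
  set H : ℝ → ℝ := fun u => h (fun _ => u) 0 with hH
  set D : ℝ → ℝ := fun u => fderivWithin ℝ h (c.dom ∩ V) (fun _ => u) (fun _ => 1) 0 with hD
  have hcst : Continuous fun u : ℝ => (fun _ => u : ℝ^1) := by fun_prop
  have hVn : ∀ᶠ u in 𝓝 x, (fun _ => u) ∈ V := hcst.continuousAt (t.isOpen_left.mem_nhds hxV)
  have huniq : UniqueDiffOn ℝ (c.dom ∩ V) := c.uniqueDiffOn_dom.inter t.isOpen_left
  have hmem : ∀ u ∈ c.ray, (fun _ => u) ∈ V → H u ∈ c'.ray := fun u hu huV => by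
    change (fun _ => h (fun _ => u) 0) ∈ c'.dom
    rw [const_apply_zero]
    exact (t.mapsTo ⟨hu, huV⟩).1
  -- In dimension one, preserving the metric means `|D| dens' = dens`. Hence `D` does not vanish and
  -- keeps a sign `ς` near `x`.
  have hDsq : ∀ u ∈ c.ray, (fun _ => u) ∈ V → (D u * c'.dens (H u)) ^ 2 = c.dens u ^ 2 := by
    intro u hu huV
    have h1 := t.pullsBack _ ⟨hu, huV⟩ (fun _ => 1) (fun _ => 1)
    simp only [Matrix.mulVec, dotProduct, Finset.univ_unique, Finset.sum_singleton,
      Fin.default_eq_zero, one_mul, mul_one] at h1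
    rw [mul_pow, sq_dens hu, sq_dens (hmem u hu huV), ← h1]
    simp only [hH, hD]
    rw [const_apply_zero]
    ring
  have hder : ∀ u ∈ c.ray, (fun _ => u) ∈ V → ∀ s : Set ℝ, s ⊆ c.ray → (∀ v ∈ s, (fun _ => v) ∈ V) →
      HasDerivWithinAt H (D u) s u := by
    intro u hu huV s hs hsV
    have h1 := (t.contDiffOn.differentiableOn (by simp) _ ⟨hu, huV⟩).hasFDerivWithinAt
    have h2 : HasDerivWithinAt (fun u : ℝ => (fun _ => u : ℝ^1)) (fun _ => 1) s u :=
      hasDerivWithinAt_pi.2 fun _ => hasDerivWithinAt_id _ _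
    have h3 := h1.comp_hasDerivWithinAt u h2
      (show MapsTo _ s (c.dom ∩ V) from fun v hv => ⟨hs hv, hsV v hv⟩)
    exact hasDerivWithinAt_pi.1 h3 0
  have hDc : ContinuousWithinAt D c.ray x := by
    have h1 := t.contDiffOn.continuousOn_fderivWithin huniq (by simp) _ ⟨hx, hxV⟩
    have h2 : Tendsto (fun u : ℝ => (fun _ => u : ℝ^1)) (𝓝[c.ray] x) (𝓝[c.dom ∩ V] fun _ => x) := by
      refine tendsto_nhdsWithin_iff.2 ⟨hcst.continuousAt.mono_left nhdsWithin_le_nhds, ?_⟩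
      filter_upwards [self_mem_nhdsWithin, nhdsWithin_le_nhds hVn] with u hu huV
      exact ⟨hu, huV⟩
    have h3 : ContinuousWithinAt (fun u : ℝ => fderivWithin ℝ h (c.dom ∩ V) fun _ => u) c.ray x :=
      h1.tendsto.comp h2
    exact (continuous_apply 0).continuousAt.comp_continuousWithinAt
      (h3.clm_apply continuousWithinAt_const)
  have hDx : D x ≠ 0 := by
    intro h0
    have h1 := hDsq x hx hxV
    rw [h0, zero_mul] at h1
    have := dens_pos (ray_subset_line hx)
    nlinarith
  obtain ⟨ς, hς, hsgn⟩ : ∃ ς : ℝ, (ς = 1 ∨ ς = -1) ∧ ∀ᶠ u in 𝓝[c.ray] x, 0 < ς * D u := by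
    rcases lt_or_gt_of_ne hDx with h1 | h1
    · refine ⟨-1, Or.inr rfl, ?_⟩
      filter_upwards [hDc.eventually_lt_const h1] with u hu
      linarith
    · refine ⟨1, Or.inl rfl, ?_⟩
      filter_upwards [hDc.eventually_const_lt h1] with u hu
      linarith
  refine ⟨ς, hς, ?_⟩
  obtain ⟨η, hη, hball⟩ := Metric.mem_nhdsWithin_iff.1 (hsgn.and (nhdsWithin_le_nhds hVn))
  filter_upwards [inter_mem_nhdsWithin c.ray (ball_mem_nhds x hη)] with u hu
  have hI : ∀ v ∈ uIcc x u, v ∈ c.ray ∧ 0 < ς * D v ∧ (fun _ => v) ∈ V := by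
    intro v hv
    have h1 := uIcc_subset_ray hx hu.1 hv
    have h2 : v ∈ ball x η := (convex_ball x η).ordConnected.uIcc_subset (mem_ball_self hη) hu.2 hv
    exact ⟨h1, hball ⟨h2, h1⟩⟩
  have hu' := hI u right_mem_uIcc
  refine ⟨hmem u hu.1 hu'.2.2, ?_, ?_⟩
  · change c'.proj (fun _ => h (fun _ => u) 0) = _
    rw [const_apply_zero]
    exact t.proj_eq _ ⟨hu.1, hu'.2.2⟩
  -- With the sign fixed, `ς D dens' = dens`, so the two lengths have the same derivative up to `ς`
  -- and their difference is constant on the segment.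
  have hd : ∀ v ∈ uIcc x u, HasDerivWithinAt (fun v => c'.len (H x) (H v) - ς * c.len x v) 0
      (uIcc x u) v := by
    intro v hv
    obtain ⟨h1, h2, h3⟩ := hI v hv
    have h4 := hder v h1 h3 (uIcc x u) (fun w hw => (hI w hw).1) (fun w hw => (hI w hw).2.2)
    have h5 := (hasStrictDerivAt_len ((uIcc_subset_ray (hmem x hx hxV)
      (hmem v h1 h3)).trans ray_subset_line)).hasDerivAt.comp_hasDerivWithinAt v h4
    have h6 := ((hasStrictDerivAt_len (c := c) ((uIcc_subset_ray hx h1).trans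
      ray_subset_line)).hasDerivAt.hasDerivWithinAt (s := uIcc x u)).const_mul ς
    refine (h5.sub h6).congr_deriv ?_
    have h7 := dens_pos (ray_subset_line h1)
    have h8 := dens_pos (ray_subset_line (hmem v h1 h3))
    have h9 := hDsq v h1 h3
    have hς2 : ς * ς = 1 := by rcases hς with rfl | rfl <;> norm_num
    have h10 : ς * D v * c'.dens (H v) = c.dens v := by
      have : (ς * D v * c'.dens (H v)) ^ 2 = c.dens v ^ 2 := by
        rw [← h9]
        linear_combination (D v * c'.dens (H v)) ^ 2 * hς2
      exact (pow_left_inj₀ (by positivity) h7.le two_ne_zero).1 this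
    rw [← h10]
    linear_combination (-(D v * c'.dens (H v))) * hς2
  have h1 := (convex_uIcc x u).norm_image_sub_le_of_norm_hasDerivWithin_le (C := 0) hd
    (fun v _ => by simp) left_mem_uIcc right_mem_uIcc
  rw [zero_mul, len_self, len_self, mul_zero, sub_zero, sub_zero] at h1
  exact sub_eq_zero.1 (norm_le_zero_iff.1 h1)

end IsTransition

/-! ### Unit speed paths in one-dimensional orbifolds. -/

/-- The length coordinates of a unit speed path at a point with coordinate `a`: the path is
reflected at the boundary point `0`, and passes through the other points. -/
def IsFold (a : ℝ) (g : ℝ → ℝ) : Prop :=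
  (a = 0 ∧ g = fun x => |x|) ∨ (0 < a ∧ ∃ ς : ℝ, (ς = 1 ∨ ς = -1) ∧ g = fun x => ς * x)

namespace IsFold

variable {a : ℝ} {g : ℝ → ℝ}

lemma abs_sub_le (h : IsFold a g) (x y : ℝ) : |g x - g y| ≤ |x - y| := by
  rcases h with ⟨-, rfl⟩ | ⟨-, ς, rfl | rfl, rfl⟩
  · exact abs_abs_sub_abs_le x y
  · simp
  · rw [← abs_neg]; simp [add_comm, sub_eq_add_neg]

lemma exists_eq (h : IsFold a g) {L : ℝ} (hL : a = 0 → 0 ≤ L) : ∃ τ, |τ| = |L| ∧ g τ = L := by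
  rcases h with ⟨h0, rfl⟩ | ⟨-, ς, rfl | rfl, rfl⟩
  · exact ⟨L, rfl, abs_of_nonneg (hL h0)⟩
  · exact ⟨L, rfl, one_mul L⟩
  · exact ⟨-L, abs_neg L, by ring⟩

lemma comp_mul (h : IsFold a g) {ς : ℝ} (hς : ς = 1 ∨ ς = -1) : IsFold a fun x => g (ς * x) := by
  rcases h with ⟨h0, rfl⟩ | ⟨h0, κ, hκ, rfl⟩
  · refine Or.inl ⟨h0, funext fun x => ?_⟩
    rcases hς with rfl | rfl <;> simp
  · refine Or.inr ⟨h0, κ * ς, ?_, funext fun x => by ring⟩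
    rcases hς with rfl | rfl <;> rcases hκ with rfl | rfl <;> norm_num

end IsFold

namespace RiemannianOrbifold

open RiemannianOrbifoldChart

variable {X : Type*} [TopologicalSpace X] {O : RiemannianOrbifold 1 X}

/-- `α` is near `t` a unit speed path, reflected at boundary points. -/
def IsArcAt (O : RiemannianOrbifold 1 X) (α : ℝ → X) (t : ℝ) : Prop :=
  ∃ c ∈ O.atlas, ∃ y g : ℝ → ℝ, IsFold (y t) g ∧ ∀ᶠ τ in 𝓝 t, ContinuousAt y τ ∧ y τ ∈ c.ray ∧
    α τ = c.toPoint (y τ) ∧ c.len (y t) (y τ) = g (τ - t)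

variable {α β : ℝ → X} {s t : ℝ}

lemma IsArcAt.congr (h : O.IsArcAt α t) (hβ : ∀ᶠ τ in 𝓝 t, β τ = α τ) : O.IsArcAt β t := by
  obtain ⟨c, hc, y, g, hg, h1⟩ := h
  refine ⟨c, hc, y, g, hg, ?_⟩
  filter_upwards [h1, hβ] with τ h2 h3
  exact ⟨h2.1, h2.2.1, h3.trans h2.2.2.1, h2.2.2.2⟩

lemma IsArcAt.comp {a ς : ℝ} (hς : ς = 1 ∨ ς = -1) (h : O.IsArcAt α (a + ς * t)) :
    O.IsArcAt (fun τ => α (a + ς * τ)) t := by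
  obtain ⟨c, hc, y, g, hg, h1⟩ := h
  refine ⟨c, hc, fun τ => y (a + ς * τ), fun x => g (ς * x), hg.comp_mul hς, ?_⟩
  have hcont : Continuous fun τ => a + ς * τ := by fun_prop
  filter_upwards [hcont.continuousAt.eventually h1] with τ ⟨h2, h3, h4, h5⟩
  refine ⟨ContinuousAt.comp (f := fun τ => a + ς * τ) h2 hcont.continuousAt, h3, h4, ?_⟩
  rw [h5]
  congr 1
  ring

/-- Near an interior point the path goes straight on. Near a reflection at the boundary, every other
time lies on one branch of the absolute value, where the path is again straight, with the sign of
that branch. -/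
lemma IsArcAt.eventually (h : O.IsArcAt α t) : ∀ᶠ s in 𝓝 t, O.IsArcAt α s := by
  obtain ⟨c, hc, y, g, hg, h1⟩ := h
  obtain ⟨-, hyt, -, -⟩ := h1.self_of_nhds
  have hpos : ∀ᶠ s in 𝓝 t, 0 < y t → 0 < y s := by
    rcases le_or_gt (y t) 0 with h0 | h0
    · exact Eventually.of_forall fun s h => absurd h h0.not_gt
    · exact (h1.self_of_nhds.1.eventually_const_lt h0).mono fun s h _ => h
  filter_upwards [h1.eventually_nhds, hpos] with s hs hys0
  obtain ⟨-, hys, -, hls⟩ := hs.self_of_nhds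
  have hlen : ∀ᶠ τ in 𝓝 s, ContinuousAt y τ ∧ y τ ∈ c.ray ∧ α τ = c.toPoint (y τ) ∧
      c.len (y s) (y τ) = g (τ - t) - g (s - t) := by
    filter_upwards [hs] with τ ⟨h2, h3, h4, h5⟩
    refine ⟨h2, h3, h4, ?_⟩
    have := len_add hyt hys h3
    linarith
  rcases hg with ⟨h0, rfl⟩ | ⟨h0, ς, hς, rfl⟩
  · rcases eq_or_ne s t with rfl | hne
    · exact ⟨c, hc, y, _, Or.inl ⟨h0, rfl⟩, h1⟩
    have hys0 : 0 < y s := by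
      refine lt_of_le_of_ne (nonneg_of_mem_ray hys) fun h => ?_
      rw [h0, ← h, len_self] at hls
      exact hne (sub_eq_zero.1 (abs_eq_zero.1 hls.symm))
    rcases lt_or_gt_of_ne hne with hlt | hlt
    · refine ⟨c, hc, y, fun x => -1 * x, Or.inr ⟨hys0, -1, Or.inr rfl, rfl⟩, ?_⟩
      filter_upwards [hlen, gt_mem_nhds hlt] with τ ⟨h2, h3, h4, h5⟩ h6
      refine ⟨h2, h3, h4, ?_⟩
      rw [h5, abs_of_neg (sub_neg.2 h6), abs_of_neg (sub_neg.2 hlt)]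
      ring
    · refine ⟨c, hc, y, fun x => 1 * x, Or.inr ⟨hys0, 1, Or.inl rfl, rfl⟩, ?_⟩
      filter_upwards [hlen, lt_mem_nhds hlt] with τ ⟨h2, h3, h4, h5⟩ h6
      refine ⟨h2, h3, h4, ?_⟩
      rw [h5, abs_of_pos (sub_pos.2 h6), abs_of_pos (sub_pos.2 hlt)]
      ring
  · refine ⟨c, hc, y, fun x => ς * x, Or.inr ⟨hys0 h0, ς, hς, rfl⟩, ?_⟩
    filter_upwards [hlen] with τ ⟨h2, h3, h4, h5⟩
    exact ⟨h2, h3, h4, by rw [h5]; ring⟩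

/-- At an interior point the inverse of the length is the path; at the boundary point it is composed
with `|τ|`, so that the path returns the way it came. The last clause gives every nearby chart point
its place on the path. -/
lemma exists_isArcAt_of_mem_ray {c : Chart 1 X} (hc : c ∈ O.atlas) {x : ℝ}
    (hx : x ∈ c.ray) : ∃ α : ℝ → X, α 0 = c.toPoint x ∧ O.IsArcAt α 0 ∧
      (0 < x → ∀ᶠ u in 𝓝 x, u ∈ c.ray ∧ c.toPoint u = α (c.len x u)) := by
  obtain ⟨E, hE0, hE⟩ := exists_len_eq hx
  rcases (nonneg_of_mem_ray hx).eq_or_lt with h0 | h0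
  · refine ⟨fun τ => c.toPoint (E |τ|), by simp only [abs_zero, hE0], ⟨c, hc, fun τ => E |τ|,
      fun x => |x|,
      Or.inl ⟨(show E |0| = 0 by rw [abs_zero, hE0, h0.symm]), rfl⟩, ?_⟩, fun h => absurd h
        (by rw [← h0]; exact lt_irrefl 0)⟩
    have habs : Tendsto (fun τ : ℝ => |τ|) (𝓝 0) (𝓝 0) := continuous_abs.tendsto' _ _ abs_zero
    filter_upwards [habs.eventually hE] with τ ⟨h1, h2, h3⟩
    refine ⟨ContinuousAt.comp (f := fun τ : ℝ => |τ|) h1 continuous_abs.continuousAt,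
      mem_ray_of_mem_line (h2 right_mem_uIcc) ?_, rfl, by simpa [hE0] using h3⟩
    by_contra hneg
    have h4 := len_pos (c := c) (x := E |τ|) (y := x) (by rwa [uIcc_comm]) (by linarith)
    rw [len_symm, h3] at h4
    linarith [abs_nonneg τ]
  · have hEx : ContinuousAt E 0 := hE.self_of_nhds.1
    have hpos : ∀ᶠ τ in 𝓝 0, 0 < E τ := hEx.eventually_const_lt (by rwa [hE0])
    have hray : ∀ᶠ τ in 𝓝 0, E τ ∈ c.ray := by
      filter_upwards [hE, hpos] with τ h1 h2
      exact mem_ray_of_mem_line (h1.2.1 right_mem_uIcc) h2.le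
    refine ⟨fun τ => c.toPoint (E τ), by simp only [hE0], ⟨c, hc, E, fun x => 1 * x,
      Or.inr ⟨by rwa [hE0], 1, Or.inl rfl, rfl⟩, ?_⟩, fun _ => ?_⟩
    · filter_upwards [hE, hray] with τ h1 h2
      exact ⟨h1.1, h2, rfl, by rw [hE0, h1.2.2]; ring⟩
    · have hlen : Tendsto (c.len x) (𝓝 x) (𝓝 0) := by
        have h1 := (hasStrictDerivAt_len (c := c) (x := x) (y := x) (by
          rw [uIcc_self, singleton_subset_iff]; exact ray_subset_line hx)).hasDerivAt.continuousAt
        rw [ContinuousAt, len_self] at h1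
        exact h1
      filter_upwards [hlen.eventually (hE.and hray), lt_mem_nhds h0,
        c.isOpen_line.mem_nhds (ray_subset_line hx)] with u ⟨h1, h2⟩ h3 h4
      have hu := mem_ray_of_mem_line h4 h3.le
      exact ⟨hu, by rw [eq_of_len_eq hx h2 hu h1.2.2]⟩

lemma exists_isArcAt (O : RiemannianOrbifold 1 X) (p : X) :
    ∃ α : ℝ → X, α 0 = p ∧ O.IsArcAt α 0 := by
  obtain ⟨c, hc, z, hz, rfl⟩ := O.cover p
  have hx : z 0 ∈ c.ray := by
    change (fun _ => z 0) ∈ c.dom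
    rwa [const_apply_zero]
  obtain ⟨α, h1, h2, -⟩ := O.exists_isArcAt_of_mem_ray hc hx
  exact ⟨α, by rw [h1, toPoint, const_apply_zero], h2⟩

/-- Unit speed paths through the same point agree up to orientation. -/
lemma IsArcAt.exists_eq (hα : O.IsArcAt α s) (hβ : O.IsArcAt β t) (h : α s = β t) :
    ∃ ς : ℝ, (ς = 1 ∨ ς = -1) ∧ ∀ᶠ τ in 𝓝 0, α (s + τ) = β (t + ς * τ) := by
  obtain ⟨c, hc, y, g, hg, h1⟩ := hα
  obtain ⟨c', hc', y', g', hg', h1'⟩ := hβ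
  obtain ⟨hyc, hy, hαs, -⟩ := h1.self_of_nhds
  obtain ⟨-, hy', hβt, -⟩ := h1'.self_of_nhds
  obtain ⟨f, k, V, W, T, hV, hf⟩ := O.exists_transition hc hc' (x := fun _ => y s)
    (y := fun _ => y' t) hy hy' (by rw [hαs, hβt] at h; exact h)
  obtain ⟨ς₀, hς₀, hT⟩ := T.exists_len_eq hy hV
  have hft : f (fun _ => y s) 0 = y' t := by rw [hf]
  rw [hft] at hT
  have hW : (fun _ => y' t) ∈ W := by rw [← hf]; exact (T.mapsTo ⟨hy, hV⟩).2
  -- Changes of charts in both directions map interior points to interior points, so both paths are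
  -- reflected at this point or neither is.
  have hzero : y s = 0 ↔ y' t = 0 := by
    have e1 : 0 < y s → 0 < y' t := fun h0 => by
      have := (T.mapsTo_interior ⟨(mem_interior_dom_iff hy).2 h0, hV⟩).1
      rw [hf] at this
      exact (mem_interior_dom_iff hy').1 this
    have e2 : 0 < y' t → 0 < y s := fun h0 => by
      have := (mapsTo_interior_of_leftInverse T.isOpen_right T.mapsTo_symm T.rightInvOn
        T.contDiffOn_symm T.contDiffOn ⟨(mem_interior_dom_iff hy').2 h0, hW⟩).1
      rw [← hf, T.leftInvOn ⟨hy, hV⟩] at this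
      exact (mem_interior_dom_iff hy).1 this
    have := nonneg_of_mem_ray hy
    have := nonneg_of_mem_ray hy'
    grind
  have hsτ : Tendsto (fun τ => s + τ) (𝓝 0) (𝓝 s) :=
    (continuous_const.add continuous_id).tendsto' _ _ (add_zero s)
  have hyT : Tendsto y (𝓝 s) (𝓝[c.ray] (y s)) :=
    tendsto_nhdsWithin_iff.2 ⟨hyc, h1.mono fun τ h => h.2.1⟩
  have e1 := hsτ.eventually ((hyT.eventually hT).and h1)
  have key : ∀ ς : ℝ, (∀ᶠ τ in 𝓝 0, ς₀ * g τ = g' (ς * τ)) →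
      ∀ᶠ τ in 𝓝 0, α (s + τ) = β (t + ς * τ) := by
    intro ς hςe
    have htτ : Tendsto (fun τ => t + ς * τ) (𝓝 0) (𝓝 t) := by
      have : Continuous fun τ => t + ς * τ := by fun_prop
      exact this.tendsto' _ _ (by simp)
    filter_upwards [e1, hςe, htτ.eventually h1'] with τ ⟨⟨h2, h3, h4⟩, h5⟩ h6 h7
    have h8 : f (fun _ => y (s + τ)) 0 = y' (t + ς * τ) := by
      refine eq_of_len_eq hy' h2 h7.2.1 ?_
      rw [h4, h5.2.2.2, h7.2.2.2]
      simpa using h6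
    rw [h5.2.2.1, h7.2.2.1, ← h3, h8]
  rcases hg with ⟨h0, rfl⟩ | ⟨h0, κ, hκ, rfl⟩
  · rcases hg' with ⟨h0', rfl⟩ | ⟨h0', -⟩
    · refine ⟨1, Or.inl rfl, key 1 ?_⟩
      filter_upwards [e1] with τ ⟨⟨h2, h3, h4⟩, h5⟩
      have h6 := h5.2.2.2
      rw [add_sub_cancel_left] at h6
      rw [h6] at h4
      have h7 := len_nonneg hy' h2 (h0' ▸ nonneg_of_mem_ray h2)
      rw [h4] at h7
      rw [one_mul]
      rcases hς₀ with rfl | rfl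
      · rw [one_mul]
      · have := abs_nonneg τ
        linarith
    · exact absurd (hzero.1 h0) h0'.ne'
  · rcases hg' with ⟨h0', -⟩ | ⟨h0', κ', hκ', rfl⟩
    · exact absurd (hzero.2 h0') h0.ne'
    · refine ⟨κ' * ς₀ * κ, ?_, key _ (Eventually.of_forall fun τ => ?_)⟩
      · rcases hς₀ with rfl | rfl <;> rcases hκ with rfl | rfl <;> rcases hκ' with rfl | rfl <;>
          norm_num
      · have : κ' * κ' = 1 := by rcases hκ' with rfl | rfl <;> norm_num
        linear_combination (-(ς₀ * κ * τ)) * this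

lemma IsArcAt.continuousAt (h : O.IsArcAt α t) : ContinuousAt α t := by
  obtain ⟨c, hc, y, g, hg, h1⟩ := h
  obtain ⟨hyc, hy, -⟩ := h1.self_of_nhds
  have h2 : ContinuousAt (fun τ => c.toPoint (y τ)) t := by
    have h3 : Tendsto (fun τ => (fun _ => y τ : ℝ^1)) (𝓝 t) (𝓝[c.dom] fun _ => y t) :=
      tendsto_nhdsWithin_iff.2 ⟨tendsto_pi_nhds.2 fun _ => hyc, h1.mono fun τ h => h.2.1⟩
    exact (c.continuousOn_proj _ hy).tendsto.comp h3
  exact h2.congr (h1.mono fun τ h => h.2.2.1.symm)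

/-- A nearby point of the chart has a small signed length, nonnegative at a boundary point, and the
fold takes this value at some small time. Points of the ray are determined by their length
coordinate. -/
lemma IsArcAt.image_mem_nhds (h : O.IsArcAt α t) {U : Set ℝ} (hU : U ∈ 𝓝 t) : α '' U ∈ 𝓝 (α t) := by
  obtain ⟨c, hc, y, g, hg, h1⟩ := h
  obtain ⟨-, hy, hαt, -⟩ := h1.self_of_nhds
  obtain ⟨ε, hε, hball⟩ := Metric.mem_nhds_iff.1 (inter_mem hU h1)
  have hlen : ∀ᶠ u in 𝓝 (y t), |c.len (y t) u| < ε := by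
    have h2 := (hasStrictDerivAt_len (c := c) (x := y t) (y := y t) (by
      rw [uIcc_self, singleton_subset_iff]; exact ray_subset_line hy)).hasDerivAt.continuousAt
    exact h2.abs.eventually_lt_const (by simpa only [len_self, abs_zero] using hε)
  obtain ⟨η, hη, hηb⟩ := eventually_nhds_iff_ball.1 hlen
  rw [hαt]
  refine mem_of_superset (isOpen_image_toPoint hy hη) ?_
  rintro _ ⟨u, ⟨hur, hu⟩, rfl⟩
  obtain ⟨τ, hτ, hgτ⟩ := hg.exists_eq (L := c.len (y t) u)
    fun h0 => len_nonneg hy hur (h0 ▸ nonneg_of_mem_ray hur)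
  obtain ⟨hτU, -, h3, h4, h5⟩ := hball (a := t + τ) (by
    rw [mem_ball, Real.dist_eq, add_sub_cancel_left, hτ]; exact hηb u hu)
  rw [add_sub_cancel_left, hgτ] at h5
  exact ⟨t + τ, hτU, by rw [h4, eq_of_len_eq hy h3 hur h5]⟩

variable [T2Space X] [MeasurableSpace X] [BorelSpace X] [CompactSpace X] [Nonempty X]

/-- The image is contained in the segment between the extreme coordinates, and the fold does not
increase distances, so this segment is no longer than the time interval. -/
lemma IsArcAt.vol_image_Icc_le (h : O.IsArcAt α t) : ∃ U ∈ 𝓝 t, ∀ a ∈ U, ∀ b ∈ U, a ≤ b →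
    O.vol (α '' Icc a b) ≤ ofReal (b - a) := by
  obtain ⟨c, hc, y, g, hg, h1⟩ := h
  obtain ⟨-, hy, -⟩ := h1.self_of_nhds
  obtain ⟨ε, hε, hball⟩ := Metric.mem_nhds_iff.1 h1
  refine ⟨_, ball_mem_nhds t hε, fun a ha b hb hab => ?_⟩
  have hI : Icc a b ⊆ ball t ε := by
    rw [Real.ball_eq_Ioo] at ha hb ⊢
    exact ordConnected_Ioo.out ha hb
  have hyc : ContinuousOn y (Icc a b) := fun τ hτ => (hball (hI hτ)).1.continuousWithinAt
  obtain ⟨u, hu, hmin⟩ := isCompact_Icc.exists_isMinOn (nonempty_Icc.2 hab) hyc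
  obtain ⟨v, hv, hmax⟩ := isCompact_Icc.exists_isMaxOn (nonempty_Icc.2 hab) hyc
  obtain ⟨-, hur, -, hlu⟩ := hball (hI hu)
  obtain ⟨-, hvr, -, hlv⟩ := hball (hI hv)
  refine (measure_mono (show α '' Icc a b ⊆ c.toPoint '' Icc (y u) (y v) from ?_)).trans
    ((vol_image_toPoint_Icc_le hc hur hvr (hmin hv)).trans (ofReal_le_ofReal ?_))
  · rintro _ ⟨τ, hτ, rfl⟩
    exact ⟨y τ, ⟨hmin hτ, hmax hτ⟩, (hball (hI hτ)).2.2.1.symm⟩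
  · have h2 := len_add hy hur hvr
    have h3 := (le_abs_self _).trans (hg.abs_sub_le (v - t) (u - t))
    rw [← hlv, ← hlu, sub_sub_sub_cancel_right] at h3
    have h4 : |v - u| ≤ b - a := abs_sub_le_iff.2 ⟨by linarith [hv.2, hu.1], by linarith [hu.2,
      hv.1]⟩
    linarith

end RiemannianOrbifold

/-- A transitive relation which holds locally holds on all segments. -/
lemma of_forall_eventually_of_trans {R : ℝ → ℝ → Prop}
    (htrans : ∀ a b c, a ≤ b → b ≤ c → R a b → R b c → R a c)
    (hloc : ∀ t, ∃ U ∈ 𝓝 t, ∀ a ∈ U, ∀ b ∈ U, a ≤ b → R a b) {a b : ℝ} (hab : a ≤ b) : R a b := by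
  choose U hU hR using hloc
  obtain ⟨τ, hτ0, hmono, ⟨N, hN⟩, hsub⟩ := exists_monotone_Icc_subset_open_cover_Icc hab
    (c := fun t => Subtype.val ⁻¹' interior (U t))
    (fun t => isOpen_interior.preimage continuous_subtype_val)
    fun t _ => mem_iUnion.2 ⟨t, mem_interior_iff_mem_nhds.2 (hU t)⟩
  have h1 : ∀ k, R a (τ k) := by
    intro k
    induction k with
    | zero =>
      obtain ⟨t, ht⟩ := hsub 0
      have := interior_subset (s := U t) (ht ⟨le_rfl, hmono (Nat.zero_le 1)⟩)
      rw [hτ0] at this ⊢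
      exact hR t a this a this le_rfl
    | succ k ih =>
      obtain ⟨t, ht⟩ := hsub k
      have hk := hmono (Nat.le_succ k)
      exact htrans _ _ _ (τ k).2.1 hk ih (hR t _ (interior_subset (ht ⟨le_rfl, hk⟩)) _
        (interior_subset (ht ⟨hk, le_rfl⟩)) hk)
  rw [← hN N le_rfl]
  exact h1 N

lemma exists_int_seq {A : Type*} [Nonempty A] {G : A → A → Prop} (hnext : ∀ x, ∃ y, G x y)
    (hprev : ∀ y, ∃ x, G x y) : ∃ x : ℤ → A, ∀ k, G (x k) (x (k + 1)) := by
  choose f hf using hnext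
  choose g hg using hprev
  obtain ⟨x₀⟩ := ‹Nonempty A›
  refine ⟨fun k => Int.rec (fun n => f^[n] x₀) (fun n => g^[n + 1] x₀) k, fun k => ?_⟩
  match k with
  | Int.ofNat n =>
    change G (f^[n] x₀) (f^[n + 1] x₀)
    rw [Function.iterate_succ_apply']
    exact hf _
  | Int.negSucc 0 => exact hg x₀
  | Int.negSucc (n + 1) =>
    change G (g^[n + 1 + 1] x₀) (g^[n + 1] x₀)
    rw [Function.iterate_succ_apply' g (n + 1)]
    exact hg _

/-! ### Complete unit speed paths. -/

namespace RiemannianOrbifold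

variable {X : Type*} [TopologicalSpace X] {O : RiemannianOrbifold 1 X} {γ σ : ℝ → X}

/-- Compactness: finitely many halves of arcs cover the orbifold, and an arc centred at one of their
points is a translate that still has time less than half the original radius on both sides. -/
lemma exists_uniform_isArcAt [CompactSpace X] (O : RiemannianOrbifold 1 X) :
    ∃ δ > 0, ∀ p, ∃ σ : ℝ → X, σ 0 = p ∧ ∀ t ∈ ball 0 δ, O.IsArcAt σ t := by
  have h1 : ∀ p, ∃ σ : ℝ → X, σ 0 = p ∧ ∃ ε > 0, ∀ t ∈ ball 0 ε, O.IsArcAt σ t := by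
    intro p
    obtain ⟨σ, h0, h⟩ := O.exists_isArcAt p
    exact ⟨σ, h0, eventually_nhds_iff_ball.1 h.eventually⟩
  choose σ h0 ε hε harc using h1
  have hnhds : ∀ p, σ p '' ball 0 (ε p / 2) ∈ 𝓝 p := fun p => by
    have := (harc p 0 (mem_ball_self (hε p))).image_mem_nhds (ball_mem_nhds 0 (half_pos (hε p)))
    rwa [h0] at this
  obtain ⟨s, hs⟩ := CompactSpace.elim_nhds_subcover _ hnhds
  obtain ⟨δ, hδ, hδs⟩ : ∃ δ > 0, ∀ p ∈ s, δ < ε p / 2 := by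
    have h2 : ∀ᶠ δ in 𝓝[>] (0 : ℝ), ∀ p ∈ s, δ < ε p / 2 :=
      (Filter.eventually_all_finset s).2 fun p _ =>
        nhdsWithin_le_nhds (gt_mem_nhds (half_pos (hε p)))
    obtain ⟨δ, h3, h4⟩ := (h2.and self_mem_nhdsWithin).exists
    exact ⟨δ, h4, h3⟩
  refine ⟨δ, hδ, fun p => ?_⟩
  obtain ⟨q, hq, t, ht, rfl⟩ : ∃ q ∈ s, p ∈ σ q '' ball 0 (ε q / 2) := by
    have : p ∈ ⋃ x ∈ s, σ x '' ball 0 (ε x / 2) := hs ▸ mem_univ p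
    simpa only [mem_iUnion, exists_prop] using this
  refine ⟨fun τ => σ q (t + 1 * τ), by simp, fun τ hτ => IsArcAt.comp (Or.inl rfl) (harc q _ ?_)⟩
  rw [mem_ball_zero_iff, Real.norm_eq_abs, abs_lt] at ht hτ ⊢
  have := hδs q hq
  exact ⟨by linarith [ht.1, hτ.1], by linarith [ht.2, hτ.2]⟩

/-- Complete unit speed paths exist. -/
lemma exists_forall_isArcAt [CompactSpace X] [Nonempty X] (O : RiemannianOrbifold 1 X) :
    ∃ γ : ℝ → X, ∀ t, O.IsArcAt γ t := by
  obtain ⟨δ, hδ, hu⟩ := O.exists_uniform_isArcAt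
  -- Arcs of radius `d = 2 e` will be glued at times `±e`. A continuation centred at such an end is
  -- evaluated at times up to `e + d = 3 e`, which stays below `δ = 4 e`.
  set e := δ / 4 with he
  set d := δ / 2 with hd
  have he0 : 0 < e := by positivity
  have hd0 : 0 < d := by positivity
  have hde : d = 2 * e := by rw [hd, he]; ring
  have hδe : δ = 4 * e := by rw [he]; ring
  set A := {σ : ℝ → X // ∀ t ∈ ball 0 d, O.IsArcAt σ t} with hA
  -- Continuation forwards for `κ = 1` and backwards for `κ = -1`: an arc centred at the end point
  -- agrees with `σ` up to orientation, and the sign `ς` corrects the orientation.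
  have hext : ∀ (σ : A) (κ : ℝ), (κ = 1 ∨ κ = -1) →
      ∃ σ' : A, ∀ᶠ τ in 𝓝 0, σ'.1 (-(κ * e) + τ) = σ.1 (κ * e + τ) := by
    intro σ κ hκ
    obtain ⟨β, hβ0, hβ⟩ := hu (σ.1 (κ * e))
    have hκe : |κ * e| = e := by rcases hκ with rfl | rfl <;> simp [abs_of_pos he0]
    obtain ⟨ς, hς, h1⟩ := (σ.2 (κ * e) (by
      rw [mem_ball_zero_iff, Real.norm_eq_abs, hκe]; linarith)).exists_eq
      (hβ 0 (mem_ball_self hδ)) hβ0.symm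
    refine ⟨⟨fun τ => β (ς * (κ * e) + ς * τ), fun t ht => IsArcAt.comp hς (hβ _ ?_)⟩,
      h1.mono fun τ h => ?_⟩
    · have h2 : |ς * (κ * e) + ς * t| = |κ * e + t| := by
        rw [← mul_add, abs_mul]
        rcases hς with rfl | rfl <;> simp
      have h3 := abs_add_le (κ * e) t
      rw [mem_ball_zero_iff, Real.norm_eq_abs] at ht ⊢
      linarith
    · rw [h]
      exact congrArg β (by ring)
  have : Nonempty A := by
    obtain ⟨p⟩ : Nonempty X := inferInstance
    obtain ⟨σ, -, hσ⟩ := hu p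
    exact ⟨⟨σ, fun t ht => hσ t (ball_subset_ball (by linarith) ht)⟩⟩
  obtain ⟨x, hx⟩ := exists_int_seq (A := A)
    (G := fun σ σ' => ∀ᶠ τ in 𝓝 0, σ'.1 (-e + τ) = σ.1 (e + τ))
    (fun σ => by simpa using hext σ 1 (Or.inl rfl)) (fun σ => by
      obtain ⟨σ', h⟩ := hext σ (-1) (Or.inr rfl)
      exact ⟨σ', h.mono fun τ h => by simpa using h.symm⟩)
  -- On `[k d, (k + 1) d)` the path is the `k`-th arc with local time in `[-e, e)`. Only at the
  -- seams `t = k d` do two arcs have to be compared.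
  set γ : ℝ → X := fun t => (x ⌊t / d⌋).1 (t - ⌊t / d⌋ * d - e) with hγ
  refine ⟨γ, fun t => ?_⟩
  set k := ⌊t / d⌋ with hk
  have hk1 : k * d ≤ t := (le_div_iff₀ hd0).1 (Int.floor_le (t / d))
  have hk2 : t < (k + 1) * d := (div_lt_iff₀ hd0).1 (Int.lt_floor_add_one (t / d))
  have hfloor : ∀ (j : ℤ) (τ : ℝ), j * d ≤ τ → τ < (j + 1) * d → ⌊τ / d⌋ = j := fun j τ h1 h2 =>
    Int.floor_eq_iff.2 ⟨(le_div_iff₀ hd0).2 h1, (div_lt_iff₀ hd0).2 h2⟩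
  have hev : ∀ᶠ τ in 𝓝 t, γ τ = (x k).1 (-(k * d + e) + 1 * τ) := by
    have hright : ∀ τ, k * d ≤ τ → τ < (k + 1) * d → γ τ = (x k).1 (-(k * d + e) + 1 * τ) := by
      intro τ h1 h2
      simp only [hγ, hfloor k τ h1 h2]
      exact congrArg (x k).1 (by ring)
    rcases hk1.eq_or_lt with h1 | h1
    · have h2 := hx (k - 1)
      rw [sub_add_cancel] at h2
      have h3 : Tendsto (fun τ => τ - k * d) (𝓝 t) (𝓝 0) :=
        (continuous_id.sub continuous_const).tendsto' _ _ (by simp [← h1])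
      filter_upwards [h3.eventually h2, gt_mem_nhds hk2,
        lt_mem_nhds (show (k - 1) * d < t by linarith)] with τ h4 h5 h6
      rcases le_or_gt (k * d) τ with h7 | h7
      · exact hright τ h7 h5
      · have h8 : ⌊τ / d⌋ = k - 1 := hfloor (k - 1) τ (by push_cast; linarith)
          (by push_cast; linarith)
        have h9 : -(k * d + e) + 1 * τ = -e + (τ - k * d) := by ring
        simp only [hγ, h8]
        rw [h9, h4]
        exact congrArg (x (k - 1)).1 (by push_cast; linarith)
    · filter_upwards [lt_mem_nhds h1, gt_mem_nhds hk2] with τ h4 h5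
      exact hright τ h4.le h5
  refine IsArcAt.congr (IsArcAt.comp (Or.inl rfl) ((x k).2 _ ?_)) hev
  rw [mem_ball_zero_iff, Real.norm_eq_abs, abs_lt]
  constructor <;> linarith

/-- A unit speed path issuing from a point of a complete one stays on it, without progressing
faster. -/
lemma exists_eq_of_isArcAt [T2Space X] (hγ : ∀ t, O.IsArcAt γ t) {a b : ℝ} (hab : a ≤ b)
    (hσ : ∀ s ∈ Icc a b, O.IsArcAt σ s) {t : ℝ} (h : σ a = γ t) :
    ∃ t', |t' - t| ≤ b - a ∧ σ b = γ t' := by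
  -- Continuous induction along `σ`. The set is closed by compactness and continuity of both paths;
  -- it extends to the right because paths through a common point agree up to orientation, so `t'`
  -- moves no faster than the time of `σ`.
  set W : Set ℝ := {x | ∃ t', |t' - t| ≤ x - a ∧ σ x = γ t'} with hW
  have hγc : Continuous γ := continuous_iff_continuousAt.2 fun t => (hγ t).continuousAt
  have hσc : ContinuousOn σ (Icc a b) := fun s hs => (hσ s hs).continuousAt.continuousWithinAt
  have hclosed : IsClosed (W ∩ Icc a b) := by
    set K : Set (ℝ × ℝ) := Icc a b ×ˢ Icc (t - (b - a)) (t + (b - a)) with hK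
    have hKc : IsCompact K := isCompact_Icc.prod isCompact_Icc
    have h1 : IsClosed {z ∈ K | (σ z.1, γ z.2) ∈ diagonal X} :=
      ((hσc.comp continuousOn_fst fun z hz => hz.1).prodMk
        (hγc.comp continuous_snd).continuousOn).preimage_isClosed_of_isClosed hKc.isClosed
        isClosed_diagonal
    have h2 : IsClosed {z : ℝ × ℝ | |z.2 - t| ≤ z.1 - a} := isClosed_le (by fun_prop) (by fun_prop)
    have h3 := (hKc.of_isClosed_subset (h1.inter h2) (fun z hz => hz.1.1)).image continuous_fst
    convert h3.isClosed using 1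
    ext x
    constructor
    · rintro ⟨⟨t', ht', he⟩, hx⟩
      have h4 := abs_le.1 (ht'.trans (sub_le_sub_right hx.2 a))
      exact ⟨(x, t'), ⟨⟨⟨hx, by linarith [h4.1], by linarith [h4.2]⟩, he⟩, ht'⟩, rfl⟩
    · rintro ⟨z, ⟨⟨hz, he⟩, hz'⟩, rfl⟩
      exact ⟨⟨z.2, hz', he⟩, hz.1⟩
  refine hclosed.Icc_subset_of_forall_exists_gt (show a ∈ W from ⟨t, by simp, h⟩) ?_
    (right_mem_Icc.2 hab)
  rintro x ⟨⟨t', ht', he⟩, hx⟩ y hy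
  obtain ⟨ς, hς, h1⟩ := (hσ x (Ico_subset_Icc_self hx)).exists_eq (hγ t') he
  obtain ⟨ε, hε, h2⟩ := eventually_nhds_iff_ball.1 h1
  have hη : 0 < min (ε / 2) (y - x) := lt_min (half_pos hε) (sub_pos.2 hy)
  refine ⟨x + min (ε / 2) (y - x), ⟨t' + ς * min (ε / 2) (y - x), ?_, h2 _ ?_⟩, by linarith,
    by linarith [min_le_right (ε / 2) (y - x)]⟩
  · have h3 : |ς * min (ε / 2) (y - x)| = min (ε / 2) (y - x) := by
      rcases hς with rfl | rfl <;> simp [abs_of_pos hη]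
    have h4 := abs_add_le (t' - t) (ς * min (ε / 2) (y - x))
    rw [h3] at h4
    have h5 : t' + ς * min (ε / 2) (y - x) - t = t' - t + ς * min (ε / 2) (y - x) := by ring
    rw [h5]
    linarith
  · rw [mem_ball_zero_iff, Real.norm_eq_abs, abs_of_pos hη]
    linarith [min_le_left (ε / 2) (y - x)]

lemma exists_eq_of_isArcAt_uIcc [T2Space X] (hγ : ∀ t, O.IsArcAt γ t) {a b : ℝ}
    (hσ : ∀ s ∈ uIcc a b, O.IsArcAt σ s) {t : ℝ} (h : σ a = γ t) :
    ∃ t', |t' - t| ≤ |b - a| ∧ σ b = γ t' := by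
  rcases le_total a b with hab | hab
  · rw [uIcc_of_le hab] at hσ
    rw [abs_of_nonneg (sub_nonneg.2 hab)]
    exact exists_eq_of_isArcAt hγ hab hσ h
  · rw [uIcc_of_ge hab] at hσ
    obtain ⟨t', h1, h2⟩ := exists_eq_of_isArcAt (σ := fun τ => σ (0 + -1 * τ)) hγ
      (neg_le_neg hab) (fun s hs => IsArcAt.comp (Or.inr rfl) (hσ _
        ⟨by linarith [hs.2], by linarith [hs.1]⟩)) (t := t) (by simpa using h)
    refine ⟨t', ?_, by simpa using h2⟩
    rw [abs_of_nonpos (sub_nonpos.2 hab)]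
    linarith

/-- The range is open, since arcs are open maps. It is closed because an arc through a limit point
meets `γ` nearby and then remains on it. Connectedness concludes. -/
lemma surjective_of_isArcAt [T2Space X] [ConnectedSpace X] (hγ : ∀ t, O.IsArcAt γ t) :
    Function.Surjective γ := by
  have hclopen : IsClopen (range γ) := by
    constructor
    · refine isClosed_of_closure_subset fun p hp => ?_
      obtain ⟨σ, h0, hσ⟩ := O.exists_isArcAt p
      obtain ⟨ε, hε, h1⟩ := eventually_nhds_iff_ball.1 hσ.eventually
      have h2 := hσ.image_mem_nhds (ball_mem_nhds 0 hε)
      rw [h0] at h2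
      obtain ⟨_, ⟨s, hs, rfl⟩, t, ht⟩ := mem_closure_iff_nhds.1 hp _ h2
      obtain ⟨t', -, h3⟩ := exists_eq_of_isArcAt_uIcc (σ := σ) (a := s) (b := 0) hγ
        (fun r hr => h1 r
        ((convex_ball (0 : ℝ) ε).ordConnected.uIcc_subset hs (mem_ball_self hε) hr)) ht.symm
      exact ⟨t', by rw [← h3, h0]⟩
    · refine isOpen_iff_mem_nhds.2 ?_
      rintro _ ⟨t, rfl⟩
      have := (hγ t).image_mem_nhds univ_mem
      rwa [image_univ] at this
  exact range_eq_univ.1 (hclopen.eq_univ ⟨γ 0, 0, rfl⟩)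

variable [T2Space X] [MeasurableSpace X] [BorelSpace X] [CompactSpace X] [Nonempty X]

lemma vol_image_Icc_le_of_isArcAt (hγ : ∀ t, O.IsArcAt γ t) {a b : ℝ} (hab : a ≤ b) :
    O.vol (γ '' Icc a b) ≤ ofReal (b - a) := by
  refine of_forall_eventually_of_trans (R := fun a b => O.vol (γ '' Icc a b) ≤ ofReal (b - a))
    (fun a b c hab hbc h1 h2 => ?_) (fun t => (hγ t).vol_image_Icc_le) hab
  rw [← Icc_union_Icc_eq_Icc hab hbc, image_union]
  refine (measure_union_le _ _).trans ((add_le_add h1 h2).trans (le_of_eq ?_))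
  rw [← ENNReal.ofReal_add (by linarith) (by linarith)]
  congr 1
  ring

end RiemannianOrbifold

/-! ### The test function in dimension one. -/

namespace RiemannianOrbifold

open RiemannianOrbifoldChart

variable {X : Type*} [TopologicalSpace X] {O : RiemannianOrbifold 1 X}

/-- The function `f` is Lipschitz along unit speed paths. -/
def LipschitzOnArcs (O : RiemannianOrbifold 1 X) (C : ℝ) (f : X → ℝ) : Prop :=
  ∀ (σ : ℝ → X) (a b : ℝ), (∀ t ∈ uIcc a b, O.IsArcAt σ t) → |f (σ b) - f (σ a)| ≤ C * |b - a|

lemma LipschitzOnArcs.continuous {C : ℝ} {f : X → ℝ} (h : O.LipschitzOnArcs C f) :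
    Continuous f := by
  refine continuous_iff_continuousAt.2 fun p => Metric.tendsto_nhds.2 fun ε hε => ?_
  obtain ⟨σ, h0, hσ⟩ := O.exists_isArcAt p
  obtain ⟨η, hη, hball⟩ := eventually_nhds_iff_ball.1 hσ.eventually
  have h1 : ∀ᶠ t : ℝ in 𝓝 0, C * |t - 0| < ε := by
    have : Continuous fun t : ℝ => C * |t - 0| := by fun_prop
    exact this.continuousAt.eventually_lt_const (by simpa using hε)
  have h2 := hσ.image_mem_nhds (inter_mem (ball_mem_nhds 0 hη) h1)
  rw [h0] at h2
  filter_upwards [h2]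
  rintro _ ⟨t, ⟨ht, htε⟩, rfl⟩
  rw [Real.dist_eq, ← h0]
  exact (h σ 0 t fun τ hτ => hball τ ((convex_ball (0 : ℝ) η).ordConnected.uIcc_subset
    (mem_ball_self hη) ht hτ)).trans_lt htε

/-- Near an interior point the chart is parametrised by one unit speed path with length as
parameter, and the strict derivative of the length at `x` is `dens`. This gives the local Lipschitz
constant up to `ε`. -/
lemma LipschitzOnArcs.eventually_chart {C : ℝ} {f : X → ℝ} (hC : 0 ≤ C)
    (h : O.LipschitzOnArcs C f) {c : Chart 1 X} (hc : c ∈ O.atlas)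
    {x : ℝ^1} (hx : x ∈ interior c.dom) {ε : ℝ} (hε : 0 < ε) :
    ∀ᶠ z in 𝓝 (x, x), |f (c.proj z.1) - f (c.proj z.2)| ≤ C * (c.dens (x 0) + ε) * ‖z.1 - z.2‖ := by
  have hxr : x 0 ∈ c.ray := by
    change (fun _ => x 0) ∈ c.dom
    rw [const_apply_zero]
    exact interior_subset hx
  have hx0 : 0 < x 0 := (mem_interior_dom_iff hxr).1 (by rwa [const_apply_zero])
  obtain ⟨α, -, hα, hαe⟩ := O.exists_isArcAt_of_mem_ray hc hxr
  obtain ⟨η, hη, hball⟩ := eventually_nhds_iff_ball.1 hα.eventually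
  have hstrict := hasStrictDerivAt_len (c := c) (x := x 0) (y := x 0)
    (by rw [uIcc_self, singleton_subset_iff]; exact ray_subset_line hxr)
  have h1 : ∀ᶠ u in 𝓝 (x 0), c.len (x 0) u ∈ ball 0 η :=
    hstrict.hasDerivAt.continuousAt.eventually (by rw [len_self]; exact ball_mem_nhds 0 hη)
  have h2 := (hasStrictFDerivAt_iff_isLittleO.1 hstrict.hasStrictFDerivAt).def hε
  have ht : Tendsto (fun z : ℝ^1 × ℝ^1 => (z.1 0, z.2 0)) (𝓝 (x, x)) (𝓝 (x 0, x 0)) := by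
    have : Continuous fun z : ℝ^1 × ℝ^1 => (z.1 0, z.2 0) := by fun_prop
    exact this.continuousAt
  have h3 := ((h1.and (hαe hx0)).prod_nhds (h1.and (hαe hx0)))
  filter_upwards [ht.eventually h2, ht.eventually h3] with z h4 ⟨⟨h5, h5', h6⟩, h7, h7', h8⟩
  rw [toPoint, const_apply_zero] at h6 h8
  rw [h6, h8]
  refine (h α _ _ fun τ hτ => hball τ ((convex_ball (0 : ℝ) η).ordConnected.uIcc_subset
    h7 h5 hτ)).trans ?_
  rw [mul_assoc]
  refine mul_le_mul_of_nonneg_left ?_ hC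
  have hnorm : |z.1 0 - z.2 0| ≤ ‖z.1 - z.2‖ := norm_le_pi_norm (z.1 - z.2) 0
  have hd := (dens_pos (c := c) (ray_subset_line hxr)).le
  have h9 : |c.len (x 0) (z.1 0) - c.len (x 0) (z.2 0) - (z.1 0 - z.2 0) * c.dens (x 0)| ≤
      ε * |z.1 0 - z.2 0| := by simpa using h4
  have h10 := abs_sub_abs_le_abs_sub (c.len (x 0) (z.1 0) - c.len (x 0) (z.2 0))
    ((z.1 0 - z.2 0) * c.dens (x 0))
  rw [abs_mul, abs_of_nonneg hd] at h10
  calc _ ≤ (c.dens (x 0) + ε) * |z.1 0 - z.2 0| := by linarith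
    _ ≤ _ := by gcongr

variable [T2Space X] [MeasurableSpace X] [BorelSpace X] [CompactSpace X]

/-- A distance function whose level sets have at most two points. -/
lemma exists_radius [ConnectedSpace X] (O : RiemannianOrbifold 1 X) : ∃ r : X → ℝ, (∀ p, 0 ≤ r p) ∧
    O.LipschitzOnArcs 1 r ∧ ∀ a b, a ≤ b →
      O.vol {p | a < r p ∧ r p ≤ b} ≤ ofReal (2 * (b - a)) := by
  obtain ⟨γ, hγ⟩ := O.exists_forall_isArcAt
  have hsurj := surjective_of_isArcAt hγ
  set A : X → Set ℝ := fun p => {x | ∃ t, γ t = p ∧ |t| = x} with hA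
  have hAn : ∀ p, (A p).Nonempty := fun p => (hsurj p).elim fun t ht => ⟨|t|, t, ht, rfl⟩
  have hA0 : ∀ p, ∀ x ∈ A p, 0 ≤ x := by rintro p x ⟨t, -, rfl⟩; exact abs_nonneg t
  -- The infimum of `|t|` over the times at which `γ` passes through the point. It plays the role of
  -- the distance from `γ 0`.
  set r : X → ℝ := fun p => sInf (A p) with hr
  have hle : ∀ t, r (γ t) ≤ |t| := fun t => csInf_le ⟨0, hA0 _⟩ ⟨t, rfl, rfl⟩
  have hlt : ∀ p b, r p < b → ∃ t, γ t = p ∧ |t| < b := fun p b h => by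
    obtain ⟨_, ⟨t, ht, rfl⟩, h2⟩ := exists_lt_of_csInf_lt (hAn p) h
    exact ⟨t, ht, h2⟩
  refine ⟨r, fun p => Real.sInf_nonneg (hA0 p), fun σ a b hσ => ?_, fun a b hab => ?_⟩
  · have key : ∀ a b : ℝ, (∀ t ∈ uIcc a b, O.IsArcAt σ t) → r (σ b) - r (σ a) ≤ |b - a| := by
      intro a b hσ
      refine le_of_forall_pos_le_add fun ε hε => ?_
      obtain ⟨t, ht, htr⟩ := hlt (σ a) (r (σ a) + ε) (by linarith)
      obtain ⟨t', h1, h2⟩ := exists_eq_of_isArcAt_uIcc hγ hσ ht.symm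
      have h3 := hle t'
      rw [← h2] at h3
      have h4 := abs_sub_abs_le_abs_sub t' t
      linarith
    rw [one_mul]
    refine abs_sub_le_iff.2 ⟨key a b hσ, ?_⟩
    rw [abs_sub_comm]
    exact key b a (by rwa [uIcc_comm])
  · have key : ∀ ε > 0, O.vol {p | a < r p ∧ r p ≤ b} ≤ ofReal (2 * (b + ε - a)) := by
      intro ε hε
      -- Each such point is `γ t` with `a < |t| < b + ε`, so two time intervals suffice. The `ε` is
      -- there because the infimum is not shown to be attained.
      have hsub : {p | a < r p ∧ r p ≤ b} ⊆ γ '' Icc a (b + ε) ∪ γ '' Icc (-(b + ε)) (-a) := by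
        rintro p ⟨h1, h2⟩
        obtain ⟨t, rfl, ht⟩ := hlt p (b + ε) (by linarith)
        have h3 := h1.trans_le (hle t)
        rcases abs_cases t with ⟨h4, -⟩ | ⟨h4, -⟩
        · exact Or.inl ⟨t, ⟨by linarith, by linarith⟩, rfl⟩
        · exact Or.inr ⟨t, ⟨by linarith, by linarith⟩, rfl⟩
      refine (measure_mono hsub).trans ((measure_union_le _ _).trans ?_)
      refine (add_le_add (vol_image_Icc_le_of_isArcAt hγ (by linarith))
        (vol_image_Icc_le_of_isArcAt hγ (by linarith))).trans (le_of_eq ?_)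
      rw [← ENNReal.ofReal_add (by linarith) (by linarith)]
      congr 1
      ring
    have hlim : Tendsto (fun ε => ofReal (2 * (b + ε - a))) (𝓝[>] 0)
        (𝓝 (ofReal (2 * (b - a)))) := by
      refine ENNReal.tendsto_ofReal (tendsto_nhdsWithin_of_tendsto_nhds ?_)
      have : Continuous fun ε => 2 * (b + ε - a) := by fun_prop
      exact this.tendsto' _ _ (by ring)
    exact ge_of_tendsto hlim (by filter_upwards [self_mem_nhdsWithin] with ε hε using key ε hε)

/-- A function with uniform distribution whose level sets have at most two points. -/
lemma exists_height [ConnectedSpace X] (O : RiemannianOrbifold 1 X) : ∃ s : X → ℝ,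
    O.LipschitzOnArcs 2 s ∧
      Measure.map s O.vol = volume.restrict (Icc 0 (O.vol.real univ)) := by
  obtain ⟨r, hr0, hr, hvol⟩ := O.exists_radius
  have hrc := hr.continuous
  set L := O.vol.real univ with hL
  -- The distribution function of `r`. The volume bound of `exists_radius` makes it 2-Lipschitz and
  -- in particular continuous, so that `F ∘ r` is uniformly distributed.
  set F : ℝ → ℝ := fun x => O.vol.real {p | r p ≤ x} with hF
  have hm : ∀ x, MeasurableSet {p | r p ≤ x} := fun x =>
    (isClosed_le hrc continuous_const).measurableSet
  have hmono : Monotone F := fun x y hxy =>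
    measureReal_mono (show {p | r p ≤ x} ⊆ {p | r p ≤ y} from fun p hp => le_trans hp hxy)
  have hlip : ∀ x y, x ≤ y → F y - F x ≤ 2 * (y - x) := by
    intro x y hxy
    have h1 : {p | r p ≤ y} = {p | r p ≤ x} ∪ {p | x < r p ∧ r p ≤ y} := by
      ext p
      simp only [mem_ofPred_eq, mem_union]
      constructor
      · intro h
        exact (le_or_gt (r p) x).imp id fun h' => ⟨h', h⟩
      · rintro (h | h)
        exacts [h.trans hxy, h.2]
    have h2 : F y ≤ F x + O.vol.real {p | x < r p ∧ r p ≤ y} := by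
      simp only [hF]
      rw [h1]
      exact measureReal_union_le _ _
    have h3 : O.vol.real {p | x < r p ∧ r p ≤ y} ≤ 2 * (y - x) :=
      ENNReal.toReal_le_of_le_ofReal (by linarith) (hvol x y hxy)
    linarith
  have habs : ∀ x y, |F y - F x| ≤ 2 * |y - x| := by
    intro x y
    rcases le_total x y with h | h
    · rw [abs_of_nonneg (sub_nonneg.2 (hmono h)), abs_of_nonneg (sub_nonneg.2 h)]
      exact hlip x y h
    · rw [abs_sub_comm, abs_sub_comm y x, abs_of_nonneg (sub_nonneg.2 (hmono h)),
        abs_of_nonneg (sub_nonneg.2 h)]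
      exact hlip y x h
  have hFc : Continuous F := (LipschitzWith.of_dist_le_mul (K := 2) fun x y => by
    rw [Real.dist_eq, Real.dist_eq]; exact habs y x).continuous
  have hs : O.LipschitzOnArcs 2 fun p => F (r p) := fun σ a b hσ =>
    (habs _ _).trans (by linarith [hr σ a b hσ])
  refine ⟨fun p => F (r p), hs, ?_⟩
  have hsm : Measurable fun p => F (r p) := (hFc.comp hrc).measurable
  have hF0 : ∀ x, 0 ≤ F x := fun x => measureReal_nonneg
  have hFL : ∀ x, F x ≤ L := fun x => measureReal_mono (subset_univ _)
  have hFneg : F (-1) = 0 := by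
    have : {p | r p ≤ -1} = ∅ := eq_empty_of_forall_notMem fun p hp => by
      have h1 : r p ≤ -1 := hp
      linarith [hr0 p]
    simp only [hF]
    rw [this, measureReal_empty]
  obtain ⟨R, hR⟩ := isCompact_univ.exists_bound_of_continuousOn hrc.continuousOn
  have hrR : ∀ p, r p ≤ R := fun p => (le_abs_self _).trans (hR p (mem_univ p))
  have hFR : ∀ x, R ≤ x → F x = L := fun x hx => by
    have : {p | r p ≤ x} = univ := eq_univ_of_forall fun p => (hrR p).trans hx
    simp only [hF]
    rw [this]
  have : IsFiniteMeasure (Measure.map (fun p => F (r p)) O.vol) := Measure.isFiniteMeasure_map _ _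
  refine Measure.ext_of_Iic _ _ fun a => ?_
  rw [Measure.map_apply hsm measurableSet_Iic, Measure.restrict_apply measurableSet_Iic]
  rcases lt_or_ge a 0 with ha | ha
  · have h1 : (fun p => F (r p)) ⁻¹' Iic a = ∅ := eq_empty_of_forall_notMem fun p hp => by
      have h2 : F (r p) ≤ a := hp
      linarith [hF0 (r p)]
    have h2 : Iic a ∩ Icc 0 L = ∅ := eq_empty_of_forall_notMem fun x hx => by
      have h3 : x ≤ a := hx.1
      linarith [hx.2.1]
    rw [h1, h2, measure_empty, measure_empty]
  rcases le_or_gt L a with haL | haL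
  · have h1 : (fun p => F (r p)) ⁻¹' Iic a = univ :=
      eq_univ_of_forall fun p => (hFL (r p)).trans haL
    have h2 : Iic a ∩ Icc 0 L = Icc 0 L := inter_eq_right.2 fun x hx => hx.2.trans haL
    rw [h1, h2, Real.volume_Icc, sub_zero, hL, ofReal_measureReal]
  -- By monotonicity and continuity the sublevel set of `F ∘ r` at `a` is the sublevel set of `r` at
  -- `sSup B`, whose volume `F (sSup B)` equals `a`.
  · set B := {x | F x ≤ a} with hB
    have hBne : B.Nonempty := ⟨-1, by rw [hB, mem_ofPred_eq, hFneg]; exact ha⟩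
    have hBb : BddAbove B := ⟨R, fun x hx => by
      by_contra hlt
      have h1 : F x ≤ a := hx
      rw [hFR x (not_le.1 hlt).le] at h1
      linarith⟩
    have hT : F (sSup B) ≤ a := (isClosed_le hFc continuous_const).csSup_mem hBne hBb
    have hTa : F (sSup B) = a := by
      refine le_antisymm hT ?_
      have hRr : -1 ≤ max R (-1) := le_max_right _ _
      obtain ⟨x, -, hx⟩ := intermediate_value_Icc hRr hFc.continuousOn
        (show a ∈ Icc (F (-1)) (F (max R (-1))) by
          rw [hFneg, hFR _ (le_max_left _ _)]; exact ⟨ha, haL.le⟩)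
      rw [← hx]
      exact hmono (le_csSup hBb (show F x ≤ a from hx.le))
    have h1 : (fun p => F (r p)) ⁻¹' Iic a = {p | r p ≤ sSup B} := by
      ext p
      constructor
      · intro hp
        exact le_csSup hBb hp
      · intro hp
        exact (hmono hp).trans hT
    have h2 : Iic a ∩ Icc 0 L = Icc 0 a := by
      ext x
      constructor
      · rintro ⟨h3, h4⟩
        exact ⟨h4.1, h3⟩
      · rintro ⟨h3, h4⟩
        exact ⟨h4, h3, h4.trans haL.le⟩
    rw [h1, h2, Real.volume_Icc, sub_zero, ← hTa, ofReal_measureReal]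

end RiemannianOrbifold

/-- Differentiability of `g` is not assumed: expanding `cos (g x + δ)` leaves `-sin (g x) sin δ` and
a quadratic error, so a local Lipschitz bound at `x` is enough. Keeping the factor `|sin|` is what
yields the sharp constant later. -/
lemma norm_fderiv_cos_le {E : Type*} [NormedAddCommGroup E] [NormedSpace ℝ E] {g : E → ℝ} {x : E}
    {D : ℝ} (hD : 0 ≤ D) (hg : ∀ ε > 0, ∀ᶠ z in 𝓝 x, |g z - g x| ≤ (D + ε) * ‖z - x‖) :
    ‖fderiv ℝ (fun z => cos (g z)) x‖ ≤ |sin (g x)| * D := by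
  have key : ∀ ε > 0, ‖fderiv ℝ (fun z => cos (g z)) x‖ ≤ (|sin (g x)| + ε) * (D + ε) := by
    intro ε hε
    refine norm_fderiv_le_of_lip' ℝ (by positivity) ?_
    have h1 : ∀ᶠ z in 𝓝 x, (D + ε) * ‖z - x‖ < 2 * ε := by
      have : Continuous fun z => (D + ε) * ‖z - x‖ := by fun_prop
      exact this.continuousAt.eventually_lt_const (by simpa using hε)
    filter_upwards [hg ε hε, h1] with z h2 h3
    obtain ⟨δ, hδ⟩ : ∃ δ, g z = g x + δ := ⟨g z - g x, by ring⟩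
    rw [hδ, add_sub_cancel_left] at h2
    rw [hδ, Real.cos_add, Real.norm_eq_abs, show cos (g x) * cos δ - sin (g x) * sin δ - cos (g x) =
        -(cos (g x) * (1 - cos δ)) - sin (g x) * sin δ by ring]
    have h4 := abs_sub (-(cos (g x) * (1 - cos δ))) (sin (g x) * sin δ)
    rw [abs_neg, abs_mul, abs_mul, abs_of_nonneg (sub_nonneg.2 (Real.cos_le_one δ))] at h4
    have h5 : 1 - cos δ ≤ ε * |δ| := by
      have := Real.one_sub_sq_div_two_le_cos (x := δ)
      rw [← sq_abs] at this
      nlinarith [abs_nonneg δ]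
    have h6 : |cos (g x)| * (1 - cos δ) ≤ 1 * (ε * |δ|) :=
      mul_le_mul (Real.abs_cos_le_one _) h5 (sub_nonneg.2 (Real.cos_le_one δ)) zero_le_one
    have h7 : |sin (g x)| * |sin δ| ≤ |sin (g x)| * |δ| :=
      mul_le_mul_of_nonneg_left Real.abs_sin_le_abs (abs_nonneg _)
    calc _ ≤ (|sin (g x)| + ε) * |δ| := by linarith
      _ ≤ (|sin (g x)| + ε) * ((D + ε) * ‖z - x‖) := by gcongr
      _ = _ := by ring
  have hlim : Tendsto (fun ε => (|sin (g x)| + ε) * (D + ε)) (𝓝[>] 0) (𝓝 (|sin (g x)| * D)) := by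
    refine tendsto_nhdsWithin_of_tendsto_nhds ?_
    have : Continuous fun ε => (|sin (g x)| + ε) * (D + ε) := by fun_prop
    exact this.tendsto' _ _ (by ring)
  exact ge_of_tendsto hlim (by filter_upwards [self_mem_nhdsWithin] with ε hε using key ε hε)

namespace RiemannianOrbifold

open RiemannianOrbifoldChart

variable {X : Type*} [TopologicalSpace X] {O : RiemannianOrbifold 1 X}

lemma cometric_self_le {c : Chart 1 X} {x : ℝ^1} (hx : x ∈ c.dom)
    {ξ : ℝ^1 →L[ℝ] ℝ} {b : ℝ} (h : ‖ξ‖ ≤ b * c.dens (x 0)) : c.cometric x ξ ξ ≤ b ^ 2 := by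
  have hxr : x 0 ∈ c.ray := by
    change (fun _ => x 0) ∈ c.dom
    rwa [const_apply_zero]
  have h1 := sq_dens hxr
  rw [const_apply_zero] at h1
  have hd := dens_pos (c := c) (ray_subset_line hxr)
  have h2 : |ξ (Pi.single 0 1)| ≤ b * c.dens (x 0) := by
    refine (ξ.le_opNorm _).trans ?_
    rw [Pi.norm_single, norm_one, mul_one]
    exact h
  have h3 : c.cometric x ξ ξ = (c.dens (x 0) ^ 2)⁻¹ * |ξ (Pi.single 0 1)| ^ 2 := by
    unfold RiemannianOrbifoldChart.cometric
    rw [Fin.sum_univ_one, Fin.sum_univ_one, Matrix.inv_subsingleton, Matrix.diagonal_apply_eq,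
      Ring.inverse_eq_inv', h1, sq_abs]
    ring
  rw [h3, inv_mul_le_iff₀ (by positivity), ← mul_pow, mul_comm]
  exact pow_le_pow_left₀ (abs_nonneg _) h2 2

/-- Functions that are Lipschitz along arcs are weakly differentiable, with the expected bound on
the gradient of their cosine. -/
lemma LipschitzOnArcs.hasChartGrad_cos {C a : ℝ} {s : X → ℝ} (hC : 0 ≤ C) (ha : 0 ≤ a)
    (h : O.LipschitzOnArcs C s) :
    O.HasChartGrad (fun p => cos (a * s p))
      (fun c => fderiv ℝ fun x => cos (a * s (c.proj x))) ∧
    ∀ c ∈ O.atlas, ∀ x ∈ interior c.dom, c.cometric x (fderiv ℝ (fun x => cos (a * s (c.proj x))) x)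
        (fderiv ℝ (fun x => cos (a * s (c.proj x))) x) ≤
      (a * C) ^ 2 * sin (a * s (c.proj x)) ^ 2 := by
  have hcos : ∀ A B : ℝ, |cos A - cos B| ≤ |A - B| := Real.abs_cos_sub_cos_le
  have hdn : ∀ c : Chart 1 X, ∀ x, 0 ≤ c.dens x := fun c x => Real.sqrt_nonneg _
  refine ⟨fun c hc => HasWeakFDerivOn.of_locallyLipschitzOn isOpen_interior fun x hx => ?_,
    fun c hc x hx => ?_⟩
  · obtain ⟨U, hU, V, hV, hUV⟩ := mem_nhds_prod_iff.1 (h.eventually_chart hC hc hx one_pos)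
    have hd := hdn c (x 0)
    refine ⟨(a * (C * (c.dens (x 0) + 1))).toNNReal, U ∩ V,
      mem_nhdsWithin_of_mem_nhds (inter_mem hU hV), LipschitzOnWith.of_dist_le_mul ?_⟩
    intro y hy z hz
    rw [Real.dist_eq, dist_eq_norm]
    refine (hcos _ _).trans ?_
    rw [← mul_sub, abs_mul, abs_of_nonneg ha, Real.coe_toNNReal _ (by positivity), mul_assoc]
    exact mul_le_mul_of_nonneg_left (hUV (mk_mem_prod hy.1 hz.2)) ha
  · have hd := hdn c (x 0)
    have h1 := norm_fderiv_cos_le (g := fun z => a * s (c.proj z)) (x := x)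
      (D := a * C * c.dens (x 0)) (by positivity) (fun ε hε => by
        have hpos : 0 < ε / (a * C + 1) := by positivity
        have h2 : ∀ᶠ z in 𝓝 x, _ := (Continuous.prodMk continuous_id
          (continuous_const (y := x))).continuousAt.eventually (h.eventually_chart hC hc hx hpos)
        filter_upwards [h2] with z hz
        rw [← mul_sub, abs_mul, abs_of_nonneg ha]
        refine (mul_le_mul_of_nonneg_left hz ha).trans ?_
        rw [← mul_assoc]
        refine mul_le_mul_of_nonneg_right ?_ (norm_nonneg _)
        have h3 : (a * C + 1) * (ε / (a * C + 1)) = ε := by field_simp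
        nlinarith)
    refine (cometric_self_le (interior_subset hx)
      (b := |sin (a * s (c.proj x))| * (a * C)) (by rw [mul_assoc]; exact h1)).trans (le_of_eq ?_)
    rw [mul_pow, sq_abs, mul_comm]

variable [T2Space X] [MeasurableSpace X] [BorelSpace X] [CompactSpace X]

/-- The first eigenvalue of a one-dimensional orbifold is at most that of the circle with the same
length. -/
theorem mul_sq_vol_le [ConnectedSpace X] {t : ℝ}
    (hray : ∀ u : O.H1, ∫ p, u.1 p ∂O.vol = 0 → t * O.l2Form u u ≤ O.dirichletForm u u) :
    t * O.vol.real univ ^ 2 ≤ (2 * Real.pi) ^ 2 := by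
  obtain ⟨s, hs, hmap⟩ := O.exists_height
  have hsc := hs.continuous
  have hL : 0 < O.vol.real univ :=
    ENNReal.toReal_pos (isOpen_univ.measure_ne_zero _ univ_nonempty) (measure_ne_top _ _)
  obtain ⟨L, hLe⟩ : ∃ L, L = O.vol.real univ := ⟨_, rfl⟩
  rw [← hLe] at hL hmap ⊢
  -- With this frequency `cos (a x)` completes half a period on `[0, L]`, so the test function has
  -- mean zero by the uniform distribution of `s`.
  obtain ⟨a, hae⟩ : ∃ a, a = Real.pi / L := ⟨_, rfl⟩
  have ha : 0 < a := hae ▸ div_pos Real.pi_pos hL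
  have haL : a * L = Real.pi := by rw [hae]; field_simp
  obtain ⟨hgrad, hbound⟩ := hs.hasChartGrad_cos zero_le_two ha.le
  have hint : ∀ f : ℝ → ℝ, Continuous f → ∫ p, f (s p) ∂O.vol = ∫ x in (0 : ℝ)..L, f x := by
    intro f hf
    rw [intervalIntegral.integral_of_le hL.le, ← integral_Icc_eq_integral_Ioc, ← hmap,
      integral_map hsc.measurable.aemeasurable hf.measurable.aestronglyMeasurable]
  have hcosk : ∀ k : ℕ, k ≠ 0 → ∫ x in (0 : ℝ)..L, cos (k * a * x) = 0 := by
    intro k hk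
    have hka : (k : ℝ) * a ≠ 0 := mul_ne_zero (Nat.cast_ne_zero.2 hk) ha.ne'
    rw [intervalIntegral.integral_comp_mul_left (fun x => cos x) hka, integral_cos, mul_zero,
      Real.sin_zero, mul_assoc, haL, Real.sin_nat_mul_pi, sub_zero, smul_zero]
  have hci : ∀ f : ℝ → ℝ, Continuous f → IntervalIntegrable f volume 0 L := fun f hf =>
    hf.intervalIntegrable _ _
  have h1 : ∫ x in (0 : ℝ)..L, cos (a * x) ^ 2 = L / 2 := by
    have e : ∀ x, cos (a * x) ^ 2 = 1 / 2 + 1 / 2 * cos ((2 : ℕ) * a * x) := fun x => by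
      rw [Real.cos_sq]; push_cast; ring_nf
    rw [intervalIntegral.integral_congr fun x _ => e x, intervalIntegral.integral_add
      (hci _ (by fun_prop)) (hci _ (by fun_prop)), intervalIntegral.integral_const_mul,
      hcosk 2 two_ne_zero, intervalIntegral.integral_const]
    simp; ring
  have h2 : ∫ x in (0 : ℝ)..L, sin (a * x) ^ 2 = L / 2 := by
    have e : ∀ x, sin (a * x) ^ 2 = 1 - cos (a * x) ^ 2 := fun x => Real.sin_sq _
    rw [intervalIntegral.integral_congr fun x _ => e x, intervalIntegral.integral_sub
      (hci _ (by fun_prop)) (hci _ (by fun_prop)), h1, intervalIntegral.integral_const]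
    simp; ring
  have hgle : ∀ᵐ p ∂O.vol, O.gradInner (fun p => cos (a * s p)) (fun p => cos (a * s p)) p
      ≤ (a * 2) ^ 2 * sin (a * s p) ^ 2 := by
    refine O.ae_vol_iff.2 fun c hc => ?_
    filter_upwards [hgrad.gradInner_ae hgrad hc, c.ae_mem_interior] with x h3 h4
    rw [h3]
    exact hbound c hc x h4
  have hIs : Integrable (fun p => (a * 2) ^ 2 * sin (a * s p) ^ 2) O.vol :=
    integrable_of_continuous_of_compactSpace (by fun_prop)
  have hgi : Integrable (O.gradInner (fun p => cos (a * s p)) (fun p => cos (a * s p))) O.vol := by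
    refine hIs.mono' (hgrad.gradInner hgrad).1.aestronglyMeasurable ?_
    filter_upwards [hgle, gradInner_self_nonneg hgrad] with p h3 h4
    rwa [Real.norm_of_nonneg h4]
  have hmem : O.MemH1 fun p => cos (a * s p) :=
    (memH1_iff hgrad).2 ⟨memLp_of_continuous (by fun_prop), hgi⟩
  have h3 := hray ⟨_, hmem⟩ (by
    rw [hint (fun x => cos (a * x)) (by fun_prop)]
    simpa using hcosk 1 one_ne_zero)
  rw [l2Form_apply, dirichletForm_apply] at h3
  have h4 := h3.trans (integral_mono_ae hgi hIs hgle)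
  simp only [← sq] at h4
  rw [integral_const_mul, hint (fun x => cos (a * x) ^ 2) (by fun_prop),
    hint (fun x => sin (a * x) ^ 2) (by fun_prop), h1, h2] at h4
  -- The integrals of `cos²` and `sin²` over half a period are both `L / 2` and cancel; the factor
  -- two is the Lipschitz constant of `s`.
  have h5 : t ≤ (a * 2) ^ 2 := le_of_mul_le_mul_right h4 (by positivity)
  calc t * L ^ 2 ≤ (a * 2) ^ 2 * L ^ 2 := by gcongr
    _ = (2 * (a * L)) ^ 2 := by ring
    _ = _ := by rw [haL]

end RiemannianOrbifold

/-! ### The main theorem. -/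

theorem mainTheorem2 {m n : ℕ} (hm : 1 ≤ m) {X : Type*} [TopologicalSpace X] [T2Space X]
    [CompactSpace X] [ConnectedSpace X] [MeasurableSpace X] [BorelSpace X]
    (O : RiemannianOrbifold m X) (φ : X → UnitSphere n) (hφ : O.IsPC φ) :
    IsLeast {t : ℝ | t ≠ 0 ∧ O.IsNeumannEigenvalue t} O.firstEigenvalue ∧
    ENNReal.ofReal O.firstEigenvalue * O.vol univ ^ ((2 : ℝ) / m) ≤
      (m : ℝ≥0∞) * O.conformalVolume φ ^ ((2 : ℝ) / m) := by
  have : NeZero m := ⟨by omega⟩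
  obtain ⟨t, ht, htN, hmin, hray⟩ := RiemannianOrbifold.exists_first_neumann_eigenvalue (O := O)
  have hleast : IsLeast {t : ℝ | t ≠ 0 ∧ O.IsNeumannEigenvalue t} t :=
    ⟨⟨ht.ne', htN⟩, fun s hs => hmin s hs.1 hs.2⟩
  have hfirst : O.firstEigenvalue = t := hleast.csInf_eq
  rw [hfirst]
  refine ⟨hleast, ?_⟩
  obtain ⟨S, hS⟩ := RiemannianOrbifold.isPC_iff.1 hφ
  obtain hm1 | hm2 : m = 1 ∨ 2 ≤ m := by omega
  · subst hm1
    have h1 := RiemannianOrbifold.mul_sq_vol_le hray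
    have h2 : (2 : ℝ) / (1 : ℕ) = (2 : ℕ) := by norm_num
    rw [h2, ENNReal.rpow_natCast, ENNReal.rpow_natCast, Nat.cast_one, one_mul]
    -- In dimension one both sides are compared with `(2 π)²`.
    refine le_trans ?_ (pow_le_pow_left₀ zero_le hS.two_pi_le_conformalVolume 2)
    rw [← ENNReal.ofReal_toReal (measure_ne_top O.vol univ), ← ENNReal.ofReal_pow (by positivity),
      ← ENNReal.ofReal_pow (by positivity), ← ENNReal.ofReal_mul ht.le]
    exact ENNReal.ofReal_le_ofReal h1
  · by_cases hV : O.conformalVolume φ = ⊤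
    · have hm0 : (0 : ℝ) < m := by exact_mod_cast hm
      rw [hV, ENNReal.top_rpow_of_pos (by positivity), ENNReal.mul_top (by simpa using NeZero.ne m)]
      exact le_top
    · exact hS.mul_vol_rpow_le hm2 hV ht.le hray
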